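/- **Setting.** Let $\mathfrak F=(\mathcal V,\mathcal F,\imath)$ be a Feynman category: $\mathcal V$ is a groupoid, $\mathcal F$ a symmetric monoidal category, $\imath:\mathcal V\to\mathcal F$ a functor such that the induced functors $\mathcal V^{\otimes}\to \mathrm{Iso}(\mathcal F)$ and $\mathrm{Iso}(\mathcal F\downarrow\mathcal V)^{\otimes}\to\mathrm{Iso}(\mathcal F\downarrow\mathcal F)$ (where $(-)^\otimes$ is the free symmetric monoidal category) are equivalences and every slice $\mathcal F\downarrow\imath(v)$ is essentially small. An odd version $\mathfrak F^{odd}$ is a twist of $\mathcal F$ that replaces each morphism $\phi$ by a free rank one module on a symbol $e_\phi$ of degree $\deg\phi\in\mathbb N$, with $e_\phi;e_\psi=\pm e_{\psi\phi}$ and $e_\phi\otimes e_\psi=\pm e_{\phi\otimes\psi}$, so that one obtains a symmetric monoidal category enriched in graded abelian groups with the Koszul sign rule; isomorphisms have degree $0$ and compose and tensor among themselves without signs. It comes with a class $\Phi^1$ of degree one morphisms with target in $\imath(\mathcal V)$, closed under isomorphisms of source and target (which act on the symbols $e_\phi$, $\phi\in\Phi^1$, without sign), which together with the morphisms of degree $0$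 generates $\mathcal F$ under composition and tensor product. Write $[\phi]$ for the class of $\phi\in\Phi^1$ with fixed target $\imath(v)$ up to isomorphism of its source $\imath(v_1)\otimes\dots\otimes \imath(v_n)$; $n$ is its arity. Let $k$ be a commutative ring and let $\mathcal C$ be a $k$-linear symmetric monoidal category, with all small colimits, preserved by $\otimes$ in each variable, and $k$-linear $\otimes$. Let $c$ be an isomorphism invariant weight $\phi\mapsto c_\phi\in k$ on $\Phi^1$ (for instance $c=1$, or $c_\phi=1/|\mathrm{Aut}\,\phi|$). Assume that $\Phi^1$ is resolving: $d_{\Phi^1}=\sum_{[\phi]}c_\phi\, e_\phi\circ$ (sum over all ways to compose with a generator, with the signs of $\mathfrak F^{odd}$ and coefficients in $k$) satisfies $d_{\Phi^1}^2=0$, for each isomorphism class of morphisms over each $\imath(v)$ separately. $\mathcal F\text{-}\mathcal Ops_{Kom(\mathcal C)}$ is the category of symmetric monoidal functors $\mathcal O$ from $\mathcal F$ to cochain complexes in $\mathcal C$ ($\mathbb Z$-graded, Koszul braiding, differential of degree $+1$) with monoidal natural transformations that commute with $d$. $\mathcal F^{odd}\text{-}\mathcal Ops_{Kom(\mathcal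 C)}$ is the category of enriched symmetric monoidal functors $\mathcal P$ from $\mathfrak F^{odd}$ to cochain complexes; thus $\mathcal P(e_\phi)$ has degree $\deg\phi$ and $d\,\mathcal P(e_\phi)=(-1)^{\deg\phi}\mathcal P(e_\phi)\,d$. For such $\mathcal P$ and $\mathcal O$, the pointwise product $\mathcal P\otimes\mathcal O$ is an $\mathcal F^{odd}$-op, with $e_\phi$ acting by $\mathcal P(e_\phi)\otimes\mathcal O(\phi)$ and differential $d\otimes1+1\otimes d$. Let $\mathcal P\in\mathcal F^{odd}\text{-}\mathcal Ops_{Kom(\mathcal C)}$ be such that each $\mathcal P(v)=\mathcal P(\imath v)$, $v\in\mathcal V$, has a dual $\mathcal P(v)^\vee$ in graded objects, and such that over each $v$ only finitely many classes $[\phi]$ of $\Phi^1$ act on $\mathcal P$ by a nonzero map. The *Feynman transform* $\mathsf{FT}(\mathcal P)$ is the free graded $\mathcal F$-op on the $\mathcal V$-module $v\mapsto\mathcal P(v)^\vee$ (contragredient action), with the differential of ops that is given on the generators $\mathcal P(v)^\vee$ by $$-\Big(d_{\mathcal P}^{\mathsf T}+\sum_{[\phi:\,v_1\otimes\cdots\otimes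 v_n\to v]}c_\phi\;\mathsf{FT}(\mathcal P)(\phi)\circ \mathcal P(e_\phi)^{\mathsf T}\Big),$$ where $t^{\mathsf T}$ is the transpose of $t$, characterised by $(t\otimes1)\circ\mathrm{coev}=(1\otimes t^{\mathsf T})\circ\mathrm{coev}$, and $\mathcal P(v_1)^\vee\otimes\dots\otimes\mathcal P(v_n)^\vee$ is mapped to $\mathsf{FT}(\mathcal P)(v_1\otimes\dots\otimes v_n)$ by multiplying generators. For $\mathcal Q=\mathcal P\otimes\mathcal O$, an element $\alpha\in\lim_{\mathcal V}(\mathcal Q)$ is a family of (generalised) elements $\alpha_v:\mathbb 1\to\mathcal Q(v)$ of degree $0$ that is compatible with all morphisms of $\mathcal V$. Put $$\Psi_{\mathcal Q,n}(\alpha^{\otimes n})_v=\sum_{[\phi:\,v_1\otimes\cdots\otimes v_n\to v]}c_\phi\,\mathcal Q(e_\phi)(\alpha_{v_1}\otimes\cdots\otimes\alpha_{v_n}),$$ and let $ME(\lim_{\mathcal V}(\mathcal Q))$ be the set of all $\alpha\in\lim_{\mathcal V}(\mathcal Q)$ with $d_{\mathcal Q}(\alpha)+\sum_n\Psi_{\mathcal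 Q,n}(\alpha^{\otimes n})=0$. **Theorem.** The Feynman transform $\mathsf{FT}(\mathcal P)$ exists, and for every $\mathcal O\in\mathcal F\text{-}\mathcal Ops_{Kom(\mathcal C)}$ the map $f\mapsto(\alpha_v)_v$, where $\alpha_v\in\mathcal P(v)\otimes\mathcal O(v)$ is the element that corresponds to the restriction $\mathcal P(v)^\vee\to\mathcal O(v)$ of $f$ to the generators, is a bijection $$\mathrm{Hom}(\mathsf{FT}(\mathcal P),\mathcal O)\;\cong\;ME\big(\lim_{\mathcal V}(\mathcal P\otimes\mathcal O)\big).$$ The bijection is natural in $\mathcal O$ and in $\mathcal P$ (a morphism $h:\mathcal P\to\mathcal P'$ of such $\mathcal F^{odd}$-ops induces a unique morphism $\mathsf{FT}(\mathcal P')\to\mathsf{FT}(\mathcal P)$ that is $h^\vee$ on generators, and the bijections are compatible with it). Moreover, the master equation takes the following forms. Choose for each class of generators of arity two an order of the two factors of its source. Let $\Delta=\Psi_{\mathcal Q,1}$, let $\alpha\circ\beta$ be the sum of $c_\phi\,\mathcal Q(e_\phi)(\alpha\otimes\beta)$ over the generators of arity two, in this order, and let $[\alpha,\beta]=\alpha\circ\beta+\beta\circ\alpha$.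 If all generators have arity one or two, then $\alpha\in\lim_{\mathcal V}(\mathcal Q)$ is a solution if and only if $d\alpha+\alpha\circ\alpha+\Delta\alpha=0$, and, if $2$ is invertible in $k$, if and only if $d\alpha+\frac12[\alpha,\alpha]+\Delta\alpha=0$. If all generators have arity two, the same holds without the term $\Delta\alpha$. -/

import Mathlib

open CategoryTheory MonoidalCategory Limits Category

universe w vC uC vV uV vF uF u
noncomputable section
namespace FeynOps

/-- `C` has coproducts and they are preserved by tensor products (so that graded objects of `C` have
a tensor product). -/
class GradedTarget (C : Type uC) [Category.{vC} C] [MonoidalCategory C] : Prop where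
  hasColimits : HasCoproducts.{0} C
  preservesLeft : ∀ (J : Type) (X : C),
    PreservesColimitsOfShape (Discrete J) ((curriedTensor C).obj X)
  preservesRight : ∀ (J : Type) (X : C),
    PreservesColimitsOfShape (Discrete J) ((curriedTensor C).flip.obj X)

attribute [instance] GradedTarget.hasColimits GradedTarget.preservesLeft GradedTarget.preservesRight

/-- Graded objects of `C`. This is a copy of `GradedObject ℤ C` that carries the braiding with the
Koszul sign. -/
def Gr (C : Type uC) : Type uC := GradedObject ℤ C

section
variable (C : Type uC) [Category.{vC} C] 

instance : Category (Gr C) := inferInstanceAs (Category (GradedObject ℤ C))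

variable [MonoidalCategory C] [GradedTarget C]

instance (X : C) : PreservesColimit (Functor.empty.{0} C) ((curriedTensor C).obj X) := by
  infer_instance
instance (X : C) : PreservesColimit (Functor.empty.{0} C) ((curriedTensor C).flip.obj X) := by
  infer_instance
instance : HasInitial C := by infer_instance
instance (X Y : GradedObject ℤ C) : GradedObject.HasTensor X Y := fun _ => inferInstance
instance (X Y Z : GradedObject ℤ C) : GradedObject.HasGoodTensor₁₂Tensor X Y Z :=
  fun _ _ => inferInstance
instance (X Y Z : GradedObject ℤ C) : GradedObject.HasGoodTensorTensor₂₃ X Y Z :=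
  fun _ _ => inferInstance
instance (X Y Z W : GradedObject ℤ C) : GradedObject.HasTensor₄ObjExt X Y Z W :=
  fun _ _ => inferInstance

instance grMonoidal : MonoidalCategory (Gr C) :=
  inferInstanceAs (MonoidalCategory (GradedObject ℤ C))

end

lemma units_smul_whiskerRight {C : Type uC} [Category.{vC} C] [MonoidalCategory C]
    [Preadditive C] [MonoidalPreadditive C] {A B : C} (u : ℤˣ) (f : A ⟶ B) (D : C) :
    (u • f) ▷ D = u • (f ▷ D) := by
  rcases Int.units_eq_one_or u with rfl | rfl
  · simp
  · rw [Units.neg_smul, one_smul, Units.neg_smul, one_smul]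
    exact (tensorRight D).map_neg (f := f)

lemma whiskerLeft_units_smul {C : Type uC} [Category.{vC} C] [MonoidalCategory C]
    [Preadditive C] [MonoidalPreadditive C] {A B : C} (u : ℤˣ) (f : A ⟶ B) (D : C) :
    D ◁ (u • f) = u • (D ◁ f) := by
  rcases Int.units_eq_one_or u with rfl | rfl
  · simp
  · rw [Units.neg_smul, one_smul, Units.neg_smul, one_smul]
    exact (tensorLeft D).map_neg (f := f)

namespace Gr
variable {C : Type uC} [Category.{vC} C]

/-- The component of a graded object in a given degree. -/
def deg (X : Gr C) (n : ℤ) : C := X n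

/-- The component of a morphism of graded objects in a given degree. -/
def app {X Y : Gr C} (f : X ⟶ Y) (n : ℤ) : X.deg n ⟶ Y.deg n := f n

@[ext] lemma hom_ext {X Y : Gr C} (f g : X ⟶ Y) (h : ∀ n, app f n = app g n) : f = g :=
  funext h

@[simp] lemma id_app (X : Gr C) (n : ℤ) : app (𝟙 X) n = 𝟙 _ := rfl
@[simp] lemma comp_app {X Y Z : Gr C} (f : X ⟶ Y) (g : Y ⟶ Z) (n : ℤ) :
    app (f ≫ g) n = app f n ≫ app g n := rfl

variable [MonoidalCategory C] [GradedTarget C]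

/-- The inclusion of a summand of the tensor product. -/
def ι (X Y : Gr C) (i j n : ℤ) (h : i + j = n) : X.deg i ⊗ Y.deg j ⟶ (X ⊗ Y).deg n :=
  GradedObject.Monoidal.ιTensorObj (C := C) X Y i j n h

lemma tensor_ext {X Y : Gr C} {A : C} {n : ℤ} (f g : (X ⊗ Y).deg n ⟶ A)
    (h : ∀ i j (hij : i + j = n), ι X Y i j n hij ≫ f = ι X Y i j n hij ≫ g) : f = g :=
  GradedObject.Monoidal.tensorObj_ext (C := C) (X₁ := X) (X₂ := Y) f g h

/-- Maps out of a tensor product. -/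
def desc {X Y : Gr C} {A : C} {n : ℤ}
    (f : ∀ i j : ℤ, i + j = n → (X.deg i ⊗ Y.deg j ⟶ A)) : (X ⊗ Y).deg n ⟶ A :=
  GradedObject.Monoidal.tensorObjDesc (C := C) (X₁ := X) (X₂ := Y) f

@[simp] lemma ι_desc {X Y : Gr C} {A : C} {n : ℤ}
    (f : ∀ i j : ℤ, i + j = n → (X.deg i ⊗ Y.deg j ⟶ A)) (i j : ℤ) (h : i + j = n) :
    ι X Y i j n h ≫ desc f = f i j h :=
  GradedObject.Monoidal.ι_tensorObjDesc (C := C) (X₁ := X) (X₂ := Y) f i j h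

@[simp] lemma ι_tensorHom {X X' Y Y' : Gr C} (f : X ⟶ X') (g : Y ⟶ Y')
    (i j n : ℤ) (h : i + j = n) :
    ι X Y i j n h ≫ app (f ⊗ₘ g) n = (app f i ⊗ₘ app g j) ≫ ι X' Y' i j n h :=
  GradedObject.Monoidal.ι_tensorHom (C := C) (X₁ := X) (X₂ := X') (Y₁ := Y) (Y₂ := Y') f g i j n h

@[simp] lemma ι_whiskerRight {X X' : Gr C} (f : X ⟶ X') (Y : Gr C)
    (i j n : ℤ) (h : i + j = n) :
    ι X Y i j n h ≫ app (f ▷ Y) n = (app f i ▷ Y.deg j) ≫ ι X' Y i j n h := by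
  rw [← tensorHom_id, ι_tensorHom, id_app, tensorHom_id]

@[simp] lemma ι_whiskerRight_assoc {X X' : Gr C} (f : X ⟶ X') (Y : Gr C)
    (i j n : ℤ) (h : i + j = n) {A : C} (g : (X' ⊗ Y).deg n ⟶ A) :
    ι X Y i j n h ≫ app (f ▷ Y) n ≫ g = (app f i ▷ Y.deg j) ≫ ι X' Y i j n h ≫ g := by
  rw [← assoc, ι_whiskerRight, assoc]

@[simp] lemma ι_whiskerLeft {Y Y' : Gr C} (X : Gr C) (f : Y ⟶ Y')
    (i j n : ℤ) (h : i + j = n) :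
    ι X Y i j n h ≫ app (X ◁ f) n = (X.deg i ◁ app f j) ≫ ι X Y' i j n h := by
  rw [← id_tensorHom, ι_tensorHom, id_app, id_tensorHom]

@[simp] lemma ι_whiskerLeft_assoc {Y Y' : Gr C} (X : Gr C) (f : Y ⟶ Y')
    (i j n : ℤ) (h : i + j = n) {A : C} (g : (X ⊗ Y').deg n ⟶ A) :
    ι X Y i j n h ≫ app (X ◁ f) n ≫ g = (X.deg i ◁ app f j) ≫ ι X Y' i j n h ≫ g := by
  rw [← assoc, ι_whiskerLeft, assoc]

lemma ι_assoc_aux (X Y Z : GradedObject ℤ C) (i j k n : ℤ) (h : i + j + k = n)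
    (h' : i + (j + k) = n) :
    GradedObject.Monoidal.ιTensorObj X Y i j _ rfl ▷ Z k ≫
      GradedObject.Monoidal.ιTensorObj (GradedObject.Monoidal.tensorObj X Y) Z (i + j) k n h ≫
      (GradedObject.Monoidal.associator X Y Z).hom n =
    (α_ _ _ _).hom ≫ X i ◁ GradedObject.Monoidal.ιTensorObj Y Z j k _ rfl ≫
      GradedObject.Monoidal.ιTensorObj X (GradedObject.Monoidal.tensorObj Y Z) i (j + k) n h' := by
  have := GradedObject.Monoidal.ιTensorObj₃'_associator_hom X Y Z i j k n h
  rw [GradedObject.Monoidal.ιTensorObj₃'_eq X Y Z i j k n h _ rfl,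
    GradedObject.Monoidal.ιTensorObj₃_eq X Y Z i j k n h _ rfl, assoc] at this
  exact this

lemma ι_assoc_hom (X Y Z : Gr C) (i j k ij jk n : ℤ) (hij : i + j = ij)
    (hjk : j + k = jk) (h : ij + k = n) (h' : i + jk = n) :
    ι X Y i j ij hij ▷ Z.deg k ≫ ι (X ⊗ Y) Z ij k n h ≫ app (α_ X Y Z).hom n =
      (α_ _ _ _).hom ≫ X.deg i ◁ ι Y Z j k jk hjk ≫ ι X (Y ⊗ Z) i jk n h' := by
  subst hij hjk
  exact ι_assoc_aux X Y Z i j k n h h'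

lemma ι_assoc_hom_assoc (X Y Z : Gr C) (i j k ij jk n : ℤ) (hij : i + j = ij)
    (hjk : j + k = jk) (h : ij + k = n) (h' : i + jk = n) {A : C}
    (f : (X ⊗ (Y ⊗ Z)).deg n ⟶ A) :
    ι X Y i j ij hij ▷ Z.deg k ≫ ι (X ⊗ Y) Z ij k n h ≫ app (α_ X Y Z).hom n ≫ f =
      (α_ _ _ _).hom ≫ X.deg i ◁ ι Y Z j k jk hjk ≫ ι X (Y ⊗ Z) i jk n h' ≫ f := by
  have := congrArg (· ≫ f) (ι_assoc_hom X Y Z i j k ij jk n hij hjk h h')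
  simpa only [assoc] using this

lemma tensor₃_ext_aux {X Y Z : GradedObject ℤ C} {A : C} {n : ℤ}
    (f g : GradedObject.Monoidal.tensorObj (GradedObject.Monoidal.tensorObj X Y) Z n ⟶ A)
    (h : ∀ i j k (hij : i + j + k = n), GradedObject.Monoidal.ιTensorObj₃' X Y Z i j k n hij ≫ f =
      GradedObject.Monoidal.ιTensorObj₃' X Y Z i j k n hij ≫ g) : f = g :=
  GradedObject.Monoidal.tensorObj₃'_ext f g h

lemma tensor₃_ext {X Y Z : Gr C} {A : C} {n : ℤ} (f g : ((X ⊗ Y) ⊗ Z).deg n ⟶ A)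
    (h : ∀ i j k (hij : i + j + k = n),
      ι X Y i j _ rfl ▷ Z.deg k ≫ ι (X ⊗ Y) Z _ k n hij ≫ f =
      ι X Y i j _ rfl ▷ Z.deg k ≫ ι (X ⊗ Y) Z _ k n hij ≫ g) : f = g := by
  refine tensor₃_ext_aux (X := X) (Y := Y) (Z := Z) f g fun i j k hij => ?_
  have := h i j k hij
  rw [← assoc, ← assoc] at this
  exact this

section
variable [SymmetricCategory C] [Preadditive C]

/-- One direction of the braiding with the Koszul sign. -/
def braidHom (X Y : Gr C) : X ⊗ Y ⟶ Y ⊗ X := fun n =>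
  desc (X := X) (Y := Y) fun i j h => (i * j).negOnePow • (β_ (X.deg i) (Y.deg j)).hom ≫
    ι Y X j i n (by omega)

@[simp] lemma ι_braidHom (X Y : Gr C) (i j n : ℤ) (h : i + j = n) :
    ι X Y i j n h ≫ app (braidHom X Y) n = (i * j).negOnePow • (β_ (X.deg i) (Y.deg j)).hom ≫
      ι Y X j i n (by omega) :=
  ι_desc (fun i j h => (i * j).negOnePow • (β_ (X.deg i) (Y.deg j)).hom ≫
    ι Y X j i n (by omega)) _ _ _

@[simp] lemma ι_braidHom_assoc (X Y : Gr C) (i j n : ℤ) (h : i + j = n) {A : C}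
    (g : (Y ⊗ X).deg n ⟶ A) :
    ι X Y i j n h ≫ app (braidHom X Y) n ≫ g =
      (i * j).negOnePow • (β_ (X.deg i) (Y.deg j)).hom ≫ ι Y X j i n (by omega) ≫ g := by
  rw [← assoc, ι_braidHom, Linear.units_smul_comp, assoc]

lemma braidHom_braidHom (X Y : Gr C) : braidHom X Y ≫ braidHom Y X = 𝟙 _ := by
  ext n
  apply tensor_ext
  intro i j h
  simp only [comp_app, ι_braidHom_assoc, ι_braidHom, Linear.comp_units_smul, smul_smul,
    id_app, comp_id, SymmetricCategory.symmetry_assoc]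
  rw [mul_comm j i, Int.units_mul_self, one_smul]

lemma braid_natural_right (X : Gr C) {Y Z : Gr C} (f : Y ⟶ Z) :
    X ◁ f ≫ braidHom X Z = braidHom X Y ≫ f ▷ X := by
  ext n
  apply tensor_ext
  intro i j h
  simp [Linear.comp_units_smul]

lemma braid_natural_left {X Y : Gr C} (f : X ⟶ Y) (Z : Gr C):
    f ▷ Z ≫ braidHom Y Z = braidHom X Z ≫ Z ◁ f := by
  ext n
  apply tensor_ext
  intro i j h
  simp [Linear.comp_units_smul]

variable [MonoidalPreadditive C]

lemma hexagon (X Y Z : Gr C) :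
    (α_ X Y Z).hom ≫ braidHom X (Y ⊗ Z) ≫ (α_ Y Z X).hom =
      braidHom X Y ▷ Z ≫ (α_ Y X Z).hom ≫ Y ◁ braidHom X Z := by
  ext n
  apply tensor₃_ext
  intro i j k h
  simp only [comp_app]
  rw [ι_assoc_hom_assoc X Y Z i j k _ _ n rfl rfl h (by omega), ι_braidHom_assoc,
    ι_whiskerRight_assoc, ← comp_whiskerRight_assoc, ι_braidHom, units_smul_whiskerRight,
    comp_whiskerRight, Linear.units_smul_comp, assoc,
    ι_assoc_hom_assoc Y X Z j i k (i + j) (i + k) n (by omega) rfl h (by omega),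
    ι_whiskerLeft, ← whiskerLeft_comp_assoc, ι_braidHom, whiskerLeft_units_smul,
    Linear.comp_units_smul, Linear.comp_units_smul, BraidedCategory.braiding_naturality_right_assoc,
    BraidedCategory.braiding_tensor_right_hom]
  simp only [assoc, Iso.hom_inv_id_assoc, whiskerLeft_comp, Linear.units_smul_comp,
    Linear.comp_units_smul, smul_smul]
  rw [ι_assoc_hom Y Z X j k i (j + k) (i + k) n rfl (by omega) (by omega) (by omega),
    Iso.inv_hom_id_assoc, mul_add, Int.negOnePow_add]

/-- The braiding of graded objects, as an isomorphism. -/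
def braid (X Y : Gr C) : X ⊗ Y ≅ Y ⊗ X :=
  ⟨braidHom X Y, braidHom Y X, braidHom_braidHom X Y, braidHom_braidHom Y X⟩

lemma hexagon_inv (X Y Z : Gr C) :
    (α_ X Y Z).inv ≫ braidHom (X ⊗ Y) Z ≫ (α_ Z X Y).inv =
      X ◁ braidHom Y Z ≫ (α_ X Z Y).inv ≫ braidHom X Z ▷ Y := by
  have h : α_ Z X Y ≪≫ braid Z (X ⊗ Y) ≪≫ α_ X Y Z =
      whiskerRightIso (braid Z X) Y ≪≫ α_ X Z Y ≪≫ whiskerLeftIso X (braid Z Y) :=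
    Iso.ext (hexagon Z X Y)
  have key := congrArg Iso.inv h
  simpa [braid] using key

/-- The symmetric braiding on graded objects given by the Koszul sign rule. -/
instance grSymmetric : SymmetricCategory (Gr C) where
  braiding := braid
  braiding_naturality_right X _ _ f := braid_natural_right X f
  braiding_naturality_left f Z := braid_natural_left f Z
  hexagon_forward := hexagon
  hexagon_reverse := hexagon_inv
  symmetry := braidHom_braidHom

end

end Gr

/-! ### Homogeneous maps of graded objects -/

/-- Families of morphisms `X p ⟶ Y (p + n)`: homogeneous maps of degree `n`. -/
def DegHom {C : Type uC} [Category.{vC} C] (n : ℤ) (X Y : Gr C) : Type vC :=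
  ∀ i : {i : ℤ × ℤ // i.1 + n = i.2}, X.deg i.1.1 ⟶ Y.deg i.1.2

namespace DegHom

section
variable {C : Type uC} [Category.{vC} C]

/-- The component from degree `p` to degree `q = p + n`. -/
def app {n : ℤ} {X Y : Gr C} (s : DegHom n X Y) (p q : ℤ) (h : p + n = q) : X.deg p ⟶ Y.deg q :=
  s ⟨(p, q), h⟩

/-- A homogeneous map is given by its components. -/
def mk {n : ℤ} {X Y : Gr C} (s : ∀ p q : ℤ, p + n = q → (X.deg p ⟶ Y.deg q)) : DegHom n X Y :=
  fun i => s i.1.1 i.1.2 i.2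

@[ext] lemma ext {n : ℤ} {X Y : Gr C} (s t : DegHom n X Y)
    (h : ∀ p q hpq, s.app p q hpq = t.app p q hpq) : s = t :=
  funext fun i => h i.1.1 i.1.2 i.2

instance [Preadditive C] (n : ℤ) (X Y : Gr C) : AddCommGroup (DegHom n X Y) :=
  inferInstanceAs (AddCommGroup (∀ i : {i : ℤ × ℤ // i.1 + n = i.2}, X.deg i.1.1 ⟶ Y.deg i.1.2))

instance {k : Type u} [Ring k] [Preadditive C] [Linear k C] (n : ℤ) (X Y : Gr C) :
    Module k (DegHom n X Y) :=
  inferInstanceAs (Module k (∀ i : {i : ℤ × ℤ // i.1 + n = i.2}, X.deg i.1.1 ⟶ Y.deg i.1.2))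

/-- A morphism of graded objects as a homogeneous map of degree zero. -/
def ofHom {X Y : Gr C} (f : X ⟶ Y) : DegHom 0 X Y := mk fun p q h =>
  Gr.app f p ≫ eqToHom (by rw [← h, add_zero])

/-- Change of the degree along an equality. -/
def ofEq {m n : ℤ} {X Y : Gr C} (h : m = n) (s : DegHom m X Y) : DegHom n X Y :=
  mk fun p q hpq => s.app p q (by omega)

/-- Composition of homogeneous maps (in diagrammatic order). -/
def comp {m n l : ℤ} {X Y Z : Gr C} (h : m + n = l) (s : DegHom m X Y) (t : DegHom n Y Z) :
    DegHom l X Z :=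
  mk fun p q hpq => s.app p (p + m) rfl ≫ t.app (p + m) q (by omega)

/-- Precomposition with a morphism of degree zero. -/
def pre {n : ℤ} {X Y Z : Gr C} (f : X ⟶ Y) (s : DegHom n Y Z) : DegHom n X Z :=
  mk fun p q hpq => Gr.app f p ≫ s.app p q hpq

/-- Postcomposition with a morphism of degree zero. -/
def post {n : ℤ} {X Y Z : Gr C} (s : DegHom n X Y) (f : Y ⟶ Z) : DegHom n X Z :=
  mk fun p q hpq => s.app p q hpq ≫ Gr.app f q

end

section
variable {C : Type uC} [Category.{vC} C] [MonoidalCategory C] [GradedTarget C] [Preadditive C]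

/-- The tensor product of homogeneous maps, with the Koszul sign:
`(s ⊗ t)(x ⊗ y) = (-1) ^ (|t| |x|) s(x) ⊗ t(y)`. -/
def tensor {m n l : ℤ} {X X' Y Y' : Gr C} (h : m + n = l) (s : DegHom m X X')
    (t : DegHom n Y Y') : DegHom l (X ⊗ Y) (X' ⊗ Y') := mk fun p q hpq =>
  Gr.desc (X := X) (Y := Y) fun i j hij => (n * i).negOnePow •
    (s.app i (i + m) rfl ⊗ₘ t.app j (j + n) rfl) ≫ Gr.ι X' Y' (i + m) (j + n) q (by omega)

/-- For `s : X ⟶ Y` of degree `n`, the map `s ⊗ 1` of degree `n`. -/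
def whiskerRight {n : ℤ} {X X' : Gr C} (s : DegHom n X X') (Y : Gr C) :
    DegHom n (X ⊗ Y) (X' ⊗ Y) :=
  tensor (add_zero n) s (ofHom (𝟙 Y))

/-- For `t : Y ⟶ Y'` of degree `n`, the map `1 ⊗ t` of degree `n` (with its Koszul sign). -/
def whiskerLeft {n : ℤ} {Y Y' : Gr C} (X : Gr C) (t : DegHom n Y Y') :
    DegHom n (X ⊗ Y) (X ⊗ Y') :=
  tensor (zero_add n) (ofHom (𝟙 X)) t

/-- The derivation `d ⊗ 1 + 1 ⊗ d` on a tensor product. -/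
def tensorD {X Y : Gr C} (d : DegHom 1 X X) (e : DegHom 1 Y Y) : DegHom 1 (X ⊗ Y) (X ⊗ Y) :=
  whiskerRight d Y + whiskerLeft X e

/-- The transpose `B' ⟶ A'` of `t : A ⟶ B`, relative to a coevaluation `𝟙 ⟶ A ⊗ A'` and an
evaluation `B' ⊗ B ⟶ 𝟙`, characterised by `(t ⊗ 1) ∘ coev = (1 ⊗ tᵀ) ∘ coev`. -/
def transpose {n : ℤ} {A A' B B' : Gr C} (coev : 𝟙_ (Gr C) ⟶ A ⊗ A')
    (ev : B' ⊗ B ⟶ 𝟙_ (Gr C)) (t : DegHom n A B) : DegHom n B' A' :=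
  post (pre ((ρ_ B').inv ≫ B' ◁ coev) (whiskerLeft B' (whiskerRight t A')))
    ((α_ B' B A').inv ≫ ev ▷ A' ≫ (λ_ A').hom)

end

end DegHom

/-! ### Monoidal structures on groupoid cores and on categories of arrows -/

section
variable (F : Type uF) [Category.{vF} F] [MonoidalCategory F]

instance coreMonoidalStruct : MonoidalCategoryStruct (Core F) where
  tensorObj X Y := ⟨X.of ⊗ Y.of⟩
  whiskerLeft X _ _ f := ⟨whiskerLeftIso X.of f.iso⟩
  whiskerRight f Y := ⟨whiskerRightIso f.iso Y.of⟩
  tensorHom f g := ⟨f.iso ⊗ᵢ g.iso⟩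
  tensorUnit := ⟨𝟙_ F⟩
  associator X Y Z := Core.isoMk (α_ X.of Y.of Z.of)
  leftUnitor X := Core.isoMk (λ_ X.of)
  rightUnitor X := Core.isoMk (ρ_ X.of)

/-- The monoidal structure on the groupoid core of a monoidal category. -/
instance coreMonoidal : MonoidalCategory (Core F) where
  tensorHom_def f g := Core.hom_ext (MonoidalCategory.tensorHom_def f.iso.hom g.iso.hom)
  id_tensorHom_id X Y := Core.hom_ext (id_tensorHom_id X.of Y.of)
  tensorHom_comp_tensorHom f g f' g' := Core.hom_ext
    (MonoidalCategory.tensorHom_comp_tensorHom f.iso.hom g.iso.hom f'.iso.hom g'.iso.hom)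
  whiskerLeft_id X Y := Core.hom_ext (whiskerLeft_id X.of Y.of)
  id_whiskerRight X Y := Core.hom_ext (id_whiskerRight X.of Y.of)
  associator_naturality f g h := Core.hom_ext
    (associator_naturality f.iso.hom g.iso.hom h.iso.hom)
  leftUnitor_naturality f := Core.hom_ext (leftUnitor_naturality f.iso.hom)
  rightUnitor_naturality f := Core.hom_ext (rightUnitor_naturality f.iso.hom)
  pentagon W X Y Z := Core.hom_ext (MonoidalCategory.pentagon W.of X.of Y.of Z.of)
  triangle X Y := Core.hom_ext (MonoidalCategory.triangle X.of Y.of)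

/-- The inclusion of the groupoid core is strict monoidal. -/
instance coreInclusionMonoidal : (Core.inclusion F).Monoidal :=
  Functor.CoreMonoidal.toMonoidal
    { εIso := Iso.refl (𝟙_ F)
      μIso := fun X Y => Iso.refl (X.of ⊗ Y.of)
      μIso_hom_natural_left := fun {X Y} f X' =>
        (comp_id (f.iso.hom ▷ X'.of)).trans (id_comp _).symm
      μIso_hom_natural_right := fun {X Y} X' f =>
        (comp_id (X'.of ◁ f.iso.hom)).trans (id_comp _).symm
      associativity := fun X Y Z => by
        change 𝟙 (X.of ⊗ Y.of) ▷ Z.of ≫ 𝟙 ((X.of ⊗ Y.of) ⊗ Z.of) ≫ (α_ X.of Y.of Z.of).hom =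
          (α_ X.of Y.of Z.of).hom ≫ X.of ◁ 𝟙 (Y.of ⊗ Z.of) ≫ 𝟙 (X.of ⊗ Y.of ⊗ Z.of)
        simp
      left_unitality := fun X => by
        change (λ_ X.of).hom = 𝟙 (𝟙_ F) ▷ X.of ≫ 𝟙 (𝟙_ F ⊗ X.of) ≫ (λ_ X.of).hom
        simp
      right_unitality := fun X => by
        change (ρ_ X.of).hom = X.of ◁ 𝟙 (𝟙_ F) ≫ 𝟙 (X.of ⊗ 𝟙_ F) ≫ (ρ_ X.of).hom
        simp }

variable [SymmetricCategory F]

/-- The symmetric structure on the groupoid core of a symmetric monoidal category. -/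
instance coreSymmetric : SymmetricCategory (Core F) where
  braiding X Y := Core.isoMk (β_ X.of Y.of)
  braiding_naturality_right X _ _ f := Core.hom_ext
    (BraidedCategory.braiding_naturality_right X.of f.iso.hom)
  braiding_naturality_left f Z := Core.hom_ext
    (BraidedCategory.braiding_naturality_left f.iso.hom Z.of)
  hexagon_forward X Y Z := Core.hom_ext (BraidedCategory.hexagon_forward X.of Y.of Z.of)
  hexagon_reverse X Y Z := Core.hom_ext (BraidedCategory.hexagon_reverse X.of Y.of Z.of)
  symmetry X Y := Core.hom_ext (SymmetricCategory.symmetry X.of Y.of)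

end

section
variable (F : Type uF) [Category.{vF} F]

/-- The category of arrows of `F`; morphisms are commutative squares. -/
abbrev Arr : Type (max uF vF) := Comma (𝟭 F) (𝟭 F)

variable [MonoidalCategory F]

instance arrMonoidalStruct : MonoidalCategoryStruct (Arr F) where
  tensorObj X Y := ⟨X.left ⊗ Y.left, X.right ⊗ Y.right, X.hom ⊗ₘ Y.hom⟩
  whiskerLeft X _ _ f := ⟨X.left ◁ f.left, X.right ◁ f.right, by
    have := f.w
    dsimp at this ⊢
    rw [← id_tensorHom, ← id_tensorHom, MonoidalCategory.tensorHom_comp_tensorHom,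
      MonoidalCategory.tensorHom_comp_tensorHom, this, id_comp, comp_id]⟩
  whiskerRight f Y := ⟨f.left ▷ Y.left, f.right ▷ Y.right, by
    have := f.w
    dsimp at this ⊢
    rw [← tensorHom_id, ← tensorHom_id, MonoidalCategory.tensorHom_comp_tensorHom,
      MonoidalCategory.tensorHom_comp_tensorHom, this, id_comp, comp_id]⟩
  tensorHom f g := ⟨f.left ⊗ₘ g.left, f.right ⊗ₘ g.right, by
    have := f.w
    have := g.w
    dsimp at *
    rw [MonoidalCategory.tensorHom_comp_tensorHom, MonoidalCategory.tensorHom_comp_tensorHom]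
    congr 1⟩
  tensorUnit := ⟨𝟙_ F, 𝟙_ F, 𝟙 _⟩
  associator X Y Z := Comma.isoMk (α_ _ _ _) (α_ _ _ _) (by simp)
  leftUnitor X := Comma.isoMk (λ_ _) (λ_ _) (by simp)
  rightUnitor X := Comma.isoMk (ρ_ _) (ρ_ _) (by simp)

/-- The pointwise monoidal structure on the category of arrows. -/
instance arrMonoidal : MonoidalCategory (Arr F) where
  tensorHom_def _ _ := CommaMorphism.ext (MonoidalCategory.tensorHom_def _ _)
    (MonoidalCategory.tensorHom_def _ _)
  id_tensorHom_id _ _ := CommaMorphism.ext (id_tensorHom_id _ _) (id_tensorHom_id _ _)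
  tensorHom_comp_tensorHom _ _ _ _ := CommaMorphism.ext
    (MonoidalCategory.tensorHom_comp_tensorHom _ _ _ _)
    (MonoidalCategory.tensorHom_comp_tensorHom _ _ _ _)
  whiskerLeft_id _ _ := CommaMorphism.ext (whiskerLeft_id _ _) (whiskerLeft_id _ _)
  id_whiskerRight _ _ := CommaMorphism.ext (id_whiskerRight _ _) (id_whiskerRight _ _)
  associator_naturality _ _ _ := CommaMorphism.ext (associator_naturality _ _ _)
    (associator_naturality _ _ _)
  leftUnitor_naturality _ := CommaMorphism.ext (leftUnitor_naturality _) (leftUnitor_naturality _)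
  rightUnitor_naturality _ := CommaMorphism.ext (rightUnitor_naturality _)
    (rightUnitor_naturality _)
  pentagon _ _ _ _ := CommaMorphism.ext (MonoidalCategory.pentagon _ _ _ _)
    (MonoidalCategory.pentagon _ _ _ _)
  triangle _ _ := CommaMorphism.ext (MonoidalCategory.triangle _ _)
    (MonoidalCategory.triangle _ _)

/-- The pointwise symmetric structure on the category of arrows. -/
instance arrSymmetric [SymmetricCategory F] : SymmetricCategory (Arr F) where
  braiding X Y := Comma.isoMk (β_ _ _) (β_ _ _)
    (BraidedCategory.braiding_naturality X.hom Y.hom).symm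
  braiding_naturality_right _ _ _ _ := CommaMorphism.ext
    (BraidedCategory.braiding_naturality_right _ _) (BraidedCategory.braiding_naturality_right _ _)
  braiding_naturality_left _ _ := CommaMorphism.ext
    (BraidedCategory.braiding_naturality_left _ _) (BraidedCategory.braiding_naturality_left _ _)
  hexagon_forward _ _ _ := CommaMorphism.ext
    (BraidedCategory.hexagon_forward _ _ _) (BraidedCategory.hexagon_forward _ _ _)
  hexagon_reverse _ _ _ := CommaMorphism.ext
    (BraidedCategory.hexagon_reverse _ _ _) (BraidedCategory.hexagon_reverse _ _ _)
  symmetry _ _ := CommaMorphism.ext (SymmetricCategory.symmetry _ _)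
    (SymmetricCategory.symmetry _ _)

end

/-! ### The free symmetric monoidal category on a category -/

/-- Objects of the free symmetric monoidal category on `A`: parenthesised words in `A`. -/
inductive FreeSym (A : Type uV) : Type uV
  | of (a : A) : FreeSym A
  | unit : FreeSym A
  | tensor (x y : FreeSym A) : FreeSym A

namespace FreeSym

/-- The number of letters of a word. -/
def length {A : Type uV} : FreeSym A → ℕ
  | of _ => 1
  | unit => 0
  | tensor x y => length x + length y

/-- The evaluation of words in a monoidal category. -/
def value {A : Type uV} {D : Type u} [Category.{w} D] [MonoidalCategory D] (G : A → D) :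
    FreeSym A → D
  | of a => G a
  | unit => 𝟙_ D
  | tensor x y => value G x ⊗ value G y

section
variable {A : Type uV} [Category.{vV} A]

/-- Formal expressions for the morphisms of the free symmetric monoidal category. -/
inductive PreHom : FreeSym A → FreeSym A → Type (max uV vV)
  | of {a b : A} (f : a ⟶ b) : PreHom (.of a) (.of b)
  | id (x : FreeSym A) : PreHom x x
  | comp {x y z : FreeSym A} (f : PreHom x y) (g : PreHom y z) : PreHom x z
  | tensor {x y x' y' : FreeSym A} (f : PreHom x x') (g : PreHom y y') :
      PreHom (.tensor x y) (.tensor x' y')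
  | assocHom (x y z : FreeSym A) : PreHom (.tensor (.tensor x y) z) (.tensor x (.tensor y z))
  | assocInv (x y z : FreeSym A) : PreHom (.tensor x (.tensor y z)) (.tensor (.tensor x y) z)
  | leftHom (x : FreeSym A) : PreHom (.tensor .unit x) x
  | leftInv (x : FreeSym A) : PreHom x (.tensor .unit x)
  | rightHom (x : FreeSym A) : PreHom (.tensor x .unit) x
  | rightInv (x : FreeSym A) : PreHom x (.tensor x .unit)
  | braid (x y : FreeSym A) : PreHom (.tensor x y) (.tensor y x)

/-- The congruence on formal expressions generated by functoriality of `of` and by the axioms of a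
symmetric monoidal category. -/
inductive Rel : ∀ {x y : FreeSym A}, PreHom x y → PreHom x y → Prop
  | refl {x y : FreeSym A} (f : PreHom x y) : Rel f f
  | symm {x y : FreeSym A} {f g : PreHom x y} : Rel f g → Rel g f
  | trans {x y : FreeSym A} {f g h : PreHom x y} : Rel f g → Rel g h → Rel f h
  | comp {x y z : FreeSym A} {f f' : PreHom x y} {g g' : PreHom y z} :
      Rel f f' → Rel g g' → Rel (.comp f g) (.comp f' g')
  | tensor {x y x' y' : FreeSym A} {f f' : PreHom x x'} {g g' : PreHom y y'} :
      Rel f f' → Rel g g' → Rel (.tensor f g) (.tensor f' g')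
  | of_id (a : A) : Rel (.of (𝟙 a)) (.id (.of a))
  | of_comp {a b c : A} (f : a ⟶ b) (g : b ⟶ c) : Rel (.of (f ≫ g)) (.comp (.of f) (.of g))
  | id_comp {x y : FreeSym A} (f : PreHom x y) : Rel (.comp (.id x) f) f
  | comp_id {x y : FreeSym A} (f : PreHom x y) : Rel (.comp f (.id y)) f
  | assoc {w x y z : FreeSym A} (f : PreHom w x) (g : PreHom x y) (h : PreHom y z) :
      Rel (.comp (.comp f g) h) (.comp f (.comp g h))
  | tensor_id (x y : FreeSym A) : Rel (.tensor (.id x) (.id y)) (.id (.tensor x y))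
  | tensor_comp {x y z x' y' z' : FreeSym A} (f : PreHom x y) (g : PreHom y z) (f' : PreHom x' y')
      (g' : PreHom y' z') : Rel (.tensor (.comp f g) (.comp f' g'))
        (.comp (.tensor f f') (.tensor g g'))
  | assoc_hom_inv (x y z : FreeSym A) : Rel (.comp (.assocHom x y z) (.assocInv x y z)) (.id _)
  | assoc_inv_hom (x y z : FreeSym A) : Rel (.comp (.assocInv x y z) (.assocHom x y z)) (.id _)
  | assoc_nat {x y z x' y' z' : FreeSym A} (f : PreHom x x') (g : PreHom y y') (h : PreHom z z') :
      Rel (.comp (.tensor (.tensor f g) h) (.assocHom x' y' z'))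
        (.comp (.assocHom x y z) (.tensor f (.tensor g h)))
  | left_hom_inv (x : FreeSym A) : Rel (.comp (.leftHom x) (.leftInv x)) (.id _)
  | left_inv_hom (x : FreeSym A) : Rel (.comp (.leftInv x) (.leftHom x)) (.id _)
  | left_nat {x y : FreeSym A} (f : PreHom x y) :
      Rel (.comp (.tensor (.id .unit) f) (.leftHom y)) (.comp (.leftHom x) f)
  | right_hom_inv (x : FreeSym A) : Rel (.comp (.rightHom x) (.rightInv x)) (.id _)
  | right_inv_hom (x : FreeSym A) : Rel (.comp (.rightInv x) (.rightHom x)) (.id _)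
  | right_nat {x y : FreeSym A} (f : PreHom x y) :
      Rel (.comp (.tensor f (.id .unit)) (.rightHom y)) (.comp (.rightHom x) f)
  | pentagon (w x y z : FreeSym A) :
      Rel (.comp (.tensor (.assocHom w x y) (.id z)) (.comp (.assocHom w (.tensor x y) z)
          (.tensor (.id w) (.assocHom x y z))))
        (.comp (.assocHom (.tensor w x) y z) (.assocHom w x (.tensor y z)))
  | triangle (x y : FreeSym A) :
      Rel (.comp (.assocHom x .unit y) (.tensor (.id x) (.leftHom y)))
        (.tensor (.rightHom x) (.id y))
  | braid_nat {x y x' y' : FreeSym A} (f : PreHom x x') (g : PreHom y y') :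
      Rel (.comp (.tensor f g) (.braid x' y')) (.comp (.braid x y) (.tensor g f))
  | symmetry (x y : FreeSym A) : Rel (.comp (.braid x y) (.braid y x)) (.id _)
  | hexagon (x y z : FreeSym A) :
      Rel (.comp (.assocHom x y z) (.comp (.braid x (.tensor y z)) (.assocHom y z x)))
        (.comp (.tensor (.braid x y) (.id z)) (.comp (.assocHom y x z)
          (.tensor (.id y) (.braid x z))))

/-- The setoid of formal expressions. -/
instance preHomSetoid (x y : FreeSym A) : Setoid (PreHom x y) :=
  ⟨Rel, ⟨Rel.refl, Rel.symm, Rel.trans⟩⟩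

/-- The category structure: morphisms are formal expressions up to congruence. -/
instance category : Category.{max uV vV} (FreeSym A) where
  Hom x y := Quotient (preHomSetoid x y)
  id x := ⟦.id x⟧
  comp f g := Quotient.map₂ PreHom.comp (fun _ _ hf _ _ hg => Rel.comp hf hg) f g
  id_comp := by rintro x y ⟨f⟩; exact Quotient.sound (Rel.id_comp f)
  comp_id := by rintro x y ⟨f⟩; exact Quotient.sound (Rel.comp_id f)
  assoc := by rintro w x y z ⟨f⟩ ⟨g⟩ ⟨h⟩; exact Quotient.sound (Rel.assoc f g h)

variable {D : Type u} [Category.{w} D] [MonoidalCategory D] [SymmetricCategory D] (G : A ⥤ D)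

/-- Interpretation of formal expressions in a symmetric monoidal category. -/
def interp : ∀ {x y : FreeSym A}, PreHom x y → (value G.obj x ⟶ value G.obj y)
  | _, _, .of f => G.map f
  | _, _, .id _ => 𝟙 _
  | _, _, .comp f g => interp f ≫ interp g
  | _, _, .tensor f g => interp f ⊗ₘ interp g
  | _, _, .assocHom _ _ _ => (α_ _ _ _).hom
  | _, _, .assocInv _ _ _ => (α_ _ _ _).inv
  | _, _, .leftHom _ => (λ_ _).hom
  | _, _, .leftInv _ => (λ_ _).inv
  | _, _, .rightHom _ => (ρ_ _).hom
  | _, _, .rightInv _ => (ρ_ _).inv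
  | _, _, .braid _ _ => (β_ _ _).hom

lemma interp_rel {x y : FreeSym A} {f g : PreHom x y} (h : Rel f g) :
    interp G f = interp G g := by
  induction h with
  | refl => rfl
  | symm _ ih => exact ih.symm
  | trans _ _ ih₁ ih₂ => exact ih₁.trans ih₂
  | comp _ _ ih₁ ih₂ => exact congrArg₂ (fun a b => a ≫ b) ih₁ ih₂
  | tensor _ _ ih₁ ih₂ => exact congrArg₂ (fun a b => a ⊗ₘ b) ih₁ ih₂
  | hexagon x y z =>
      have h := BraidedCategory.hexagon_forward (value G.obj x) (value G.obj y) (value G.obj z)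
      rw [← tensorHom_id, ← id_tensorHom] at h
      exact h
  | _ => simp [interp, value]

/-- The symmetric monoidal extension of a functor `G` to the free symmetric monoidal category. -/
def lift : FreeSym A ⥤ D where
  obj := value G.obj
  map f := Quotient.lift (fun e => interp G e) (fun _ _ h => interp_rel G h) f
  map_id _ := rfl
  map_comp := by rintro x y z ⟨f⟩ ⟨g⟩; rfl

end
end FreeSym

/-! ### Feynman categories and their odd versions -/

section
variable {V : Type uV} [Groupoid.{vV} V] {F : Type uF} [Category.{vF} F]

/-- The functor `Iso(F ↓ V) ⥤ Iso(F ↓ F)` forgetting that the target comes from `V`. -/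
def arrowsOver (ι : V ⥤ F) : Core (Comma (𝟭 F) ι) ⥤ Core (Arr F) :=
  Functor.core
    { obj := fun f => ⟨f.left, ι.obj f.right, f.hom⟩
      map := fun g => ⟨g.left, ι.map g.right, g.w⟩
      map_id := fun _ => CommaMorphism.ext rfl (ι.map_id _)
      map_comp := fun _ _ => CommaMorphism.ext rfl (ι.map_comp _ _) }

variable [MonoidalCategory F] [SymmetricCategory F]

/-- A Feynman category `(V, F, ι)`: a groupoid `V`, a symmetric monoidal category `F` and a functor
`ι : V ⥤ F`, with the isomorphism, hereditary and size conditions. -/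
structure IsFeynmanCategory (ι : V ⥤ F) : Prop where
  /-- The free symmetric monoidal category on `V` is equivalent to the groupoid core of `F`. -/
  isoCondition : (FreeSym.lift (Core.functorToCore ι)).IsEquivalence
  /-- The free symmetric monoidal category on `Iso(F ↓ V)` is equivalent to `Iso(F ↓ F)`. -/
  hereditary : (FreeSym.lift (arrowsOver ι)).IsEquivalence
  /-- The slices over objects of `V` are essentially small. -/
  size : ∀ v : V, EssentiallySmall.{w} (Over (ι.obj v))

/-- The morphisms of `F` generated under composition and tensor product by a class of morphisms. -/
inductive Generated (W : ∀ {X Y : F}, (X ⟶ Y) → Prop) : ∀ {X Y : F}, (X ⟶ Y) → Prop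
  | of {X Y : F} (f : X ⟶ Y) : W f → Generated W f
  | comp {X Y Z : F} (f : X ⟶ Y) (g : Y ⟶ Z) : Generated W f → Generated W g →
      Generated W (f ≫ g)
  | tensor {X Y X' Y' : F} (f : X ⟶ Y) (g : X' ⟶ Y') : Generated W f → Generated W g →
      Generated W (f ⊗ₘ g)

/-- A choice of odd version of `F` together with its degree one generators `Φ¹`. The odd version is
the twist of `F` assigning to a morphism `f` the free module of rank one on a symbol `e_f` of degree
`deg f`, with `e_f ; e_g = ε(f,g) e_{f ≫ g}` and `e_f ⊗ e_g = η(f,g) e_{f ⊗ g}`; the axioms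
say that this is a symmetric monoidal category enriched in graded abelian groups with
the Koszul sign rule. -/
structure OddVersion (ι : V ⥤ F) where
  /-- The degree. -/
  deg : ∀ {X Y : F}, (X ⟶ Y) → ℕ
  /-- The composition sign. -/
  ε : ∀ {X Y Z : F}, (X ⟶ Y) → (Y ⟶ Z) → ℤˣ
  /-- The tensor sign. -/
  η : ∀ {X Y X' Y' : F}, (X ⟶ Y) → (X' ⟶ Y') → ℤˣ
  deg_iso : ∀ {X Y : F} (f : X ⟶ Y) [IsIso f], deg f = 0
  deg_comp : ∀ {X Y Z : F} (f : X ⟶ Y) (g : Y ⟶ Z), deg (f ≫ g) = deg f + deg g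
  deg_tensor : ∀ {X Y X' Y' : F} (f : X ⟶ Y) (g : X' ⟶ Y'), deg (f ⊗ₘ g) = deg f + deg g
  ε_iso : ∀ {X Y Z : F} (f : X ⟶ Y) (g : Y ⟶ Z) [IsIso f] [IsIso g], ε f g = 1
  η_iso : ∀ {X Y X' Y' : F} (f : X ⟶ Y) (g : X' ⟶ Y') [IsIso f] [IsIso g], η f g = 1
  ε_id_left : ∀ {X Y : F} (f : X ⟶ Y), ε (𝟙 X) f = 1
  ε_id_right : ∀ {X Y : F} (f : X ⟶ Y), ε f (𝟙 Y) = 1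
  ε_assoc : ∀ {X Y Z W : F} (f : X ⟶ Y) (g : Y ⟶ Z) (h : Z ⟶ W),
    ε f g * ε (f ≫ g) h = ε g h * ε f (g ≫ h)
  interchange : ∀ {X Y Z X' Y' Z' : F} (f : X ⟶ Y) (g : Y ⟶ Z) (f' : X' ⟶ Y') (g' : Y' ⟶ Z'),
    η f f' * η g g' * ε (f ⊗ₘ f') (g ⊗ₘ g') =
      (-1) ^ (deg f * deg g') * ε f g * ε f' g' * η (f ≫ g) (f' ≫ g')
  associator : ∀ {X Y X' Y' X'' Y'' : F} (f : X ⟶ Y) (g : X' ⟶ Y') (h : X'' ⟶ Y''),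
    η f g * η (f ⊗ₘ g) h * ε ((f ⊗ₘ g) ⊗ₘ h) (α_ Y Y' Y'').hom =
      η g h * η f (g ⊗ₘ h) * ε (α_ X X' X'').hom (f ⊗ₘ (g ⊗ₘ h))
  leftUnitor : ∀ {X Y : F} (f : X ⟶ Y),
    η (𝟙 (𝟙_ F)) f * ε (𝟙 (𝟙_ F) ⊗ₘ f) (λ_ Y).hom = ε (λ_ X).hom f
  rightUnitor : ∀ {X Y : F} (f : X ⟶ Y),
    η f (𝟙 (𝟙_ F)) * ε (f ⊗ₘ 𝟙 (𝟙_ F)) (ρ_ Y).hom = ε (ρ_ X).hom f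
  braiding : ∀ {X Y X' Y' : F} (f : X ⟶ Y) (g : X' ⟶ Y'),
    η f g * ε (f ⊗ₘ g) (β_ Y Y').hom =
      (-1) ^ (deg f * deg g) * η g f * ε (β_ X X').hom (g ⊗ₘ f)
  /-- The degree one generators. -/
  IsGen : ∀ {X : F} {v : V}, (X ⟶ ι.obj v) → Prop
  deg_gen : ∀ {X : F} {v : V} (f : X ⟶ ι.obj v), IsGen f → deg f = 1
  gen_source : ∀ {X Y : F} {v : V} (σ : X ≅ Y) (f : Y ⟶ ι.obj v), IsGen f →
    IsGen (σ.hom ≫ f) ∧ ε σ.hom f = 1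
  gen_target : ∀ {X : F} {v v' : V} (f : X ⟶ ι.obj v) (τ : v ⟶ v'), IsGen f →
    IsGen (f ≫ ι.map τ) ∧ ε f (ι.map τ) = 1
  generation : ∀ {X Y : F} (f : X ⟶ Y), Generated
    (fun {X Y} (g : X ⟶ Y) => deg g = 0 ∨
      ∃ (v : V) (h : Y = ι.obj v), IsGen (g ≫ eqToHom h)) f

end

section
variable {V : Type uV} [Groupoid.{vV} V] {F : Type uF} [Category.{vF} F] [MonoidalCategory F]
  [SymmetricCategory F] {ι : V ⥤ F}

/-- The object of `F` given by a word in `V`. -/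
abbrev wordObj (ι : V ⥤ F) (w : FreeSym V) : F := FreeSym.value ι.obj w

namespace OddVersion
variable (Φ : OddVersion ι)

/-- A degree one generator with target `v` and source a word in `V`. -/
structure Gen (v : V) where
  /-- The source. -/
  word : FreeSym V
  /-- The morphism. -/
  hom : wordObj ι word ⟶ ι.obj v
  isGen : Φ.IsGen hom

/-- Generators over `v` are equivalent if they differ by an isomorphism of their sources. -/
instance genSetoid (v : V) : Setoid (Φ.Gen v) where
  r g g' := ∃ σ : wordObj ι g.word ≅ wordObj ι g'.word, σ.hom ≫ g'.hom = g.hom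
  iseqv :=
    { refl := fun _ => ⟨Iso.refl _, id_comp _⟩
      symm := fun ⟨σ, h⟩ => ⟨σ.symm, by simp [← h]⟩
      trans := fun ⟨σ, hσ⟩ ⟨τ, hτ⟩ => ⟨σ ≪≫ τ, by simp [hσ, hτ]⟩ }

/-- The isomorphism classes of degree one generators over `v`. -/
abbrev GenClass (v : V) := Quotient (Φ.genSetoid v)

/-- A weight on the generators that only depends on their isomorphism class: the coefficient with
which a generator enters the differential. The most basic choice is the constant `1`; when
generators have automorphisms, the inverses of the orders of the automorphism groups are used. -/
structure Weight (k : Type u) where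
  /-- The coefficient of a generator. -/
  coeff : ∀ {X : F} {v : V}, (X ⟶ ι.obj v) → k
  source_iso : ∀ {X Y : F} {v : V} (σ : X ≅ Y) (f : Y ⟶ ι.obj v), Φ.IsGen f →
    coeff (σ.hom ≫ f) = coeff f
  target_iso : ∀ {X : F} {v v' : V} (f : X ⟶ ι.obj v) (τ : v ⟶ v'), Φ.IsGen f →
    coeff (f ≫ ι.map τ) = coeff f

/-- The sum over all ways of inserting a class of generators into one letter of the word `w`, the
other letters being kept. The summand `K y f s c` receives the new word `y`, the morphism
`f : y ⟶ w` that is the generator on the chosen letter and the identity on all others, the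
sign `s` relating `1 ⊗ e_g ⊗ 1` to `e_f`, and the weight `c` of the generator. -/
def insertSum {k : Type u} (c : Φ.Weight k) {M : Type*} [AddCommGroup M] : (w : FreeSym V) →
    ((y : FreeSym V) → (wordObj ι y ⟶ wordObj ι w) → ℤˣ → k → M) → M
  | .unit, _ => 0
  | .of v, K => ∑ᶠ g : Φ.GenClass v, K g.out.word g.out.hom 1 (c.coeff g.out.hom)
  | .tensor a b, K =>
      insertSum c a (fun y f s r => K (.tensor y b) (f ⊗ₘ 𝟙 (wordObj ι b))
        (s * Φ.η f (𝟙 (wordObj ι b))) r) +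
      insertSum c b (fun y f s r => K (.tensor a y) (𝟙 (wordObj ι a) ⊗ₘ f)
        (s * Φ.η (𝟙 (wordObj ι a)) f) r)

/-- The set of generators is resolving: the operator `∑ c_g e_g` (composition with all
classes of generators) squares to zero. This is expressed one isomorphism class of morphisms
with target `v` at a time: `m` runs over all functions on morphisms over `v`, with values in a
`k`-module, that are supported on one isomorphism class and compatible with the
orientations `e_f`. -/
def Resolving (k : Type u) [CommRing k] (c : Φ.Weight k) : Prop :=
  ∀ (v : V) (M : Type vC) [AddCommGroup M] [Module k M]
    (m : (y : FreeSym V) → (wordObj ι y ⟶ ι.obj v) → M),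
    (∀ (y y' : FreeSym V) (τ : wordObj ι y ≅ wordObj ι y') (f : wordObj ι y' ⟶ ι.obj v),
      m y (τ.hom ≫ f) = Φ.ε τ.hom f • m y' f) →
    (∃ (y₀ : FreeSym V) (f₀ : wordObj ι y₀ ⟶ ι.obj v), ∀ (y : FreeSym V)
      (f : wordObj ι y ⟶ ι.obj v),
      m y f ≠ 0 → ∃ τ : wordObj ι y ≅ wordObj ι y₀, τ.hom ≫ f₀ = f) →
    ∑ᶠ g : Φ.GenClass v, c.coeff g.out.hom • Φ.insertSum c g.out.word
      (fun y f s r => (s * Φ.ε f g.out.hom) • r • m y (f ≫ g.out.hom)) = 0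

end OddVersion
end

/-! ### Differential graded ops and odd ops -/

section
variable (F : Type uF) [Category.{vF} F] [MonoidalCategory F] [SymmetricCategory F]
variable (C : Type uC) [Category.{vC} C] [MonoidalCategory C] [GradedTarget C]
  [SymmetricCategory C] [Preadditive C] [MonoidalPreadditive C]

/-- Graded `F`-ops: symmetric monoidal functors from `F` to graded objects. -/
structure GrOp where
  /-- The underlying functor. -/
  fn : F ⥤ Gr C
  [braided : fn.Braided]

attribute [instance] GrOp.braided

/-- Differential graded `F`-ops: graded ops with a differential of degree one, which is natural
and a derivation. Equivalently, symmetric monoidal functors from `F` to complexes in `C`. -/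
structure DGOp extends GrOp F C where
  /-- The differential. -/
  d : ∀ X : F, DegHom 1 (fn.obj X) (fn.obj X)
  d_d : ∀ X : F, DegHom.comp (l := 2) (by norm_num) (d X) (d X) = 0
  d_natural : ∀ {X Y : F} (f : X ⟶ Y),
    DegHom.pre (fn.map f) (d Y) = DegHom.post (d X) (fn.map f)
  d_tensor : ∀ X Y : F, DegHom.pre (Functor.LaxMonoidal.μ fn X Y) (d (X ⊗ Y)) =
    DegHom.post (DegHom.tensorD (d X) (d Y)) (Functor.LaxMonoidal.μ fn X Y)

variable {F C}

/-- Morphisms of graded ops are monoidal natural transformations. -/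
structure GrOp.Hom (R S : GrOp F C) where
  /-- The underlying natural transformation. -/
  trans : R.fn ⟶ S.fn
  [monoidal : trans.IsMonoidal]

/-- Morphisms of differential graded ops are those that commute with the differentials. -/
structure DGOp.Hom (R S : DGOp F C) extends GrOp.Hom R.toGrOp S.toGrOp where
  comm : ∀ X : F, DegHom.pre (trans.app X) (S.d X) = DegHom.post (R.d X) (trans.app X)

/-- Composition of morphisms of differential graded ops. -/
def DGOp.Hom.comp {R S T : DGOp F C} (f : DGOp.Hom R S) (g : DGOp.Hom S T) : DGOp.Hom R T :=
  letI := f.monoidal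
  letI := g.monoidal
  { trans := f.trans ≫ g.trans
    comm := fun X => by
      ext p q h
      have h₁ := congrArg (fun t => t.app p q h) (f.comm X)
      have h₂ := congrArg (fun t => t.app p q h) (g.comm X)
      simp only [DegHom.pre, DegHom.post, DegHom.app, DegHom.mk, NatTrans.comp_app,
        Gr.comp_app, assoc] at h₁ h₂ ⊢
      rw [h₂, reassoc_of% h₁] }

end
section
variable {V : Type uV} [Groupoid.{vV} V] {F : Type uF} [Category.{vF} F] [MonoidalCategory F]
  [SymmetricCategory F] {ι : V ⥤ F} (Φ : OddVersion ι)
variable (C : Type uC) [Category.{vC} C] [MonoidalCategory C] [GradedTarget C]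
  [SymmetricCategory C] [Preadditive C] [MonoidalPreadditive C]

/-- The data of an op over the odd version: a monoidal functor on the groupoid core of `F`, an
action `act f = Q(e_f)` of degree `deg f` of every morphism, and a differential. -/
structure OddOpData where
  /-- The action of isomorphisms. -/
  core : Core F ⥤ Gr C
  [monoidal : core.Monoidal]
  /-- The action of the basis element `e_f`. -/
  act : ∀ {X Y : F} (f : X ⟶ Y), DegHom (Φ.deg f) (core.obj ⟨X⟩) (core.obj ⟨Y⟩)
  /-- The differential. -/
  d : ∀ X : F, DegHom 1 (core.obj ⟨X⟩) (core.obj ⟨X⟩)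

attribute [instance] OddOpData.monoidal

/-- Ops over the odd version: enriched symmetric monoidal functors from the odd version of `F` to
complexes in `C`. -/
structure OddOp extends OddOpData Φ C where
  braided : ∀ X Y : Core F, Functor.LaxMonoidal.μ core X Y ≫ core.map (β_ X Y).hom =
    (β_ (core.obj X) (core.obj Y)).hom ≫ Functor.LaxMonoidal.μ core Y X
  act_iso : ∀ {X Y : F} (σ : X ≅ Y) (p q : ℤ) (h : p + 0 = q) (h' : p + Φ.deg σ.hom = q),
    (act σ.hom).app p q h' = (DegHom.ofHom (core.map (⟨σ⟩ : (⟨X⟩ : Core F) ⟶ ⟨Y⟩))).app p q h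
  act_comp : ∀ {X Y Z : F} (f : X ⟶ Y) (g : Y ⟶ Z),
    DegHom.comp (by rw [Φ.deg_comp, Nat.cast_add]) (act f) (act g) = Φ.ε f g • act (f ≫ g)
  act_tensor : ∀ {X Y X' Y' : F} (f : X ⟶ Y) (g : X' ⟶ Y'),
    DegHom.post (DegHom.tensor (by rw [Φ.deg_tensor, Nat.cast_add]) (act f) (act g))
        (Functor.LaxMonoidal.μ core ⟨Y⟩ ⟨Y'⟩) =
      Φ.η f g • DegHom.pre (Functor.LaxMonoidal.μ core ⟨X⟩ ⟨X'⟩) (act (f ⊗ₘ g))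
  d_d : ∀ X : F, DegHom.comp (l := 2) (by norm_num) (d X) (d X) = 0
  d_act : ∀ {X Y : F} (f : X ⟶ Y),
    DegHom.comp (l := Φ.deg f + 1) rfl (act f) (d Y) =
      (-1 : ℤˣ) ^ Φ.deg f • DegHom.comp (l := Φ.deg f + 1) (add_comm _ _) (d X) (act f)
  d_tensor : ∀ X Y : F, DegHom.pre (Functor.LaxMonoidal.μ core ⟨X⟩ ⟨Y⟩) (d (X ⊗ Y)) =
    DegHom.post (DegHom.tensorD (d X) (d Y)) (Functor.LaxMonoidal.μ core ⟨X⟩ ⟨Y⟩)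

variable {Φ C}

/-- Morphisms of ops over the odd version. -/
structure OddOp.Hom (P P' : OddOp Φ C) where
  /-- The underlying natural transformation. -/
  trans : P.core ⟶ P'.core
  monoidal : trans.IsMonoidal
  comm_act : ∀ {X Y : F} (f : X ⟶ Y),
    DegHom.pre (trans.app ⟨X⟩) (P'.act f) = DegHom.post (P.act f) (trans.app ⟨Y⟩)
  comm_d : ∀ X : F,
    DegHom.pre (trans.app ⟨X⟩) (P'.d X) = DegHom.post (P.d X) (trans.app ⟨X⟩)

/-- The functor underlying the pointwise tensor product `P ⊗ O`. -/
abbrev hadamardCore (P : OddOpData Φ C) (O : GrOp F C) : Core F ⥤ Gr C :=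
  Functor.prod' P.core (Core.inclusion F ⋙ O.fn) ⋙ MonoidalCategory.tensor (Gr C)

/-- The pointwise tensor product `P ⊗ O` of an odd op and an op, which is again an odd op:
`e_f` acts by `P(e_f) ⊗ O(f)` and the differential is `d ⊗ 1 + 1 ⊗ d`. -/
def hadamard (P : OddOp Φ C) (O : DGOp F C) : OddOpData Φ C where
  core := hadamardCore P.toOddOpData O.toGrOp
  act f := DegHom.tensor (add_zero _) (P.act f) (DegHom.ofHom (O.fn.map f))
  d X := DegHom.tensorD (P.d X) (O.d X)

namespace OddOpData
variable (Q : OddOpData Φ C)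

/-- The value of `Q` on an object of `F`. -/
abbrev val (X : F) : Gr C := Q.core.obj ⟨X⟩

/-- Families of degree zero elements of the values of `Q` on the objects of `V`. -/
abbrev Family := ∀ v : V, 𝟙_ (Gr C) ⟶ Q.val (ι.obj v)

/-- The (generalised, degree zero) elements of the limit over `V` of the restriction of `Q`:
families of elements compatible with the morphisms of `V`. -/
def limV : Set Q.Family :=
  (Core.functorToCore ι ⋙ Q.core ⋙ coyoneda.obj (Opposite.op (𝟙_ (Gr C)))).sections

variable {Q}

/-- The product of two elements of values of `Q`. -/
def mul {X Y : F} (x : 𝟙_ (Gr C) ⟶ Q.val X) (y : 𝟙_ (Gr C) ⟶ Q.val Y) :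
    𝟙_ (Gr C) ⟶ Q.val (X ⊗ Y) :=
  (λ_ (𝟙_ (Gr C))).inv ≫ (x ⊗ₘ y) ≫ Functor.LaxMonoidal.μ Q.core ⟨X⟩ ⟨Y⟩

/-- The tensor power of a family: `α_{v₁} ⊗ ⋯ ⊗ α_{vₙ}` as an element of
the value of `Q` on the word `v₁ ⋯ vₙ`. -/
def power (α : Q.Family) : (w : FreeSym V) → (𝟙_ (Gr C) ⟶ Q.val (wordObj ι w))
  | .of v => α v
  | .unit => Functor.LaxMonoidal.ε Q.core
  | .tensor a b => mul (power α a) (power α b)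

variable (Q) in
/-- The action of a degree one generator. -/
def actGen {X : F} {v : V} (f : X ⟶ ι.obj v) (h : Φ.IsGen f) :
    DegHom 1 (Q.val X) (Q.val (ι.obj v)) :=
  DegHom.ofEq (by rw [Φ.deg_gen f h]; rfl) (Q.act f)

variable {k : Type u} [CommRing k] [Linear k C] (c : Φ.Weight k)

/-- The natural operation of arity `n`, evaluated at `α ⊗ ⋯ ⊗ α`: the sum over the isomorphism
classes of degree one generators with a source of length `n`. -/
def psi (n : ℕ) (α : Q.Family) (v : V) : DegHom 1 (𝟙_ (Gr C)) (Q.val (ι.obj v)) :=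
  ∑ᶠ (g : Φ.GenClass v) (_ : g.out.word.length = n),
    c.coeff g.out.hom • DegHom.pre (power α g.out.word) (Q.actGen g.out.hom g.out.isGen)

variable (Q)

/-- The solutions of the master equation `d(α) + ∑ₙ Ψₙ(α ⊗ ⋯ ⊗ α) = 0` in the limit of `Q`. -/
def masterEquation : Set Q.Family :=
  {α | α ∈ Q.limV ∧ ∀ v : V,
    DegHom.pre (α v) (Q.d (ι.obj v)) + ∑ᶠ n : ℕ, psi c n α v = 0}

variable {Q}

/-- A representative `ι a ⊗ ι b ⟶ ι v` of a class of generators with source of length two. -/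
structure OrderedRep {v : V} (g : Φ.GenClass v) where
  /-- The first letter. -/
  fst : V
  /-- The second letter. -/
  snd : V
  /-- The morphism. -/
  hom : ι.obj fst ⊗ ι.obj snd ⟶ ι.obj v
  isGen : Φ.IsGen hom
  rep : ∃ σ : ι.obj fst ⊗ ι.obj snd ≅ wordObj ι g.out.word, σ.hom ≫ g.out.hom = hom

/-- The unary operation `Δ`: the sum of the actions of all generators of arity one. -/
def delta (α : Q.Family) (v : V) : DegHom 1 (𝟙_ (Gr C)) (Q.val (ι.obj v)) :=
  psi c 1 α v

/-- The binary operation `α ∘ β` that is given by the generators of arity two, for a choice of an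
order of the two factors of the source of each generator. -/
def circ (s : ∀ (v : V) (g : Φ.GenClass v), g.out.word.length = 2 → OrderedRep g)
    (α β : Q.Family) (v : V) : DegHom 1 (𝟙_ (Gr C)) (Q.val (ι.obj v)) :=
  ∑ᶠ (g : Φ.GenClass v) (h : g.out.word.length = 2), c.coeff (s v g h).hom •
    DegHom.pre (mul (α (s v g h).fst) (β (s v g h).snd)) (Q.actGen (s v g h).hom (s v g h).isGen)

/-- The bracket `[α, β] = α ∘ β + β ∘ α` (a commutator of degree zero elements with respect
to an operation of degree one). -/
def bracket (s : ∀ (v : V) (g : Φ.GenClass v), g.out.word.length = 2 → OrderedRep g)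
    (α β : Q.Family) (v : V) : DegHom 1 (𝟙_ (Gr C)) (Q.val (ι.obj v)) :=
  circ c s α β v + circ c s β α v

end OddOpData
end
/-! ### The Feynman transform -/

section
variable {V : Type uV} [Groupoid.{vV} V] {F : Type uF} [Category.{vF} F] [MonoidalCategory F]
  [SymmetricCategory F] {ι : V ⥤ F} {Φ : OddVersion ι}
variable {C : Type uC} [Category.{vC} C] [MonoidalCategory C] [GradedTarget C]
  [SymmetricCategory C] [Preadditive C] [MonoidalPreadditive C]

namespace OddOp
variable (P : OddOp Φ C)

/-- Only finitely many classes of degree one generators over each object of `V` act nontrivially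
on `P`, so that the differential given by the sum over these classes is defined. -/
def LocallyFinite : Prop :=
  ∀ v : V, {g : Φ.GenClass v | P.act g.out.hom ≠ 0}.Finite

/-- The value of `P` on an object of `V`. -/
abbrev atV (v : V) : Gr C := P.val (ι.obj v)

/-- The action of a morphism of `V` on the values of `P`. -/
def mapV {v v' : V} (τ : v ⟶ v') : P.atV v ⟶ P.atV v' :=
  P.core.map ((Core.functorToCore ι).map τ)

variable [∀ v : V, HasRightDual (P.atV v)]

/-- The tensor product of the dual values of `P` on the letters of a word. -/
def dualWord : FreeSym V → Gr C :=
  FreeSym.value fun v => (P.atV v)ᘁ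

/-- The exchange of the two middle factors, followed by the multiplication of `P`. -/
def coevTensor {X Y : F} {A B : Gr C} (x : 𝟙_ (Gr C) ⟶ P.val X ⊗ A)
    (y : 𝟙_ (Gr C) ⟶ P.val Y ⊗ B) : 𝟙_ (Gr C) ⟶ P.val (X ⊗ Y) ⊗ (A ⊗ B) :=
  (λ_ (𝟙_ (Gr C))).inv ≫ (x ⊗ₘ y) ≫ tensorμ (P.val X) A (P.val Y) B ≫
    Functor.LaxMonoidal.μ P.core ⟨X⟩ ⟨Y⟩ ▷ (A ⊗ B)

/-- The coevaluation exhibiting `dualWord w` as a dual of the value of `P` on the word `w`. -/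
def coev : (w : FreeSym V) → (𝟙_ (Gr C) ⟶ P.val (wordObj ι w) ⊗ P.dualWord w)
  | .of v => η_ (P.atV v) (P.atV v)ᘁ
  | .unit => (λ_ (𝟙_ (Gr C))).inv ≫ Functor.LaxMonoidal.ε P.core ▷ 𝟙_ (Gr C)
  | .tensor a b => coevTensor P (coev a) (coev b)

/-- The transpose of a homogeneous map `P(w) ⟶ P(v)`. -/
def transpose {n : ℤ} {w : FreeSym V} {v : V} (t : DegHom n (P.val (wordObj ι w)) (P.atV v)) :
    DegHom n (P.atV v)ᘁ (P.dualWord w) :=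
  DegHom.transpose (P.coev w) (ε_ (P.atV v) (P.atV v)ᘁ) t

variable {P}

/-- A morphism of `V`-modules from the dual of the restriction of `P` (with the contragredient
action) to the restriction of a graded op. -/
structure DualModHom (P : OddOp Φ C) [∀ v : V, HasRightDual (P.atV v)] (R : GrOp F C) where
  /-- The components. -/
  app : ∀ v : V, (P.atV v)ᘁ ⟶ R.fn.obj (ι.obj v)
  natural : ∀ {v u : V} (τ : v ⟶ u),
    app v ≫ R.fn.map (ι.map τ) = (P.mapV (Groupoid.inv τ))ᘁ ≫ app u

/-- The extension of a morphism of `V`-modules to words. -/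
def DualModHom.word {R : GrOp F C} (g : DualModHom P R) :
    (w : FreeSym V) → (P.dualWord w ⟶ R.fn.obj (wordObj ι w))
  | .of v => g.app v
  | .unit => Functor.LaxMonoidal.ε R.fn
  | .tensor a b => (word g a ⊗ₘ word g b) ≫ Functor.LaxMonoidal.μ R.fn (wordObj ι a) (wordObj ι b)

variable (P) in
/-- The Feynman transform of `P`, with respect to the weight `c`: the free op on the dual of the
restriction of `P` to `V`, with the differential that is given on the generators by (minus) the
transpose of the differential of `P` plus the sum of the transposes of the actions of
the degree one generators of `Φ`. -/
structure FeynmanTransform {k : Type u} [CommRing k] [Linear k C] (c : Φ.Weight k) where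
  /-- The underlying differential graded op. -/
  op : DGOp F C
  /-- The inclusion of the generators. -/
  incl : DualModHom P op.toGrOp
  free : ∀ (S : GrOp F C) (g : DualModHom P S), ∃! f : GrOp.Hom op.toGrOp S,
    ∀ v : V, incl.app v ≫ f.trans.app (ι.obj v) = g.app v
  d_incl : ∀ v : V, DegHom.pre (incl.app v) (op.d (ι.obj v)) +
    (DegHom.post (P.transpose (w := .of v) (P.d (ι.obj v))) (incl.app v) +
      ∑ᶠ g : Φ.GenClass v, c.coeff g.out.hom •
        DegHom.post (P.transpose (P.actGen g.out.hom g.out.isGen))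
          (incl.word g.out.word ≫ op.fn.map g.out.hom)) = 0

variable {k : Type u} [CommRing k] [Linear k C] {c : Φ.Weight k}

/-- The family of elements of `P(v) ⊗ O(v)` that corresponds to a morphism from the Feynman
transform of `P` to `O`: restrict to generators and use `Hom(P(v)ᘁ, O(v)) = P(v) ⊗ O(v)`. -/
def FeynmanTransform.family (T : P.FeynmanTransform c) {O : DGOp F C} (f : DGOp.Hom T.op O) :
    (hadamard P O).Family := fun v =>
  η_ (P.atV v) (P.atV v)ᘁ ≫ P.atV v ◁ (T.incl.app v ≫ f.trans.app (ι.obj v))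

end OddOp
end
end FeynOps
end

/-! As a graded op the Feynman transform is free, so a graded morphism from it to `O` is a morphism
of `V`-modules `P(v)ᘁ ⟶ O(v)`. By duality this is a family of degree zero elements of `P(v) ⊗ O(v)`
compatible with `V` (`eta_whiskerLeft_bijective`, `DualModHom.elt_mem_limV`, `exists_elt_eq`). Such
a morphism `f` commutes with the differentials as soon as it does so on generators: both composites
of `f` with a differential are derivations along `f`, and derivations on a free op are determined by
the generators (`IsFreeOp.derivation_ext`). On generators the difference of the two composites
corresponds under duality (`DegHom.twist`) to `d(α) + ∑ c_φ e_φ(α ⊗ ⋯ ⊗ α)`, because a transpose on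
the dual side is an action on the element (`twist_dualSum`). This is the bijection.

The existence of the transform has two halves. The first is the free graded op. Its value at `X` is
the colimit of the module over all words in `V` lying over `X`, a left Kan extension along words.
The size condition makes the indexing categories essentially small, and the hereditary condition
makes the extension strong monoidal: a word over `X ⊗ Y` splits into a word over `X` and a word over
`Y`, uniquely up to a pair of isomorphisms (`exists_split`, `exists_tensor_of_split`). The
hereditary condition is an equivalence out of a category presented by generators and relations. To
extract the splitting from it, formal expressions are interpreted in an auxiliary symmetric monoidal
category `Fam`, whose morphisms are sets of morphisms of `F`. An isomorphism between tensor products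
of arrows that is the identity on targets comes from a formal expression whose effect on targets is,
by the isomorphism condition, the identity of the free category. Its interpretation in `Fam` is then
the identity relation, so the isomorphism is a tensor product of isomorphisms over the single
letters (`mem_mor_of_comp_eq`).

The second half is the differential. The formula on generators extends to a derivation `d` of the
free op `R` (`IsFreeOp.exists_derivation`). Its square is again a derivation, so only the generators
matter for `d² = 0`. There no transposes are composed. Instead, the tautological element `α` of `P ⊗
R`, which corresponds to the inclusion of the generators, solves the master equation by the very
definition of `d`. For any solution, `dα = -∑ c_φ e_φ(α ⊗ ⋯ ⊗ α)`. Applying `d` again, using the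
product rule and that odd generators anticommute with `d`, gives up to sign the sum over all
compositions of two generators applied to powers of `α`, which is zero because the generators are
resolving (`OddOpData.IsOdd.pre_d_d`). As `d_P² = 0`, this reads `(1 ⊗ d²)α = 0`, and duality gives
`d² = 0` on generators. For this argument pointwise products are considered with derivations whose
square is not known to vanish. -/

noncomputable section
namespace FeynOps
set_option linter.unusedSectionVars false

-- The value of a concatenated word is to count as the tensor product of the values, without a
-- comparison isomorphism.
attribute [reducible] FreeSym.value FreeSym.lift OddOp.dualWord

section
/-! ### Families of objects with sets of morphisms between them -/

/-- A family of objects of `F` together with a distinguished set of morphisms between any two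
members, containing the identities and closed under composition. -/
structure Fam (F : Type uF) [Category.{vF} F] where
  carrier : Type u
  src : carrier → F
  mor : ∀ k l : carrier, Set (src k ⟶ src l)
  id_mem : ∀ k, 𝟙 (src k) ∈ mor k k
  comp_mem : ∀ {k l m} {f : src k ⟶ src l} {g : src l ⟶ src m}, f ∈ mor k l → g ∈ mor l m →
    f ≫ g ∈ mor k m

namespace Fam

section
variable {F : Type uF} [Category.{vF} F]

/-- Morphisms of families: bimodules in sets of morphisms of `F`. -/
@[ext] structure Hom (X Y : Fam.{vF, uF, u} F) where
  rel : ∀ (k : X.carrier) (l : Y.carrier), Set (X.src k ⟶ Y.src l)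
  left_mem : ∀ {k k' l} {j : X.src k ⟶ X.src k'} {s : X.src k' ⟶ Y.src l},
    j ∈ X.mor k k' → s ∈ rel k' l → j ≫ s ∈ rel k l
  right_mem : ∀ {k l l'} {s : X.src k ⟶ Y.src l} {j : Y.src l ⟶ Y.src l'},
    s ∈ rel k l → j ∈ Y.mor l l' → s ≫ j ∈ rel k l'

instance : Category (Fam.{vF, uF, u} F) where
  Hom X Y := Hom X Y
  id X := ⟨X.mor, X.comp_mem, X.comp_mem⟩
  comp {X Y Z} S T :=
    { rel := fun k m => {f | ∃ (l : Y.carrier) (s : X.src k ⟶ Y.src l) (t : Y.src l ⟶ Z.src m),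
        s ∈ S.rel k l ∧ t ∈ T.rel l m ∧ s ≫ t = f}
      left_mem := by
        rintro k k' m j _ hj ⟨l, s, t, hs, ht, rfl⟩
        exact ⟨l, j ≫ s, t, S.left_mem hj hs, ht, assoc _ _ _⟩
      right_mem := by
        rintro k m m' _ j ⟨l, s, t, hs, ht, rfl⟩ hj
        exact ⟨l, s, t ≫ j, hs, T.right_mem ht hj, (assoc _ _ _).symm⟩ }
  id_comp {X Y} S := by
    apply Hom.ext
    ext k m f
    constructor
    · rintro ⟨l, s, t, hs, ht, rfl⟩
      exact S.left_mem hs ht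
    · intro h
      exact ⟨k, 𝟙 _, f, X.id_mem k, h, id_comp f⟩
  comp_id {X Y} S := by
    apply Hom.ext
    ext k m f
    constructor
    · rintro ⟨l, s, t, hs, ht, rfl⟩
      exact S.right_mem hs ht
    · intro h
      exact ⟨m, f, 𝟙 _, h, Y.id_mem m, comp_id f⟩
  assoc {W X Y Z} S T U := by
    apply Hom.ext
    ext k m f
    constructor
    · rintro ⟨l, _, t, ⟨l', s, u, hs, hu, rfl⟩, ht, rfl⟩
      exact ⟨l', s, u ≫ t, hs, ⟨l, u, t, hu, ht, rfl⟩, (assoc _ _ _).symm⟩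
    · rintro ⟨l, s, _, hs, ⟨l', t, u, ht, hu, rfl⟩, rfl⟩
      exact ⟨l', s ≫ t, u, ⟨l, s, t, hs, ht, rfl⟩, hu, assoc _ _ _⟩

@[ext] lemma hom_ext {X Y : Fam.{vF, uF, u} F} (S T : X ⟶ Y)
    (h : ∀ k l f, f ∈ S.rel k l ↔ f ∈ T.rel k l) : S = T :=
  Hom.ext (by ext k l f; exact h k l f)

/-- The morphism of families given by a map of the index sets and morphisms of `F`. -/
def graph {X Y : Fam.{vF, uF, u} F} (a : X.carrier → Y.carrier) (θ : ∀ k, X.src k ⟶ Y.src (a k))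
    (h : ∀ k l (j : X.src k ⟶ X.src l), j ∈ X.mor k l →
      ∃ j' ∈ Y.mor (a k) (a l), j ≫ θ l = θ k ≫ j') : X ⟶ Y where
  rel k m := {f | ∃ j ∈ Y.mor (a k) m, θ k ≫ j = f}
  left_mem := by
    rintro k k' l j _ hj ⟨i, hi, rfl⟩
    obtain ⟨j', hj', e⟩ := h _ _ j hj
    exact ⟨j' ≫ i, Y.comp_mem hj' hi, by rw [← assoc, ← e, assoc]⟩
  right_mem := by
    rintro k l l' _ j ⟨i, hi, rfl⟩ hj
    exact ⟨i ≫ j, Y.comp_mem hi hj, (assoc _ _ _).symm⟩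

/-- All coherence isomorphisms of families are graphs. Pentagon, triangle and hexagon thereby reduce
to the same identities in `F`, index by index. -/
lemma graph_comp {X Y Z : Fam.{vF, uF, u} F} {a : X.carrier → Y.carrier}
    {θ : ∀ k, X.src k ⟶ Y.src (a k)} {h} {b : Y.carrier → Z.carrier}
    {ξ : ∀ k, Y.src k ⟶ Z.src (b k)} {h'} :
    (graph a θ h ≫ graph b ξ h' : X ⟶ Z) = graph (fun k => b (a k)) (fun k => θ k ≫ ξ (a k))
      (fun k l j hj => by
        obtain ⟨j₁, hj₁, e₁⟩ := h k l j hj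
        obtain ⟨j₂, hj₂, e₂⟩ := h' _ _ j₁ hj₁
        exact ⟨j₂, hj₂, by rw [← assoc, e₁, assoc, e₂, assoc]⟩) := by
  ext k m f
  constructor
  · rintro ⟨l, _, _, ⟨j, hj, rfl⟩, ⟨i, hi, rfl⟩, rfl⟩
    obtain ⟨j', hj', e⟩ := h' _ _ j hj
    exact ⟨j' ≫ i, Z.comp_mem hj' hi, by simp only [assoc]; rw [← assoc j, e, assoc]⟩
  · rintro ⟨j, hj, rfl⟩
    exact ⟨a k, θ k, ξ (a k) ≫ j, ⟨𝟙 _, Y.id_mem _, comp_id _⟩, ⟨j, hj, rfl⟩, (assoc _ _ _).symm⟩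

lemma graph_id (X : Fam.{vF, uF, u} F) : graph id (fun k => 𝟙 (X.src k))
    (fun _ _ j hj => ⟨j, hj, by simp⟩) = 𝟙 X := by
  ext k m f
  constructor
  · rintro ⟨j, hj, rfl⟩
    exact (id_comp j).symm ▸ hj
  · intro h
    exact ⟨f, h, id_comp f⟩

end

section
variable {F : Type uF} [Category.{vF} F] [MonoidalCategory F]

/-- The tensor product of families. -/
abbrev tens (X Y : Fam.{vF, uF, u} F) : Fam.{vF, uF, u} F where
  carrier := X.carrier × Y.carrier
  src k := X.src k.1 ⊗ Y.src k.2
  mor k l := {f | ∃ i ∈ X.mor k.1 l.1, ∃ j ∈ Y.mor k.2 l.2, i ⊗ₘ j = f}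
  id_mem k := ⟨𝟙 _, X.id_mem _, 𝟙 _, Y.id_mem _, id_tensorHom_id _ _⟩
  comp_mem := by
    rintro k l m _ _ ⟨i, hi, j, hj, rfl⟩ ⟨i', hi', j', hj', rfl⟩
    exact ⟨i ≫ i', X.comp_mem hi hi', j ≫ j', Y.comp_mem hj hj', by simp⟩

/-- The unit family. -/
abbrev one : Fam.{vF, uF, u} F where
  carrier := PUnit
  src _ := 𝟙_ F
  mor _ _ := {𝟙 (𝟙_ F)}
  id_mem _ := rfl
  comp_mem := by
    rintro _ _ _ _ _ rfl rfl
    exact id_comp _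

/-- The tensor product of morphisms of families. -/
def tensHom {X Y X' Y' : Fam.{vF, uF, u} F} (S : X ⟶ X') (T : Y ⟶ Y') : tens X Y ⟶ tens X' Y' where
  rel k l := {f | ∃ s ∈ S.rel k.1 l.1, ∃ t ∈ T.rel k.2 l.2, s ⊗ₘ t = f}
  left_mem := by
    rintro k l m _ _ ⟨i, hi, j, hj, rfl⟩ ⟨i', hi', j', hj', rfl⟩
    exact ⟨i ≫ i', S.left_mem hi hi', j ≫ j', T.left_mem hj hj', by simp⟩
  right_mem := by
    rintro k l m _ _ ⟨i, hi, j, hj, rfl⟩ ⟨i', hi', j', hj', rfl⟩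
    exact ⟨i ≫ i', S.right_mem hi hi', j ≫ j', T.right_mem hj hj', by simp⟩

/-- The associator of families. -/
def assocGraph (X Y Z : Fam.{vF, uF, u} F) : tens (tens X Y) Z ⟶ tens X (tens Y Z) :=
  graph (fun k => (k.1.1, k.1.2, k.2)) (fun k => (α_ _ _ _).hom) (by
    rintro k l _ ⟨_, ⟨i, hi, j, hj, rfl⟩, m, hm, rfl⟩
    exact ⟨i ⊗ₘ j ⊗ₘ m, ⟨i, hi, _, ⟨j, hj, m, hm, rfl⟩, rfl⟩, associator_naturality _ _ _⟩)

/-- The associativity isomorphism of families. -/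
def assocIso (X Y Z : Fam.{vF, uF, u} F) : tens (tens X Y) Z ≅ tens X (tens Y Z) where
  hom := assocGraph X Y Z
  inv := graph (fun k => ((k.1, k.2.1), k.2.2)) (fun k => (α_ _ _ _).inv) (by
    rintro k l _ ⟨i, hi, _, ⟨j, hj, m, hm, rfl⟩, rfl⟩
    exact ⟨(i ⊗ₘ j) ⊗ₘ m, ⟨_, ⟨i, hi, j, hj, rfl⟩, m, hm, rfl⟩, associator_inv_naturality _ _ _⟩)
  hom_inv_id := by
    refine graph_comp.trans ?_
    rw [← graph_id]
    congr 1
    funext k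
    exact Iso.hom_inv_id _
  inv_hom_id := by
    refine graph_comp.trans ?_
    rw [← graph_id]
    congr 1
    funext k
    exact Iso.inv_hom_id _

/-- The left unitor of families. -/
def leftGraph (X : Fam.{vF, uF, u} F) : tens one X ⟶ X :=
  graph (fun k => k.2) (fun k => (λ_ _).hom) (by
    rintro k l _ ⟨_, rfl, j, hj, rfl⟩
    exact ⟨j, hj, by rw [id_tensorHom, leftUnitor_naturality]⟩)

/-- The left unit isomorphism of families. -/
def leftIso (X : Fam.{vF, uF, u} F) : tens one X ≅ X where
  hom := leftGraph X
  inv := graph (fun k => (PUnit.unit, k)) (fun k => (λ_ _).inv) (by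
    rintro k l j hj
    exact ⟨_, ⟨𝟙 _, rfl, j, hj, rfl⟩, by rw [id_tensorHom, leftUnitor_inv_naturality]⟩)
  hom_inv_id := by
    refine graph_comp.trans ?_
    rw [← graph_id]
    congr 1
    funext k
    exact Iso.hom_inv_id _
  inv_hom_id := by
    refine graph_comp.trans ?_
    rw [← graph_id]
    congr 1
    funext k
    exact Iso.inv_hom_id _

/-- The right unitor of families. -/
def rightGraph (X : Fam.{vF, uF, u} F) : tens X one ⟶ X :=
  graph (fun k => k.1) (fun k => (ρ_ _).hom) (by
    rintro k l _ ⟨j, hj, _, rfl, rfl⟩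
    exact ⟨j, hj, by rw [tensorHom_id, rightUnitor_naturality]⟩)

/-- The right unit isomorphism of families. -/
def rightIso (X : Fam.{vF, uF, u} F) : tens X one ≅ X where
  hom := rightGraph X
  inv := graph (fun k => (k, PUnit.unit)) (fun k => (ρ_ _).inv) (by
    rintro k l j hj
    exact ⟨_, ⟨j, hj, 𝟙 _, rfl, rfl⟩, by rw [tensorHom_id, rightUnitor_inv_naturality]⟩)
  hom_inv_id := by
    refine graph_comp.trans ?_
    rw [← graph_id]
    congr 1
    funext k
    exact Iso.hom_inv_id _
  inv_hom_id := by
    refine graph_comp.trans ?_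
    rw [← graph_id]
    congr 1
    funext k
    exact Iso.inv_hom_id _

lemma tensHom_id_id (X Y : Fam.{vF, uF, u} F) : tensHom (𝟙 X) (𝟙 Y) = 𝟙 (tens X Y) := rfl

lemma tensHom_graph {X Y X' Y' : Fam.{vF, uF, u} F} {a : X.carrier → X'.carrier}
    {θ : ∀ k, X.src k ⟶ X'.src (a k)} {h} {b : Y.carrier → Y'.carrier}
    {ξ : ∀ k, Y.src k ⟶ Y'.src (b k)} {h'} :
    tensHom (graph a θ h) (graph b ξ h') = graph (X := tens X Y) (Y := tens X' Y')
      (fun k => (a k.1, b k.2)) (fun k => θ k.1 ⊗ₘ ξ k.2)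
      (by
        rintro k l _ ⟨i, hi, j, hj, rfl⟩
        obtain ⟨i', hi', e⟩ := h _ _ i hi
        obtain ⟨j', hj', e'⟩ := h' _ _ j hj
        exact ⟨_, ⟨i', hi', j', hj', rfl⟩, by
          rw [MonoidalCategory.tensorHom_comp_tensorHom, e, e',
            MonoidalCategory.tensorHom_comp_tensorHom]⟩) := by
  ext k m f
  constructor
  · rintro ⟨_, ⟨i, hi, rfl⟩, _, ⟨j, hj, rfl⟩, rfl⟩
    exact ⟨_, ⟨i, hi, j, hj, rfl⟩, MonoidalCategory.tensorHom_comp_tensorHom _ _ _ _⟩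
  · rintro ⟨_, ⟨i, hi, j, hj, rfl⟩, rfl⟩
    exact ⟨_, ⟨i, hi, rfl⟩, _, ⟨j, hj, rfl⟩,
      (MonoidalCategory.tensorHom_comp_tensorHom _ _ _ _).symm⟩

lemma leftUnitor_naturality_aux {A B D : F} (s : A ⟶ B) (j : B ⟶ D) :
    (λ_ A).hom ≫ s ≫ j = (𝟙 (𝟙_ F) ⊗ₘ s) ≫ (λ_ B).hom ≫ j := by simp

lemma rightUnitor_naturality_aux {A B D : F} (s : A ⟶ B) (j : B ⟶ D) :
    (ρ_ A).hom ≫ s ≫ j = (s ⊗ₘ 𝟙 (𝟙_ F)) ≫ (ρ_ B).hom ≫ j := by simp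

lemma leftUnitor_naturality_aux' {A B D : F} (s : A ⟶ B) (j : B ⟶ D) :
    (𝟙 (𝟙_ F) ⊗ₘ s ≫ j) ≫ (λ_ D).hom = ((λ_ A).hom ≫ s) ≫ j := by simp

lemma rightUnitor_naturality_aux' {A B D : F} (s : A ⟶ B) (j : B ⟶ D) :
    (s ≫ j ⊗ₘ 𝟙 (𝟙_ F)) ≫ (ρ_ D).hom = ((ρ_ A).hom ≫ s) ≫ j := by simp

instance : MonoidalCategoryStruct (Fam.{vF, uF, u} F) where
  tensorObj := tens
  tensorHom := tensHom
  whiskerLeft X _ _ f := tensHom (𝟙 X) f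
  whiskerRight f Y := tensHom f (𝟙 Y)
  tensorUnit := one
  associator := assocIso
  leftUnitor := leftIso
  rightUnitor := rightIso

/-- The coherence axioms concern graphs only, but functoriality and naturality concern arbitrary
relations and are checked on elements. Closure of a relation under distinguished morphisms on both
sides absorbs the extra factor coming from a graph. -/
instance : MonoidalCategory (Fam.{vF, uF, u} F) := MonoidalCategory.ofTensorHom
  (id_tensorHom_id := tensHom_id_id)
  (id_tensorHom := fun _ _ _ _ => rfl)
  (tensorHom_id := fun _ _ => rfl)
  (tensorHom_comp_tensorHom := by
    intro X Y Z X' Y' Z' S T S' T'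
    ext k m f
    constructor
    · rintro ⟨l, _, _, ⟨s, hs, t, ht, rfl⟩, ⟨s', hs', t', ht', rfl⟩, rfl⟩
      exact ⟨_, ⟨_, s, s', hs, hs', rfl⟩, _, ⟨_, t, t', ht, ht', rfl⟩, by simp⟩
    · rintro ⟨_, ⟨l, s, s', hs, hs', rfl⟩, _, ⟨l', t, t', ht, ht', rfl⟩, rfl⟩
      exact ⟨(l, l'), _, _, ⟨s, hs, t, ht, rfl⟩, ⟨s', hs', t', ht', rfl⟩, by simp⟩)
  (associator_naturality := by
    intro X Y Z X' Y' Z' S T U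
    ext k m f
    constructor
    · rintro ⟨l, _, _, ⟨_, ⟨s, hs, t, ht, rfl⟩, v, hv, rfl⟩,
        ⟨_, ⟨i, hi, _, ⟨j, hj, j', hj', rfl⟩, rfl⟩, rfl⟩, rfl⟩
      exact ⟨_, _, _, ⟨𝟙 _, Fam.id_mem _ _, comp_id _⟩, ⟨s ≫ i, S.right_mem hs hi, _,
        ⟨t ≫ j, T.right_mem ht hj, v ≫ j', U.right_mem hv hj', rfl⟩, rfl⟩, by
          simp [tens]⟩
    · rintro ⟨l, _, _, ⟨_, ⟨i, hi, _, ⟨j, hj, j', hj', rfl⟩, rfl⟩, rfl⟩,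
        ⟨s, hs, _, ⟨t, ht, v, hv, rfl⟩, rfl⟩, rfl⟩
      exact ⟨((m.1, m.2.1), m.2.2), _, _, ⟨_, ⟨i ≫ s, S.left_mem hi hs, j ≫ t, T.left_mem hj ht,
        rfl⟩, j' ≫ v, U.left_mem hj' hv, rfl⟩, ⟨𝟙 _, Fam.id_mem _ _, comp_id _⟩, by
          simp [tens]⟩)
  (leftUnitor_naturality := by
    intro X Y S
    ext k m f
    constructor
    · rintro ⟨l, _, _, ⟨_, rfl, s, hs, rfl⟩, ⟨j, hj, rfl⟩, rfl⟩
      exact ⟨_, _, _, ⟨𝟙 _, Fam.id_mem _ _, comp_id _⟩, S.right_mem hs hj,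
        leftUnitor_naturality_aux s j⟩
    · rintro ⟨l, _, s, ⟨j, hj, rfl⟩, hs, rfl⟩
      exact ⟨(PUnit.unit, m), _, _, ⟨_, rfl, _, S.left_mem hj hs, rfl⟩,
        ⟨𝟙 _, Fam.id_mem _ _, comp_id _⟩, leftUnitor_naturality_aux' j s⟩)
  (rightUnitor_naturality := by
    intro X Y S
    ext k m f
    constructor
    · rintro ⟨l, _, _, ⟨s, hs, _, rfl, rfl⟩, ⟨j, hj, rfl⟩, rfl⟩
      exact ⟨_, _, _, ⟨𝟙 _, Fam.id_mem _ _, comp_id _⟩, S.right_mem hs hj,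
        rightUnitor_naturality_aux s j⟩
    · rintro ⟨l, _, s, ⟨j, hj, rfl⟩, hs, rfl⟩
      exact ⟨(m, PUnit.unit), _, _, ⟨_, S.left_mem hj hs, _, rfl, rfl⟩,
        ⟨𝟙 _, Fam.id_mem _ _, comp_id _⟩, rightUnitor_naturality_aux' j s⟩)
  (pentagon := by
    intro W X Y Z
    change tensHom (assocGraph W X Y) (𝟙 Z) ≫ assocGraph W (tens X Y) Z ≫
      tensHom (𝟙 W) (assocGraph X Y Z) =
      assocGraph (tens W X) Y Z ≫ assocGraph W X (tens Y Z)
    unfold assocGraph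
    rw [← graph_id, ← graph_id, tensHom_graph, tensHom_graph, graph_comp, graph_comp, graph_comp]
    congr 1
    funext k
    simp [tens])
  (triangle := by
    intro X Y
    change assocGraph X one Y ≫ tensHom (𝟙 X) (leftGraph Y) = tensHom (rightGraph X) (𝟙 Y)
    unfold assocGraph leftGraph rightGraph
    rw [← graph_id, ← graph_id, tensHom_graph, tensHom_graph, graph_comp]
    congr 1
    funext k
    simp [tens, one])

variable [SymmetricCategory F]

/-- The braiding of families. -/
def braidGraph (X Y : Fam.{vF, uF, u} F) : tens X Y ⟶ tens Y X :=
  graph (fun k => (k.2, k.1)) (fun k => (β_ _ _).hom) (by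
    rintro k l _ ⟨i, hi, j, hj, rfl⟩
    exact ⟨j ⊗ₘ i, ⟨j, hj, i, hi, rfl⟩, BraidedCategory.braiding_naturality _ _⟩)

lemma braidGraph_braidGraph (X Y : Fam.{vF, uF, u} F) :
    braidGraph X Y ≫ braidGraph Y X = 𝟙 (tens X Y) := by
  rw [braidGraph, braidGraph, graph_comp, ← graph_id]
  congr 1
  funext k
  exact SymmetricCategory.symmetry _ _

lemma braidGraph_naturality {X Y X' Y' : Fam.{vF, uF, u} F} (S : X ⟶ X') (T : Y ⟶ Y') :
    tensHom S T ≫ braidGraph X' Y' = braidGraph X Y ≫ tensHom T S := by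
  ext k m f
  constructor
  · rintro ⟨l, _, _, ⟨s, hs, t, ht, rfl⟩, ⟨_, ⟨i, hi, j, hj, rfl⟩, rfl⟩, rfl⟩
    exact ⟨_, _, _, ⟨𝟙 _, Fam.id_mem _ _, comp_id _⟩,
      ⟨t ≫ i, T.right_mem ht hi, s ≫ j, S.right_mem hs hj, rfl⟩, by simp [tens]⟩
  · rintro ⟨l, _, _, ⟨_, ⟨i, hi, j, hj, rfl⟩, rfl⟩, ⟨t, ht, s, hs, rfl⟩, rfl⟩
    exact ⟨(m.2, m.1), _, _, ⟨j ≫ s, S.left_mem hj hs, i ≫ t, T.left_mem hi ht, rfl⟩,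
      ⟨𝟙 _, Fam.id_mem _ _, comp_id _⟩, by simp [tens]⟩

lemma braidGraph_hexagon (X Y Z : Fam.{vF, uF, u} F) :
    (α_ X Y Z).hom ≫ braidGraph X (Y ⊗ Z) ≫ (α_ Y Z X).hom =
      tensHom (braidGraph X Y) (𝟙 Z) ≫ (α_ Y X Z).hom ≫ tensHom (𝟙 Y) (braidGraph X Z) := by
  change assocGraph X Y Z ≫ braidGraph X (tens Y Z) ≫ assocGraph Y Z X =
    tensHom (braidGraph X Y) (𝟙 Z) ≫ assocGraph Y X Z ≫ tensHom (𝟙 Y) (braidGraph X Z)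
  unfold assocGraph braidGraph
  rw [← graph_id, ← graph_id, tensHom_graph, tensHom_graph, graph_comp, graph_comp, graph_comp,
    graph_comp]
  congr 1
  funext k
  exact (BraidedCategory.hexagon_forward _ _ _).trans
    (by rw [← tensorHom_id, ← id_tensorHom]; rfl)

/-- The braiding of families, as an isomorphism. -/
def braidIso (X Y : Fam.{vF, uF, u} F) : X ⊗ Y ≅ Y ⊗ X :=
  ⟨braidGraph X Y, braidGraph Y X, braidGraph_braidGraph X Y, braidGraph_braidGraph Y X⟩

/-- Since the braiding is its own inverse, the second hexagon is the inverse of the first. -/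
lemma braidGraph_hexagon_inv (X Y Z : Fam.{vF, uF, u} F) :
    (α_ X Y Z).inv ≫ braidGraph (X ⊗ Y) Z ≫ (α_ Z X Y).inv =
      X ◁ braidGraph Y Z ≫ (α_ X Z Y).inv ≫ braidGraph X Z ▷ Y := by
  have h : α_ Z X Y ≪≫ braidIso Z (X ⊗ Y) ≪≫ α_ X Y Z =
      whiskerRightIso (braidIso Z X) Y ≪≫ α_ X Z Y ≪≫ whiskerLeftIso X (braidIso Z Y) :=
    Iso.ext (braidGraph_hexagon Z X Y)
  have key := congrArg Iso.inv h
  simpa [braidIso] using key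

instance : SymmetricCategory (Fam.{vF, uF, u} F) where
  braiding := braidIso
  braiding_naturality_right X _ _ f := braidGraph_naturality (𝟙 X) f
  braiding_naturality_left f Z := braidGraph_naturality f (𝟙 Z)
  hexagon_forward := braidGraph_hexagon
  hexagon_reverse := braidGraph_hexagon_inv
  symmetry := braidGraph_braidGraph

end
end Fam
end

section
/-! ### Slices of a Feynman category -/

section
variable {V : Type uV} [Groupoid.{vV} V] {F : Type uF} [Category.{vF} F] [MonoidalCategory F]
  [SymmetricCategory F] (ι : V ⥤ F)

/-- The underlying object of the value of a word in the groupoid core. -/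
def valueCoreIso : ∀ w : FreeSym V,
    (FreeSym.value (Core.functorToCore ι).obj w).of ≅ wordObj ι w
  | .of _ => Iso.refl _
  | .unit => Iso.refl _
  | .tensor a b => valueCoreIso a ⊗ᵢ valueCoreIso b

/-- One expression is interpreted in the groupoid core and in `F`. The first interpretation is
invertible by construction, which makes the second one invertible as well. -/
lemma interp_valueCoreIso {x y : FreeSym V} (e : FreeSym.PreHom x y) :
    (FreeSym.interp (Core.functorToCore ι) e).iso.hom ≫ (valueCoreIso ι y).hom =
      (valueCoreIso ι x).hom ≫ FreeSym.interp ι e := by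
  induction e with
  | of f => exact (comp_id _).trans (id_comp _).symm
  | id x => exact (id_comp _).trans (comp_id _).symm
  | comp f g hf hg =>
      have := hg
      change (_ ≫ _) ≫ _ = _ ≫ _ ≫ _
      rw [assoc, hg, reassoc_of% hf]
  | tensor f g hf hg =>
      change (_ ⊗ₘ _) ≫ (_ ⊗ₘ _) = (_ ⊗ₘ _) ≫ (_ ⊗ₘ _)
      rw [MonoidalCategory.tensorHom_comp_tensorHom, hf, hg,
        MonoidalCategory.tensorHom_comp_tensorHom]
  | assocHom x y z =>
      change (α_ _ _ _).hom ≫ (_ ⊗ₘ (_ ⊗ₘ _)) = ((_ ⊗ₘ _) ⊗ₘ _) ≫ (α_ _ _ _).hom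
      simp
  | assocInv x y z =>
      change (α_ _ _ _).inv ≫ ((_ ⊗ₘ _) ⊗ₘ _) = (_ ⊗ₘ (_ ⊗ₘ _)) ≫ (α_ _ _ _).inv
      simp
  | leftHom x =>
      change (λ_ _).hom ≫ _ = (𝟙 _ ⊗ₘ _) ≫ (λ_ _).hom
      simp
  | leftInv x =>
      change (λ_ _).inv ≫ (𝟙 _ ⊗ₘ _) = _ ≫ (λ_ _).inv
      simp
  | rightHom x =>
      change (ρ_ _).hom ≫ _ = (_ ⊗ₘ 𝟙 _) ≫ (ρ_ _).hom
      simp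
  | rightInv x =>
      change (ρ_ _).inv ≫ (_ ⊗ₘ 𝟙 _) = _ ≫ (ρ_ _).inv
      simp
  | braid x y => exact (BraidedCategory.braiding_naturality _ _).symm

/-- The symmetric monoidal functor given by a functor from `V`, on words. -/
abbrev wordFun : FreeSym V ⥤ F := FreeSym.lift ι

/-- The isomorphism of values given by a formal expression. -/
def interpIso {x y : FreeSym V} (e : FreeSym.PreHom x y) : wordObj ι x ≅ wordObj ι y :=
  (valueCoreIso ι x).symm ≪≫ (FreeSym.interp (Core.functorToCore ι) e).iso ≪≫ valueCoreIso ι y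

@[simp] lemma interpIso_hom {x y : FreeSym V} (e : FreeSym.PreHom x y) :
    (interpIso ι e).hom = FreeSym.interp ι e := by
  simp [interpIso, interp_valueCoreIso]

instance {x y : FreeSym V} (e : FreeSym.PreHom x y) : IsIso (FreeSym.interp ι e) := by
  rw [← interpIso_hom]
  infer_instance

/-! ### Consequences of the isomorphism condition -/

section
variable {ι} (h : (FreeSym.lift (Core.functorToCore ι)).IsEquivalence)
include h

/-- The isomorphism condition enters through this lemma (essential surjectivity), `exists_preHom`
(fullness: isomorphisms of words come from formal expressions) and `interp_injective` (faithfulness: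
expressions with equal values are congruent). -/
lemma exists_word (X : F) : ∃ w : FreeSym V, Nonempty (X ≅ wordObj ι w) := by
  let e := (FreeSym.lift (Core.functorToCore ι)).objObjPreimageIso (⟨X⟩ : Core F)
  exact ⟨_, ⟨(e.symm.hom.iso : X ≅ _) ≪≫ valueCoreIso ι _⟩⟩

lemma exists_preHom {x y : FreeSym V} (σ : wordObj ι x ≅ wordObj ι y) :
    ∃ e : FreeSym.PreHom x y, FreeSym.interp ι e = σ.hom := by
  obtain ⟨e, he⟩ := (FreeSym.lift (Core.functorToCore ι)).map_surjective
    (X := x) (Y := y) ⟨valueCoreIso ι x ≪≫ σ ≪≫ (valueCoreIso ι y).symm⟩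
  induction e using Quotient.inductionOn with
  | h e =>
    refine ⟨e, ?_⟩
    have h₁ := interp_valueCoreIso ι e
    have h₂ : (FreeSym.interp (Core.functorToCore ι) e).iso.hom =
      (valueCoreIso ι x).hom ≫ σ.hom ≫ (valueCoreIso ι y).inv := congrArg (·.iso.hom) he
    rw [h₂] at h₁
    simpa using h₁.symm

lemma interp_injective {x y : FreeSym V} {e e' : FreeSym.PreHom x y}
    (he : FreeSym.interp ι e = FreeSym.interp ι e') : FreeSym.Rel e e' := by
  have : (⟦e⟧ : x ⟶ y) = ⟦e'⟧ := by
    apply (FreeSym.lift (Core.functorToCore ι)).map_injective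
    apply Core.hom_ext
    change (FreeSym.interp (Core.functorToCore ι) e).iso.hom =
      (FreeSym.interp (Core.functorToCore ι) e').iso.hom
    rw [← cancel_mono (valueCoreIso ι y).hom, interp_valueCoreIso, interp_valueCoreIso, he]
  exact Quotient.exact this

end

/-- The family of objects over the objects of `V`. -/
def sliceFam : V ⥤ Fam.{vF, uF, max uF vF} F where
  obj v :=
    { carrier := Over (ι.obj v)
      src := fun φ => φ.left
      mor := fun φ ψ => {σ | IsIso σ ∧ σ ≫ ψ.hom = φ.hom}
      id_mem := fun φ => ⟨inferInstance, id_comp _⟩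
      comp_mem := by
        rintro φ ψ χ f g ⟨_, hf⟩ ⟨_, hg⟩
        exact ⟨inferInstance, by rw [assoc, hg, hf]⟩ }
  map {v v'} τ :=
    { rel := fun φ ψ => {σ | IsIso σ ∧ σ ≫ ψ.hom = φ.hom ≫ ι.map τ}
      left_mem := by
        rintro φ ψ χ f g ⟨_, hf⟩ ⟨_, hg⟩
        exact ⟨inferInstance, by rw [assoc, hg, ← assoc, hf]⟩
      right_mem := by
        rintro φ ψ χ f g ⟨_, hf⟩ ⟨_, hg⟩
        exact ⟨inferInstance, by rw [assoc, hg, hf]⟩ }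
  map_id v := by
    ext φ ψ f
    change (IsIso f ∧ f ≫ ψ.hom = φ.hom ≫ ι.map (𝟙 v)) ↔ (IsIso f ∧ f ≫ ψ.hom = φ.hom)
    rw [ι.map_id, comp_id]
  map_comp {v v' v''} τ τ' := by
    ext φ ψ f
    constructor
    · rintro ⟨hi, hf⟩
      exact ⟨Over.mk (φ.hom ≫ ι.map τ), 𝟙 _, f, ⟨inferInstance, id_comp _⟩,
        ⟨hi, hf.trans (by simp)⟩, id_comp _⟩
    · rintro ⟨χ, s, t, ⟨_, hs⟩, ⟨_, ht⟩, rfl⟩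
      exact ⟨inferInstance, by rw [assoc, ht, ← assoc, hs, assoc, ι.map_comp]⟩

/-- The family of tensor products of morphisms over the letters of a word. -/
abbrev wordFam (w : FreeSym V) : Fam.{vF, uF, max uF vF} F := FreeSym.value (sliceFam ι).obj w

/-- The tensor product of morphisms over the letters of a word. -/
def famHom : ∀ (w : FreeSym V) (p : (wordFam ι w).carrier), (wordFam ι w).src p ⟶ wordObj ι w
  | .of _, p => Over.hom p
  | .unit, _ => 𝟙 _
  | .tensor a b, p => famHom a p.1 ⊗ₘ famHom b p.2

/-- The converse inclusion, that every isomorphism over the whole word decomposes over the letters,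
is `mem_mor_of_comp_eq`; it requires the isomorphism and hereditary conditions. -/
lemma mem_mor : ∀ (w : FreeSym V) (p q : (wordFam ι w).carrier)
    (f : (wordFam ι w).src p ⟶ (wordFam ι w).src q), f ∈ (wordFam ι w).mor p q →
    IsIso f ∧ f ≫ famHom ι w q = famHom ι w p
  | .of _, _, _, _, hf => hf
  | .unit, _, _, _, hf => by
      obtain rfl := hf
      exact ⟨inferInstanceAs (IsIso (𝟙 _)), id_comp _⟩
  | .tensor a b, p, q, _, ⟨i, hi, j, hj, e⟩ => by
      subst e
      obtain ⟨_, h₁⟩ := mem_mor a _ _ _ hi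
      obtain ⟨_, h₂⟩ := mem_mor b _ _ _ hj
      refine ⟨inferInstanceAs (IsIso (i ⊗ₘ j)), ?_⟩
      exact (MonoidalCategory.tensorHom_comp_tensorHom _ _ _ _).trans (by rw [h₁, h₂]; rfl)

lemma isIso_comp_and {A B D E : F} (θ : A ⟶ B) [IsIso θ] {j : B ⟶ D} {m : D ⟶ E} {m' : B ⟶ E}
    {n : A ⟶ E} (hj : IsIso j ∧ j ≫ m = m') (hθ : θ ≫ m' = n) :
    IsIso (θ ≫ j) ∧ (θ ≫ j) ≫ m = n := by
  obtain ⟨_, h⟩ := hj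
  exact ⟨inferInstance, by rw [assoc, h, hθ]⟩

lemma leftUnitor_naturality_aux₂ {A B : F} (s : A ⟶ B) :
    (λ_ A).hom ≫ s = (𝟙 (𝟙_ F) ⊗ₘ s) ≫ (λ_ B).hom := by simp

lemma rightUnitor_naturality_aux₂ {A B : F} (s : A ⟶ B) :
    (ρ_ A).hom ≫ s = (s ⊗ₘ 𝟙 (𝟙_ F)) ≫ (ρ_ B).hom := by simp

lemma leftUnitor_inv_naturality_aux {A B : F} (s : A ⟶ B) :
    (λ_ A).inv ≫ (𝟙 (𝟙_ F) ⊗ₘ s) = s ≫ (λ_ B).inv := by simp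

lemma rightUnitor_inv_naturality_aux {A B : F} (s : A ⟶ B) :
    (ρ_ A).inv ≫ (s ⊗ₘ 𝟙 (𝟙_ F)) = s ≫ (ρ_ B).inv := by simp

/-- The relation attached to `e` remembers how `e` permutes the letters: its members permute the
sources of the arrows in the same way, up to isomorphisms over the single letters. In particular
they are isomorphisms lying over the value of `e`, and this weaker property passes through every
constructor. -/
lemma mem_interp_rel {x y : FreeSym V} (e : FreeSym.PreHom x y) :
    ∀ (p : (wordFam ι x).carrier) (q : (wordFam ι y).carrier)
    (f : (wordFam ι x).src p ⟶ (wordFam ι y).src q),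
    f ∈ Fam.Hom.rel (FreeSym.interp (sliceFam ι) e) p q →
    IsIso f ∧ f ≫ famHom ι y q = famHom ι x p ≫ FreeSym.interp ι e := by
  induction e with
  | of τ => exact fun _ _ _ hf => hf
  | id x =>
      intro p q f hf
      obtain ⟨h₁, h₂⟩ := mem_mor ι x p q f hf
      exact ⟨h₁, h₂.trans (comp_id _).symm⟩
  | comp e e' ih ih' =>
      rintro p q _ ⟨r, s, t, hs, ht, rfl⟩
      obtain ⟨_, h₁⟩ := ih _ _ _ hs
      obtain ⟨_, h₂⟩ := ih' _ _ _ ht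
      refine ⟨inferInstance, ?_⟩
      rw [assoc, h₂, ← assoc, h₁, assoc]
      rfl
  | tensor e e' ih ih' =>
      rintro p q _ ⟨s, hs, t, ht, rfl⟩
      obtain ⟨_, h₁⟩ := ih _ _ _ hs
      obtain ⟨_, h₂⟩ := ih' _ _ _ ht
      refine ⟨inferInstanceAs (IsIso (s ⊗ₘ t)), ?_⟩
      refine (MonoidalCategory.tensorHom_comp_tensorHom _ _ _ _).trans ?_
      rw [h₁, h₂]
      exact (MonoidalCategory.tensorHom_comp_tensorHom _ _ _ _).symm
  | assocHom x y z =>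
      rintro p q _ ⟨j, hj, rfl⟩
      exact isIso_comp_and (α_ _ _ _).hom (mem_mor ι (.tensor x (.tensor y z)) _ _ _ hj) (associator_naturality _ _ _).symm
  | assocInv x y z =>
      rintro p q _ ⟨j, hj, rfl⟩
      exact isIso_comp_and (α_ _ _ _).inv (mem_mor ι (.tensor (.tensor x y) z) _ _ _ hj) (associator_inv_naturality _ _ _).symm
  | leftHom x =>
      rintro p q _ ⟨j, hj, rfl⟩
      exact isIso_comp_and (λ_ _).hom (mem_mor ι (x) _ _ _ hj) (leftUnitor_naturality_aux₂ _)
  | leftInv x =>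
      rintro p q _ ⟨j, hj, rfl⟩
      exact isIso_comp_and (λ_ _).inv (mem_mor ι (.tensor .unit x) _ _ _ hj) (leftUnitor_inv_naturality_aux _)
  | rightHom x =>
      rintro p q _ ⟨j, hj, rfl⟩
      exact isIso_comp_and (ρ_ _).hom (mem_mor ι (x) _ _ _ hj) (rightUnitor_naturality_aux₂ _)
  | rightInv x =>
      rintro p q _ ⟨j, hj, rfl⟩
      exact isIso_comp_and (ρ_ _).inv (mem_mor ι (.tensor x .unit) _ _ _ hj) (rightUnitor_inv_naturality_aux _)
  | braid x y =>
      rintro p q _ ⟨j, hj, rfl⟩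
      exact isIso_comp_and (β_ _ _).hom (mem_mor ι (.tensor y x) _ _ _ hj) (BraidedCategory.braiding_naturality _ _).symm

/-- A decomposition over the letters of `x` is transported along `e`. A morphism of `V` is composed
with the arrow over its letter, without change of the source. -/
lemma exists_interp_rel {x y : FreeSym V} (e : FreeSym.PreHom x y) :
    ∀ (p : (wordFam ι x).carrier), ∃ (q : (wordFam ι y).carrier)
    (f : (wordFam ι x).src p ⟶ (wordFam ι y).src q),
    f ∈ Fam.Hom.rel (FreeSym.interp (sliceFam ι) e) p q := by
  induction e with
  | of τ => exact fun p => ⟨Over.mk (Over.hom p ≫ ι.map τ), 𝟙 (Comma.left p),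
      ⟨inferInstanceAs (IsIso (𝟙 (Comma.left p))), id_comp _⟩⟩
  | id x => exact fun p => ⟨p, 𝟙 _, Fam.id_mem _ _⟩
  | comp e e' ih ih' =>
      intro p
      obtain ⟨q, s, hs⟩ := ih p
      obtain ⟨r, t, ht⟩ := ih' q
      exact ⟨r, s ≫ t, q, s, t, hs, ht, rfl⟩
  | tensor e e' ih ih' =>
      intro p
      obtain ⟨q, s, hs⟩ := ih p.1
      obtain ⟨r, t, ht⟩ := ih' p.2
      exact ⟨(q, r), s ⊗ₘ t, s, hs, t, ht, rfl⟩
  -- The remaining constructors are interpreted by graphs, so the index is moved by the underlying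
  -- function.
  | _ => exact fun p => ⟨_, _, ⟨𝟙 _, Fam.id_mem _ _, rfl⟩⟩

/-- The word in `V` formed by the targets of a word of morphisms. -/
def targetWord : FreeSym (Core (Comma (𝟭 F) ι)) → FreeSym V
  | .of φ => .of φ.of.right
  | .unit => .unit
  | .tensor a b => .tensor (targetWord a) (targetWord b)

/-- The effect of `targetWord` on formal expressions. -/
def targetHom : ∀ {x y : FreeSym (Core (Comma (𝟭 F) ι))}, FreeSym.PreHom x y →
    FreeSym.PreHom (targetWord ι x) (targetWord ι y)
  | _, _, .of f => .of f.iso.hom.right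
  | _, _, .id _ => .id _
  | _, _, .comp f g => .comp (targetHom f) (targetHom g)
  | _, _, .tensor f g => .tensor (targetHom f) (targetHom g)
  | _, _, .assocHom _ _ _ => .assocHom _ _ _
  | _, _, .assocInv _ _ _ => .assocInv _ _ _
  | _, _, .leftHom _ => .leftHom _
  | _, _, .leftInv _ => .leftInv _
  | _, _, .rightHom _ => .rightHom _
  | _, _, .rightInv _ => .rightInv _
  | _, _, .braid _ _ => .braid _ _

/-- The member of the family over the word of targets given by a word of morphisms. -/
def targetElt : ∀ x : FreeSym (Core (Comma (𝟭 F) ι)), (wordFam ι (targetWord ι x)).carrier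
  | .of φ => Over.mk φ.of.hom
  | .unit => PUnit.unit
  | .tensor a b => (targetElt a, targetElt b)

/-- The arrow given by a word of morphisms. -/
abbrev arrowVal (x : FreeSym (Core (Comma (𝟭 F) ι))) : Arr F :=
  (FreeSym.value (arrowsOver ι).obj x).of

/-- The comparison of sources. -/
def sourceIso : ∀ x : FreeSym (Core (Comma (𝟭 F) ι)),
    (arrowVal ι x).left ≅ (wordFam ι (targetWord ι x)).src (targetElt ι x)
  | .of _ => Iso.refl _
  | .unit => Iso.refl _
  | .tensor a b => sourceIso a ⊗ᵢ sourceIso b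

/-- The comparison of targets. -/
def targetIso : ∀ x : FreeSym (Core (Comma (𝟭 F) ι)),
    (arrowVal ι x).right ≅ wordObj ι (targetWord ι x)
  | .of _ => Iso.refl _
  | .unit => Iso.refl _
  | .tensor a b => targetIso a ⊗ᵢ targetIso b

lemma arrowVal_hom : ∀ x : FreeSym (Core (Comma (𝟭 F) ι)),
    (arrowVal ι x).hom ≫ (targetIso ι x).hom =
      (sourceIso ι x).hom ≫ famHom ι _ (targetElt ι x)
  | .of _ => (comp_id _).trans (id_comp _).symm
  | .unit => rfl
  | .tensor a b => by
      change (_ ⊗ₘ _) ≫ (_ ⊗ₘ _) = (_ ⊗ₘ _) ≫ (_ ⊗ₘ _)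
      rw [MonoidalCategory.tensorHom_comp_tensorHom, MonoidalCategory.tensorHom_comp_tensorHom,
        arrowVal_hom a, arrowVal_hom b]
      rfl

lemma interp_targetIso {x y : FreeSym (Core (Comma (𝟭 F) ι))} (e : FreeSym.PreHom x y) :
    (FreeSym.interp (arrowsOver ι) e).iso.hom.right ≫ (targetIso ι y).hom =
      (targetIso ι x).hom ≫ FreeSym.interp ι (targetHom ι e) := by
  induction e with
  | of f => exact (comp_id _).trans (id_comp _).symm
  | id x => exact (id_comp _).trans (comp_id _).symm
  | comp f g hf hg =>
      change (_ ≫ _) ≫ _ = _ ≫ _ ≫ _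
      rw [assoc, hg, reassoc_of% hf]
  | tensor f g hf hg =>
      change (_ ⊗ₘ _) ≫ (_ ⊗ₘ _) = (_ ⊗ₘ _) ≫ (_ ⊗ₘ _)
      rw [MonoidalCategory.tensorHom_comp_tensorHom, hf, hg,
        MonoidalCategory.tensorHom_comp_tensorHom]
  | assocHom x y z =>
      change (α_ _ _ _).hom ≫ (_ ⊗ₘ (_ ⊗ₘ _)) = ((_ ⊗ₘ _) ⊗ₘ _) ≫ (α_ _ _ _).hom
      simp
  | assocInv x y z =>
      change (α_ _ _ _).inv ≫ ((_ ⊗ₘ _) ⊗ₘ _) = (_ ⊗ₘ (_ ⊗ₘ _)) ≫ (α_ _ _ _).inv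
      simp
  | leftHom x =>
      change (λ_ _).hom ≫ _ = (𝟙 _ ⊗ₘ _) ≫ (λ_ _).hom
      simp
  | leftInv x =>
      change (λ_ _).inv ≫ (𝟙 _ ⊗ₘ _) = _ ≫ (λ_ _).inv
      simp
  | rightHom x =>
      change (ρ_ _).hom ≫ _ = (_ ⊗ₘ 𝟙 _) ≫ (ρ_ _).hom
      simp
  | rightInv x =>
      change (ρ_ _).inv ≫ (_ ⊗ₘ 𝟙 _) = _ ≫ (ρ_ _).inv
      simp
  | braid x y => exact (BraidedCategory.braiding_naturality _ _).symm

/-! ### Coherence isomorphisms conjugated by isomorphisms of the factors -/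

section
variable {A A' B B' D D' : F}

lemma conj_tensor (s : A ≅ A') {E : F} (f : A ⟶ B) (t : B ≅ B') (s' : D ≅ D') (f' : D ⟶ E)
    {E' : F} (t' : E ≅ E') : (s.inv ≫ f ≫ t.hom) ⊗ₘ (s'.inv ≫ f' ≫ t'.hom) =
      (s.inv ⊗ₘ s'.inv) ≫ (f ⊗ₘ f') ≫ (t.hom ⊗ₘ t'.hom) := by simp

lemma conj_assoc (s : A ≅ A') (t : B ≅ B') (r : D ≅ D') : (α_ A' B' D').hom =
    ((s.inv ⊗ₘ t.inv) ⊗ₘ r.inv) ≫ (α_ A B D).hom ≫ (s.hom ⊗ₘ (t.hom ⊗ₘ r.hom)) := by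
  rw [← associator_naturality, ← assoc, MonoidalCategory.tensorHom_comp_tensorHom,
    MonoidalCategory.tensorHom_comp_tensorHom]
  simp

lemma conj_assoc_inv (s : A ≅ A') (t : B ≅ B') (r : D ≅ D') : (α_ A' B' D').inv =
    (s.inv ⊗ₘ (t.inv ⊗ₘ r.inv)) ≫ (α_ A B D).inv ≫ ((s.hom ⊗ₘ t.hom) ⊗ₘ r.hom) := by
  rw [← associator_inv_naturality, ← assoc, MonoidalCategory.tensorHom_comp_tensorHom,
    MonoidalCategory.tensorHom_comp_tensorHom]
  simp

lemma conj_left (s : A ≅ A') : (λ_ A').hom = (𝟙 (𝟙_ F) ⊗ₘ s.inv) ≫ (λ_ A).hom ≫ s.hom := by simp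

lemma conj_left_inv (s : A ≅ A') : (λ_ A').inv = s.inv ≫ (λ_ A).inv ≫ (𝟙 (𝟙_ F) ⊗ₘ s.hom) := by
  simp

lemma conj_right (s : A ≅ A') : (ρ_ A').hom = (s.inv ⊗ₘ 𝟙 (𝟙_ F)) ≫ (ρ_ A).hom ≫ s.hom := by simp

lemma conj_right_inv (s : A ≅ A') : (ρ_ A').inv = s.inv ≫ (ρ_ A).inv ≫ (s.hom ⊗ₘ 𝟙 (𝟙_ F)) := by
  simp

lemma conj_braid (s : A ≅ A') (t : B ≅ B') : (β_ A' B').hom =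
    (s.inv ⊗ₘ t.inv) ≫ (β_ A B).hom ≫ (t.hom ⊗ₘ s.hom) := by
  rw [← BraidedCategory.braiding_naturality, ← assoc,
    MonoidalCategory.tensorHom_comp_tensorHom]
  simp

end

/-- An expression in arrows acts on the sources by the same permutation of letters as on the
targets. This is what turns fullness in the hereditary condition into information about sources. -/
lemma interp_sourceIso {x y : FreeSym (Core (Comma (𝟭 F) ι))} (e : FreeSym.PreHom x y) :
    (sourceIso ι x).inv ≫ (FreeSym.interp (arrowsOver ι) e).iso.hom.left ≫ (sourceIso ι y).hom ∈
      Fam.Hom.rel (FreeSym.interp (sliceFam ι) (targetHom ι e)) (targetElt ι x)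
        (targetElt ι y) := by
  induction e with
  | @of a b f =>
      refine Set.mem_of_eq_of_mem ((id_comp _).trans (comp_id f.iso.hom.left)) ?_
      exact ⟨inferInstanceAs (IsIso ((Comma.fst _ _).map f.iso.hom)), f.iso.hom.w⟩
  | id x =>
      have : (sourceIso ι x).inv ≫ 𝟙 _ ≫ (sourceIso ι x).hom = 𝟙 _ := by simp
      exact this ▸ Fam.id_mem (wordFam ι (targetWord ι x)) _
  | comp f g hf hg =>
      refine ⟨_, _, _, hf, hg, ?_⟩
      change _ = _ ≫ (_ ≫ _) ≫ _
      simp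
  | tensor f g hf hg => exact ⟨_, hf, _, hg, conj_tensor _ _ _ _ _ _⟩
  | assocHom x y z =>
      exact ⟨𝟙 _, Fam.id_mem _ _, (comp_id _).trans
        (conj_assoc (sourceIso ι x) (sourceIso ι y) (sourceIso ι z))⟩
  | assocInv x y z =>
      exact ⟨𝟙 _, Fam.id_mem _ _, (comp_id _).trans
        (conj_assoc_inv (sourceIso ι x) (sourceIso ι y) (sourceIso ι z))⟩
  | leftHom x =>
      exact ⟨𝟙 _, Fam.id_mem _ _, (comp_id _).trans (conj_left (sourceIso ι x))⟩
  | leftInv x =>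
      exact ⟨𝟙 _, Fam.id_mem _ _, (comp_id _).trans (conj_left_inv (sourceIso ι x))⟩
  | rightHom x =>
      exact ⟨𝟙 _, Fam.id_mem _ _, (comp_id _).trans (conj_right (sourceIso ι x))⟩
  | rightInv x =>
      exact ⟨𝟙 _, Fam.id_mem _ _, (comp_id _).trans (conj_right_inv (sourceIso ι x))⟩
  | braid x y =>
      exact ⟨𝟙 _, Fam.id_mem _ _, (comp_id _).trans
        (conj_braid (sourceIso ι x) (sourceIso ι y))⟩

/-- The word of targets of `x` agrees with `w` letter by letter. The expressions `b` and `b'`,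
assembled from identities, replace transport along this equality. -/
lemma exists_targetElt : ∀ (w : FreeSym V) (p : (wordFam ι w).carrier),
    ∃ (x : FreeSym (Core (Comma (𝟭 F) ι))) (b : FreeSym.PreHom (targetWord ι x) w)
      (b' : FreeSym.PreHom w (targetWord ι x))
      (σ : (wordFam ι (targetWord ι x)).src (targetElt ι x) ≅ (wordFam ι w).src p),
      FreeSym.interp ι b' ≫ FreeSym.interp ι b = 𝟙 _ ∧
      σ.hom ∈ Fam.Hom.rel (FreeSym.interp (sliceFam ι) b) (targetElt ι x) p ∧
      σ.inv ∈ Fam.Hom.rel (FreeSym.interp (sliceFam ι) b') p (targetElt ι x)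
  | .of v, p => ⟨.of ⟨⟨Comma.left p, v, Over.hom p⟩⟩, .id _, .id _, Iso.refl (Comma.left p),
      id_comp _, Fam.id_mem (wordFam ι (.of v)) p, Fam.id_mem (wordFam ι (.of v)) p⟩
  | .unit, _ => ⟨.unit, .id _, .id _, Iso.refl (𝟙_ F), id_comp _, rfl, rfl⟩
  | .tensor a a', p => by
      obtain ⟨x, b, c, σ, h, h₁, h₂⟩ := exists_targetElt a p.1
      obtain ⟨y, b', c', σ', h', h₁', h₂'⟩ := exists_targetElt a' p.2
      refine ⟨.tensor x y, .tensor b b', .tensor c c', σ ⊗ᵢ σ', ?_, ⟨_, h₁, _, h₁', rfl⟩,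
        ⟨_, h₂, _, h₂', rfl⟩⟩
      refine (MonoidalCategory.tensorHom_comp_tensorHom _ _ _ _).trans ?_
      rw [h, h']
      exact id_tensorHom_id _ _

variable {ι}

/-- The essential surjectivity half of the hereditary condition: every morphism to a word is a
tensor product of morphisms to its letters, up to an isomorphism of the source. -/
theorem exists_fam (hF : IsFeynmanCategory.{w} ι) {X : F} (x : FreeSym V) (ψ : X ⟶ wordObj ι x) :
    ∃ (p : (wordFam ι x).carrier) (σ : X ≅ (wordFam ι x).src p), σ.hom ≫ famHom ι x p = ψ := by
  have := hF.hereditary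
  obtain ⟨y, ⟨i⟩⟩ : ∃ y, Nonempty ((FreeSym.lift (arrowsOver ι)).obj y ≅
      (⟨⟨X, wordObj ι x, ψ⟩⟩ : Core (Arr F))) :=
    ⟨_, ⟨(FreeSym.lift (arrowsOver ι)).objObjPreimageIso _⟩⟩
  have j : arrowVal ι y ≅ (⟨X, wordObj ι x, ψ⟩ : Arr F) := i.hom.iso
  -- The hereditary condition only provides a target isomorphic to `x`. The comparison `τ` comes
  -- from a formal expression by the isomorphism condition, and the decomposition is transported
  -- along it.
  let τ : wordObj ι (targetWord ι y) ≅ wordObj ι x :=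
    (targetIso ι y).symm ≪≫ (Comma.snd _ _).mapIso j
  obtain ⟨e, he⟩ := exists_preHom hF.isoCondition τ
  obtain ⟨q, f, hf⟩ := exists_interp_rel ι e (targetElt ι y)
  obtain ⟨_, h⟩ := mem_interp_rel ι e _ _ _ hf
  refine ⟨q, (Comma.fst _ _).mapIso j.symm ≪≫ sourceIso ι y ≪≫ asIso f, ?_⟩
  have w := j.inv.w
  dsimp [τ] at he w ⊢
  rw [he] at h
  have w' : j.inv.right ≫ j.hom.right = 𝟙 _ := congrArg (·.right) j.inv_hom_id
  rw [assoc, assoc, h, ← reassoc_of% (arrowVal_hom ι y), Iso.hom_inv_id_assoc, ← assoc]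
  erw [w]
  rw [assoc]
  exact (congrArg (ψ ≫ ·) w').trans (comp_id _)

/-- The fully faithful half: an isomorphism of sources over the identity of a word cannot mix
letters. Fullness lifts it to an expression `e` in arrows, faithfulness over `V` shows that `e` is
the identity on targets, and the interpretation of an identity in `Fam` consists of letterwise
isomorphisms. -/
theorem mem_mor_of_comp_eq (hF : IsFeynmanCategory.{w} ι) (x : FreeSym V)
    (p q : (wordFam ι x).carrier) (σ : (wordFam ι x).src p ≅ (wordFam ι x).src q)
    (h : σ.hom ≫ famHom ι x q = famHom ι x p) : σ.hom ∈ (wordFam ι x).mor p q := by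
  have := hF.hereditary
  obtain ⟨y, b, c, ρ, hb, h₁, h₂⟩ := exists_targetElt ι x p
  obtain ⟨z, b', c', ρ', hb', h₁', h₂'⟩ := exists_targetElt ι x q
  have e₁ := (mem_interp_rel ι _ _ _ _ h₁).2
  have e₂ := (mem_interp_rel ι _ _ _ _ h₂').2
  -- With `σ` on the sources and the identification of both target words with `x` on the targets, an
  -- isomorphism of arrows is obtained, to which fullness applies.
  let l : (arrowVal ι y).left ≅ (arrowVal ι z).left :=
    sourceIso ι y ≪≫ ρ ≪≫ σ ≪≫ ρ'.symm ≪≫ (sourceIso ι z).symm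
  let r : (arrowVal ι y).right ≅ (arrowVal ι z).right :=
    targetIso ι y ≪≫ asIso (FreeSym.interp ι b) ≪≫ asIso (FreeSym.interp ι c') ≪≫
      (targetIso ι z).symm
  have hlr : l.hom ≫ (arrowVal ι z).hom = (arrowVal ι y).hom ≫ r.hom := by
    rw [← cancel_mono (targetIso ι z).hom, assoc, arrowVal_hom]
    simp only [l, r, Iso.trans_hom, Iso.symm_hom, assoc, Iso.inv_hom_id_assoc, asIso_hom,
      Iso.inv_hom_id, comp_id]
    rw [e₂, reassoc_of% h, reassoc_of% e₁, reassoc_of% (arrowVal_hom ι y)]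
  let j : arrowVal ι y ≅ arrowVal ι z := Comma.isoMk l r hlr
  obtain ⟨e, he⟩ := (FreeSym.lift (arrowsOver ι)).map_surjective (X := y) (Y := z) ⟨j⟩
  induction e using Quotient.inductionOn with
  | h e =>
    have hl : (FreeSym.interp (arrowsOver ι) e).iso.hom.left = l.hom :=
      congrArg (fun t => t.iso.hom.left) he
    have hr : (FreeSym.interp (arrowsOver ι) e).iso.hom.right = r.hom :=
      congrArg (fun t => t.iso.hom.right) he
    have t₁ := interp_targetIso ι e
    have t₂ := interp_sourceIso ι e
    rw [hr] at t₁
    rw [hl] at t₂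
    -- Congruence of expressions, not just equality of their values in `F`, is needed here:
    -- congruent expressions have the same interpretation in every symmetric monoidal category, in
    -- particular in `Fam`.
    have key : FreeSym.Rel (.comp c (.comp (targetHom ι e) b')) (.id x) := by
      apply interp_injective hF.isoCondition
      change _ ≫ _ ≫ _ = 𝟙 _
      have : FreeSym.interp ι (targetHom ι e) = FreeSym.interp ι b ≫ FreeSym.interp ι c' := by
        rw [← cancel_epi (targetIso ι y).hom, ← t₁]
        simp [r]
      rw [this, assoc, hb', comp_id, hb]
    have mem : σ.hom ∈ Fam.Hom.rel
        (FreeSym.interp (sliceFam ι) (.comp c (.comp (targetHom ι e) b'))) p q := by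
      refine ⟨_, _, _, h₂, ⟨_, _, _, t₂, h₁', rfl⟩, ?_⟩
      simp [l]
    rw [FreeSym.interp_rel (sliceFam ι) key] at mem
    exact mem

lemma exists_fam_tensor (hF : IsFeynmanCategory.{w} ι) {X : F} (a b : FreeSym V)
    (ψ : X ⟶ wordObj ι a ⊗ wordObj ι b) :
    ∃ (p : (wordFam ι a).carrier) (q : (wordFam ι b).carrier)
      (σ : X ≅ (wordFam ι a).src p ⊗ (wordFam ι b).src q),
      σ.hom ≫ (famHom ι a p ⊗ₘ famHom ι b q) = ψ := by
  obtain ⟨p, σ, h⟩ := exists_fam hF (.tensor a b) ψ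
  exact ⟨p.1, p.2, σ, h⟩

/-- With `exists_tensor_of_split` this says that words over `A ⊗ B` are the same as pairs of words
over `A` and over `B`. Arbitrary objects `A` and `B` are replaced by words isomorphic to them. -/
theorem exists_split (hF : IsFeynmanCategory.{w} ι) {X A B : F} (ψ : X ⟶ A ⊗ B) :
    ∃ (y z : FreeSym V) (f : wordObj ι y ⟶ A) (g : wordObj ι z ⟶ B)
      (σ : X ≅ wordObj ι y ⊗ wordObj ι z), σ.hom ≫ (f ⊗ₘ g) = ψ := by
  obtain ⟨a, ⟨i⟩⟩ := exists_word hF.isoCondition A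
  obtain ⟨b, ⟨j⟩⟩ := exists_word hF.isoCondition B
  obtain ⟨p, q, σ, hσ⟩ := exists_fam_tensor hF a b (ψ ≫ (i.hom ⊗ₘ j.hom))
  obtain ⟨y, ⟨i'⟩⟩ := exists_word hF.isoCondition ((wordFam ι a).src p)
  obtain ⟨z, ⟨j'⟩⟩ := exists_word hF.isoCondition ((wordFam ι b).src q)
  refine ⟨y, z, i'.inv ≫ famHom ι a p ≫ i.inv, j'.inv ≫ famHom ι b q ≫ j.inv,
    σ ≪≫ (i' ⊗ᵢ j'), ?_⟩
  simp only [Iso.trans_hom, tensorIso_hom, assoc]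
  rw [MonoidalCategory.tensorHom_comp_tensorHom, Iso.hom_inv_id_assoc,
    Iso.hom_inv_id_assoc, ← MonoidalCategory.tensorHom_comp_tensorHom, reassoc_of% hσ,
    MonoidalCategory.tensorHom_comp_tensorHom]
  simp

theorem exists_tensor_of_split (hF : IsFeynmanCategory.{w} ι) {X Y X' Y' A B : F}
    (f : X ⟶ A) (g : Y ⟶ B) (f' : X' ⟶ A) (g' : Y' ⟶ B) (σ : X ⊗ Y ≅ X' ⊗ Y')
    (h : σ.hom ≫ (f' ⊗ₘ g') = f ⊗ₘ g) :
    ∃ (s : X ≅ X') (t : Y ≅ Y'), σ.hom = s.hom ⊗ₘ t.hom ∧ s.hom ≫ f' = f ∧ t.hom ≫ g' = g := by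
  obtain ⟨a, ⟨i⟩⟩ := exists_word hF.isoCondition A
  obtain ⟨b, ⟨j⟩⟩ := exists_word hF.isoCondition B
  obtain ⟨p, u, hu⟩ := exists_fam hF a (f ≫ i.hom)
  obtain ⟨q, v, hv⟩ := exists_fam hF b (g ≫ j.hom)
  obtain ⟨p', u', hu'⟩ := exists_fam hF a (f' ≫ i.hom)
  obtain ⟨q', v', hv'⟩ := exists_fam hF b (g' ≫ j.hom)
  -- For a word of the form `tensor a b` a distinguished morphism is by definition a tensor product,
  -- so the splitting of `σ` is read off from membership.
  obtain ⟨s, hs, t, ht, e⟩ := mem_mor_of_comp_eq hF (.tensor a b) (p, q) (p', q')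
    ((u ⊗ᵢ v).symm ≪≫ σ ≪≫ (u' ⊗ᵢ v')) (by
      change ((u.inv ⊗ₘ v.inv) ≫ σ.hom ≫ (u'.hom ⊗ₘ v'.hom)) ≫
        (famHom ι a p' ⊗ₘ famHom ι b q') = (famHom ι a p ⊗ₘ famHom ι b q)
      simp only [assoc]
      rw [MonoidalCategory.tensorHom_comp_tensorHom, hu', hv',
        ← MonoidalCategory.tensorHom_comp_tensorHom, reassoc_of% h,
        MonoidalCategory.tensorHom_comp_tensorHom, MonoidalCategory.tensorHom_comp_tensorHom,
        ← hu, ← hv]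
      simp)
  obtain ⟨_, hs⟩ := mem_mor ι a _ _ _ hs
  obtain ⟨_, ht⟩ := mem_mor ι b _ _ _ ht
  replace e : s ⊗ₘ t = (u.inv ⊗ₘ v.inv) ≫ σ.hom ≫ (u'.hom ⊗ₘ v'.hom) := e
  refine ⟨u ≪≫ asIso s ≪≫ u'.symm, v ≪≫ asIso t ≪≫ v'.symm, ?_, ?_, ?_⟩
  · simp only [Iso.trans_hom, asIso_hom, Iso.symm_hom]
    rw [← MonoidalCategory.tensorHom_comp_tensorHom, ← MonoidalCategory.tensorHom_comp_tensorHom,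
      e]
    simp
  · rw [← cancel_mono i.hom, assoc, ← hu', ← hu]
    simp [hs]
  · rw [← cancel_mono j.hom, assoc, ← hv', ← hv]
    simp [ht]

/-- The family over the empty word has the identity of the unit as its only arrow. -/
theorem isIso_of_unit (hF : IsFeynmanCategory.{w} ι) {X : F} (ψ : X ⟶ 𝟙_ F) : IsIso ψ := by
  obtain ⟨p, σ, rfl⟩ := exists_fam hF .unit ψ
  exact inferInstanceAs (IsIso (σ.hom ≫ 𝟙 _))

end
end

section
/-! ### The free symmetric monoidal category: structural morphisms -/

namespace FreeSym
section
variable {A : Type uV} [Category.{vV} A] {D : Type u} [Category.{w} D] [MonoidalCategory D]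
  [SymmetricCategory D] (G : A ⥤ D)

/-- The tensor product of morphisms of the free symmetric monoidal category. -/
def tensorMor {x y x' y' : FreeSym A} (f : x ⟶ x') (g : y ⟶ y') :
    FreeSym.tensor x y ⟶ FreeSym.tensor x' y' :=
  Quotient.map₂ PreHom.tensor (fun _ _ hf _ _ hg => Rel.tensor hf hg) f g

lemma lift_map_tensorMor {x y x' y' : FreeSym A} (f : x ⟶ x') (g : y ⟶ y') :
    (lift G).map (tensorMor f g) = (lift G).map f ⊗ₘ (lift G).map g := by
  induction f using Quotient.inductionOn
  induction g using Quotient.inductionOn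
  rfl

/-- The class of a formal expression. -/
def mor {x y : FreeSym A} (e : PreHom x y) : x ⟶ y := ⟦e⟧

lemma exists_mor {x y : FreeSym A} (f : x ⟶ y) : ∃ e, mor e = f := Quotient.exists_rep f

end
end FreeSym

section
variable {V : Type uV} [Groupoid.{vV} V] {F : Type uF} [Category.{vF} F] [MonoidalCategory F]
  [SymmetricCategory F] {ι : V ⥤ F}

instance {x y : FreeSym V} (e : x ⟶ y) : IsIso ((wordFun ι).map e) := by
  obtain ⟨e, rfl⟩ := FreeSym.exists_mor e
  exact inferInstanceAs (IsIso (FreeSym.interp ι e))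

section
variable (h : (FreeSym.lift (Core.functorToCore ι)).IsEquivalence)
include h

lemma exists_wordFun_map {x y : FreeSym V} (σ : wordObj ι x ≅ wordObj ι y) :
    ∃ e : x ⟶ y, (wordFun ι).map e = σ.hom := by
  obtain ⟨e, he⟩ := exists_preHom h σ
  exact ⟨FreeSym.mor e, he⟩

lemma wordFun_map_injective {x y : FreeSym V} {e e' : x ⟶ y}
    (he : (wordFun ι).map e = (wordFun ι).map e') : e = e' := by
  obtain ⟨e, rfl⟩ := FreeSym.exists_mor e
  obtain ⟨e', rfl⟩ := FreeSym.exists_mor e'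
  exact Quotient.sound (interp_injective h he)

/-- The isomorphism of words given by an isomorphism of their values. -/
lemma exists_wordFun_iso {x y : FreeSym V} (σ : wordObj ι x ≅ wordObj ι y) :
    ∃ e : x ≅ y, (wordFun ι).map e.hom = σ.hom := by
  obtain ⟨e, he⟩ := exists_wordFun_map h σ
  obtain ⟨e', he'⟩ := exists_wordFun_map h σ.symm
  refine ⟨⟨e, e', wordFun_map_injective h ?_, wordFun_map_injective h ?_⟩, he⟩
  · rw [Functor.map_comp, he, he']
    exact σ.hom_inv_id.trans ((wordFun ι).map_id x).symm
  · rw [Functor.map_comp, he, he']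
    exact σ.inv_hom_id.trans ((wordFun ι).map_id y).symm

end

lemma essentiallySmall_of_family {D : Type u} [Category.{uC} D] {I : Type w} (o : I → D)
    (ho : ∀ d, ∃ i, Nonempty (d ≅ o i)) (hs : ∀ i j, Small.{w} (o i ⟶ o j)) :
    EssentiallySmall.{w} D := by
  rw [essentiallySmall_iff]
  constructor
  · refine small_of_surjective (f := fun i => toSkeleton (o i)) fun d => ?_
    obtain ⟨d, rfl⟩ := Quotient.exists_rep d
    obtain ⟨i, ⟨e⟩⟩ := ho d
    exact ⟨i, Quotient.sound ⟨e.symm⟩⟩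
  · refine ⟨fun d d' => ?_⟩
    obtain ⟨i, ⟨e⟩⟩ := ho d
    obtain ⟨j, ⟨e'⟩⟩ := ho d'
    have := hs i j
    exact small_of_injective (f := fun f : d ⟶ d' => e.inv ≫ f ≫ e'.hom) fun f g hfg => by
      simpa using hfg

/-- The category of words over an object. -/
abbrev WordOver (ι : V ⥤ F) (X : F) := CostructuredArrow (wordFun ι) X

/-- An object of the category of words over `X`. -/
abbrev WordOver.mk {X : F} {y : FreeSym V} (φ : wordObj ι y ⟶ X) : WordOver ι X :=
  CostructuredArrow.mk (S := wordFun ι) φ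

/-- Words over `X` need only be compared in `F`: fullness lifts an isomorphism of values over `X` to
one of words. -/
lemma WordOver.nonempty_iso (h : (FreeSym.lift (Core.functorToCore ι)).IsEquivalence) {X : F}
    (a b : WordOver ι X) (σ : wordObj ι a.left ≅ wordObj ι b.left) (hσ : σ.hom ≫ b.hom = a.hom) :
    Nonempty (a ≅ b) := by
  obtain ⟨e, he⟩ := exists_wordFun_iso h σ
  exact ⟨CostructuredArrow.isoMk e (by rw [he]; exact hσ)⟩

variable (hF : IsFeynmanCategory.{w} ι)
include hF

/-- A single letter is the size condition. The empty word has one isomorphism class of words over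
it, and a tensor product is covered by pairs, both on objects and on morphisms, by the hereditary
condition. -/
theorem essentiallySmall_wordOver_word : ∀ x : FreeSym V,
    EssentiallySmall.{w} (WordOver ι (wordObj ι x))
  | .of v => by
      have := hF.size v
      let T : WordOver ι (ι.obj v) ⥤ Over (ι.obj v) := CostructuredArrow.toOver (wordFun ι) (ι.obj v)
      let E := equivSmallModel.{w} (Over (ι.obj v))
      -- Not every object over `v` is itself a word. The index set keeps those isomorphism types
      -- that contain a word, and one such word is chosen for each.
      let I := {i : SmallModel.{w} (Over (ι.obj v)) //
        ∃ d : WordOver ι (ι.obj v), Nonempty (E.functor.obj (T.obj d) ≅ i)}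
      refine essentiallySmall_of_family (I := I) (fun i => i.2.choose) (fun d => ?_) (fun i j => ?_)
      · let i : I := ⟨_, d, ⟨Iso.refl _⟩⟩
        obtain ⟨e⟩ := i.2.choose_spec
        refine ⟨i, ?_⟩
        let e' : T.obj d ≅ T.obj (i.2.choose) := E.functor.preimageIso e.symm
        exact WordOver.nonempty_iso hF.isoCondition _ _ ((Over.forget _).mapIso e') (Over.w e'.hom)
      · refine small_of_injective (f := fun f => T.map f) fun f g hfg => ?_
        apply CostructuredArrow.hom_ext
        exact wordFun_map_injective hF.isoCondition (congrArg (·.left) hfg)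
  | .unit => by
      refine essentiallySmall_of_family (I := PUnit)
        (fun _ => WordOver.mk (y := .unit) (𝟙 (𝟙_ F))) (fun d => ?_) (fun i j => ?_)
      · let ψ : wordObj ι d.left ⟶ 𝟙_ F := d.hom
        have : IsIso ψ := isIso_of_unit hF ψ
        exact ⟨⟨⟩, WordOver.nonempty_iso hF.isoCondition _ _ (@asIso _ _ _ _ ψ this) (comp_id _)⟩
      · refine @small_subsingleton _ ⟨fun f g => ?_⟩
        apply CostructuredArrow.hom_ext
        apply wordFun_map_injective hF.isoCondition
        have h₁ := CostructuredArrow.w f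
        have h₂ := CostructuredArrow.w g
        exact ((comp_id _).symm.trans h₁).trans ((comp_id _).symm.trans h₂).symm
  | .tensor a b => by
      have ha := essentiallySmall_wordOver_word a
      have hb := essentiallySmall_wordOver_word b
      let Ea := equivSmallModel.{w} (WordOver ι (wordObj ι a))
      let Eb := equivSmallModel.{w} (WordOver ι (wordObj ι b))
      let ten (p : WordOver ι (wordObj ι a)) (q : WordOver ι (wordObj ι b)) :
        WordOver ι (wordObj ι (.tensor a b)) :=
        WordOver.mk (X := wordObj ι (.tensor a b)) (y := .tensor p.left q.left) (p.hom ⊗ₘ q.hom)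
      have hten (p q p' q') (s : wordObj ι p.left ≅ wordObj ι p'.left)
          (t : wordObj ι q.left ≅ wordObj ι q'.left) (hs : s.hom ≫ p'.hom = p.hom)
          (ht : t.hom ≫ q'.hom = q.hom) : (s.hom ⊗ₘ t.hom) ≫ (ten p' q').hom = (ten p q).hom :=
        (MonoidalCategory.tensorHom_comp_tensorHom _ _ _ _).trans (by rw [hs, ht]; rfl)
      refine essentiallySmall_of_family (I := SmallModel.{w} (WordOver ι (wordObj ι a)) ×
        SmallModel.{w} (WordOver ι (wordObj ι b)))
        (fun i => ten (Ea.inverse.obj i.1) (Eb.inverse.obj i.2)) (fun d => ?_) (fun i j => ?_)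
      · obtain ⟨y, z, f, g, σ, hσ⟩ := exists_split hF (A := wordObj ι a) (B := wordObj ι b) d.hom
        let p : WordOver ι (wordObj ι a) := WordOver.mk f
        let q : WordOver ι (wordObj ι b) := WordOver.mk g
        refine ⟨(Ea.functor.obj p, Eb.functor.obj q), ?_⟩
        let i := Ea.unitIso.app p
        let j := Eb.unitIso.app q
        have w₁ := CostructuredArrow.w i.hom
        have w₂ := CostructuredArrow.w j.hom
        let s : wordObj ι p.left ≅ wordObj ι (Ea.inverse.obj (Ea.functor.obj p)).left :=
          (CostructuredArrow.proj _ _ ⋙ wordFun ι).mapIso i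
        let t : wordObj ι q.left ≅ wordObj ι (Eb.inverse.obj (Eb.functor.obj q)).left :=
          (CostructuredArrow.proj _ _ ⋙ wordFun ι).mapIso j
        refine WordOver.nonempty_iso hF.isoCondition _ _ (σ ≪≫ (s ⊗ᵢ t)) ?_
        have := hten _ _ _ _ s t w₁ w₂
        refine (assoc _ _ _).trans ((congrArg (σ.hom ≫ ·) this).trans hσ)
      · have h₁ : Small.{w} (Ea.inverse.obj i.1 ⟶ Ea.inverse.obj j.1) :=
          (locallySmall_of_essentiallySmall.{w} _).hom_small _ _
        have h₂ : Small.{w} (Eb.inverse.obj i.2 ⟶ Eb.inverse.obj j.2) :=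
          (locallySmall_of_essentiallySmall.{w} _).hom_small _ _
        refine small_of_surjective.{w} (α := (Ea.inverse.obj i.1 ⟶ Ea.inverse.obj j.1) ×
          (Eb.inverse.obj i.2 ⟶ Eb.inverse.obj j.2))
          (f := fun p => CostructuredArrow.homMk (FreeSym.tensorMor p.1.left p.2.left) ?_)
          fun f => ?_
        · rw [FreeSym.lift_map_tensorMor]
          refine (MonoidalCategory.tensorHom_comp_tensorHom _ _ _ _).trans ?_
          have w₁ := CostructuredArrow.w p.1
          have w₂ := CostructuredArrow.w p.2
          rw [w₁, w₂]
          rfl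
        · let σ := asIso ((wordFun ι).map f.left)
          -- A morphism between two split words over `a ⊗ b` is a tensor product, hence the image of
          -- a pair of morphisms taken from small sets.
          obtain ⟨s, t, hst, hs, ht⟩ := exists_tensor_of_split hF _ _ _ _ σ
            (CostructuredArrow.w f)
          obtain ⟨e, he⟩ := exists_wordFun_map hF.isoCondition s
          obtain ⟨e', he'⟩ := exists_wordFun_map hF.isoCondition t
          refine ⟨(CostructuredArrow.homMk e (by rw [he]; exact hs),
            CostructuredArrow.homMk e' (by rw [he']; exact ht)), ?_⟩
          apply CostructuredArrow.hom_ext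
          apply wordFun_map_injective hF.isoCondition
          refine (FreeSym.lift_map_tensorMor ι e e').trans ?_
          change (wordFun ι).map e ⊗ₘ (wordFun ι).map e' = _
          rw [he, he']
          exact hst.symm

theorem essentiallySmall_wordOver (X : F) : EssentiallySmall.{w} (WordOver ι X) := by
  obtain ⟨x, ⟨i⟩⟩ := exists_word hF.isoCondition X
  have := essentiallySmall_wordOver_word hF x
  exact (essentiallySmall_congr (CostructuredArrow.mapIso i)).2 this

end
end

section
/-! ### Free symmetric monoidal functors -/

section
variable {V : Type uV} [Groupoid.{vV} V] {F : Type uF} [Category.{vF} F] [MonoidalCategory F]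
  [SymmetricCategory F] {ι : V ⥤ F}
variable {D : Type uC} [Category.{vC} D] [MonoidalCategory D] [SymmetricCategory D] (M : V ⥤ D)

section
variable {A : Type uV} [Category.{vV} A] (G : A ⥤ D)

/-- The morphism of values given by a morphism of words. -/
def letterMap {x y : FreeSym A} (e : x ⟶ y) :
    FreeSym.value G.obj x ⟶ FreeSym.value G.obj y := (FreeSym.lift G).map e

@[simp] lemma letterMap_id (x : FreeSym A) : letterMap G (𝟙 x) = 𝟙 _ := (FreeSym.lift G).map_id x

lemma letterMap_comp {x y z : FreeSym A} (e : x ⟶ y) (f : y ⟶ z) :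
    letterMap G (e ≫ f) = letterMap G e ≫ letterMap G f := (FreeSym.lift G).map_comp e f

lemma letterMap_tensorMor {x y x' y' : FreeSym A} (e : x ⟶ x') (f : y ⟶ y') :
    letterMap G (FreeSym.tensorMor e f) = letterMap G e ⊗ₘ letterMap G f :=
  FreeSym.lift_map_tensorMor G e f

end

instance (G : V ⥤ D) {x y : FreeSym V} (e : x ⟶ y) : IsIso (letterMap G e) :=
  inferInstanceAs (IsIso ((wordFun G).map e))

section
variable {M} {S : F ⥤ D} [S.Braided] (g : M ⟶ ι ⋙ S)

/-- The extension of a natural transformation to words. -/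
def wordMap : ∀ x : FreeSym V, wordObj M x ⟶ S.obj (wordObj ι x)
  | .of v => g.app v
  | .unit => Functor.LaxMonoidal.ε S
  | .tensor a b => (wordMap a ⊗ₘ wordMap b) ≫ Functor.LaxMonoidal.μ S _ _

section
variable (S)
open Functor.LaxMonoidal

/-- The coherence conditions of a braided functor with morphisms inserted into the factors. This
lemma and the next ones are the constructor cases of `wordMap_interp`. -/
lemma μ_assoc_hom {X Y Z : F} {A B E : D} (a : A ⟶ S.obj X) (b : B ⟶ S.obj Y) (c : E ⟶ S.obj Z) :
    (α_ A B E).hom ≫ (a ⊗ₘ ((b ⊗ₘ c) ≫ μ S Y Z)) ≫ μ S X (Y ⊗ Z) =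
      ((((a ⊗ₘ b) ≫ μ S X Y) ⊗ₘ c) ≫ μ S (X ⊗ Y) Z) ≫ S.map (α_ X Y Z).hom := by
  have h := Functor.LaxMonoidal.associativity S X Y Z
  have h₁ : ((a ⊗ₘ b) ≫ μ S X Y) ⊗ₘ c = ((a ⊗ₘ b) ⊗ₘ c) ≫ μ S X Y ▷ S.obj Z := by
    rw [← tensorHom_id, MonoidalCategory.tensorHom_comp_tensorHom, comp_id]
  have h₂ : a ⊗ₘ ((b ⊗ₘ c) ≫ μ S Y Z) = (a ⊗ₘ (b ⊗ₘ c)) ≫ S.obj X ◁ μ S Y Z := by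
    rw [← id_tensorHom, MonoidalCategory.tensorHom_comp_tensorHom, comp_id]
  rw [h₁, h₂, assoc, assoc, assoc, h, associator_naturality_assoc]

lemma μ_assoc_inv {X Y Z : F} {A B E : D} (a : A ⟶ S.obj X) (b : B ⟶ S.obj Y) (c : E ⟶ S.obj Z) :
    (α_ A B E).inv ≫ ((((a ⊗ₘ b) ≫ μ S X Y) ⊗ₘ c) ≫ μ S (X ⊗ Y) Z) =
      ((a ⊗ₘ ((b ⊗ₘ c) ≫ μ S Y Z)) ≫ μ S X (Y ⊗ Z)) ≫ S.map (α_ X Y Z).inv := by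
  rw [Iso.inv_comp_eq, ← cancel_mono (S.map (α_ X Y Z).hom), ← μ_assoc_hom]
  simp only [assoc, Iso.map_inv_hom_id, comp_id]

lemma μ_left_hom {X : F} {A : D} (a : A ⟶ S.obj X) :
    (λ_ A).hom ≫ a = ((ε S ⊗ₘ a) ≫ μ S _ X) ≫ S.map (λ_ X).hom := by
  rw [MonoidalCategory.tensorHom_def', assoc, assoc, ← Functor.LaxMonoidal.left_unitality,
    leftUnitor_naturality]

lemma μ_left_inv {X : F} {A : D} (a : A ⟶ S.obj X) :
    (λ_ A).inv ≫ ((ε S ⊗ₘ a) ≫ μ S _ X) = a ≫ S.map (λ_ X).inv := by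
  rw [Iso.inv_comp_eq, ← assoc, μ_left_hom]
  simp only [assoc, Iso.map_hom_inv_id, comp_id]

lemma μ_right_hom {X : F} {A : D} (a : A ⟶ S.obj X) :
    (ρ_ A).hom ≫ a = ((a ⊗ₘ ε S) ≫ μ S X _) ≫ S.map (ρ_ X).hom := by
  rw [MonoidalCategory.tensorHom_def, assoc, assoc, ← Functor.LaxMonoidal.right_unitality,
    rightUnitor_naturality]

lemma μ_right_inv {X : F} {A : D} (a : A ⟶ S.obj X) :
    (ρ_ A).inv ≫ ((a ⊗ₘ ε S) ≫ μ S X _) = a ≫ S.map (ρ_ X).inv := by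
  rw [Iso.inv_comp_eq, ← assoc, μ_right_hom]
  simp only [assoc, Iso.map_hom_inv_id, comp_id]

lemma μ_braid {X Y : F} {A B : D} (a : A ⟶ S.obj X) (b : B ⟶ S.obj Y) :
    (β_ A B).hom ≫ ((b ⊗ₘ a) ≫ μ S Y X) = ((a ⊗ₘ b) ≫ μ S X Y) ≫ S.map (β_ X Y).hom := by
  rw [assoc, Functor.LaxBraided.braided, BraidedCategory.braiding_naturality_assoc]

lemma μ_comp {S S' : F ⥤ D} [S.Braided] [S'.Braided] (t : S ⟶ S') [t.IsMonoidal] {X Y : F}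
    {A B : D} (a : A ⟶ S.obj X) (b : B ⟶ S.obj Y) :
    ((a ≫ t.app X) ⊗ₘ (b ≫ t.app Y)) ≫ μ S' X Y = ((a ⊗ₘ b) ≫ μ S X Y) ≫ t.app (X ⊗ Y) := by
  rw [assoc, NatTrans.IsMonoidal.tensor, MonoidalCategory.tensorHom_comp_tensorHom_assoc]

lemma μ_tensor {X Y X' Y' : F} {A B A' B' : D} {a : A ⟶ S.obj X} {b : B ⟶ S.obj Y}
    {a' : A' ⟶ S.obj X'} {b' : B' ⟶ S.obj Y'} {f : X ⟶ X'} {g : Y ⟶ Y'} {s : A ⟶ A'} {t : B ⟶ B'}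
    (h : s ≫ a' = a ≫ S.map f) (h' : t ≫ b' = b ≫ S.map g) :
    (s ⊗ₘ t) ≫ (a' ⊗ₘ b') ≫ μ S X' Y' = ((a ⊗ₘ b) ≫ μ S X Y) ≫ S.map (f ⊗ₘ g) := by
  rw [MonoidalCategory.tensorHom_comp_tensorHom_assoc, h, h', assoc,
    ← Functor.LaxMonoidal.μ_natural, MonoidalCategory.tensorHom_comp_tensorHom_assoc]

end

lemma wordMap_interp {x y : FreeSym V} (e : FreeSym.PreHom x y) :
    FreeSym.interp M e ≫ wordMap g y = wordMap g x ≫ S.map (FreeSym.interp ι e) := by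
  induction e with
  | of f => exact g.naturality f
  | id x => exact (id_comp _).trans ((comp_id _).symm.trans (congrArg (wordMap g x ≫ ·)
      (S.map_id _).symm))
  | comp e e' h h' =>
      change (_ ≫ _) ≫ _ = _ ≫ S.map (_ ≫ _)
      rw [assoc, h', reassoc_of% h, S.map_comp]
  | tensor e e' h h' => exact μ_tensor S h h'
  | assocHom x y z => exact μ_assoc_hom S _ _ _
  | assocInv x y z => exact μ_assoc_inv S _ _ _
  | leftHom x => exact μ_left_hom S _
  | leftInv x => exact μ_left_inv S _
  | rightHom x => exact μ_right_hom S _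
  | rightInv x => exact μ_right_inv S _
  | braid x y => exact μ_braid S _ _

lemma wordMap_naturality {x y : FreeSym V} (e : x ⟶ y) :
    letterMap M e ≫ wordMap g y = wordMap g x ≫ S.map (letterMap ι e) := by
  obtain ⟨e, rfl⟩ := FreeSym.exists_mor e
  exact wordMap_interp g e

lemma wordMap_comp {S' : F ⥤ D} [S'.Braided] (t : S ⟶ S') [t.IsMonoidal] :
    ∀ x, wordMap (g ≫ Functor.whiskerLeft ι t) x = wordMap g x ≫ t.app _
  | .of v => rfl
  | .unit => (NatTrans.IsMonoidal.unit).symm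
  | .tensor a b => by
      refine Eq.trans ?_ (μ_comp t (wordMap g a) (wordMap g b))
      rw [← wordMap_comp t a, ← wordMap_comp t b]
      rfl

end

variable [∀ X : F, HasColimitsOfShape (WordOver ι X) D]

variable (ι) in
/-- The values of the free functor. -/
def freeObj (X : F) : D := colimit (CostructuredArrow.proj (wordFun ι) X ⋙ wordFun M)

/-- The inclusions of the terms of the colimit. -/
def freeInj {X : F} (y : FreeSym V) (φ : wordObj ι y ⟶ X) : wordObj M y ⟶ freeObj ι M X :=
  colimit.ι (CostructuredArrow.proj (wordFun ι) X ⋙ wordFun M) (WordOver.mk φ)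

lemma map_freeInj {X : F} {y z : FreeSym V} (e : y ⟶ z) (φ : wordObj ι z ⟶ X) :
    letterMap M e ≫ freeInj M z φ = freeInj M y (letterMap ι e ≫ φ) :=
  colimit.w (CostructuredArrow.proj (wordFun ι) X ⋙ wordFun M)
    (CostructuredArrow.homMk e rfl :
      WordOver.mk (letterMap ι e ≫ φ) ⟶ WordOver.mk φ)

variable {M} in
lemma free_hom_ext {X : F} {Z : D} {f g : freeObj ι M X ⟶ Z}
    (h : ∀ y (φ : wordObj ι y ⟶ X), freeInj M y φ ≫ f = freeInj M y φ ≫ g) : f = g :=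
  colimit.hom_ext fun a => h a.left a.hom

/-- The cocone given by a compatible family of morphisms. -/
def freeCocone {X : F} (G : D ⥤ D) {Z : D}
    (g : ∀ y, (wordObj ι y ⟶ X) → (G.obj (wordObj M y) ⟶ Z))
    (hg : ∀ {y z : FreeSym V} (e : y ⟶ z) (φ : wordObj ι z ⟶ X),
      G.map (letterMap M e) ≫ g z φ = g y (letterMap ι e ≫ φ)) :
    Cocone ((CostructuredArrow.proj (wordFun ι) X ⋙ wordFun M) ⋙ G) where
  pt := Z
  ι :=
    { app := fun a => g a.left a.hom
      naturality := fun a b f => by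
        have h₁ := hg f.left b.hom
        have h₂ := congrArg (g a.left) (CostructuredArrow.w f)
        exact (h₁.trans h₂).trans (comp_id _).symm }

/-- Morphisms out of the image of the values of the free functor. -/
def freeDescOf {X : F} (G : D ⥤ D) [PreservesColimitsOfShape (WordOver ι X) G] {Z : D}
    (g : ∀ y, (wordObj ι y ⟶ X) → (G.obj (wordObj M y) ⟶ Z))
    (hg : ∀ {y z : FreeSym V} (e : y ⟶ z) (φ : wordObj ι z ⟶ X),
      G.map (letterMap M e) ≫ g z φ = g y (letterMap ι e ≫ φ)) :
    G.obj (freeObj ι M X) ⟶ Z :=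
  (isColimitOfPreserves G (colimit.isColimit
    (CostructuredArrow.proj (wordFun ι) X ⋙ wordFun M))).desc (freeCocone M G g hg)

lemma freeInj_freeDescOf {X : F} (G : D ⥤ D) [PreservesColimitsOfShape (WordOver ι X) G] {Z : D}
    (g : ∀ y, (wordObj ι y ⟶ X) → (G.obj (wordObj M y) ⟶ Z)) (hg) (y : FreeSym V)
    (φ : wordObj ι y ⟶ X) : G.map (freeInj M y φ) ≫ freeDescOf M G g hg = g y φ :=
  (isColimitOfPreserves G (colimit.isColimit
    (CostructuredArrow.proj (wordFun ι) X ⋙ wordFun M))).fac (freeCocone M G g hg) (WordOver.mk φ)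

lemma free_hom_ext_of {X : F} (G : D ⥤ D) [PreservesColimitsOfShape (WordOver ι X) G] {Z : D}
    {f g : G.obj (freeObj ι M X) ⟶ Z}
    (h : ∀ y (φ : wordObj ι y ⟶ X), G.map (freeInj M y φ) ≫ f = G.map (freeInj M y φ) ≫ g) :
    f = g :=
  (isColimitOfPreserves G (colimit.isColimit
    (CostructuredArrow.proj (wordFun ι) X ⋙ wordFun M))).hom_ext fun a => h a.left a.hom

/-- Morphisms out of the values of the free functor. -/
def freeDesc {X : F} {Z : D} (g : ∀ y, (wordObj ι y ⟶ X) → (wordObj M y ⟶ Z))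
    (hg : ∀ {y z : FreeSym V} (e : y ⟶ z) (φ : wordObj ι z ⟶ X),
      letterMap M e ≫ g z φ = g y (letterMap ι e ≫ φ)) : freeObj ι M X ⟶ Z :=
  colimit.desc (CostructuredArrow.proj (wordFun ι) X ⋙ wordFun M) (freeCocone M (𝟭 D) g hg)

@[simp]
lemma freeInj_freeDesc {X : F} {Z : D} (g : ∀ y, (wordObj ι y ⟶ X) → (wordObj M y ⟶ Z)) (hg)
    (y : FreeSym V) (φ : wordObj ι y ⟶ X) : freeInj M y φ ≫ freeDesc M g hg = g y φ :=
  colimit.ι_desc (freeCocone M (𝟭 D) g hg) (WordOver.mk φ)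

@[simp] lemma freeInj_freeDesc_assoc {X : F} {Z W : D}
    (g : ∀ y, (wordObj ι y ⟶ X) → (wordObj M y ⟶ Z)) (hg)
    (y : FreeSym V) (φ : wordObj ι y ⟶ X) (h : Z ⟶ W) :
    freeInj M y φ ≫ freeDesc M g hg ≫ h = g y φ ≫ h := by
  rw [← assoc, freeInj_freeDesc]

/-- The action of morphisms on the values of the free functor. -/
def freeMap {X Y : F} (f : X ⟶ Y) : freeObj ι M X ⟶ freeObj ι M Y :=
  freeDesc M (fun y φ => freeInj M y (φ ≫ f)) fun e φ => by rw [map_freeInj, assoc]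

@[simp]
lemma freeInj_freeMap {X Y : F} (f : X ⟶ Y) (y : FreeSym V) (φ : wordObj ι y ⟶ X) :
    freeInj M y φ ≫ freeMap M f = freeInj M y (φ ≫ f) :=
  freeInj_freeDesc M _ _ y φ

@[simp] lemma freeInj_freeMap_assoc {X Y : F} (f : X ⟶ Y) (y : FreeSym V) (φ : wordObj ι y ⟶ X)
    {Z : D} (h : freeObj ι M Y ⟶ Z) :
    freeInj M y φ ≫ freeMap M f ≫ h = freeInj M y (φ ≫ f) ≫ h := by
  rw [← assoc, freeInj_freeMap]

/-- The inclusion of the term of a tensor product of words. -/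
def freeInj₂ {X : F} (y z : FreeSym V) (φ : wordObj ι y ⊗ wordObj ι z ⟶ X) :
    wordObj M y ⊗ wordObj M z ⟶ freeObj ι M X := freeInj M (.tensor y z) φ

lemma map_freeInj₂ {X : F} {y z y' z' : FreeSym V} (e : y ⟶ y') (f : z ⟶ z')
    (φ : wordObj ι y' ⊗ wordObj ι z' ⟶ X) :
    (letterMap M e ⊗ₘ letterMap M f) ≫ freeInj₂ M y' z' φ =
      freeInj₂ M y z ((letterMap ι e ⊗ₘ letterMap ι f) ≫ φ) := by
  have := map_freeInj M (FreeSym.tensorMor e f) φ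
  rw [letterMap_tensorMor, letterMap_tensorMor] at this
  exact this

@[simp]
lemma freeInj₂_freeMap {X Y : F} (f : X ⟶ Y) (y z : FreeSym V)
    (φ : wordObj ι y ⊗ wordObj ι z ⟶ X) :
    freeInj₂ M y z φ ≫ freeMap M f = freeInj₂ M y z (φ ≫ f) :=
  freeInj_freeDesc M _ _ (.tensor y z) φ

variable (ι) in
/-- The free symmetric monoidal functor, as a functor. -/
abbrev freeFun : F ⥤ D where
  obj := freeObj ι M
  map f := freeMap M f
  map_id X := free_hom_ext fun y φ => by simp
  map_comp f g := free_hom_ext fun y φ => by simp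

variable [∀ (X : F) (A : D), PreservesColimitsOfShape (WordOver ι X) (tensorLeft A)]
variable [∀ (X : F) (A : D), PreservesColimitsOfShape (WordOver ι X) (tensorRight A)]

/-! ### Maps out of tensor products of values of the free functor -/

section
variable {M}

lemma free_whiskerRight_ext {X : F} {A Z : D} {f g : freeObj ι M X ⊗ A ⟶ Z}
    (h : ∀ y (φ : wordObj ι y ⟶ X), freeInj M y φ ▷ A ≫ f = freeInj M y φ ▷ A ≫ g) : f = g :=
  free_hom_ext_of M (tensorRight A) h

lemma free_whiskerLeft_ext {X : F} {A Z : D} {f g : A ⊗ freeObj ι M X ⟶ Z}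
    (h : ∀ y (φ : wordObj ι y ⟶ X), A ◁ freeInj M y φ ≫ f = A ◁ freeInj M y φ ≫ g) : f = g :=
  free_hom_ext_of M (tensorLeft A) h

lemma free_tensor_ext {X Y : F} {Z : D} {f g : freeObj ι M X ⊗ freeObj ι M Y ⟶ Z}
    (h : ∀ y (φ : wordObj ι y ⟶ X) z (ψ : wordObj ι z ⟶ Y),
      (freeInj M y φ ⊗ₘ freeInj M z ψ) ≫ f = (freeInj M y φ ⊗ₘ freeInj M z ψ) ≫ g) : f = g := by
  refine free_whiskerRight_ext fun y φ => free_whiskerLeft_ext fun z ψ => ?_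
  have := h y φ z ψ
  rw [MonoidalCategory.tensorHom_def', assoc, assoc] at this
  exact this

/-- The three colimits are resolved one variable at a time. In each step the remaining factors act
by functors that preserve the colimit. -/
lemma free_tensor₃_ext {X Y W : F} {Z : D}
    {f g : (freeObj ι M X ⊗ freeObj ι M Y) ⊗ freeObj ι M W ⟶ Z}
    (h : ∀ y (φ : wordObj ι y ⟶ X) z (ψ : wordObj ι z ⟶ Y) u (χ : wordObj ι u ⟶ W),
      ((freeInj M y φ ⊗ₘ freeInj M z ψ) ⊗ₘ freeInj M u χ) ≫ f =
        ((freeInj M y φ ⊗ₘ freeInj M z ψ) ⊗ₘ freeInj M u χ) ≫ g) : f = g := by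
  refine free_whiskerLeft_ext fun u χ => ?_
  refine free_hom_ext_of M (tensorRight (freeObj ι M Y) ⋙ tensorRight (wordObj M u))
    fun y φ => ?_
  refine free_hom_ext_of M (tensorLeft (wordObj M y) ⋙ tensorRight (wordObj M u))
    fun z ψ => ?_
  have := h y φ z ψ u χ
  rw [MonoidalCategory.tensorHom_def (freeInj M y φ ⊗ₘ freeInj M z ψ),
    MonoidalCategory.tensorHom_def' (freeInj M y φ), comp_whiskerRight, assoc, assoc, assoc,
    assoc] at this
  exact this

end

/-! ### The monoidal structure of the free functor -/

section
variable (hF : IsFeynmanCategory.{w} ι)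

/-- The multiplication of the free functor, restricted to a term of the first factor. -/
def freeMulLeft {X : F} (Y : F) (y : FreeSym V) (φ : wordObj ι y ⟶ X) :
    wordObj M y ⊗ freeObj ι M Y ⟶ freeObj ι M (X ⊗ Y) :=
  freeDescOf M (tensorLeft (wordObj M y)) (fun z ψ => freeInj₂ M y z (φ ⊗ₘ ψ))
    (fun {z z'} e ψ => by
      have := map_freeInj₂ M (𝟙 y) e (φ ⊗ₘ ψ)
      rw [letterMap_id, letterMap_id, id_tensorHom, MonoidalCategory.tensorHom_comp_tensorHom,
        id_comp] at this
      exact this)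

lemma whiskerLeft_freeInj_freeMulLeft {X Y : F} (y : FreeSym V) (φ : wordObj ι y ⟶ X)
    (z : FreeSym V) (ψ : wordObj ι z ⟶ Y) :
    wordObj M y ◁ freeInj M z ψ ≫ freeMulLeft M Y y φ = freeInj₂ M y z (φ ⊗ₘ ψ) :=
  freeInj_freeDescOf M (tensorLeft (wordObj M y)) _ _ z ψ

lemma whiskerRight_freeMulLeft {X Y : F} {y y' : FreeSym V} (e : y ⟶ y')
    (φ : wordObj ι y' ⟶ X) : letterMap M e ▷ freeObj ι M Y ≫ freeMulLeft M Y y' φ =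
      freeMulLeft M Y y (letterMap ι e ≫ φ) := by
  refine free_whiskerLeft_ext fun z ψ => ?_
  have := map_freeInj₂ M e (𝟙 z) (φ ⊗ₘ ψ)
  rw [letterMap_id, letterMap_id, tensorHom_id, MonoidalCategory.tensorHom_comp_tensorHom,
    id_comp] at this
  rw [whisker_exchange_assoc, whiskerLeft_freeInj_freeMulLeft, whiskerLeft_freeInj_freeMulLeft,
    this]

/-- The multiplication of the free functor. -/
def freeMul (X Y : F) : freeObj ι M X ⊗ freeObj ι M Y ⟶ freeObj ι M (X ⊗ Y) :=
  freeDescOf M (tensorRight (freeObj ι M Y)) (fun y φ => freeMulLeft M Y y φ)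
    (fun e φ => whiskerRight_freeMulLeft M e φ)

@[simp]
lemma freeInj_tensor_freeMul {X Y : F} (y : FreeSym V) (φ : wordObj ι y ⟶ X)
    (z : FreeSym V) (ψ : wordObj ι z ⟶ Y) :
    (freeInj M y φ ⊗ₘ freeInj M z ψ) ≫ freeMul M X Y = freeInj₂ M y z (φ ⊗ₘ ψ) := by
  have : freeInj M y φ ▷ _ ≫ freeMul M X Y = freeMulLeft M Y y φ :=
    freeInj_freeDescOf M (tensorRight (freeObj ι M Y)) _ _ y φ
  rw [MonoidalCategory.tensorHom_def', assoc, this, whiskerLeft_freeInj_freeMulLeft]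

lemma freeInj_tensor_freeMul_assoc {X Y : F} (y : FreeSym V) (φ : wordObj ι y ⟶ X)
    (z : FreeSym V) (ψ : wordObj ι z ⟶ Y) {Z : D} (h : freeObj ι M (X ⊗ Y) ⟶ Z) :
    (freeInj M y φ ⊗ₘ freeInj M z ψ) ≫ freeMul M X Y ≫ h = freeInj₂ M y z (φ ⊗ₘ ψ) ≫ h := by
  rw [← assoc, freeInj_tensor_freeMul]

lemma freeMul_natural {X Y X' Y' : F} (f : X ⟶ X') (g : Y ⟶ Y') :
    (freeMap (ι := ι) M f ⊗ₘ freeMap M g) ≫ freeMul M X' Y' = freeMul M X Y ≫ freeMap M (f ⊗ₘ g) := by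
  refine free_tensor_ext fun y φ z ψ => ?_
  rw [MonoidalCategory.tensorHom_comp_tensorHom_assoc, freeInj_freeMap, freeInj_freeMap,
    freeInj_tensor_freeMul, freeInj_tensor_freeMul_assoc, freeInj₂_freeMap,
    MonoidalCategory.tensorHom_comp_tensorHom]

/-- Both composites send the terms of `y`, `z`, `u` to terms indexed by the two bracketings of the
word, and the colimit identifies these along the formal associator. The braiding and the unit laws
are obtained in the same way. -/
lemma freeMul_assoc (X Y Z : F) :
    freeMul M X Y ▷ freeObj ι M Z ≫ freeMul M (X ⊗ Y) Z ≫ freeMap M (α_ X Y Z).hom =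
      (α_ _ _ _).hom ≫ freeObj ι M X ◁ freeMul M Y Z ≫ freeMul M X (Y ⊗ Z) := by
  refine free_tensor₃_ext fun y φ z ψ u χ => ?_
  have h₁ : (freeInj₂ M y z (φ ⊗ₘ ψ) ⊗ₘ freeInj M u χ) ≫ freeMul M (X ⊗ Y) Z =
    freeInj M (.tensor (.tensor y z) u) ((φ ⊗ₘ ψ) ⊗ₘ χ) :=
      freeInj_tensor_freeMul M (.tensor y z) (φ ⊗ₘ ψ) u χ
  have h₂ : (freeInj M y φ ⊗ₘ freeInj₂ M z u (ψ ⊗ₘ χ)) ≫ freeMul M X (Y ⊗ Z) =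
    freeInj M (.tensor y (.tensor z u)) (φ ⊗ₘ (ψ ⊗ₘ χ)) :=
      freeInj_tensor_freeMul M y φ (.tensor z u) (ψ ⊗ₘ χ)
  have h₃ : freeInj M (.tensor (.tensor y z) u) ((φ ⊗ₘ ψ) ⊗ₘ χ) ≫ freeMap M (α_ X Y Z).hom =
      freeInj M (.tensor (.tensor y z) u) (((φ ⊗ₘ ψ) ⊗ₘ χ) ≫ (α_ X Y Z).hom) :=
    freeInj_freeMap M _ _ _
  rw [← tensorHom_id, ← id_tensorHom, MonoidalCategory.tensorHom_comp_tensorHom_assoc,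
    comp_id, freeInj_tensor_freeMul, reassoc_of% h₁, h₃,
    associator_naturality_assoc, MonoidalCategory.tensorHom_comp_tensorHom_assoc, comp_id,
    freeInj_tensor_freeMul, h₂]
  refine (congrArg (freeInj M _) (associator_naturality φ ψ χ)).trans ?_
  exact (map_freeInj M (FreeSym.mor (.assocHom y z u)) (φ ⊗ₘ (ψ ⊗ₘ χ))).symm

lemma freeMul_braid (X Y : F) : freeMul (ι := ι) M X Y ≫ freeMap M (β_ X Y).hom =
    (β_ _ _).hom ≫ freeMul M Y X := by
  refine free_tensor_ext fun y φ z ψ => ?_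
  rw [freeInj_tensor_freeMul_assoc, freeInj₂_freeMap, BraidedCategory.braiding_naturality_assoc,
    freeInj_tensor_freeMul, BraidedCategory.braiding_naturality]
  exact (map_freeInj M (FreeSym.mor (.braid y z)) (ψ ⊗ₘ φ)).symm

variable (ι) in
/-- The unit of the free functor. -/
def freeUnit : 𝟙_ D ⟶ freeObj ι M (𝟙_ F) := freeInj M .unit (𝟙 (𝟙_ F))

lemma freeUnit_left (X : F) : (λ_ (freeObj ι M X)).hom =
    freeUnit ι M ▷ freeObj ι M X ≫ freeMul M (𝟙_ F) X ≫ freeMap M (λ_ X).hom := by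
  refine free_whiskerLeft_ext fun y φ => ?_
  have h₁ : (freeUnit ι M ⊗ₘ freeInj M y φ) ≫ freeMul M _ X =
    freeInj M (.tensor .unit y) (𝟙 _ ⊗ₘ φ) := freeInj_tensor_freeMul M .unit (𝟙 (𝟙_ F)) y φ
  rw [leftUnitor_naturality, ← assoc, ← MonoidalCategory.tensorHom_def', reassoc_of% h₁]
  refine Eq.trans (map_freeInj M (FreeSym.mor (.leftHom y)) φ) ?_
  refine Eq.trans ?_ (freeInj_freeMap M (λ_ X).hom (.tensor .unit y) (𝟙 (𝟙_ F) ⊗ₘ φ)).symm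
  exact congrArg (freeInj M _) (leftUnitor_naturality_aux₂ φ)

lemma freeUnit_right (X : F) : (ρ_ (freeObj ι M X)).hom =
    freeObj ι M X ◁ freeUnit ι M ≫ freeMul M X (𝟙_ F) ≫ freeMap M (ρ_ X).hom := by
  refine free_whiskerRight_ext fun y φ => ?_
  have h₁ : (freeInj M y φ ⊗ₘ freeUnit ι M) ≫ freeMul M X _ =
    freeInj M (.tensor y .unit) (φ ⊗ₘ 𝟙 _) := freeInj_tensor_freeMul M y φ .unit (𝟙 (𝟙_ F))
  rw [rightUnitor_naturality, ← assoc, ← MonoidalCategory.tensorHom_def, reassoc_of% h₁]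
  refine Eq.trans (map_freeInj M (FreeSym.mor (.rightHom y)) φ) ?_
  refine Eq.trans ?_ (freeInj_freeMap M (ρ_ X).hom (.tensor y .unit) (φ ⊗ₘ 𝟙 (𝟙_ F))).symm
  exact congrArg (freeInj M _) (rightUnitor_naturality_aux₂ φ)

-- Morphisms to the unit are invertible, so every word over the unit has a morphism to the empty
-- word that is unique by faithfulness. The colimit is therefore its value on the empty word.
include hF in
lemma isIso_freeUnit : IsIso (freeUnit ι M) := by
  have h (y : FreeSym V) (φ : wordObj ι y ⟶ 𝟙_ F) : ∃ e : y ⟶ .unit, letterMap ι e = φ := by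
    have := isIso_of_unit hF φ
    exact exists_wordFun_map hF.isoCondition (y := .unit) (@asIso _ _ _ _ φ this)
  choose e he using h
  refine ⟨freeDesc M (fun y φ => letterMap M (e y φ)) (fun {y z} f φ => ?_), ?_, ?_⟩
  · refine (letterMap_comp M f (e z φ)).symm.trans (congrArg (letterMap M) ?_)
    apply wordFun_map_injective hF.isoCondition
    refine Eq.trans ?_ (he y _).symm
    exact ((wordFun ι).map_comp _ _).trans (congrArg (letterMap ι f ≫ ·) (he z φ))
  · refine (freeInj_freeDesc M _ _ _ _).trans ?_
    have : e .unit (𝟙 (𝟙_ F)) = 𝟙 _ := by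
      apply wordFun_map_injective hF.isoCondition
      exact (he _ _).trans ((wordFun ι).map_id .unit).symm
    rw [this]
    exact letterMap_id M _
  · refine free_hom_ext fun y φ => ?_
    rw [freeInj_freeDesc_assoc, comp_id]
    refine (map_freeInj M (e y φ) (𝟙 (𝟙_ F))).trans ?_
    exact congrArg (freeInj M y) ((comp_id _).trans (he y φ))

-- On the term of a word `u` over `X ⊗ Y`, the inverse splits `u` into a word over `X` and a word
-- over `Y` and includes the two terms. The choice of the splitting does not matter after passage to
-- the colimits.
include hF in
lemma isIso_freeMul (X Y : F) : IsIso (freeMul (ι := ι) M X Y) := by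
  have h (u : FreeSym V) (θ : wordObj ι u ⟶ X ⊗ Y) : ∃ (y z : FreeSym V) (φ : wordObj ι y ⟶ X)
      (ψ : wordObj ι z ⟶ Y) (e : u ⟶ .tensor y z),
      letterMap ι e ≫ (φ ⊗ₘ ψ : wordObj ι (.tensor y z) ⟶ _) = θ := by
    obtain ⟨y, z, φ, ψ, σ, hσ⟩ := exists_split hF θ
    obtain ⟨e, he⟩ := exists_wordFun_map hF.isoCondition (y := .tensor y z) σ
    exact ⟨y, z, φ, ψ, e, (congrArg (· ≫ (φ ⊗ₘ ψ)) he).trans hσ⟩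
  choose y z φ ψ e he using h
  -- Two splittings of the same morphism differ by a pair of isomorphisms over `X` and `Y`, and
  -- these are absorbed by the two colimits. This gives both the compatibility with morphisms of
  -- words and the inverse laws.
  have indep (u : FreeSym V) (y z : FreeSym V) (φ : wordObj ι y ⟶ X) (ψ : wordObj ι z ⟶ Y)
      (e : u ⟶ .tensor y z) (y' z' : FreeSym V) (φ' : wordObj ι y' ⟶ X) (ψ' : wordObj ι z' ⟶ Y)
      (e' : u ⟶ .tensor y' z') (h : letterMap ι e ≫ (φ ⊗ₘ ψ : wordObj ι (.tensor y z) ⟶ _) =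
        letterMap ι e' ≫ (φ' ⊗ₘ ψ' : wordObj ι (.tensor y' z') ⟶ _)) :
      letterMap M e ≫ (freeInj M y φ ⊗ₘ freeInj M z ψ : wordObj M (.tensor y z) ⟶ _) =
        letterMap M e' ≫ (freeInj M y' φ' ⊗ₘ freeInj M z' ψ' : wordObj M (.tensor y' z') ⟶ _) := by
    let σ : wordObj ι u ≅ wordObj ι y ⊗ wordObj ι z := asIso (letterMap ι e)
    let σ' : wordObj ι u ≅ wordObj ι y' ⊗ wordObj ι z' := asIso (letterMap ι e')
    obtain ⟨s, t, hst, hs, ht⟩ := exists_tensor_of_split hF φ ψ φ' ψ' (σ.symm ≪≫ σ') (by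
      rw [Iso.trans_hom, Iso.symm_hom, assoc, Iso.inv_comp_eq]
      exact h.symm)
    obtain ⟨a, ha⟩ := exists_wordFun_map hF.isoCondition s
    obtain ⟨b, hb⟩ := exists_wordFun_map hF.isoCondition t
    replace ha : letterMap ι a = s.hom := ha
    replace hb : letterMap ι b = t.hom := hb
    have key : e' = e ≫ FreeSym.tensorMor a b := by
      apply wordFun_map_injective hF.isoCondition
      refine Eq.trans ?_ ((wordFun ι).map_comp _ _).symm
      refine Eq.trans ?_ (congrArg (letterMap ι e ≫ ·) (letterMap_tensorMor ι a b).symm)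
      rw [ha, hb, ← hst]
      exact (σ.hom_inv_id_assoc σ'.hom).symm
    rw [key, letterMap_comp, letterMap_tensorMor]
    refine Eq.trans ?_ (assoc _ _ _).symm
    refine congrArg (letterMap M e ≫ ·) ?_
    refine Eq.trans ?_ (MonoidalCategory.tensorHom_comp_tensorHom _ _ _ _).symm
    rw [map_freeInj, map_freeInj, ha, hb, hs, ht]
  refine ⟨freeDesc M (fun u θ => letterMap M (e u θ) ≫
    (freeInj M (y u θ) (φ u θ) ⊗ₘ freeInj M (z u θ) (ψ u θ) : wordObj M (.tensor _ _) ⟶ _))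
    (fun {u v} f θ => ?_), ?_, ?_⟩
  · rw [← assoc, ← letterMap_comp]
    apply indep
    rw [he, letterMap_comp, assoc, he]
  · refine free_tensor_ext fun a f b g => ?_
    rw [freeInj_tensor_freeMul_assoc, comp_id]
    refine (freeInj_freeDesc M _ _ _ _).trans ?_
    refine (indep _ _ _ _ _ _ a b f g (𝟙 _) ?_).trans ?_
    · rw [he, letterMap_id]
      exact (id_comp _).symm
    · rw [letterMap_id]
      exact id_comp _
  · refine free_hom_ext fun u θ => ?_
    rw [freeInj_freeDesc_assoc, comp_id, assoc]
    refine (congrArg (letterMap M (e u θ) ≫ ·) (freeInj_tensor_freeMul M _ _ _ _)).trans ?_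
    refine (map_freeInj M (e u θ) (φ u θ ⊗ₘ ψ u θ)).trans ?_
    rw [he]

/-- The monoidal structure of the free functor. -/
abbrev freeMonoidal : (freeFun ι M).Monoidal :=
  Functor.CoreMonoidal.toMonoidal
    { εIso := @asIso _ _ _ _ (freeUnit ι M) (isIso_freeUnit M hF)
      μIso := fun X Y => @asIso _ _ _ _ (freeMul M X Y) (isIso_freeMul M hF X Y)
      μIso_hom_natural_left := fun {X Y} f X' => by
        have := freeMul_natural (ι := ι) M f (𝟙 X')
        rw [show freeMap M (𝟙 X') = 𝟙 _ from (freeFun ι M).map_id X', tensorHom_id,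
          tensorHom_id] at this
        exact this
      μIso_hom_natural_right := fun {X Y} X' f => by
        have := freeMul_natural (ι := ι) M (𝟙 X') f
        rw [show freeMap M (𝟙 X') = 𝟙 _ from (freeFun ι M).map_id X', id_tensorHom,
          id_tensorHom] at this
        exact this
      associativity := freeMul_assoc M
      left_unitality := freeUnit_left M
      right_unitality := freeUnit_right M }

/-- The braided structure of the free functor. -/
abbrev freeBraided : (freeFun ι M).Braided :=
  letI := freeMonoidal M hF
  { braided := freeMul_braid M }

end

end
end

section
/-! ### The universal property of the free functor -/

section
variable {V : Type uV} [Groupoid.{vV} V] {F : Type uF} [Category.{vF} F] [MonoidalCategory F]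
  [SymmetricCategory F] {ι : V ⥤ F}
variable {D : Type uC} [Category.{vC} D] [MonoidalCategory D] [SymmetricCategory D] {M : V ⥤ D}
variable [∀ X : F, HasColimitsOfShape (WordOver ι X) D]

section
variable {S : F ⥤ D} [S.Braided] (g : M ⟶ ι ⋙ S)

/-- The natural transformation from the free functor that extends `g`. -/
def freeLift : freeFun ι M ⟶ S where
  app X := freeDesc M (fun y φ => wordMap g y ≫ S.map φ) fun e φ => by
    rw [← assoc, wordMap_naturality, assoc, S.map_comp]
  naturality X Y f := free_hom_ext fun y φ => by
    change _ ≫ freeMap M f ≫ _ = _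
    rw [freeInj_freeMap_assoc, freeInj_freeDesc, freeInj_freeDesc_assoc, assoc, S.map_comp]

lemma freeInj_freeLift {X : F} (y : FreeSym V) (φ : wordObj ι y ⟶ X) :
    freeInj M y φ ≫ (freeLift g).app X = wordMap g y ≫ S.map φ :=
  freeInj_freeDesc M _ _ y φ

variable [∀ (X : F) (A : D), PreservesColimitsOfShape (WordOver ι X) (tensorLeft A)]
variable [∀ (X : F) (A : D), PreservesColimitsOfShape (WordOver ι X) (tensorRight A)]

lemma freeUnit_freeLift :
    freeUnit ι M ≫ (freeLift g).app (𝟙_ F) = Functor.LaxMonoidal.ε S := by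
  refine (freeInj_freeLift g .unit (𝟙 (𝟙_ F))).trans ?_
  rw [S.map_id, comp_id, wordMap]

/-- On terms, the extension of `g` to a concatenated word is the product of the extensions, by the
recursion that defines `wordMap`. -/
lemma freeMul_freeLift (X Y : F) : freeMul M X Y ≫ (freeLift g).app (X ⊗ Y) =
    ((freeLift g).app X ⊗ₘ (freeLift g).app Y) ≫ Functor.LaxMonoidal.μ S X Y := by
  refine free_tensor_ext fun y φ z ψ => ?_
  rw [freeInj_tensor_freeMul_assoc, MonoidalCategory.tensorHom_comp_tensorHom_assoc,
    freeInj_freeLift, freeInj_freeLift, ← MonoidalCategory.tensorHom_comp_tensorHom, assoc,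
    Functor.LaxMonoidal.μ_natural]
  exact (freeInj_freeLift g (.tensor y z) (φ ⊗ₘ ψ)).trans (assoc _ _ _)

end

variable (ι M) in
/-- The inclusion of the generators of the free functor. -/
def freeIncl : M ⟶ ι ⋙ freeFun ι M where
  app v := freeInj M (.of v) (𝟙 (ι.obj v))
  naturality v u τ := by
    refine (map_freeInj M (FreeSym.mor (.of τ)) (𝟙 (ι.obj u))).trans ?_
    refine Eq.trans ?_ (freeInj_freeMap M (ι.map τ) (.of v) (𝟙 (ι.obj v))).symm
    exact congrArg (freeInj M (.of v)) ((comp_id _).trans (id_comp _).symm)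

lemma freeIncl_freeLift {S : F ⥤ D} [S.Braided] (g : M ⟶ ι ⋙ S) (v : V) :
    (freeIncl ι M).app v ≫ (freeLift g).app (ι.obj v) = g.app v := by
  refine (freeInj_freeLift g (.of v) (𝟙 (ι.obj v))).trans ?_
  rw [S.map_id, comp_id, wordMap]

end

/-! ### Colimits of graded objects -/

namespace Gr
variable {C : Type uC} [Category.{vC} C] {J : Type u} [Category.{w} J]

/-- The functor taking a graded object to its component of degree `n`. -/
def eval (C : Type uC) [Category.{vC} C] (n : ℤ) : Gr C ⥤ C where
  obj X := X.deg n
  map f := app f n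

/-- A cocone of graded objects is a colimit if it is one in each degree. -/
def isColimitOfEval {K : J ⥤ Gr C} (c : Cocone K)
    (h : ∀ n, IsColimit ((eval C n).mapCocone c)) : IsColimit c where
  desc s := fun n => (h n).desc ((eval C n).mapCocone s)
  fac s j := by
    ext n
    exact (h n).fac ((eval C n).mapCocone s) j
  uniq s m hm := by
    ext n
    exact (h n).uniq ((eval C n).mapCocone s) (app m n) fun j => congrArg (app · n) (hm j)

section
variable [HasColimitsOfShape J C] (K : J ⥤ Gr C)

/-- The degreewise colimit of graded objects. -/
def colimitCocone : Cocone K where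
  pt := fun n => colimit (K ⋙ eval C n)
  ι :=
    { app := fun j n => colimit.ι (K ⋙ eval C n) j
      naturality := fun i j f => by
        ext n
        exact (colimit.w (K ⋙ eval C n) f).trans (comp_id _).symm }

/-- The degreewise colimit is a colimit. -/
def colimitCoconeIsColimit : IsColimit (colimitCocone K) :=
  isColimitOfEval _ fun n => IsColimit.ofIsoColimit (colimit.isColimit (K ⋙ eval C n))
    (Cocone.ext (Iso.refl _) fun _ => comp_id _)

instance : HasColimitsOfShape J (Gr C) := ⟨fun K => ⟨⟨⟨_, colimitCoconeIsColimit K⟩⟩⟩⟩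

instance (n : ℤ) : PreservesColimitsOfShape J (eval C n) := ⟨fun {K} =>
  preservesColimit_of_preserves_colimit_cocone (colimitCoconeIsColimit K)
    (IsColimit.ofIsoColimit (colimit.isColimit (K ⋙ eval C n))
      (Cocone.ext (Iso.refl _) fun _ => comp_id _))⟩

variable [MonoidalCategory C] [GradedTarget C]
  [∀ X : C, PreservesColimitsOfShape J (tensorLeft X)]

/-- In degree `n` the tensor product is the coproduct of the objects `A_i ⊗ X_j` with `i + j = n`.
Each summand preserves the colimit, and maps out of the coproduct are given summand by summand. -/
instance preservesColimit_tensorLeft (A : Gr C) :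
    PreservesColimitsOfShape J (tensorLeft A) := ⟨fun {K} => ⟨fun {c} hc => ⟨by
  have h (i j : ℤ) : IsColimit ((eval C j ⋙ tensorLeft (A.deg i)).mapCocone c) :=
    isColimitOfPreserves (eval C j ⋙ tensorLeft (A.deg i)) hc
  have w (n i j : ℤ) (hij : i + j = n) (s : Cocone ((K ⋙ tensorLeft A) ⋙ eval C n)) :
      ∃ l : A.deg i ⊗ c.pt.deg j ⟶ s.pt, ∀ a : J,
        A.deg i ◁ app (c.ι.app a) j ≫ l = ι A (K.obj a) i j n hij ≫ s.ι.app a := by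
    refine ⟨(h i j).desc ⟨s.pt, fun a => ι A (K.obj a) i j n hij ≫ s.ι.app a, ?_⟩, fun a =>
      (h i j).fac _ a⟩
    intro a b f
    have := s.w f
    refine Eq.trans ?_ (comp_id _).symm
    refine Eq.trans ?_ (congrArg (ι A (K.obj a) i j n hij ≫ ·) this)
    exact (ι_whiskerLeft_assoc A (K.map f) i j n hij (s.ι.app b)).symm
  choose l hl using w
  refine isColimitOfEval _ fun n => ⟨fun s => desc fun i j hij => l n i j hij s, ?_, ?_⟩
  · intro s a
    refine tensor_ext _ _ fun i j hij => ?_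
    refine (ι_whiskerLeft_assoc A (c.ι.app a) i j n hij _).trans ?_
    refine (congrArg (_ ≫ ·) (ι_desc _ i j hij)).trans (hl n i j hij s a)
  · intro s m hm
    refine tensor_ext _ _ fun i j hij => ?_
    refine Eq.trans ?_ (ι_desc _ i j hij).symm
    refine (h i j).hom_ext fun a => ?_
    refine Eq.trans ?_ (hl n i j hij s a).symm
    refine (ι_whiskerLeft_assoc A (c.ι.app a) i j n hij m).symm.trans ?_
    exact congrArg (_ ≫ ·) (hm a)⟩⟩⟩

instance preservesColimit_tensorRight [SymmetricCategory C] [Preadditive C] [MonoidalPreadditive C]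
    (A : Gr C) : PreservesColimitsOfShape J (tensorRight A) :=
  preservesColimitsOfShape_of_natIso (BraidedCategory.tensorLeftIsoTensorRight A)

end
end Gr

lemma hasColimitsOfShape_of_size {J : Type u} [Category.{vV} J] [EssentiallySmall.{w} J]
    (C : Type uC) [Category.{vC} C] [HasColimitsOfSize.{w, w} C] : HasColimitsOfShape J C :=
  hasColimitsOfShape_of_equivalence (equivSmallModel J).symm

lemma preservesColimitsOfShape_of_size {J : Type u} [Category.{vV} J] [EssentiallySmall.{w} J]
    {C : Type uC} [Category.{vC} C] {D : Type uF} [Category.{vF} D] (G : C ⥤ D)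
    [PreservesColimitsOfSize.{w, w} G] :
    PreservesColimitsOfShape J G :=
  preservesColimitsOfShape_of_equiv (equivSmallModel J).symm G

/-! ### The free graded op -/

section
variable {V : Type uV} [Groupoid.{vV} V] {F : Type uF} [Category.{vF} F] [MonoidalCategory F]
  [SymmetricCategory F] {ι : V ⥤ F}
variable {C : Type uC} [Category.{vC} C] [MonoidalCategory C] [GradedTarget C]
  [SymmetricCategory C] [Preadditive C] [MonoidalPreadditive C]
/-- A natural transformation from `M` to the restriction of a graded op that exhibits it as the
free op on `M`. -/
structure IsFreeOp {M : V ⥤ Gr C} {R : GrOp F C} (i : M ⟶ ι ⋙ R.fn) : Prop where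
  hom_ext : ∀ {X : F} {Z : Gr C} (f g : R.fn.obj X ⟶ Z),
    (∀ y (φ : wordObj ι y ⟶ X), wordMap i y ≫ R.fn.map φ ≫ f = wordMap i y ≫ R.fn.map φ ≫ g) →
      f = g
  exists_desc : ∀ {X : F} {Z : Gr C} (g : ∀ y, (wordObj ι y ⟶ X) → (wordObj M y ⟶ Z)),
    (∀ {y z : FreeSym V} (e : y ⟶ z) (φ : wordObj ι z ⟶ X),
      letterMap M e ≫ g z φ = g y (letterMap ι e ≫ φ)) →
    ∃ f : R.fn.obj X ⟶ Z, ∀ y φ, wordMap i y ≫ R.fn.map φ ≫ f = g y φ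
  tensor_ext : ∀ {X Y : F} {Z : Gr C} (f g : R.fn.obj X ⊗ R.fn.obj Y ⟶ Z),
    (∀ y (φ : wordObj ι y ⟶ X) z (ψ : wordObj ι z ⟶ Y),
      ((wordMap i y ≫ R.fn.map φ) ⊗ₘ (wordMap i z ≫ R.fn.map ψ)) ≫ f =
        ((wordMap i y ≫ R.fn.map φ) ⊗ₘ (wordMap i z ≫ R.fn.map ψ)) ≫ g) → f = g
  exists_lift : ∀ (S : GrOp F C) (g : M ⟶ ι ⋙ S.fn), ∃ f : GrOp.Hom R S,
    ∀ v, i.app v ≫ f.trans.app (ι.obj v) = g.app v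

/-- Monoidality propagates agreement from letters to words, and naturality propagates it to the
terms over an arbitrary object. -/
lemma IsFreeOp.op_hom_ext {M : V ⥤ Gr C} {R : GrOp F C} {i : M ⟶ ι ⋙ R.fn} (hi : IsFreeOp i)
    {S : GrOp F C} (f g : GrOp.Hom R S)
    (h : ∀ v, i.app v ≫ f.trans.app (ι.obj v) = i.app v ≫ g.trans.app (ι.obj v)) : f = g := by
  obtain ⟨f⟩ := f
  obtain ⟨g⟩ := g
  have key : f = g := by
    ext X : 2
    refine hi.hom_ext _ _ fun y φ => ?_
    have h' : i ≫ Functor.whiskerLeft ι f = i ≫ Functor.whiskerLeft ι g := by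
      ext v : 2
      exact h v
    have h₁ := (wordMap_comp i f y).symm.trans
      ((congrArg (fun t => wordMap t y) h').trans (wordMap_comp i g y))
    rw [f.naturality, g.naturality, reassoc_of% h₁]
  subst key
  rfl

variable [∀ X : F, HasColimitsOfShape (WordOver ι X) C]
  [∀ (X : F) (A : C), PreservesColimitsOfShape (WordOver ι X) (tensorLeft A)]

theorem exists_isFreeOp (hF : IsFeynmanCategory.{w} ι) (M : V ⥤ Gr C) :
    ∃ (R : GrOp F C) (i : M ⟶ ι ⋙ R.fn), IsFreeOp i := by
  let := freeBraided M hF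
  -- The inclusion of the term of `y` is the product of the inclusions of its letters. This rewrites
  -- the colimit description through `wordMap`, in a form that is meaningful for any op with a map
  -- from `M`.
  have h₁ (y : FreeSym V) : wordMap (freeIncl ι M) y = freeInj M y (𝟙 (wordObj ι y)) := by
    induction y with
    | of v => rfl
    | unit => rfl
    | tensor a b ha hb =>
        refine (congrArg₂ (fun s t => (s ⊗ₘ t) ≫ freeMul M _ _) ha hb).trans ?_
        refine (freeInj_tensor_freeMul M a (𝟙 _) b (𝟙 _)).trans ?_
        exact congrArg (freeInj M (.tensor a b)) (id_tensorHom_id _ _)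
  have h₂ {X : F} (y : FreeSym V) (φ : wordObj ι y ⟶ X) :
      wordMap (freeIncl ι M) y ≫ freeMap M φ = freeInj M y φ := by
    rw [h₁, freeInj_freeMap, id_comp]
  have h₃ {X : F} (y : FreeSym V) (φ : wordObj ι y ⟶ X) {Z : Gr C} (f : freeObj ι M X ⟶ Z) :
      wordMap (freeIncl ι M) y ≫ freeMap M φ ≫ f = freeInj M y φ ≫ f := by
    rw [← assoc, h₂]
  refine ⟨{ fn := freeFun ι M }, freeIncl ι M, ⟨fun f g h => ?_, fun g hg => ?_, fun f g h => ?_,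
    fun S g => ?_⟩⟩
  · refine free_hom_ext fun y φ => ?_
    rw [← h₃, ← h₃]
    exact h y φ
  · exact ⟨freeDesc M g hg, fun y φ => (h₃ y φ _).trans (freeInj_freeDesc M g hg y φ)⟩
  · refine free_tensor_ext fun y φ z ψ => ?_
    rw [← h₂, ← h₂]
    exact h y φ z ψ
  · exact ⟨{ trans := freeLift g
             monoidal :=
              { unit := freeUnit_freeLift g
                tensor := freeMul_freeLift g } }, freeIncl_freeLift g⟩

end
end

section
/-! ### Calculus of homogeneous maps -/

namespace Gr
variable {C : Type uC} [Category.{vC} C] [MonoidalCategory C] [GradedTarget C]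

/-- The isomorphism of the unit with the degree zero component of the graded unit. -/
def unitZero (C : Type uC) [Category.{vC} C] [MonoidalCategory C] [GradedTarget C] :
    𝟙_ C ⟶ (𝟙_ (Gr C)).deg 0 :=
  (GradedObject.Monoidal.tensorUnit₀ (I := ℤ) (C := C)).inv

lemma leftUnitor_inv_app (X : Gr C) (n : ℤ) : app (λ_ X).inv n =
    (λ_ (X.deg n)).inv ≫ unitZero C ▷ X.deg n ≫ ι (𝟙_ (Gr C)) X 0 n n (zero_add n) :=
  GradedObject.Monoidal.leftUnitor_inv_apply (C := C) (I := ℤ) X n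

lemma rightUnitor_inv_app (X : Gr C) (n : ℤ) : app (ρ_ X).inv n =
    (ρ_ (X.deg n)).inv ≫ X.deg n ◁ unitZero C ≫ ι X (𝟙_ (Gr C)) n 0 n (add_zero n) :=
  GradedObject.Monoidal.rightUnitor_inv_apply (C := C) (I := ℤ) X n

lemma ι_tensorHom_assoc {X X' Y Y' : Gr C} (f : X ⟶ X') (g : Y ⟶ Y')
    (i j n : ℤ) (h : i + j = n) {A : C} (k : (X' ⊗ Y').deg n ⟶ A) :
    ι X Y i j n h ≫ app (f ⊗ₘ g) n ≫ k = (app f i ⊗ₘ app g j) ≫ ι X' Y' i j n h ≫ k := by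
  rw [← assoc, ι_tensorHom, assoc]

/-- The shift of a graded object. -/
def shift (n : ℤ) (X : Gr C) : Gr C := fun p => X.deg (p + n)

end Gr

namespace DegHom
open Gr

section
variable {C : Type uC} [Category.{vC} C] {X Y Z W : Gr C} {m n l : ℤ}

@[simp] lemma mk_app (s : ∀ p q : ℤ, p + n = q → (X.deg p ⟶ Y.deg q)) (p q : ℤ) (h : p + n = q) :
    (mk s : DegHom n X Y).app p q h = s p q h := rfl

@[simp] lemma pre_app (f : X ⟶ Y) (s : DegHom n Y Z) (p q : ℤ) (h : p + n = q) :
    (pre f s).app p q h = Gr.app f p ≫ s.app p q h := rfl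

@[simp] lemma post_app (s : DegHom n X Y) (f : Y ⟶ Z) (p q : ℤ) (h : p + n = q) :
    (post s f).app p q h = s.app p q h ≫ Gr.app f q := rfl

@[simp] lemma ofEq_app (e : m = n) (s : DegHom m X Y) (p q : ℤ) (h : p + n = q) :
    (ofEq e s).app p q h = s.app p q (by omega) := rfl

lemma comp_app (e : m + n = l) (s : DegHom m X Y) (t : DegHom n Y Z) (p r q : ℤ) (h : p + l = q)
    (h₁ : p + m = r) : (comp e s t).app p q h = s.app p r h₁ ≫ t.app r q (by omega) := by
  subst h₁
  rfl

@[simp] lemma ofHom_app (f : X ⟶ Y) (p : ℤ) (h : p + 0 = p) :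
    (ofHom f).app p p h = Gr.app f p := comp_id _

lemma pre_pre (f : X ⟶ Y) (g : Y ⟶ Z) (s : DegHom n Z W) : pre f (pre g s) = pre (f ≫ g) s := by
  ext; simp

lemma post_post (s : DegHom n X Y) (f : Y ⟶ Z) (g : Z ⟶ W) :
    post (post s f) g = post s (f ≫ g) := by ext; simp

lemma pre_post (f : X ⟶ Y) (s : DegHom n Y Z) (g : Z ⟶ W) :
    pre f (post s g) = post (pre f s) g := by ext; simp

@[simp] lemma pre_id (s : DegHom n X Y) : pre (𝟙 X) s = s := by ext; simp

@[simp] lemma post_id (s : DegHom n X Y) : post s (𝟙 Y) = s := by ext; simp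

lemma ofEq_pre (e : m = n) (f : X ⟶ Y) (s : DegHom m Y Z) :
    ofEq e (pre f s) = pre f (ofEq e s) := rfl

lemma ofEq_post (e : m = n) (s : DegHom m X Y) (f : Y ⟶ Z) :
    ofEq e (post s f) = post (ofEq e s) f := rfl

@[simp] lemma ofEq_rfl (e : m = m) (s : DegHom m X Y) : ofEq e s = s := rfl

lemma comp_pre (e : m + n = l) (f : X ⟶ Y) (s : DegHom m Y Z) (t : DegHom n Z W) :
    comp e (pre f s) t = pre f (comp e s t) := by
  ext p q h; simp [comp]

lemma comp_post (e : m + n = l) (s : DegHom m X Y) (t : DegHom n Y Z) (f : Z ⟶ W) :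
    comp e s (post t f) = post (comp e s t) f := by
  ext p q h; simp [comp]

lemma post_comp (e : m + n = l) (s : DegHom m X Y) (f : Y ⟶ Z) (t : DegHom n Z W) :
    comp e (post s f) t = comp e s (pre f t) := by
  ext p q h; simp [comp]

lemma ofHom_comp (e : 0 + n = l) (f : X ⟶ Y) (t : DegHom n Y Z) :
    comp e (ofHom f) t = ofEq (by omega) (pre f t) := by
  ext p q h
  rw [comp_app e _ _ p p q h (by omega), ofHom_app]
  rfl

lemma comp_ofHom (e : n + 0 = l) (t : DegHom n X Y) (f : Y ⟶ Z) :
    comp e t (ofHom f) = ofEq (by omega) (post t f) := by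
  ext p q h
  rw [comp_app e _ _ p q q h (by omega), ofHom_app]
  rfl

lemma pre_ofHom (f : X ⟶ Y) (g : Y ⟶ Z) : pre f (ofHom g) = ofHom (f ≫ g) := by
  ext p q h
  obtain rfl : p = q := by omega
  simp

lemma post_ofHom (f : X ⟶ Y) (g : Y ⟶ Z) : post (ofHom f) g = ofHom (f ≫ g) := by
  ext p q h
  obtain rfl : p = q := by omega
  simp

/-- A homogeneous map as a morphism to a shift. -/
def toShift (s : DegHom n X Y) : X ⟶ shift n Y := fun p => s.app p (p + n) rfl

/-- A morphism to a shift as a homogeneous map. -/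
def ofShift (f : X ⟶ shift n Y) : DegHom n X Y :=
  mk fun p _ h => (f p : X.deg p ⟶ Y.deg (p + n)) ≫ eqToHom (congrArg Y.deg h)

lemma ofShift_toShift (s : DegHom n X Y) : ofShift (toShift s) = s := by
  ext p q h
  subst h
  exact comp_id _

lemma toShift_ofShift (f : X ⟶ shift n Y) : toShift (ofShift f) = f := by
  ext p
  exact comp_id _

lemma toShift_injective {s t : DegHom n X Y} (h : toShift s = toShift t) : s = t := by
  rw [← ofShift_toShift s, h, ofShift_toShift]

lemma comp_toShift (f : X ⟶ Y) (s : DegHom n Y Z) : f ≫ toShift s = toShift (pre f s) := rfl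

end

section
variable {C : Type uC} [Category.{vC} C] [Preadditive C] {X Y Z W : Gr C} {m n l : ℤ}

@[simp] lemma zero_app (p q : ℤ) (h : p + n = q) : (0 : DegHom n X Y).app p q h = 0 := rfl
@[simp] lemma add_app (s t : DegHom n X Y) (p q : ℤ) (h : p + n = q) :
    (s + t).app p q h = s.app p q h + t.app p q h := rfl
@[simp] lemma neg_app (s : DegHom n X Y) (p q : ℤ) (h : p + n = q) :
    (-s).app p q h = -s.app p q h := rfl
@[simp] lemma units_smul_app (a : ℤˣ) (s : DegHom n X Y) (p q : ℤ) (h : p + n = q) :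
    (a • s).app p q h = a • s.app p q h := rfl
@[simp] lemma smul_app {k : Type u} [Ring k] [Linear k C] (a : k) (s : DegHom n X Y) (p q : ℤ)
    (h : p + n = q) : (a • s).app p q h = a • s.app p q h := rfl

section
variable {k : Type u} [CommRing k] [Linear k C]

/-- Precomposition as a linear map. -/
def preₗ (k : Type u) [CommRing k] [Linear k C] (n : ℤ) (Z : Gr C) (f : X ⟶ Y) :
    DegHom n Y Z →ₗ[k] DegHom n X Z where
  toFun := pre f
  map_add' s t := by ext; simp
  map_smul' a s := by ext; simp

/-- Postcomposition as a linear map. -/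
def postₗ (k : Type u) [CommRing k] [Linear k C] (n : ℤ) (X : Gr C) (f : Y ⟶ Z) :
    DegHom n X Y →ₗ[k] DegHom n X Z where
  toFun s := post s f
  map_add' s t := by ext; simp
  map_smul' a s := by ext; simp

/-- Composition as a bilinear map. -/
def compₗ (k : Type u) [CommRing k] [Linear k C] (e : m + n = l) :
    DegHom m X Y →ₗ[k] DegHom n Y Z →ₗ[k] DegHom l X Z :=
  LinearMap.mk₂ k (comp e) (fun _ _ _ => by ext; simp [comp]) (fun _ _ _ => by ext; simp [comp])
    (fun _ _ _ => by ext; simp [comp]) (fun _ _ _ => by ext; simp [comp])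

end

lemma pre_add (f : X ⟶ Y) (s t : DegHom n Y Z) : pre f (s + t) = pre f s + pre f t := by
  ext; simp
@[simp] lemma pre_zero (f : X ⟶ Y) : pre f (0 : DegHom n Y Z) = 0 := by ext; simp
lemma pre_neg (f : X ⟶ Y) (s : DegHom n Y Z) : pre f (-s) = -pre f s := by ext; simp
lemma pre_units_smul (f : X ⟶ Y) (a : ℤˣ) (s : DegHom n Y Z) : pre f (a • s) = a • pre f s := by
  ext; simp [Linear.comp_units_smul]
lemma post_add (s t : DegHom n X Y) (f : Y ⟶ Z) : post (s + t) f = post s f + post t f := by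
  ext; simp
@[simp] lemma zero_post (f : Y ⟶ Z) : post (0 : DegHom n X Y) f = 0 := by ext; simp
lemma neg_post (s : DegHom n X Y) (f : Y ⟶ Z) : post (-s) f = -post s f := by ext; simp
lemma units_smul_post (a : ℤˣ) (s : DegHom n X Y) (f : Y ⟶ Z) :
    post (a • s) f = a • post s f := by
  ext; simp [Linear.units_smul_comp]
lemma comp_add (e : m + n = l) (s : DegHom m X Y) (t t' : DegHom n Y Z) :
    comp e s (t + t') = comp e s t + comp e s t' := by ext; simp [comp]
lemma add_comp (e : m + n = l) (s s' : DegHom m X Y) (t : DegHom n Y Z) :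
    comp e (s + s') t = comp e s t + comp e s' t := by ext; simp [comp]
lemma neg_comp (e : m + n = l) (s : DegHom m X Y) (t : DegHom n Y Z) :
    comp e (-s) t = -comp e s t := by ext; simp [comp]
@[simp] lemma zero_comp (e : m + n = l) (t : DegHom n Y Z) :
    comp e (0 : DegHom m X Y) t = 0 := by ext; simp [comp]
@[simp] lemma comp_zero (e : m + n = l) (s : DegHom m X Y) :
    comp e s (0 : DegHom n Y Z) = 0 := by ext; simp [comp]
lemma ofEq_units_smul (e : m = n) (a : ℤˣ) (s : DegHom m X Y) : ofEq e (a • s) = a • ofEq e s :=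
  rfl

end

section
variable {C : Type uC} [Category.{vC} C] [MonoidalCategory C] [GradedTarget C] [Preadditive C]
variable {X X' X'' Y Y' Y'' Z Z' : Gr C} {m n l : ℤ}

lemma ι_tensor (e : m + n = l) (s : DegHom m X X') (t : DegHom n Y Y') (i j p i' j' q : ℤ)
    (hij : i + j = p) (hpq : p + l = q) (hi : i + m = i') (hj : j + n = j') :
    ι X Y i j p hij ≫ (tensor e s t).app p q hpq =
      (n * i).negOnePow • (s.app i i' hi ⊗ₘ t.app j j' hj) ≫ ι X' Y' i' j' q (by omega) := by
  subst hi hj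
  exact Gr.ι_desc (X := X) (Y := Y) (fun i j hij => (n * i).negOnePow •
    (s.app i (i + m) rfl ⊗ₘ t.app j (j + n) rfl) ≫ ι X' Y' (i + m) (j + n) q (by omega)) i j hij

lemma ι_tensor_assoc (e : m + n = l) (s : DegHom m X X') (t : DegHom n Y Y') (i j p i' j' q : ℤ)
    (hij : i + j = p) (hpq : p + l = q) (hi : i + m = i') (hj : j + n = j') {A : C}
    (f : (X' ⊗ Y').deg q ⟶ A) :
    ι X Y i j p hij ≫ (tensor e s t).app p q hpq ≫ f =
      (n * i).negOnePow • (s.app i i' hi ⊗ₘ t.app j j' hj) ≫ ι X' Y' i' j' q (by omega) ≫ f := by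
  rw [← assoc, ι_tensor e s t i j p i' j' q hij hpq hi hj, Linear.units_smul_comp, assoc]

lemma tensor_ext {s t : DegHom n (X ⊗ Y) Z}
    (h : ∀ (i j p q : ℤ) (hij : i + j = p) (hpq : p + n = q),
      ι X Y i j p hij ≫ s.app p q hpq = ι X Y i j p hij ≫ t.app p q hpq) : s = t := by
  ext p q hpq
  exact Gr.tensor_ext _ _ fun i j hij => h i j p q hij hpq

lemma pre_tensor (e : m + n = l) (f : X ⟶ X') (g : Y ⟶ Y') (s : DegHom m X' X'')
    (t : DegHom n Y' Y'') : pre (f ⊗ₘ g) (tensor e s t) = tensor e (pre f s) (pre g t) := by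
  refine tensor_ext fun i j p q hij hpq => ?_
  rw [pre_app, ι_tensorHom_assoc, ι_tensor e s t i j p _ _ q hij hpq rfl rfl,
    ι_tensor e _ _ i j p _ _ q hij hpq rfl rfl, Linear.comp_units_smul,
    MonoidalCategory.tensorHom_comp_tensorHom_assoc, pre_app, pre_app]

lemma tensor_post (e : m + n = l) (s : DegHom m X X') (t : DegHom n Y Y') (f : X' ⟶ X'')
    (g : Y' ⟶ Y'') : post (tensor e s t) (f ⊗ₘ g) = tensor e (post s f) (post t g) := by
  refine tensor_ext fun i j p q hij hpq => ?_
  rw [post_app, ι_tensor_assoc e s t i j p _ _ q hij hpq rfl rfl,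
    ι_tensor e _ _ i j p _ _ q hij hpq rfl rfl, ι_tensorHom,
    MonoidalCategory.tensorHom_comp_tensorHom_assoc, post_app, post_app]

lemma tensor_ofHom (e : (0 : ℤ) + 0 = 0) (f : X ⟶ X') (g : Y ⟶ Y') :
    tensor e (ofHom f) (ofHom g) = ofHom (f ⊗ₘ g) := by
  refine tensor_ext fun i j p q hij hpq => ?_
  obtain rfl : p = q := by omega
  rw [ι_tensor e _ _ i j p i j p hij hpq (by omega) (by omega), ofHom_app, ofHom_app, ofHom_app,
    ι_tensorHom, zero_mul, Int.negOnePow_zero, one_smul]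

lemma tensor_ofEq {m' n' : ℤ} (e : m' + n' = l) (h : m = m') (h' : n = n') (s : DegHom m X X')
    (t : DegHom n Y Y') : tensor e (ofEq h s) (ofEq h' t) = tensor (by omega) s t := by
  subst h h'
  rfl

lemma unit_left (e : (0 : ℤ) + n = n) (s : DegHom n X Y) :
    pre (λ_ X).inv (tensor e (ofHom (𝟙 (𝟙_ (Gr C)))) s) = post s (λ_ Y).inv := by
  ext p q h
  rw [pre_app, post_app, leftUnitor_inv_app, leftUnitor_inv_app, assoc, assoc,
    ι_tensor e _ s 0 p p 0 q q (by omega) h (by omega) h, mul_zero, Int.negOnePow_zero, one_smul,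
    ofHom_app, id_app, id_tensorHom, leftUnitor_inv_naturality_assoc, whisker_exchange_assoc]

lemma unit_right (e : n + (0 : ℤ) = n) (s : DegHom n X Y) :
    pre (ρ_ X).inv (tensor e s (ofHom (𝟙 (𝟙_ (Gr C))))) = post s (ρ_ Y).inv := by
  ext p q h
  rw [pre_app, post_app, rightUnitor_inv_app, rightUnitor_inv_app, assoc, assoc,
    ι_tensor e s _ p 0 p q 0 q (by omega) h h (by omega), zero_mul, Int.negOnePow_zero, one_smul,
    ofHom_app, id_app, tensorHom_id, rightUnitor_inv_naturality_assoc, whisker_exchange_assoc]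

lemma units_smul_tensorHom [MonoidalPreadditive C] {A B A' B' : C} (a : ℤˣ) (f : A ⟶ B)
    (g : A' ⟶ B') : (a • f) ⊗ₘ g = a • (f ⊗ₘ g) := by
  rw [MonoidalCategory.tensorHom_def, MonoidalCategory.tensorHom_def, units_smul_whiskerRight,
    Linear.units_smul_comp]

lemma tensorHom_units_smul [MonoidalPreadditive C] {A B A' B' : C} (a : ℤˣ) (f : A ⟶ B)
    (g : A' ⟶ B') : f ⊗ₘ (a • g) = a • (f ⊗ₘ g) := by
  rw [MonoidalCategory.tensorHom_def, MonoidalCategory.tensorHom_def, whiskerLeft_units_smul,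
    Linear.comp_units_smul]

/-- The Koszul sign arises because `g'`, of degree `b'`, is moved past `f`, of degree `a`. -/
lemma comp_tensor {a b a' b' ab ab' aa bb t : ℤ} (h₁ : a + b = ab) (h₂ : a' + b' = ab')
    (h₃ : ab + ab' = t) (h₄ : a + a' = aa) (h₅ : b + b' = bb) (h₆ : aa + bb = t)
    (f : DegHom a X X') (g : DegHom b Y Y') (f' : DegHom a' X' X'') (g' : DegHom b' Y' Y'') :
    comp h₃ (tensor h₁ f g) (tensor h₂ f' g') =
      (a * b').negOnePow • tensor h₆ (comp h₄ f f') (comp h₅ g g') := by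
  refine tensor_ext fun i j p q hij hpq => ?_
  rw [comp_app h₃ _ _ p (p + ab) q hpq rfl, units_smul_app,
    ι_tensor_assoc h₁ f g i j p (i + a) (j + b) (p + ab) hij rfl rfl rfl, Linear.comp_units_smul,
    ι_tensor h₂ f' g' (i + a) (j + b) (p + ab) (i + aa) (j + bb) q (by omega) (by omega)
      (by omega) (by omega),
    ι_tensor h₆ _ _ i j p (i + aa) (j + bb) q hij hpq rfl rfl,
    comp_app h₄ _ _ i (i + a) (i + aa) rfl rfl, comp_app h₅ _ _ j (j + b) (j + bb) rfl rfl,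
    Linear.comp_units_smul, smul_smul, smul_smul,
    MonoidalCategory.tensorHom_comp_tensorHom_assoc, ← Int.negOnePow_add, ← Int.negOnePow_add]
  congr 2
  subst h₅
  ring

section
variable [MonoidalPreadditive C]

lemma tensor_add (e : m + n = l) (s : DegHom m X X') (t t' : DegHom n Y Y') :
    tensor e s (t + t') = tensor e s t + tensor e s t' := by
  refine tensor_ext fun i j p q hij hpq => ?_
  simp only [add_app, Preadditive.comp_add, ι_tensor e _ _ i j p _ _ q hij hpq rfl rfl,
    MonoidalPreadditive.tensor_add, Preadditive.add_comp, smul_add]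

lemma add_tensor (e : m + n = l) (s s' : DegHom m X X') (t : DegHom n Y Y') :
    tensor e (s + s') t = tensor e s t + tensor e s' t := by
  refine tensor_ext fun i j p q hij hpq => ?_
  simp only [add_app, Preadditive.comp_add, ι_tensor e _ _ i j p _ _ q hij hpq rfl rfl,
    MonoidalPreadditive.add_tensor, Preadditive.add_comp, smul_add]

lemma tensor_units_smul (e : m + n = l) (s : DegHom m X X') (a : ℤˣ) (t : DegHom n Y Y') :
    tensor e s (a • t) = a • tensor e s t := by
  refine tensor_ext fun i j p q hij hpq => ?_
  simp only [units_smul_app, ι_tensor e _ _ i j p _ _ q hij hpq rfl rfl, Linear.comp_units_smul,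
    tensorHom_units_smul, Linear.units_smul_comp]
  rw [smul_comm]

lemma units_smul_tensor (e : m + n = l) (a : ℤˣ) (s : DegHom m X X') (t : DegHom n Y Y') :
    tensor e (a • s) t = a • tensor e s t := by
  refine tensor_ext fun i j p q hij hpq => ?_
  simp only [units_smul_app, ι_tensor e _ _ i j p _ _ q hij hpq rfl rfl, Linear.comp_units_smul,
    units_smul_tensorHom, Linear.units_smul_comp]
  rw [smul_comm]

@[simp] lemma tensor_zero (e : m + n = l) (s : DegHom m X X') :
    tensor e s (0 : DegHom n Y Y') = 0 := by
  have := tensor_add e s (0 : DegHom n Y Y') 0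
  rw [add_zero] at this
  exact (add_eq_left.1 this.symm)

@[simp] lemma zero_tensor (e : m + n = l) (t : DegHom n Y Y') :
    tensor e (0 : DegHom m X X') t = 0 := by
  have := add_tensor e (0 : DegHom m X X') 0 t
  rw [add_zero] at this
  exact (add_eq_left.1 this.symm)

/-- The tensor product of homogeneous maps as a bilinear map. -/
def tensorₗ (k : Type u) [CommRing k] [Linear k C] [MonoidalLinear k C] (e : m + n = l) :
    DegHom m X X' →ₗ[k] DegHom n Y Y' →ₗ[k] DegHom l (X ⊗ Y) (X' ⊗ Y') :=
  LinearMap.mk₂ k (tensor e) (add_tensor e)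
    (fun a s t => by
      refine tensor_ext fun i j p q hij hpq => ?_
      simp only [smul_app, ι_tensor e _ _ i j p _ _ q hij hpq rfl rfl, Linear.comp_smul,
        MonoidalCategory.tensorHom_def, MonoidalLinear.smul_whiskerRight, Linear.smul_comp]
      rw [smul_comm])
    (tensor_add e)
    (fun a s t => by
      refine tensor_ext fun i j p q hij hpq => ?_
      simp only [smul_app, ι_tensor e _ _ i j p _ _ q hij hpq rfl rfl, Linear.comp_smul,
        MonoidalCategory.tensorHom_def, MonoidalLinear.whiskerLeft_smul, Linear.smul_comp]
      rw [smul_comm])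

lemma associator_tensor {a b c ab bc abc : ℤ} (h₁ : a + b = ab) (h₂ : ab + c = abc)
    (h₃ : b + c = bc) (h₄ : a + bc = abc) (s : DegHom a X X') (t : DegHom b Y Y')
    (r : DegHom c Z Z') : pre (α_ X Y Z).hom (tensor h₄ s (tensor h₃ t r)) =
      post (tensor h₂ (tensor h₁ s t) r) (α_ X' Y' Z').hom := by
  ext p q h
  refine Gr.tensor₃_ext _ _ fun i j k hp => ?_
  rw [pre_app, post_app, ι_assoc_hom_assoc X Y Z i j k _ (j + k) p rfl rfl hp (by omega),
    ι_tensor h₄ _ _ i (j + k) p (i + a) (j + k + bc) q (by omega) h rfl rfl,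
    ι_tensor_assoc h₂ _ _ (i + j) k p (i + j + ab) (k + c) q hp h rfl rfl]
  simp only [Linear.comp_units_smul]
  rw [← id_tensorHom, MonoidalCategory.tensorHom_comp_tensorHom_assoc, id_comp,
    ι_tensor h₃ _ _ j k (j + k) (j + b) (k + c) (j + k + bc) rfl rfl rfl rfl,
    ← tensorHom_id, MonoidalCategory.tensorHom_comp_tensorHom_assoc, id_comp,
    ι_tensor h₁ _ _ i j (i + j) (i + a) (j + b) (i + j + ab) rfl rfl rfl rfl,
    tensorHom_units_smul, units_smul_tensorHom, Linear.units_smul_comp, Linear.units_smul_comp,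
    Linear.comp_units_smul, smul_smul, smul_smul, ← Int.negOnePow_add, ← Int.negOnePow_add]
  have h₇ : bc * i + c * j = c * (i + j) + b * i := by subst h₃; ring
  rw [h₇]
  congr 1
  have h₅ : (s.app i (i + a) rfl ⊗ₘ ((t.app j (j + b) rfl ⊗ₘ r.app k (k + c) rfl) ≫
      ι Y' Z' (j + b) (k + c) (j + k + bc) (by omega))) =
    (s.app i (i + a) rfl ⊗ₘ (t.app j (j + b) rfl ⊗ₘ r.app k (k + c) rfl)) ≫
      X'.deg (i + a) ◁ ι Y' Z' (j + b) (k + c) (j + k + bc) (by omega) := by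
    rw [← id_tensorHom, MonoidalCategory.tensorHom_comp_tensorHom, comp_id]
  have h₆ : (((s.app i (i + a) rfl ⊗ₘ t.app j (j + b) rfl) ≫
      ι X' Y' (i + a) (j + b) (i + j + ab) (by omega)) ⊗ₘ r.app k (k + c) rfl) =
    ((s.app i (i + a) rfl ⊗ₘ t.app j (j + b) rfl) ⊗ₘ r.app k (k + c) rfl) ≫
      ι X' Y' (i + a) (j + b) (i + j + ab) (by omega) ▷ Z'.deg (k + c) := by
    rw [← tensorHom_id, MonoidalCategory.tensorHom_comp_tensorHom, comp_id]
  rw [h₅, h₆, assoc, assoc, ι_assoc_hom X' Y' Z' (i + a) (j + b) (k + c) _ (j + k + bc) q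
    (by omega) (by omega) (by omega) (by omega), associator_naturality_assoc]

variable [SymmetricCategory C]

lemma braiding_tensor (e : m + n = l) (e' : n + m = l) (s : DegHom m X X') (t : DegHom n Y Y') :
    pre (β_ X Y).hom (tensor e' t s) =
      (m * n).negOnePow • post (tensor e s t) (β_ X' Y').hom := by
  refine tensor_ext fun i j p q hij hpq => ?_
  rw [units_smul_app, pre_app, post_app, Linear.comp_units_smul,
    ι_tensor_assoc e _ _ i j p (i + m) (j + n) q hij hpq rfl rfl]
  refine (ι_braidHom_assoc X Y i j p hij _).trans ?_
  rw [ι_tensor e' _ _ j i p (j + n) (i + m) q (by omega) hpq rfl rfl]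
  have := ι_braidHom X' Y' (i + m) (j + n) q (by omega)
  refine Eq.trans ?_ (congrArg (fun z => (m * n).negOnePow • (n * i).negOnePow •
    (s.app i (i + m) rfl ⊗ₘ t.app j (j + n) rfl) ≫ z) this).symm
  rw [Linear.comp_units_smul, Linear.comp_units_smul,
    BraidedCategory.braiding_naturality_assoc, smul_smul, smul_smul, smul_smul,
    ← Int.negOnePow_add, ← Int.negOnePow_add, ← Int.negOnePow_add]
  congr 1
  -- After expansion of the sign `(i + m)(j + n)` of the braiding on the target, the two exponents
  -- differ by an even number.
  rw [show m * n + n * i + (i + m) * (j + n) = i * j + m * j + 2 * (m * n + n * i) by ring,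
    Int.negOnePow_add (i * j + m * j), Int.negOnePow_two_mul, mul_one]

end

/-! ### Commuting squares of homogeneous maps and the exchange of tensor factors -/

section
variable {C : Type uC} [Category.{vC} C] {X X' Y Y' Z Z' W W' : Gr C} {n : ℤ}

lemma inv_square {f : X ⟶ Y} {g : Y ⟶ X} {f' : X' ⟶ Y'} {g' : Y' ⟶ X'} (h : g ≫ f = 𝟙 Y)
    (h' : f' ≫ g' = 𝟙 X') {s : DegHom n Y Y'} {t : DegHom n X X'} (e : pre f s = post t f') :
    pre g t = post s g' := by
  rw [← pre_id s, ← h, ← pre_pre, e, pre_post, post_post, h', post_id]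

lemma comp_square {f : X ⟶ Y} {g : Y ⟶ Z} {f' : X' ⟶ Y'} {g' : Y' ⟶ Z'} {r : DegHom n X X'}
    {s : DegHom n Y Y'} {t : DegHom n Z Z'} (h₁ : pre f s = post r f') (h₂ : pre g t = post s g') :
    pre (f ≫ g) t = post r (f' ≫ g') := by
  rw [← pre_pre, h₂, pre_post, h₁, post_post]

end

section
variable {m l : ℤ} [MonoidalPreadditive C]

lemma whiskerLeft_square (e : m + n = l) {f : X ⟶ Y} {f' : X' ⟶ Y'} {s : DegHom n Y Y'}
    {t : DegHom n X X'} (h : pre f s = post t f') (r : DegHom m Z Z') :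
    pre (Z ◁ f) (tensor e r s) = post (tensor e r t) (Z' ◁ f') := by
  rw [← id_tensorHom, ← id_tensorHom, pre_tensor, tensor_post, h, pre_id, post_id]

lemma pre_whiskerLeft_tensor (e : m + n = l) (f : X ⟶ Y) (s : DegHom n Y Y')
    (r : DegHom m Z Z') : pre (Z ◁ f) (tensor e r s) = tensor e r (pre f s) := by
  rw [← id_tensorHom, pre_tensor, pre_id]

lemma pre_whiskerRight_tensor (e : m + n = l) (f : X ⟶ Y) (s : DegHom m Y Y')
    (r : DegHom n Z Z') : pre (f ▷ Z) (tensor e s r) = tensor e (pre f s) r := by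
  rw [← tensorHom_id, pre_tensor, pre_id]

lemma tensor_post_whiskerLeft (e : m + n = l) (s : DegHom n Y Y') (f : Y' ⟶ X)
    (r : DegHom m Z Z') : post (tensor e r s) (Z' ◁ f) = tensor e r (post s f) := by
  rw [← id_tensorHom, tensor_post, post_id]

lemma tensor_post_whiskerRight (e : m + n = l) (s : DegHom m Y Y') (f : Y' ⟶ X)
    (r : DegHom n Z Z') : post (tensor e s r) (f ▷ Z') = tensor e (post s f) r := by
  rw [← tensorHom_id, tensor_post, post_id]

lemma unit_left_hom (e : (0 : ℤ) + n = n) (s : DegHom n X Y) :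
    pre (λ_ X).hom s = post (tensor e (ofHom (𝟙 (𝟙_ (Gr C)))) s) (λ_ Y).hom :=
  inv_square (by simp) (by simp) (unit_left e s)

lemma unit_right_hom (e : n + (0 : ℤ) = n) (s : DegHom n X Y) :
    pre (ρ_ X).hom s = post (tensor e s (ofHom (𝟙 (𝟙_ (Gr C))))) (ρ_ Y).hom :=
  inv_square (by simp) (by simp) (unit_right e s)

lemma associator_inv_tensor {a b c ab bc abc : ℤ} (h₁ : a + b = ab) (h₂ : ab + c = abc)
    (h₃ : b + c = bc) (h₄ : a + bc = abc) (s : DegHom a X X') (t : DegHom b Y Y')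
    (r : DegHom c Z Z') : pre (α_ X Y Z).inv (tensor h₂ (tensor h₁ s t) r) =
      post (tensor h₄ s (tensor h₃ t r)) (α_ X' Y' Z').inv :=
  inv_square (by simp) (by simp) (associator_tensor h₁ h₂ h₃ h₄ s t r)

variable [SymmetricCategory C]

/-- The exchange of the middle factors of a tensor product of four homogeneous maps. -/
theorem tensorμ_tensor {W W' : Gr C} {a b c d ab cd ac bd t : ℤ} (h₁ : a + b = ab)
    (h₂ : c + d = cd) (h₃ : a + c = ac) (h₄ : b + d = bd) (h₅ : ab + cd = t) (h₆ : ac + bd = t)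
    (r : DegHom a X X') (s : DegHom b Y Y') (u : DegHom c Z Z') (v : DegHom d W W') :
    pre (tensorμ X Y Z W) (tensor h₆ (tensor h₃ r u) (tensor h₄ s v)) =
      (b * c).negOnePow • post (tensor h₅ (tensor h₁ r s) (tensor h₂ u v))
        (tensorμ X' Y' Z' W') := by
  have k₁ := associator_tensor h₁ h₅ (bc := b + cd) rfl (by omega) r s (tensor h₂ u v)
  have k₂ := whiskerLeft_square (l := t) (m := a) (by omega) (associator_inv_tensor
    (bc := cd) (abc := b + cd) (ab := b + c) rfl (by omega) h₂ rfl s u v) r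
  -- Reassociation produces no sign. The interchange of the two middle factors, of degrees `b` and
  -- `c`, is the only source of one.
  have k₃ : pre ((β_ Y Z).hom ▷ W) (tensor (l := b + cd) (by omega)
      (tensor (add_comm c b) u s) v) = (b * c).negOnePow •
        post (tensor (l := b + cd) (by omega) (tensor (l := b + c) rfl s u) v) ((β_ Y' Z').hom ▷ W') := by
    rw [pre_whiskerRight_tensor, braiding_tensor rfl, tensor_post_whiskerRight,
      units_smul_tensor]
  have k₃' : pre (X ◁ (β_ Y Z).hom ▷ W) (tensor (l := t) (by omega) r (tensor (l := b + cd)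
      (by omega) (tensor (add_comm c b) u s) v)) = (b * c).negOnePow •
        post (tensor (l := t) (by omega) r (tensor (l := b + cd) (by omega)
            (tensor (l := b + c) rfl s u) v))
          (X' ◁ (β_ Y' Z').hom ▷ W') := by
    rw [pre_whiskerLeft_tensor, k₃, tensor_post_whiskerLeft, tensor_units_smul]
  have k₄ := whiskerLeft_square (l := t) (m := a) (by omega) (associator_tensor
    (bc := bd) (abc := b + cd) (ab := b + c) (add_comm c b) (by omega) h₄ (by omega) u s v) r
  have k₅ := associator_inv_tensor h₃ h₆ (bc := b + cd) (by omega) (by omega) r u (tensor h₄ s v)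
  unfold tensorμ
  rw [← pre_pre, ← pre_pre, ← pre_pre, ← pre_pre, k₅, pre_post, k₄, post_post, pre_post, k₃',
    units_smul_post, pre_units_smul, pre_units_smul, post_post, pre_post, k₂, pre_post, pre_post,
    k₁, post_post, post_post]

end

end
end DegHom

/-- The exchange already interchanges the middle factors, so the block swap followed by the exchange
contains a swap and its inverse, which cancel by symmetry. It is used for the symmetry of pointwise
products. -/
lemma tensorμ_braiding {D : Type uC} [Category.{vC} D] [MonoidalCategory D] [SymmetricCategory D]
    (X₁ X₂ Y₁ Y₂ : D) : tensorμ X₁ X₂ Y₁ Y₂ ≫ ((β_ X₁ Y₁).hom ⊗ₘ (β_ X₂ Y₂).hom) =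
      (β_ (X₁ ⊗ X₂) (Y₁ ⊗ Y₂)).hom ≫ tensorμ Y₁ Y₂ X₁ X₂ := by
  have h : Y₁ ◁ (β_ X₁ Y₂).hom ▷ X₂ ≫ Y₁ ◁ (β_ Y₂ X₁).hom ▷ X₂ = 𝟙 _ := by
    rw [← whiskerLeft_comp, ← comp_whiskerRight, SymmetricCategory.symmetry]
    simp
  simp [tensorμ, SymmetricCategory.braiding_swap_eq_inv_braiding Y₁ X₂,
    MonoidalCategory.tensorHom_def, reassoc_of% h]

lemma tensorμ_braiding_assoc {D : Type uC} [Category.{vC} D] [MonoidalCategory D]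
    [SymmetricCategory D] (X₁ X₂ Y₁ Y₂ : D) {Z : D} (f : (Y₁ ⊗ X₁) ⊗ (Y₂ ⊗ X₂) ⟶ Z) :
    (β_ (X₁ ⊗ X₂) (Y₁ ⊗ Y₂)).hom ≫ tensorμ Y₁ Y₂ X₁ X₂ ≫ f =
      tensorμ X₁ X₂ Y₁ Y₂ ≫ ((β_ X₁ Y₁).hom ⊗ₘ (β_ X₂ Y₂).hom) ≫ f := by
  rw [← assoc, ← tensorμ_braiding, assoc]
end

section
/-! ### Derivations on free ops -/

section
variable {V : Type uV} [Groupoid.{vV} V] {F : Type uF} [Category.{vF} F] [MonoidalCategory F]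
  [SymmetricCategory F] {ι : V ⥤ F}
variable {C : Type uC} [Category.{vC} C] [MonoidalCategory C] [GradedTarget C]
  [SymmetricCategory C] [Preadditive C] [MonoidalPreadditive C]

section leibniz
open DegHom
open Functor.LaxMonoidal (μ)

variable {F : Type uF} [Category.{vF} F] [MonoidalCategory F]
variable (S : F ⥤ Gr C) [S.LaxMonoidal] {n : ℤ} {X Y Z X' Y' : F} {A B E A' B' : Gr C}

/-- The product rule: the value of a derivation on a product, from its values on the factors. -/
def leibniz (a : A ⟶ S.obj X) (s : DegHom n A (S.obj X)) (b : B ⟶ S.obj Y)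
    (t : DegHom n B (S.obj Y)) : DegHom n (A ⊗ B) (S.obj (X ⊗ Y)) :=
  post (tensor (add_zero n) s (ofHom b) + tensor (zero_add n) (ofHom a) t) (μ S X Y)

variable {S}

/-- The product rule respects tensor products of morphisms, the associator, the unitors and the
braiding. These statements are the constructor cases of `derWord_interp`. -/
lemma leibniz_tensor {a : A ⟶ S.obj X} {s : DegHom n A (S.obj X)} {b : B ⟶ S.obj Y}
    {t : DegHom n B (S.obj Y)} {a' : A' ⟶ S.obj X'} {s' : DegHom n A' (S.obj X')}
    {b' : B' ⟶ S.obj Y'} {t' : DegHom n B' (S.obj Y')} {p : A ⟶ A'} {q : B ⟶ B'} {f : X ⟶ X'}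
    {g : Y ⟶ Y'} (ha : p ≫ a' = a ≫ S.map f) (hs : pre p s' = post s (S.map f))
    (hb : q ≫ b' = b ≫ S.map g) (ht : pre q t' = post t (S.map g)) :
    pre (p ⊗ₘ q) (leibniz S a' s' b' t') = post (leibniz S a s b t) (S.map (f ⊗ₘ g)) := by
  unfold leibniz
  rw [pre_post, pre_add, pre_tensor, pre_tensor, pre_ofHom, pre_ofHom, ha, hb, hs, ht, post_post,
    ← Functor.LaxMonoidal.μ_natural, ← post_post, post_add _ _ (S.map f ⊗ₘ S.map g), tensor_post, tensor_post, post_ofHom,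
    post_ofHom, post_add]

lemma pre_leibniz (a : A ⟶ S.obj X) (s : DegHom n A (S.obj X)) (b : B ⟶ S.obj Y)
    (t : DegHom n B (S.obj Y)) (p : A' ⟶ A) (q : B' ⟶ B) :
    pre (p ⊗ₘ q) (leibniz S a s b t) = leibniz S (p ≫ a) (pre p s) (q ≫ b) (pre q t) := by
  unfold leibniz
  rw [pre_post, pre_add, pre_tensor, pre_tensor, pre_ofHom, pre_ofHom]

lemma leibniz_split (a : A ⟶ S.obj X) (s : DegHom n A (S.obj X)) (b : B ⟶ S.obj Y)
    (t : DegHom n B (S.obj Y)) : leibniz S a s b t = leibniz S a s b 0 + leibniz S a 0 b t := by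
  unfold leibniz
  rw [tensor_zero, zero_tensor, add_zero, zero_add, post_add]

lemma leibniz_associator (a : A ⟶ S.obj X) (s : DegHom n A (S.obj X)) (b : B ⟶ S.obj Y)
    (t : DegHom n B (S.obj Y)) (c : E ⟶ S.obj Z) (r : DegHom n E (S.obj Z)) :
    pre (α_ A B E).hom (leibniz S a s ((b ⊗ₘ c) ≫ μ S Y Z) (leibniz S b t c r)) =
      post (leibniz S ((a ⊗ₘ b) ≫ μ S X Y) (leibniz S a s b t) c r) (S.map (α_ X Y Z).hom) := by
  unfold leibniz
  rw [← post_ofHom, ← tensor_ofHom (add_zero 0), ← tensor_post_whiskerLeft,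
    ← tensor_post_whiskerLeft, ← post_add, post_post, pre_post, pre_add,
    associator_tensor (add_zero n) (add_zero n), tensor_add, pre_add,
    associator_tensor (zero_add n) (add_zero n), associator_tensor (zero_add 0) (zero_add n),
    ← post_ofHom, ← tensor_ofHom (add_zero 0), ← tensor_post_whiskerRight,
    ← tensor_post_whiskerRight, ← post_add (f := μ S X Y ▷ S.obj Z), post_post, post_post,
    ← post_add, ← post_add, post_post,
    Functor.LaxMonoidal.associativity, add_tensor, add_assoc]

lemma leibniz_left (a : A ⟶ S.obj X) (s : DegHom n A (S.obj X)) :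
    pre (λ_ A).hom s = post (leibniz S (Functor.LaxMonoidal.ε S) 0 a s) (S.map (λ_ X).hom) := by
  unfold leibniz
  rw [zero_tensor, zero_add, ← id_comp (Functor.LaxMonoidal.ε S), ← post_ofHom,
    ← tensor_post_whiskerRight, post_post, post_post,
    ← Functor.LaxMonoidal.left_unitality, unit_left_hom]

lemma leibniz_right (a : A ⟶ S.obj X) (s : DegHom n A (S.obj X)) :
    pre (ρ_ A).hom s = post (leibniz S a s (Functor.LaxMonoidal.ε S) 0) (S.map (ρ_ X).hom) := by
  unfold leibniz
  rw [tensor_zero, add_zero, ← id_comp (Functor.LaxMonoidal.ε S), ← post_ofHom,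
    ← tensor_post_whiskerLeft, post_post, post_post,
    ← Functor.LaxMonoidal.right_unitality, unit_right_hom]

/-- Derivations vanish on the unit. -/
lemma pre_ε_eq_zero (d : ∀ X, DegHom n (S.obj X) (S.obj X))
    (h₁ : pre (S.map (λ_ (𝟙_ F)).hom) (d (𝟙_ F)) =
      post (d (𝟙_ F ⊗ 𝟙_ F)) (S.map (λ_ (𝟙_ F)).hom))
    (h₂ : pre (μ S (𝟙_ F) (𝟙_ F)) (d (𝟙_ F ⊗ 𝟙_ F)) =
      leibniz S (𝟙 _) (d (𝟙_ F)) (𝟙 _) (d (𝟙_ F))) :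
    pre (Functor.LaxMonoidal.ε S) (d (𝟙_ F)) = 0 := by
  set e := Functor.LaxMonoidal.ε S
  set z := pre e (d (𝟙_ F)) with hz
  have k₁ : (e ⊗ₘ e) ≫ μ S _ _ ≫ S.map (λ_ (𝟙_ F)).hom = (λ_ _).hom ≫ e := by
    rw [MonoidalCategory.tensorHom_def', assoc, ← Functor.LaxMonoidal.left_unitality,
      leftUnitor_naturality]
  -- With `z = d(1)`, the product rule for `1 · 1 = 1` reads `z = z + z`.
  have k₂ : pre (λ_ (𝟙_ (Gr C))).hom z = pre (λ_ _).hom z + pre (λ_ _).hom z := by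
    conv_lhs => rw [hz, pre_pre, ← k₁, ← pre_pre, ← pre_pre, h₁, pre_post, h₂, pre_post,
      pre_leibniz, comp_id]
    have k₃ := leibniz_left (S := S) e z
    have k₄ := leibniz_right (S := S) e z
    rw [← unitors_equal, ← unitors_equal] at k₄
    rw [← hz, leibniz_split, post_add, ← k₃, ← k₄]
  have k₃ := congrArg (pre (λ_ (𝟙_ (Gr C))).inv) k₂
  rw [pre_add, pre_pre, Iso.inv_hom_id, pre_id] at k₃
  exact (left_eq_add.1 k₃)

variable [SymmetricCategory F]

lemma leibniz_braid {S : F ⥤ Gr C} [S.Braided] (a : A ⟶ S.obj X) (s : DegHom n A (S.obj X))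
    (b : B ⟶ S.obj Y) (t : DegHom n B (S.obj Y)) :
    pre (β_ A B).hom (leibniz S b t a s) = post (leibniz S a s b t) (S.map (β_ X Y).hom) := by
  unfold leibniz
  rw [pre_post, pre_add, braiding_tensor (zero_add n), braiding_tensor (add_zero n), zero_mul,
    mul_zero, Int.negOnePow_zero, one_smul, one_smul, ← post_add, post_post, post_post,
    Functor.LaxBraided.braided, add_comm]

end leibniz

open DegHom

/-- A family of homogeneous maps `R(X) ⟶ S(X)` that is natural and a derivation along `f`. -/
structure IsDerivation {R S : F ⥤ Gr C} [R.LaxMonoidal] [S.LaxMonoidal] (f : R ⟶ S) {n : ℤ}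
    (d : ∀ X, DegHom n (R.obj X) (S.obj X)) : Prop where
  natural : ∀ {X Y : F} (φ : X ⟶ Y), pre (R.map φ) (d Y) = post (d X) (S.map φ)
  unit : pre (Functor.LaxMonoidal.ε R) (d (𝟙_ F)) = 0
  tensor : ∀ X Y : F, pre (Functor.LaxMonoidal.μ R X Y) (d (X ⊗ Y)) =
    leibniz S (f.app X) (d X) (f.app Y) (d Y)

/-! ### Extension of derivations from letters to words -/

section
variable {M : V ⥤ Gr C} {S : F ⥤ Gr C} [S.Braided] (g : M ⟶ ι ⋙ S) {n : ℤ}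
  (δ : ∀ v : V, DegHom n (M.obj v) (S.obj (ι.obj v)))

/-- The extension of a family of homogeneous maps on generators to words, as a derivation. -/
def derWord : ∀ w : FreeSym V, DegHom n (wordObj M w) (S.obj (wordObj ι w))
  | .of v => δ v
  | .unit => 0
  | .tensor a b => leibniz S (wordMap g a) (derWord a) (wordMap g b) (derWord b)

variable {δ}

lemma derWord_interp (hδ : ∀ {v u : V} (τ : v ⟶ u),
      pre (M.map τ) (δ u) = post (δ v) (S.map (ι.map τ))) {x y : FreeSym V}
    (e : FreeSym.PreHom x y) : pre (FreeSym.interp M e) (derWord g δ y) =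
      post (derWord g δ x) (S.map (FreeSym.interp ι e)) := by
  -- A square with isomorphisms on both sides may be inverted, so each inverse coherence isomorphism
  -- is reduced to its forward version.
  have inv {X Y : F} {A B : Gr C} {s : DegHom n A (S.obj X)} {t : DegHom n B (S.obj Y)}
      (i : A ≅ B) (j : X ≅ Y) (h : pre i.hom t = post s (S.map j.hom)) :
      pre i.inv s = post t (S.map j.inv) :=
    inv_square i.inv_hom_id (by rw [← S.map_comp, j.hom_inv_id, S.map_id]) h
  induction e with
  | of f => exact hδ f
  | id x => exact (pre_id _).trans (by rw [FreeSym.interp, S.map_id, post_id])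
  | comp e e' h h' =>
      refine (comp_square h h').trans ?_
      rw [← S.map_comp]
      rfl
  | tensor e e' h h' => exact leibniz_tensor (wordMap_interp g e) h (wordMap_interp g e') h'
  | assocHom x y z => exact leibniz_associator _ _ _ _ _ _
  | assocInv x y z => exact inv (α_ _ _ _) (α_ _ _ _) (leibniz_associator _ _ _ _ _ _)
  | leftHom x => exact leibniz_left _ _
  | leftInv x => exact inv (λ_ _) (λ_ _) (leibniz_left _ _)
  | rightHom x => exact leibniz_right _ _
  | rightInv x => exact inv (ρ_ _) (ρ_ _) (leibniz_right _ _)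
  | braid x y => exact leibniz_braid _ _ _ _

lemma derWord_naturality (hδ : ∀ {v u : V} (τ : v ⟶ u),
      pre (M.map τ) (δ u) = post (δ v) (S.map (ι.map τ))) {x y : FreeSym V}
    (e : x ⟶ y) : pre (letterMap M e) (derWord g δ y) =
      post (derWord g δ x) (S.map (letterMap ι e)) := by
  obtain ⟨e, rfl⟩ := FreeSym.exists_mor e
  exact derWord_interp g hδ e

end

/-- The product rule determines a derivation on a word from its letters; the values of `f` on the
remaining letters enter through `wordMap`. -/
lemma IsDerivation.pre_wordMap {M : V ⥤ Gr C} {R S : GrOp F C} (i : M ⟶ ι ⋙ R.fn)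
    (f : GrOp.Hom R S) {n : ℤ} {d : ∀ X, DegHom n (R.fn.obj X) (S.fn.obj X)}
    (hd : IsDerivation f.trans d) (y : FreeSym V) : pre (wordMap i y) (d (wordObj ι y)) =
      derWord (i ≫ Functor.whiskerLeft ι f.trans) (fun v => pre (i.app v) (d (ι.obj v))) y := by
  have := f.monoidal
  induction y with
  | of v => rfl
  | unit => exact hd.unit
  | tensor a b ha hb =>
      rw [wordMap, ← pre_pre, hd.tensor, pre_leibniz, ha, hb, derWord, wordMap_comp, wordMap_comp]

/-! ### Derivations out of a free op -/

namespace IsFreeOp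
variable {M : V ⥤ Gr C} {R : GrOp F C} {i : M ⟶ ι ⋙ R.fn} (hi : IsFreeOp i)
include hi

/-- A map of degree `n` is a morphism to a shift of the target, so the universal property of the
colimit applies to homogeneous maps as well. -/
lemma degHom_ext {n : ℤ} {X : F} {Z : Gr C} {s t : DegHom n (R.fn.obj X) Z}
    (h : ∀ y (φ : wordObj ι y ⟶ X), pre (wordMap i y) (pre (R.fn.map φ) s) =
      pre (wordMap i y) (pre (R.fn.map φ) t)) : s = t :=
  toShift_injective (hi.hom_ext _ _ fun y φ => by
    rw [comp_toShift, comp_toShift, comp_toShift, comp_toShift, h])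

lemma degHom_tensor_ext {n : ℤ} {X Y : F} {Z : Gr C} {s t : DegHom n (R.fn.obj X ⊗ R.fn.obj Y) Z}
    (h : ∀ y (φ : wordObj ι y ⟶ X) z (ψ : wordObj ι z ⟶ Y),
      pre ((wordMap i y ≫ R.fn.map φ) ⊗ₘ (wordMap i z ≫ R.fn.map ψ)) s =
        pre ((wordMap i y ≫ R.fn.map φ) ⊗ₘ (wordMap i z ≫ R.fn.map ψ)) t) : s = t :=
  toShift_injective (hi.tensor_ext _ _ fun y φ z ψ => by
    rw [comp_toShift, comp_toShift, h])

/-- For `f` the identity this serves to prove that the differential of the Feynman transform squares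
to zero. For general `f` it reduces the commutation of `f` with differentials to generators. -/
theorem derivation_ext {S : GrOp F C} {f : GrOp.Hom R S} {n : ℤ}
    {d d' : ∀ X, DegHom n (R.fn.obj X) (S.fn.obj X)}
    (hd : IsDerivation f.trans d) (hd' : IsDerivation f.trans d')
    (h : ∀ v, pre (i.app v) (d (ι.obj v)) = pre (i.app v) (d' (ι.obj v))) (X : F) :
    d X = d' X := by
  refine hi.degHom_ext fun y φ => ?_
  rw [hd.natural, hd'.natural, pre_post, pre_post, hd.pre_wordMap i f, hd'.pre_wordMap i f]
  congr 3
  exact funext h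

/-- The product rule defines the derivation on words. Compatibility of `δ` with `V` extends to all
morphisms of words, and this is the condition for the values to descend to the colimit. The product
rule for general objects is then checked on pairs of terms. -/
theorem exists_derivation {n : ℤ} (δ : ∀ v : V, DegHom n (M.obj v) (R.fn.obj (ι.obj v)))
    (hδ : ∀ {v u : V} (τ : v ⟶ u), pre (M.map τ) (δ u) = post (δ v) (R.fn.map (ι.map τ))) :
    ∃ d : ∀ X, DegHom n (R.fn.obj X) (R.fn.obj X), IsDerivation (𝟙 R.fn) d ∧
      ∀ v, pre (i.app v) (d (ι.obj v)) = δ v := by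
  have key (X : F) := hi.exists_desc (X := X) (Z := Gr.shift n (R.fn.obj X))
    (fun y φ => toShift (post (derWord i δ y) (R.fn.map φ))) (fun e φ => by
      rw [comp_toShift, pre_post, derWord_naturality i hδ, post_post, ← R.fn.map_comp])
  choose D hD using key
  have hD' {X : F} (y) (φ : wordObj ι y ⟶ X) : pre (wordMap i y) (pre (R.fn.map φ)
      (ofShift (D X))) = post (derWord i δ y) (R.fn.map φ) := by
    apply toShift_injective
    rw [← comp_toShift, ← comp_toShift, toShift_ofShift, hD]
  have hw (y) : pre (wordMap i y) (ofShift (D (wordObj ι y))) = derWord i δ y := by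
    have := hD' y (𝟙 _)
    rwa [R.fn.map_id, pre_id, post_id] at this
  refine ⟨fun X => ofShift (D X), ⟨fun {X Y} φ => ?_, ?_, fun X Y => ?_⟩, fun v => hw (.of v)⟩
  · refine hi.degHom_ext fun y ψ => ?_
    rw [pre_pre (R.fn.map ψ), ← R.fn.map_comp, hD', pre_post, pre_post, hD', post_post,
      ← R.fn.map_comp]
  · exact hw .unit
  · refine hi.degHom_tensor_ext fun y φ z ψ => ?_
    have h₁ : ((wordMap i y ≫ R.fn.map φ) ⊗ₘ (wordMap i z ≫ R.fn.map ψ)) ≫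
        Functor.LaxMonoidal.μ R.fn X Y = wordMap i (.tensor y z) ≫ R.fn.map (φ ⊗ₘ ψ) := by
      rw [wordMap, assoc, ← Functor.LaxMonoidal.μ_natural,
        MonoidalCategory.tensorHom_comp_tensorHom_assoc]
    have h₂ := hD' (.tensor y z) (φ ⊗ₘ ψ)
    rw [pre_pre, h₁, ← pre_pre, h₂, pre_leibniz, ← pre_pre, ← pre_pre, hD', hD', derWord]
    have := leibniz_tensor (S := R.fn) (a := wordMap i y) (s := derWord i δ y) (b := wordMap i z)
      (t := derWord i δ z) (a' := wordMap i y ≫ R.fn.map φ)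
      (s' := post (derWord i δ y) (R.fn.map φ)) (b' := wordMap i z ≫ R.fn.map ψ)
      (t' := post (derWord i δ z) (R.fn.map ψ)) (p := 𝟙 _) (q := 𝟙 _) (f := φ) (g := ψ)
      (id_comp _) (pre_id _) (id_comp _) (pre_id _)
    rw [id_tensorHom_id, pre_id] at this
    rw [NatTrans.id_app, NatTrans.id_app, comp_id, comp_id, this]

end IsFreeOp
end
end

section
/-! ### Duality for homogeneous maps -/

namespace DegHom
variable {C : Type uC} [Category.{vC} C] [MonoidalCategory C] [GradedTarget C] [Preadditive C]
  [MonoidalPreadditive C]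

section
variable {A Z Z' : Gr C} [HasRightDual A] {n : ℤ}

/-- The element of `A ⊗ Z` that corresponds to a homogeneous map from the dual of `A` to `Z`. -/
def twist (s : DegHom n Aᘁ Z) : DegHom n (𝟙_ (Gr C)) (A ⊗ Z) :=
  pre (η_ A Aᘁ) (whiskerLeft A s)

/-- The homogeneous map from the dual of `A` that corresponds to an element of `A ⊗ Z`. -/
def untwist (t : DegHom n (𝟙_ (Gr C)) (A ⊗ Z)) : DegHom n Aᘁ Z :=
  post (pre (ρ_ Aᘁ).inv (whiskerLeft Aᘁ t)) ((α_ Aᘁ A Z).inv ≫ ε_ A Aᘁ ▷ Z ≫ (λ_ Z).hom)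

lemma tensor_ofHom_left {m l : ℤ} (e : 0 + m = l) {X Y : Gr C} (f : X ⟶ Y) (s : DegHom m A Z) :
    tensor e (ofHom f) s = post (tensor e (ofHom (𝟙 X)) s) (f ▷ Z) := by
  rw [tensor_post_whiskerRight, post_ofHom, id_comp]

/-- One of the two triangle identities of the duality, and `twist_untwist` is the other one.
Evaluation and coevaluation have degree zero, so no Koszul signs occur. -/
lemma untwist_twist (s : DegHom n Aᘁ Z) : untwist (twist s) = s := by
  have h₁ := associator_inv_tensor (zero_add 0) (zero_add n) (zero_add n) (zero_add n)
    (ofHom (𝟙 Aᘁ)) (ofHom (𝟙 A)) s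
  unfold untwist twist whiskerLeft
  rw [← pre_whiskerLeft_tensor, pre_pre, ← post_post, ← pre_post, ← h₁, pre_pre,
    tensor_ofHom (zero_add 0), ← post_post, ← pre_post, tensor_post_whiskerRight, post_ofHom,
    id_tensorHom_id, id_comp]
  conv_lhs => rw [← comp_id (ε_ A Aᘁ), ← pre_ofHom, ← pre_whiskerRight_tensor,
    ← pre_post, ← pre_post, ← unit_left_hom, pre_pre, pre_pre]
  have h₂ := ExactPairing.coevaluation_evaluation A Aᘁ
  convert pre_id s using 2
  simp only [assoc]
  rw [reassoc_of% h₂]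
  simp

lemma zigzag : (λ_ (A ⊗ Z)).inv ≫ η_ A Aᘁ ▷ (A ⊗ Z) ≫ (α_ A Aᘁ (A ⊗ Z)).hom ≫
    A ◁ ((α_ Aᘁ A Z).inv ≫ ε_ A Aᘁ ▷ Z ≫ (λ_ Z).hom) = 𝟙 (A ⊗ Z) := by
  have h := congrArg (· ▷ Z) (ExactPairing.evaluation_coevaluation A Aᘁ)
  simp only [comp_whiskerRight] at h
  rw [whiskerLeft_comp, whiskerLeft_comp]
  have h₂ : (α_ A Aᘁ (A ⊗ Z)).hom ≫ A ◁ (α_ Aᘁ A Z).inv =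
      (α_ (A ⊗ Aᘁ) A Z).inv ≫ (α_ A Aᘁ A).hom ▷ Z ≫ (α_ A (Aᘁ ⊗ A) Z).hom := by
    simp
  rw [reassoc_of% h₂, associator_inv_naturality_left_assoc]
  have h₃ : (α_ A (Aᘁ ⊗ A) Z).hom ≫ A ◁ ε_ A Aᘁ ▷ Z = (A ◁ ε_ A Aᘁ) ▷ Z ≫ (α_ _ _ _).hom := by
    simp
  rw [reassoc_of% h₃, reassoc_of% h]
  simp

lemma twist_untwist (t : DegHom n (𝟙_ (Gr C)) (A ⊗ Z)) : twist (untwist t) = t := by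
  have h₁ := associator_tensor (zero_add 0) (zero_add n) (zero_add n) (zero_add n)
    (ofHom (𝟙 A)) (ofHom (𝟙 Aᘁ)) t
  have h₂ : tensor (zero_add n) (ofHom (𝟙 A)) (tensor (zero_add n) (ofHom (𝟙 Aᘁ)) t) =
      pre (α_ _ _ _).inv (post (tensor (zero_add n) (tensor (zero_add 0) (ofHom (𝟙 A))
        (ofHom (𝟙 Aᘁ))) t) (α_ _ _ _).hom) := by
    rw [← h₁, pre_pre, Iso.inv_hom_id, pre_id]
  have h₃ : η_ A Aᘁ ≫ A ◁ (ρ_ Aᘁ).inv ≫ (α_ A Aᘁ (𝟙_ _)).inv = (λ_ (𝟙_ (Gr C))).inv ≫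
      η_ A Aᘁ ▷ 𝟙_ (Gr C) := by
    rw [whiskerLeft_rightUnitor_inv, assoc, Iso.hom_inv_id, comp_id, rightUnitor_inv_naturality,
      unitors_inv_equal]
  unfold untwist twist whiskerLeft
  rw [← tensor_post_whiskerLeft, ← pre_whiskerLeft_tensor, h₂, pre_post, pre_pre, pre_post,
    pre_post, pre_pre, assoc, h₃, tensor_ofHom, id_tensorHom_id, ← pre_pre, pre_whiskerRight_tensor,
    pre_ofHom, comp_id, tensor_ofHom_left, pre_post, unit_left, post_post, post_post, post_post]
  rw [zigzag, post_id]

lemma twist_injective : Function.Injective (twist (A := A) (Z := Z) (n := n)) :=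
  Function.LeftInverse.injective untwist_twist

/-- Precomposition with a dual map on one side of the coevaluation is postcomposition with the map
itself on the other side. -/
lemma twist_pre {B : Gr C} [HasRightDual B] (f : A ⟶ B) (s : DegHom n Aᘁ Z) :
    twist (pre (fᘁ) s) = post (twist s) (f ▷ Z) := by
  unfold twist whiskerLeft
  rw [← pre_whiskerLeft_tensor, pre_pre, coevaluation_comp_rightAdjointMate, ← pre_pre,
    ← pre_post, tensor_post_whiskerRight, post_ofHom, id_comp, pre_whiskerRight_tensor, pre_ofHom,
    comp_id]

lemma twist_post (s : DegHom n Aᘁ Z) (f : Z ⟶ Z') : twist (post s f) = post (twist s) (A ◁ f) := by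
  unfold twist whiskerLeft
  rw [← tensor_post_whiskerLeft, pre_post]

lemma twist_pre_left {B : Gr C} (f : Aᘁ ⟶ B) (s : DegHom n B Z) :
    twist (pre f s) = pre (η_ A Aᘁ ≫ A ◁ f) (whiskerLeft A s) := by
  unfold twist whiskerLeft
  rw [← pre_whiskerLeft_tensor, pre_pre]

/-- The characterisation of transposes. -/
lemma twist_transpose {B B' : Gr C} (coev : 𝟙_ (Gr C) ⟶ B ⊗ B') (t : DegHom n B A) :
    twist (transpose coev (ε_ A Aᘁ) t) = pre coev (whiskerRight t B') := by
  rw [← twist_untwist (pre coev (whiskerRight t B'))]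
  congr 1
  unfold transpose untwist whiskerLeft
  rw [← pre_whiskerLeft_tensor, pre_pre]

end

section
variable {A Z : Gr C} [HasRightDual A] {n : ℤ}

/-- `twist` as a linear map. -/
def twistₗ {k : Type u} [CommRing k] [Linear k C] [MonoidalLinear k C] :
    DegHom n Aᘁ Z →ₗ[k] DegHom n (𝟙_ (Gr C)) (A ⊗ Z) :=
  preₗ k n _ (η_ A Aᘁ) ∘ₗ tensorₗ k (zero_add n) (ofHom (𝟙 A))

lemma twist_add (s t : DegHom n Aᘁ Z) : twist (s + t) = twist s + twist t := by
  unfold twist whiskerLeft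
  rw [tensor_add, pre_add]

lemma twist_zero : twist (0 : DegHom n Aᘁ Z) = 0 := by
  unfold twist whiskerLeft
  rw [tensor_zero, pre_zero]

end
end DegHom

/-! ### The odd op structure of a pointwise tensor product -/

section
variable {V : Type uV} [Groupoid.{vV} V] {F : Type uF} [Category.{vF} F] [MonoidalCategory F]
  [SymmetricCategory F] {ι : V ⥤ F} {Φ : OddVersion ι}
variable {C : Type uC} [Category.{vC} C] [MonoidalCategory C] [GradedTarget C]
  [SymmetricCategory C] [Preadditive C] [MonoidalPreadditive C]
open DegHom
open Functor.LaxMonoidal (μ)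

/-- The axioms of an odd op, without the condition that the differential squares to zero. -/
structure OddOpData.IsOdd (Q : OddOpData Φ C) : Prop where
  braided : ∀ X Y : Core F, μ Q.core X Y ≫ Q.core.map (β_ X Y).hom =
    (β_ (Q.core.obj X) (Q.core.obj Y)).hom ≫ μ Q.core Y X
  act_iso : ∀ {X Y : F} (σ : X ≅ Y), Q.act σ.hom =
    ofEq (by rw [Φ.deg_iso]; rfl) (ofHom (Q.core.map (⟨σ⟩ : (⟨X⟩ : Core F) ⟶ ⟨Y⟩)))
  act_comp : ∀ {X Y Z : F} (f : X ⟶ Y) (g : Y ⟶ Z),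
    comp (by rw [Φ.deg_comp, Nat.cast_add]) (Q.act f) (Q.act g) = Φ.ε f g • Q.act (f ≫ g)
  act_tensor : ∀ {X Y X' Y' : F} (f : X ⟶ Y) (g : X' ⟶ Y'),
    post (tensor (by rw [Φ.deg_tensor, Nat.cast_add]) (Q.act f) (Q.act g))
      (μ Q.core ⟨Y⟩ ⟨Y'⟩) = Φ.η f g • pre (μ Q.core ⟨X⟩ ⟨X'⟩) (Q.act (f ⊗ₘ g))
  d_act : ∀ {X Y : F} (f : X ⟶ Y),
    comp (l := Φ.deg f + 1) rfl (Q.act f) (Q.d Y) =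
      (-1 : ℤˣ) ^ Φ.deg f • comp (l := Φ.deg f + 1) (add_comm _ _) (Q.d X) (Q.act f)
  d_tensor : ∀ X Y : F, pre (μ Q.core ⟨X⟩ ⟨Y⟩) (Q.d (X ⊗ Y)) =
    post (tensorD (Q.d X) (Q.d Y)) (μ Q.core ⟨X⟩ ⟨Y⟩)

lemma OddOp.isOdd (P : OddOp Φ C) : P.IsOdd where
  braided := P.braided
  act_iso σ := by
    ext p q h
    exact P.act_iso σ p q _ h
  act_comp := P.act_comp
  act_tensor := P.act_tensor
  d_act := P.d_act
  d_tensor := P.d_tensor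

/-- The pointwise tensor product of an odd op and a graded op with a family of homogeneous maps
of degree one. -/
def hadamardD (P : OddOp Φ C) (R : GrOp F C) (d : ∀ X, DegHom 1 (R.fn.obj X) (R.fn.obj X)) :
    OddOpData Φ C where
  core := hadamardCore P.toOddOpData R
  act f := DegHom.tensor (add_zero _) (P.act f) (DegHom.ofHom (R.fn.map f))
  d X := DegHom.tensorD (P.d X) (d X)

section
variable (P : OddOpData Φ C) (R : GrOp F C)

lemma hadamardCore_μ (X Y : F) : μ (hadamardCore P R) ⟨X⟩ ⟨Y⟩ =
    tensorμ (P.val X) (R.fn.obj X) (P.val Y) (R.fn.obj Y) ≫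
      (μ P.core ⟨X⟩ ⟨Y⟩ ⊗ₘ μ R.fn X Y) := by
  have : μ (Core.inclusion F ⋙ R.fn) (⟨X⟩ : Core F) ⟨Y⟩ = μ R.fn X Y :=
    (congrArg (μ R.fn X Y ≫ ·) (R.fn.map_id _)).trans (comp_id _)
  rw [← this]
  exact congrArg (tensorμ (P.val X) (R.fn.obj X) (P.val Y) (R.fn.obj Y) ≫ ·)
    (congrArg₂ (· ⊗ₘ ·) (Functor.prod'_μ_fst P.core (Core.inclusion F ⋙ R.fn) _ _)
      (Functor.prod'_μ_snd P.core (Core.inclusion F ⋙ R.fn) _ _))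

lemma hadamardCore_ε : Functor.LaxMonoidal.ε (hadamardCore P R) = (λ_ (𝟙_ (Gr C))).inv ≫
      (Functor.LaxMonoidal.ε P.core ⊗ₘ Functor.LaxMonoidal.ε R.fn) := by
  have : Functor.LaxMonoidal.ε (Core.inclusion F ⋙ R.fn) = Functor.LaxMonoidal.ε R.fn :=
    (congrArg (Functor.LaxMonoidal.ε R.fn ≫ ·) (R.fn.map_id _)).trans (comp_id _)
  rw [← this]
  exact congrArg ((λ_ (𝟙_ (Gr C))).inv ≫ ·)
    (congrArg₂ (· ⊗ₘ ·) (Functor.prod'_ε_fst P.core (Core.inclusion F ⋙ R.fn))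
      (Functor.prod'_ε_snd P.core (Core.inclusion F ⋙ R.fn)))

end

section
variable {A A' B B' AA BB K K' L L' KK LL : Gr C}

/-- Each axiom for a pointwise product follows from the axiom for its two factors by an exchange of
the middle tensor factors. The following lemmas isolate this, free of functors. -/
lemma braid_product {m : A ⊗ A' ⟶ AA} {m' : A' ⊗ A ⟶ BB} {b : AA ⟶ BB}
    (h : m ≫ b = (β_ A A').hom ≫ m') {n : K ⊗ K' ⟶ KK} {n' : K' ⊗ K ⟶ LL} {c : KK ⟶ LL}
    (h' : n ≫ c = (β_ K K').hom ≫ n') :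
    (tensorμ A K A' K' ≫ (m ⊗ₘ n)) ≫ (b ⊗ₘ c) =
      (β_ (A ⊗ K) (A' ⊗ K')).hom ≫ tensorμ A' K' A K ≫ (m' ⊗ₘ n') := by
  rw [tensorμ_braiding_assoc, assoc, MonoidalCategory.tensorHom_comp_tensorHom,
    MonoidalCategory.tensorHom_comp_tensorHom, h, h']

lemma act_product {a a' aa : ℤ} (e : a + a' = aa) {u : ℤˣ} {mX : A ⊗ A' ⟶ AA}
    {mY : B ⊗ B' ⟶ BB} {p : DegHom a A B} {p' : DegHom a' A' B'} {pp : DegHom aa AA BB}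
    (h : post (tensor e p p') mY = u • pre mX pp) {nX : K ⊗ K' ⟶ KK} {nY : L ⊗ L' ⟶ LL}
    {o : K ⟶ L} {o' : K' ⟶ L'} {oo : KK ⟶ LL} (h' : (o ⊗ₘ o') ≫ nY = nX ≫ oo) :
    post (tensor e (tensor (add_zero _) p (ofHom o)) (tensor (add_zero _) p' (ofHom o')))
      (tensorμ B L B' L' ≫ (mY ⊗ₘ nY)) =
      u • pre (tensorμ A K A' K' ≫ (mX ⊗ₘ nX)) (tensor (add_zero _) pp (ofHom oo)) := by
  -- The factors coming from the op have degree zero, so the exchange causes no sign and the sign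
  -- `u` of the odd op is inherited unchanged.
  have k := tensorμ_tensor (add_zero _) (add_zero _) e (add_zero 0) e (add_zero _) p (ofHom o) p'
    (ofHom o')
  rw [zero_mul, Int.negOnePow_zero, one_smul] at k
  rw [← post_post, ← k, ← pre_post, tensor_post, h, tensor_ofHom (add_zero 0), post_ofHom, h',
    units_smul_tensor, pre_units_smul, ← pre_pre, pre_tensor, pre_ofHom]

lemma d_product {m : A ⊗ A' ⟶ AA} {d : DegHom 1 A A} {d' : DegHom 1 A' A'} {dd : DegHom 1 AA AA}
    (h : pre m dd = post (tensorD d d') m) {n : K ⊗ K' ⟶ KK} {e : DegHom 1 K K}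
    {e' : DegHom 1 K' K'} {ee : DegHom 1 KK KK} (h' : pre n ee = post (tensorD e e') n) :
    pre (tensorμ A K A' K' ≫ (m ⊗ₘ n)) (tensorD dd ee) =
      post (tensorD (tensorD d e) (tensorD d' e')) (tensorμ A K A' K' ≫ (m ⊗ₘ n)) := by
  -- Identities of products are split into two factors so that the exchange applies to all four
  -- terms. In each term only one factor has degree one, so every exchange sign is trivial.
  have k (A B : Gr C) : ofHom (𝟙 (A ⊗ B)) =
      tensor (add_zero 0) (ofHom (𝟙 A)) (ofHom (𝟙 B)) := by
    rw [tensor_ofHom, id_tensorHom_id]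
  have k' : pre (m ⊗ₘ n) (tensorD dd ee) =
      post (tensorD (tensorD d d') (tensorD e e')) (m ⊗ₘ n) := by
    unfold DegHom.tensorD DegHom.whiskerLeft DegHom.whiskerRight at *
    rw [pre_add, pre_tensor, pre_tensor, h, h', pre_ofHom, pre_ofHom, comp_id, comp_id]
    conv_rhs => rw [post_add, tensor_post, tensor_post, post_ofHom, post_ofHom, id_comp, id_comp]
  rw [← pre_pre, k', pre_post, ← post_post]
  congr 1
  unfold DegHom.tensorD DegHom.whiskerLeft DegHom.whiskerRight
  rw [k, k, k, k, tensor_add, add_tensor, add_tensor, tensor_add]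
  simp only [pre_add, post_add]
  rw [tensorμ_tensor (add_zero 1) (add_zero 0) _ _ (add_zero 1) _,
    tensorμ_tensor (add_zero 0) (add_zero 1) _ _ (zero_add 1) _,
    tensorμ_tensor (zero_add 1) (add_zero 0) _ _ (add_zero 1) _,
    tensorμ_tensor (add_zero 0) (zero_add 1) _ _ (zero_add 1) _]
  simp only [mul_zero, zero_mul, Int.negOnePow_zero, one_smul]
  abel

lemma comp_product {a b ab : ℤ} (e : a + b = ab) (s : DegHom a A B) (t : DegHom b B AA)
    (f : K ⟶ L) (g : L ⟶ LL) :
    comp e (tensor (add_zero _) s (ofHom f)) (tensor (add_zero _) t (ofHom g)) =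
      tensor (add_zero _) (comp e s t) (ofHom (f ≫ g)) := by
  rw [comp_tensor (add_zero _) (add_zero _) _ e (add_zero 0) (add_zero _), mul_zero,
    Int.negOnePow_zero, one_smul, ofHom_comp, ofEq_rfl, pre_ofHom]

lemma d_act_product {n : ℕ} {p : DegHom (n : ℤ) A B} {d : DegHom 1 A A} {d' : DegHom 1 B B}
    (h : comp (l := (n : ℤ) + 1) rfl p d' =
      (-1 : ℤˣ) ^ n • comp (l := (n : ℤ) + 1) (add_comm _ _) d p) {o : K ⟶ L}
    {e : DegHom 1 K K} {e' : DegHom 1 L L} (h' : pre o e' = post e o) :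
    comp (l := (n : ℤ) + 1) rfl (tensor (add_zero _) p (ofHom o)) (tensorD d' e') =
      (-1 : ℤˣ) ^ n • comp (l := (n : ℤ) + 1) (add_comm _ _) (tensorD d e)
        (tensor (add_zero _) p (ofHom o)) := by
  unfold DegHom.tensorD DegHom.whiskerLeft DegHom.whiskerRight
  -- In the term `1 ⊗ e'` the sign is that of `e'` passing `p`; in the term `d' ⊗ 1` it is the sign
  -- of the hypothesis `h`. Both equal `(-1) ^ n`.
  have k : ((n : ℤ) * 1).negOnePow = (-1 : ℤˣ) ^ n := by
    rw [mul_one, Int.negOnePow_def, zpow_natCast]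
  rw [comp_add, add_comp,
    comp_tensor _ _ _ rfl (add_zero 0) (add_zero _),
    comp_tensor _ _ _ (add_zero _) (zero_add 1) rfl,
    comp_tensor _ _ _ (add_comm _ _) (add_zero 0) (add_zero _),
    comp_tensor _ _ _ (zero_add _) (add_zero 1) rfl, h, ofHom_comp, ofHom_comp, ofHom_comp,
    ofHom_comp, comp_ofHom, comp_ofHom, h', units_smul_tensor, smul_add, k]
  simp only [mul_zero, Int.negOnePow_zero, one_smul, ofEq_rfl, pre_ofHom, comp_id, id_comp, pre_id,
    post_id]

lemma act_iso_product {a : ℤ} (e : 0 = a) {p : DegHom a A B} {f : A ⟶ B} (h : p = ofEq e (ofHom f))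
    (g : K ⟶ L) : tensor (add_zero a) p (ofHom g) = ofEq e (ofHom (f ⊗ₘ g)) := by
  subst e h
  rw [ofEq_rfl, ofEq_rfl, tensor_ofHom]

end

/-- It suffices that `d` is a derivation. No condition on its square is imposed, so the result
applies to the free op before `d² = 0` is known. -/
theorem hadamardD_isOdd (P : OddOp Φ C) (R : GrOp F C)
    (d : ∀ X, DegHom 1 (R.fn.obj X) (R.fn.obj X)) (hd : IsDerivation (𝟙 R.fn) d) :
    (hadamardD P R d).IsOdd where
  braided X Y := by
    have := braid_product (P.braided X Y) (Functor.LaxBraided.braided (F := R.fn) X.of Y.of)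
    rw [← hadamardCore_μ, ← hadamardCore_μ] at this
    exact this
  act_iso σ := act_iso_product _ (P.isOdd.act_iso σ) (R.fn.map σ.hom)
  act_comp f g := by
    refine (comp_product _ (P.act f) (P.act g) (R.fn.map f) (R.fn.map g)).trans ?_
    rw [P.act_comp, units_smul_tensor, ← R.fn.map_comp]
    rfl
  act_tensor f g := by
    have := act_product _ (P.act_tensor f g) (Functor.LaxMonoidal.μ_natural R.fn f g)
    rw [← hadamardCore_μ, ← hadamardCore_μ] at this
    exact this
  d_act f := d_act_product (P.d_act f) (hd.natural f)
  d_tensor X Y := by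
    have h := hd.tensor X Y
    rw [NatTrans.id_app, NatTrans.id_app] at h
    have := d_product (P.d_tensor X Y) h
    rw [← hadamardCore_μ] at this
    exact this

end
end

section
/-! ### Products of elements -/

section
variable {F : Type uF} [Category.{vF} F] [MonoidalCategory F]
variable {D : Type uC} [Category.{vC} D] [MonoidalCategory D] (S : F ⥤ D)
open Functor.LaxMonoidal

section
variable [S.LaxMonoidal]

/-- The product of elements of the values of a lax monoidal functor. -/
abbrev elementMul {X Y : F} (x : 𝟙_ D ⟶ S.obj X) (y : 𝟙_ D ⟶ S.obj Y) : 𝟙_ D ⟶ S.obj (X ⊗ Y) :=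
  (λ_ (𝟙_ D)).inv ≫ (x ⊗ₘ y) ≫ μ S X Y

lemma elementMul_map {X Y X' Y' : F} {x : 𝟙_ D ⟶ S.obj X} {y : 𝟙_ D ⟶ S.obj Y}
    {x' : 𝟙_ D ⟶ S.obj X'} {y' : 𝟙_ D ⟶ S.obj Y'} {f : X ⟶ X'} {g : Y ⟶ Y'}
    (h : x ≫ S.map f = x') (h' : y ≫ S.map g = y') :
    elementMul S x y ≫ S.map (f ⊗ₘ g) = elementMul S x' y' := by
  subst h h'
  simp only [assoc, ← Functor.LaxMonoidal.μ_natural,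
    MonoidalCategory.tensorHom_comp_tensorHom_assoc]

end

variable [SymmetricCategory F] [SymmetricCategory D] [S.Braided]

lemma elementMul_assoc {X Y Z : F} (x : 𝟙_ D ⟶ S.obj X) (y : 𝟙_ D ⟶ S.obj Y) (z : 𝟙_ D ⟶ S.obj Z) :
    elementMul S (elementMul S x y) z ≫ S.map (α_ X Y Z).hom =
      elementMul S x (elementMul S y z) := by
  have h := μ_assoc_hom S x y z
  have h₁ : (λ_ (𝟙_ D)).inv ▷ 𝟙_ D ≫ (α_ _ _ _).hom = 𝟙_ D ◁ (λ_ (𝟙_ D)).inv := by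
    simp [unitors_inv_equal]
  have h₂ : elementMul S x y ⊗ₘ z =
      (λ_ (𝟙_ D)).inv ▷ 𝟙_ D ≫ (((x ⊗ₘ y) ≫ μ S X Y) ⊗ₘ z) := by
    rw [← tensorHom_id, MonoidalCategory.tensorHom_comp_tensorHom, id_comp]
  have h₃ : x ⊗ₘ elementMul S y z =
      𝟙_ D ◁ (λ_ (𝟙_ D)).inv ≫ (x ⊗ₘ ((y ⊗ₘ z) ≫ μ S Y Z)) := by
    rw [← id_tensorHom, MonoidalCategory.tensorHom_comp_tensorHom, id_comp]
  change ((λ_ _).inv ≫ (elementMul S x y ⊗ₘ z) ≫ μ S _ _) ≫ _ =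
    (λ_ _).inv ≫ (x ⊗ₘ elementMul S y z) ≫ μ S _ _
  rw [h₂, h₃, ← h₁]
  simp only [assoc] at h ⊢
  rw [h]

lemma elementMul_unit_left {X : F} (x : 𝟙_ D ⟶ S.obj X) :
    elementMul S (ε S) x ≫ S.map (λ_ X).hom = x := by
  have h := μ_left_hom S x
  simp only [assoc] at h ⊢
  rw [← h, Iso.inv_hom_id_assoc]

lemma elementMul_unit_right {X : F} (x : 𝟙_ D ⟶ S.obj X) :
    elementMul S x (ε S) ≫ S.map (ρ_ X).hom = x := by
  have h := μ_right_hom S x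
  simp only [assoc] at h ⊢
  rw [← h, unitors_inv_equal, Iso.inv_hom_id_assoc]

lemma elementMul_braid {X Y : F} (x : 𝟙_ D ⟶ S.obj X) (y : 𝟙_ D ⟶ S.obj Y) :
    elementMul S x y ≫ S.map (β_ X Y).hom = elementMul S y x := by
  have h := μ_braid S x y
  simp only [assoc] at h ⊢
  rw [← h, braiding_tensorUnit_left]
  simp [unitors_equal]

lemma comp_map_inv {X Y : F} (σ : X ≅ Y) {x : 𝟙_ D ⟶ S.obj X} {y : 𝟙_ D ⟶ S.obj Y}
    (h : x ≫ S.map σ.hom = y) : y ≫ S.map σ.inv = x := by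
  rw [← h, assoc, Iso.map_hom_inv_id, comp_id]

end

section
variable {V : Type uV} [Groupoid.{vV} V] {F : Type uF} [Category.{vF} F] [MonoidalCategory F]
  [SymmetricCategory F] {ι : V ⥤ F} {Φ : OddVersion ι}
variable {C : Type uC} [Category.{vC} C] [MonoidalCategory C] [GradedTarget C]
  [SymmetricCategory C] [Preadditive C] [MonoidalPreadditive C]
open DegHom
open Functor.LaxMonoidal (μ ε)

namespace OddOpData.IsOdd
variable {Q : OddOpData Φ C} (hQ : Q.IsOdd)
include hQ

/-- The elements have degree zero, so their products commute without sign. Invariance under all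
coherence expressions follows, and `hα` gives invariance under the morphisms of `V`. -/
lemma power_interp {α : Q.Family} (hα : α ∈ Q.limV) {x y : FreeSym V} (e : FreeSym.PreHom x y) :
    power α x ≫ Q.core.map (⟨interpIso ι e⟩ : (⟨wordObj ι x⟩ : Core F) ⟶ ⟨wordObj ι y⟩) =
      power α y := by
  let : Q.core.Braided := { Q.monoidal with braided := hQ.braided }
  have key {x y : FreeSym V} (e : FreeSym.PreHom x y)
      (σ : (⟨wordObj ι x⟩ : Core F) ⟶ ⟨wordObj ι y⟩)
      (h : FreeSym.interp ι e = σ.iso.hom) (h' : power α x ≫ Q.core.map σ = power α y) :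
      power α x ≫ Q.core.map (⟨interpIso ι e⟩ : (⟨wordObj ι x⟩ : Core F) ⟶ ⟨wordObj ι y⟩) =
        power α y := by
    have : (⟨interpIso ι e⟩ : (⟨wordObj ι x⟩ : Core F) ⟶ ⟨wordObj ι y⟩) = σ :=
      Core.hom_ext ((interpIso_hom ι e).trans h)
    rw [this, h']
  induction e with
  | of f => exact key _ ((Core.functorToCore ι).map f) rfl (hα f)
  | id x => exact key _ (𝟙 _) rfl ((congrArg (_ ≫ ·) (Q.core.map_id _)).trans (comp_id _))
  | comp e e' h h' =>
      refine key (.comp e e') (⟨interpIso ι e⟩ ≫ ⟨interpIso ι e'⟩)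
        (congrArg₂ (· ≫ ·) (interpIso_hom ι e).symm (interpIso_hom ι e').symm) ?_
      rw [Q.core.map_comp, reassoc_of% h, h']
  | tensor e e' h h' =>
      exact key (.tensor e e') (⟨interpIso ι e⟩ ⊗ₘ ⟨interpIso ι e'⟩)
        (congrArg₂ (· ⊗ₘ ·) (interpIso_hom ι e).symm (interpIso_hom ι e').symm)
        (elementMul_map Q.core h h')
  | assocHom x y z => exact key _ (α_ _ _ _).hom rfl (elementMul_assoc Q.core _ _ _)
  | assocInv x y z =>
      exact key _ (α_ _ _ _).inv rfl (comp_map_inv Q.core (α_ _ _ _) (elementMul_assoc Q.core _ _ _))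
  | leftHom x => exact key _ (λ_ _).hom rfl (elementMul_unit_left Q.core _)
  | leftInv x =>
      exact key _ (λ_ _).inv rfl (comp_map_inv Q.core (λ_ _) (elementMul_unit_left Q.core _))
  | rightHom x => exact key _ (ρ_ _).hom rfl (elementMul_unit_right Q.core _)
  | rightInv x =>
      exact key _ (ρ_ _).inv rfl (comp_map_inv Q.core (ρ_ _) (elementMul_unit_right Q.core _))
  | braid x y => exact key _ (β_ _ _).hom rfl (elementMul_braid Q.core _ _)

/-- Tensor powers of compatible families are compatible with isomorphisms of words. -/
lemma power_map (hF : (FreeSym.lift (Core.functorToCore ι)).IsEquivalence) {α : Q.Family}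
    (hα : α ∈ Q.limV) {x y : FreeSym V} (σ : wordObj ι x ≅ wordObj ι y) :
    power α x ≫ Q.core.map (⟨σ⟩ : (⟨wordObj ι x⟩ : Core F) ⟶ ⟨wordObj ι y⟩) = power α y := by
  obtain ⟨e, he⟩ := exists_preHom hF σ
  obtain rfl : interpIso ι e = σ := Iso.ext ((interpIso_hom ι e).trans he)
  exact hQ.power_interp hα e

end OddOpData.IsOdd

/-! ### The action on homogeneous elements -/

section
variable {A B : Gr C}

lemma pre_eq_post_of_comp {n : ℕ} {p : DegHom (n : ℤ) A B} {d : DegHom 1 A A} {d' : DegHom 1 B B}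
    {f : A ⟶ B} (hn : n = 0) (hp : p = ofEq (by rw [hn]; rfl) (ofHom f))
    (h : comp (l := (n : ℤ) + 1) rfl p d' =
      (-1 : ℤˣ) ^ n • comp (l := (n : ℤ) + 1) (add_comm _ _) d p) : pre f d' = post d f := by
  subst hn hp
  rw [pow_zero, one_smul] at h
  have h' : comp (l := 1) (zero_add 1) (ofHom f) d' = comp (add_zero 1) d (ofHom f) := h
  rwa [ofHom_comp, comp_ofHom] at h'

end

namespace OddOpData
variable (Q : OddOpData Φ C)

/-- The action of `e_f` if `f` has degree `n`. -/
def actDeg (n : ℤ) {X Y : F} (f : X ⟶ Y) : DegHom n (Q.val X) (Q.val Y) :=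
  if h : (Φ.deg f : ℤ) = n then ofEq h (Q.act f) else 0

variable {Q}

lemma actDeg_of {n : ℤ} {X Y : F} {f : X ⟶ Y} (h : (Φ.deg f : ℤ) = n) :
    Q.actDeg n f = ofEq h (Q.act f) := dif_pos h

lemma actDeg_of_ne {n : ℤ} {X Y : F} {f : X ⟶ Y} (h : (Φ.deg f : ℤ) ≠ n) :
    Q.actDeg n f = 0 := dif_neg h

lemma actDeg_eq_zero (n : ℤ) {X Y : F} {f : X ⟶ Y} (h : Q.act f = 0) : Q.actDeg n f = 0 := by
  unfold actDeg
  split_ifs with h'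
  · rw [h]; rfl
  · rfl

lemma actDeg_gen {X : F} {v : V} {f : X ⟶ ι.obj v} (h : Φ.IsGen f) :
    Q.actDeg 1 f = Q.actGen f h := actDeg_of _

namespace IsOdd
variable (hQ : Q.IsOdd)
include hQ

/-- With the degree fixed as an integer, maps of different morphisms can be added. If `f` does not
have degree `m`, then by additivity of the degree the composite does not have degree `l`, and both
sides vanish. -/
lemma actDeg_comp_right {m n l : ℤ} (e : m + n = l) {X Y Z : F} (f : X ⟶ Y) (g : Y ⟶ Z)
    (hg : (Φ.deg g : ℤ) = n) :
    comp e (Q.actDeg m f) (Q.actDeg n g) = Φ.ε f g • Q.actDeg l (f ≫ g) := by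
  by_cases hf : (Φ.deg f : ℤ) = m
  · subst hf hg e
    rw [actDeg_of rfl, actDeg_of rfl, actDeg_of (by rw [Φ.deg_comp, Nat.cast_add]),
      ← ofEq_units_smul, ← hQ.act_comp f g]
    rfl
  · rw [actDeg_of_ne hf, actDeg_of_ne (f := f ≫ g) (by rw [Φ.deg_comp]; omega), DegHom.zero_comp,
      smul_zero]

lemma actDeg_iso {X Y : F} (σ : X ≅ Y) :
    Q.actDeg 0 σ.hom = ofHom (Q.core.map (⟨σ⟩ : (⟨X⟩ : Core F) ⟶ ⟨Y⟩)) := by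
  rw [actDeg_of (by rw [Φ.deg_iso]; rfl), hQ.act_iso]
  rfl

lemma pre_map_actDeg {n : ℤ} {X Y Z : F} (σ : X ≅ Y) (g : Y ⟶ Z) :
    pre (Q.core.map (⟨σ⟩ : (⟨X⟩ : Core F) ⟶ ⟨Y⟩)) (Q.actDeg n g) =
      Φ.ε σ.hom g • Q.actDeg n (σ.hom ≫ g) := by
  by_cases hg : (Φ.deg g : ℤ) = n
  · rw [← hQ.actDeg_comp_right (zero_add n) _ _ hg, hQ.actDeg_iso, ofHom_comp]
    rfl
  · rw [actDeg_of_ne hg, actDeg_of_ne (by rw [Φ.deg_comp, Φ.deg_iso, zero_add]; exact hg),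
      pre_zero, smul_zero]

lemma actDeg_map {n : ℤ} {X Y Z : F} (f : X ⟶ Y) (σ : Y ≅ Z) :
    post (Q.actDeg n f) (Q.core.map (⟨σ⟩ : (⟨Y⟩ : Core F) ⟶ ⟨Z⟩)) =
      Φ.ε f σ.hom • Q.actDeg n (f ≫ σ.hom) := by
  rw [← hQ.actDeg_comp_right (add_zero n) _ _ (by rw [Φ.deg_iso]; rfl), hQ.actDeg_iso, comp_ofHom]
  rfl

lemma actDeg_tensor_id {n : ℤ} {X X' : F} (f : X ⟶ X') (Y : F) :
    post (tensor (add_zero n) (Q.actDeg n f) (ofHom (𝟙 (Q.val Y)))) (μ Q.core ⟨X'⟩ ⟨Y⟩) =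
      Φ.η f (𝟙 Y) • pre (μ Q.core ⟨X⟩ ⟨Y⟩) (Q.actDeg n (f ⊗ₘ 𝟙 Y)) := by
  have h₀ : (Φ.deg (𝟙 Y) : ℤ) = 0 := by rw [Φ.deg_iso]; rfl
  have h₁ : ofHom (𝟙 (Q.val Y)) = ofEq h₀ (Q.act (𝟙 Y)) := by
    have := hQ.actDeg_iso (Iso.refl Y)
    have h₂ := Q.core.map_id (⟨Y⟩ : Core F)
    exact (congrArg ofHom h₂.symm).trans (this.symm.trans (actDeg_of h₀))
  by_cases hf : (Φ.deg f : ℤ) = n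
  · subst hf
    rw [actDeg_of rfl, actDeg_of (by rw [Φ.deg_tensor, Nat.cast_add, h₀, add_zero]), h₁,
      tensor_ofEq, ← ofEq_pre, ← ofEq_units_smul, ← hQ.act_tensor f (𝟙 Y)]
    rfl
  · rw [actDeg_of_ne hf, actDeg_of_ne (by rw [Φ.deg_tensor, Nat.cast_add, h₀, add_zero]; exact hf),
      zero_tensor, pre_zero, smul_zero, zero_post]

lemma actDeg_id_tensor {n : ℤ} {Y Y' : F} (X : F) (f : Y ⟶ Y') :
    post (tensor (zero_add n) (ofHom (𝟙 (Q.val X))) (Q.actDeg n f)) (μ Q.core ⟨X⟩ ⟨Y'⟩) =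
      Φ.η (𝟙 X) f • pre (μ Q.core ⟨X⟩ ⟨Y⟩) (Q.actDeg n (𝟙 X ⊗ₘ f)) := by
  have h₀ : (Φ.deg (𝟙 X) : ℤ) = 0 := by rw [Φ.deg_iso]; rfl
  have h₁ : ofHom (𝟙 (Q.val X)) = ofEq h₀ (Q.act (𝟙 X)) := by
    have := hQ.actDeg_iso (Iso.refl X)
    have h₂ := Q.core.map_id (⟨X⟩ : Core F)
    exact (congrArg ofHom h₂.symm).trans (this.symm.trans (actDeg_of h₀))
  by_cases hf : (Φ.deg f : ℤ) = n
  · subst hf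
    rw [actDeg_of rfl, actDeg_of (by rw [Φ.deg_tensor, Nat.cast_add, h₀, zero_add]), h₁,
      tensor_ofEq, ← ofEq_pre, ← ofEq_units_smul, ← hQ.act_tensor (𝟙 X) f]
    rfl
  · rw [actDeg_of_ne hf, actDeg_of_ne (by rw [Φ.deg_tensor, Nat.cast_add, h₀, zero_add]; exact hf),
      tensor_zero, pre_zero, smul_zero, zero_post]

lemma act_eq_zero_iff {X Y : F} (f : X ⟶ Y) : Q.act f = 0 ↔ ∀ n, Q.actDeg n f = 0 := by
  refine ⟨fun h n => actDeg_eq_zero n h, fun h => ?_⟩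
  have := h (Φ.deg f)
  rwa [actDeg_of rfl, ofEq_rfl] at this

lemma eq_zero_of_pre_μ {n : ℤ} {X Y : F} {Z : Gr C} {t : DegHom n (Q.val (X ⊗ Y)) Z}
    (h : pre (μ Q.core ⟨X⟩ ⟨Y⟩) t = 0) : t = 0 := by
  have h' := congrArg (pre (Functor.OplaxMonoidal.δ Q.core ⟨X⟩ ⟨Y⟩)) h
  rw [pre_pre, Functor.Monoidal.δ_μ, pre_zero] at h'
  exact (pre_id t).symm.trans h'

/-- Vanishing of an action is inherited by tensor products with identities and by compositions. All
sums over insertions therefore have finite support when only finitely many generators act over each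
letter. The inverse of the multiplication of `Q` is used to cancel it. -/
lemma act_tensor_id_eq_zero {X X' : F} {f : X ⟶ X'} (Y : F) (h : Q.act f = 0) :
    Q.act (f ⊗ₘ 𝟙 Y) = 0 := by
  refine (hQ.act_eq_zero_iff _).2 fun n => hQ.eq_zero_of_pre_μ ?_
  have := hQ.actDeg_tensor_id (n := n) f Y
  rw [actDeg_eq_zero n h, zero_tensor, zero_post] at this
  exact (smul_eq_zero_iff_eq _).1 this.symm

lemma act_id_tensor_eq_zero {Y Y' : F} {f : Y ⟶ Y'} (X : F) (h : Q.act f = 0) :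
    Q.act (𝟙 X ⊗ₘ f) = 0 := by
  refine (hQ.act_eq_zero_iff _).2 fun n => hQ.eq_zero_of_pre_μ ?_
  have := hQ.actDeg_id_tensor (n := n) X f
  rw [actDeg_eq_zero n h, tensor_zero, zero_post] at this
  exact (smul_eq_zero_iff_eq _).1 this.symm

lemma act_comp_eq_zero {X Y Z : F} (f : X ⟶ Y) (g : Y ⟶ Z) (h : Q.act f = 0 ∨ Q.act g = 0) :
    Q.act (f ≫ g) = 0 := by
  have := hQ.act_comp f g
  refine (smul_eq_zero_iff_eq _).1 (this.symm.trans ?_)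
  rcases h with h | h
  · rw [h, DegHom.zero_comp]
  · rw [h, DegHom.comp_zero]

lemma d_map {X Y : F} (σ : X ≅ Y) : pre (Q.core.map (⟨σ⟩ : (⟨X⟩ : Core F) ⟶ ⟨Y⟩)) (Q.d Y) =
    post (Q.d X) (Q.core.map (⟨σ⟩ : (⟨X⟩ : Core F) ⟶ ⟨Y⟩)) :=
  pre_eq_post_of_comp (Φ.deg_iso σ.hom) (hQ.act_iso σ) (hQ.d_act σ.hom)

lemma pre_ε_d : pre (ε Q.core) (Q.d (𝟙_ F)) = 0 :=
  pre_ε_eq_zero (S := Q.core) (fun X => Q.d X.of) (hQ.d_map (λ_ (𝟙_ F))) (hQ.d_tensor _ _)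

lemma pre_mul_d {X Y : F} (x : 𝟙_ (Gr C) ⟶ Q.val X) (y : 𝟙_ (Gr C) ⟶ Q.val Y) :
    pre (mul x y) (Q.d (X ⊗ Y)) = pre (λ_ (𝟙_ (Gr C))).inv
      (post (tensor (add_zero 1) (pre x (Q.d X)) (ofHom y)) (μ Q.core ⟨X⟩ ⟨Y⟩)) +
      pre (λ_ (𝟙_ (Gr C))).inv
      (post (tensor (zero_add 1) (ofHom x) (pre y (Q.d Y))) (μ Q.core ⟨X⟩ ⟨Y⟩)) := by
  unfold mul
  rw [← pre_pre, ← pre_pre, hQ.d_tensor, ← pre_add, ← post_add, pre_post (x ⊗ₘ y)]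
  unfold tensorD DegHom.whiskerLeft DegHom.whiskerRight
  rw [pre_add, pre_tensor, pre_tensor, pre_ofHom, pre_ofHom, comp_id, comp_id]

/-- The sign `η` is the one that `insertSum` accumulates for an insertion into the left part of a
word; `mul_actDeg_right` treats the right part. -/
lemma mul_actDeg_left {n : ℤ} {X X' Y : F} (x : 𝟙_ (Gr C) ⟶ Q.val X) (y : 𝟙_ (Gr C) ⟶ Q.val Y)
    (f : X ⟶ X') : pre (λ_ (𝟙_ (Gr C))).inv
      (post (tensor (add_zero n) (pre x (Q.actDeg n f)) (ofHom y)) (μ Q.core ⟨X'⟩ ⟨Y⟩)) =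
      Φ.η f (𝟙 Y) • pre (mul x y) (Q.actDeg n (f ⊗ₘ 𝟙 Y)) := by
  have : ofHom y = pre y (ofHom (𝟙 (Q.val Y))) := by rw [pre_ofHom, comp_id]
  unfold mul
  rw [this, ← pre_tensor, ← pre_post, hQ.actDeg_tensor_id, pre_units_smul, pre_units_smul, pre_pre,
    pre_pre, assoc]

lemma mul_actDeg_right {n : ℤ} {X Y Y' : F} (x : 𝟙_ (Gr C) ⟶ Q.val X) (y : 𝟙_ (Gr C) ⟶ Q.val Y)
    (f : Y ⟶ Y') : pre (λ_ (𝟙_ (Gr C))).inv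
      (post (tensor (zero_add n) (ofHom x) (pre y (Q.actDeg n f))) (μ Q.core ⟨X⟩ ⟨Y'⟩)) =
      Φ.η (𝟙 X) f • pre (mul x y) (Q.actDeg n (𝟙 X ⊗ₘ f)) := by
  have : ofHom x = pre x (ofHom (𝟙 (Q.val X))) := by rw [pre_ofHom, comp_id]
  unfold mul
  rw [this, ← pre_tensor, ← pre_post, hQ.actDeg_id_tensor, pre_units_smul, pre_units_smul, pre_pre,
    pre_pre, assoc]

end IsOdd
end OddOpData

end
end

section
/-! ### Sums over insertions of generators -/

section
variable {V : Type uV} [Groupoid.{vV} V] {F : Type uF} [Category.{vF} F] [MonoidalCategory F]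
  [SymmetricCategory F] {ι : V ⥤ F} {Φ : OddVersion ι}
variable {C : Type uC} [Category.{vC} C] [MonoidalCategory C] [GradedTarget C]
  [SymmetricCategory C] [Preadditive C] [MonoidalPreadditive C]
open DegHom
open Functor.LaxMonoidal (μ ε)

lemma map_int_units_smul {M N : Type*} [AddCommGroup M] [AddCommGroup N] (φ : M →+ N) (s : ℤˣ)
    (x : M) : φ (s • x) = s • φ x := by
  rw [Units.smul_def, Units.smul_def, map_zsmul]

lemma comp_ofEq_eq_neg {A B : Gr C} {n : ℕ} {p : DegHom (n : ℤ) A B} {d : DegHom 1 A A}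
    {d' : DegHom 1 B B} (hn : n = 1) (h : comp (l := (n : ℤ) + 1) rfl p d' =
      (-1 : ℤˣ) ^ n • comp (l := (n : ℤ) + 1) (add_comm _ _) d p) (h₁ : (n : ℤ) = 1)
    (e : (1 : ℤ) + 1 = 2) : comp e (ofEq h₁ p) d' = -comp e d (ofEq h₁ p) := by
  subst hn
  rw [pow_one, Units.neg_smul, one_smul] at h
  exact h

namespace OddOpData

/-- Only finitely many classes of generators over each object of `V` act nontrivially. -/
def ActsFinitely (Q : OddOpData Φ C) : Prop :=
  ∀ v : V, {g : Φ.GenClass v | Q.act g.out.hom ≠ 0}.Finite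

variable {k : Type u} [CommRing k] [Linear k C] (c : Φ.Weight k)

/-- The sum over all compositions with two generators that occurs in the resolving condition. -/
def doubleSum {M : Type*} [AddCommGroup M] [Module k M] {v : V}
    (m : (y : FreeSym V) → (wordObj ι y ⟶ ι.obj v) → M) : M :=
  ∑ᶠ g : Φ.GenClass v, c.coeff g.out.hom • Φ.insertSum c g.out.word
    (fun y f s r => (s * Φ.ε f g.out.hom) • r • m y (f ≫ g.out.hom))

lemma insertSum_zero {M : Type*} [AddCommGroup M] : ∀ w : FreeSym V,
    Φ.insertSum c w (fun _ _ _ _ => (0 : M)) = 0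
  | .unit => rfl
  | .of _ => finsum_zero
  | .tensor a b => (congrArg₂ (· + ·) (insertSum_zero a) (insertSum_zero b)).trans (add_zero 0)

namespace IsOdd
variable {Q : OddOpData Φ C} (hQ : Q.IsOdd) (hfin : Q.ActsFinitely)
include hQ hfin

/-- An additive map commutes with these sums because of their finite support: by `hK` a summand can
be nonzero only for a generator that acts nontrivially. -/
lemma map_insertSum {M N : Type*} [AddCommGroup M] [AddCommGroup N] (φ : M →+ N)
    (w : FreeSym V) (K : (y : FreeSym V) → (wordObj ι y ⟶ wordObj ι w) → ℤˣ → k → M)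
    (hK : ∀ y f s r, Q.act f = 0 → K y f s r = 0) :
    φ (Φ.insertSum c w K) = Φ.insertSum c w (fun y f s r => φ (K y f s r)) := by
  induction w with
  | unit => exact map_zero φ
  | of v =>
      refine AddMonoidHom.map_finsum φ ((hfin v).subset fun g hg h => hg (hK _ _ _ _ h))
  | tensor a b ha hb =>
      refine (map_add φ _ _).trans (congrArg₂ (· + ·) (ha _ fun y f s r h => ?_)
        (hb _ fun y f s r h => ?_))
      · exact hK _ _ _ _ (hQ.act_tensor_id_eq_zero _ h)
      · exact hK _ _ _ _ (hQ.act_id_tensor_eq_zero _ h)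

lemma map_doubleSum {M N : Type*} [AddCommGroup M] [Module k M] [AddCommGroup N] [Module k N]
    (φ : M →ₗ[k] N) (v : V) (m : (y : FreeSym V) → (wordObj ι y ⟶ ι.obj v) → M)
    (hm : ∀ y f, Q.act f = 0 → m y f = 0) :
    φ (doubleSum c m) = doubleSum c (fun y f => φ (m y f)) := by
  have hm' (g : Φ.GenClass v) {y : FreeSym V} (f : wordObj ι y ⟶ wordObj ι g.out.word)
      (h : Q.act f = 0 ∨ Q.act g.out.hom = 0) : m y (f ≫ g.out.hom) = 0 :=
    hm _ _ (hQ.act_comp_eq_zero _ _ h)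
  refine (AddMonoidHom.map_finsum φ.toAddMonoidHom ((hfin v).subset fun g hg h => hg ?_)).trans
    (finsum_congr fun g => ?_)
  · have : (fun (y : FreeSym V) (f : wordObj ι y ⟶ wordObj ι g.out.word) (s : ℤˣ) (r : k) =>
        (s * Φ.ε f g.out.hom) • r • m y (f ≫ g.out.hom)) = fun _ _ _ _ => 0 := by
      funext y f s r
      rw [hm' g f (Or.inr h), smul_zero, smul_zero]
    rw [this, insertSum_zero, smul_zero]
  · refine (φ.map_smul _ _).trans (congrArg _ ?_)
    refine (hQ.map_insertSum c hfin φ.toAddMonoidHom _ _ fun y f s r h => ?_).trans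
      (congrArg _ ?_)
    · rw [hm' g f (Or.inl h), smul_zero, smul_zero]
    · funext y f s r
      refine (map_int_units_smul _ _ _).trans (congrArg _ (φ.map_smul _ _))

/-- The resolving condition, for functions that need not be supported on one isomorphism class of
morphisms. -/
theorem doubleSum_eq_zero (hc : OddVersion.Resolving.{vC} Φ k c) {v : V} {M : Type vC}
    [AddCommGroup M] [Module k M] (m : (y : FreeSym V) → (wordObj ι y ⟶ ι.obj v) → M)
    (hm : ∀ y f, Q.act f = 0 → m y f = 0)
    (h : ∀ (y y' : FreeSym V) (τ : wordObj ι y ≅ wordObj ι y') (f : wordObj ι y' ⟶ ι.obj v),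
      m y (τ.hom ≫ f) = Φ.ε τ.hom f • m y' f) : doubleSum c m = 0 := by
  classical
  let r : Setoid (Σ y : FreeSym V, wordObj ι y ⟶ ι.obj v) :=
    { r := fun a b => ∃ τ : wordObj ι a.1 ≅ wordObj ι b.1, τ.hom ≫ b.2 = a.2
      iseqv :=
        { refl := fun _ => ⟨Iso.refl _, id_comp _⟩
          symm := fun ⟨σ, h⟩ => ⟨σ.symm, by simp [← h]⟩
          trans := fun ⟨σ, hσ⟩ ⟨τ, hτ⟩ => ⟨σ ≪≫ τ, by simp [hσ, hτ]⟩ } }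
  let cls (y : FreeSym V) (f : wordObj ι y ⟶ ι.obj v) : Quotient r := ⟦⟨y, f⟩⟧
  -- The isomorphism class is recorded as a coordinate. Every coordinate of `m'` is supported on a
  -- single class, so that the resolving condition applies to it.
  let m' (y : FreeSym V) (f : wordObj ι y ⟶ ι.obj v) : Quotient r →₀ M :=
    Finsupp.single (cls y f) (m y f)
  have hm' : ∀ y f, Q.act f = 0 → m' y f = 0 := fun y f h => by
    change Finsupp.single _ _ = 0
    rw [hm y f h, Finsupp.single_zero]
  have key : doubleSum c m' = 0 := by
    ext κ
    refine (hQ.map_doubleSum c hfin (Finsupp.lapply (R := k) κ) v m' hm').trans ?_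
    obtain ⟨⟨y₀, f₀⟩, rfl⟩ := Quotient.exists_rep κ
    refine hc v M (fun y f => Finsupp.lapply (R := k) ⟦⟨y₀, f₀⟩⟧ (m' y f)) ?_
      ⟨y₀, f₀, fun y f hf => ?_⟩
    · intro y y' τ f
      have e : cls y (τ.hom ≫ f) = cls y' f := Quotient.sound ⟨τ, rfl⟩
      have : m' y (τ.hom ≫ f) = Φ.ε τ.hom f • m' y' f := by
        change Finsupp.single _ _ = _ • Finsupp.single _ _
        rw [e, h]
        exact map_int_units_smul (Finsupp.singleAddHom (cls y' f)) _ _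
      refine (congrArg _ this).trans ?_
      exact map_int_units_smul (Finsupp.lapply (R := k) (M := M)
        (⟦⟨y₀, f₀⟩⟧ : Quotient r)).toAddMonoidHom _ _
    · by_cases e : cls y f = ⟦⟨y₀, f₀⟩⟧
      · exact Quotient.exact e
      · exact absurd (Finsupp.single_eq_of_ne (Ne.symm e)) hf
  -- Summation over the coordinates recovers `m` from `m'`.
  have := congrArg (Finsupp.lsum k fun _ : Quotient r => (LinearMap.id : M →ₗ[k] M)) key
  rw [hQ.map_doubleSum c hfin _ v m' hm', map_zero] at this
  rw [← this]
  congr 1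
  funext y f
  change _ = Finsupp.lsum k _ (Finsupp.single _ _)
  rw [Finsupp.lsum_single]
  rfl

end IsOdd

/-! ### The square of the differential on solutions of the master equation -/

variable [MonoidalLinear k C]

/-- The sum of the actions of all generators on the tensor powers of a family. -/
def genSum {Q : OddOpData Φ C} (α : Q.Family) (v : V) : DegHom 1 (𝟙_ (Gr C)) (Q.val (ι.obj v)) :=
  ∑ᶠ g : Φ.GenClass v, c.coeff g.out.hom •
    pre (power α g.out.word) (Q.actGen g.out.hom g.out.isGen)

namespace IsOdd
variable {Q : OddOpData Φ C} (hQ : Q.IsOdd) (hfin : Q.ActsFinitely)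
include hQ hfin

/-- By the product rule the differential of a tensor power replaces one factor `α` at a time by
`d(α)`, which the master equation turns into minus the insertion of a generator into that letter. -/
theorem pre_power_d {α : Q.Family}
    (h : ∀ v, pre (α v) (Q.d (ι.obj v)) + genSum c α v = 0) (w : FreeSym V) :
    pre (power α w) (Q.d (wordObj ι w)) = -Φ.insertSum c w
      (fun y f s r => s • r • pre (power α y) (Q.actDeg 1 f)) := by
  induction w with
  | unit => exact hQ.pre_ε_d.trans neg_zero.symm
  | of v =>
      refine (eq_neg_of_add_eq_zero_left (h v)).trans (congrArg _ (finsum_congr fun g => ?_))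
      refine Eq.trans ?_ (one_smul _ _).symm
      rw [actDeg_gen g.out.isGen]
  | tensor a b ha hb =>
      -- Multiplication by the power over the other half of the word, as a linear map, so that it
      -- can be taken inside the sum.
      let φ : DegHom 1 (𝟙_ (Gr C)) (Q.val (wordObj ι a)) →ₗ[k]
          DegHom 1 (𝟙_ (Gr C)) (Q.val (wordObj ι a ⊗ wordObj ι b)) :=
        preₗ k 1 _ (λ_ (𝟙_ (Gr C))).inv ∘ₗ postₗ k 1 _ (μ Q.core ⟨wordObj ι a⟩ ⟨wordObj ι b⟩) ∘ₗ
          (tensorₗ k (add_zero 1)).flip (ofHom (power α b))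
      let ψ : DegHom 1 (𝟙_ (Gr C)) (Q.val (wordObj ι b)) →ₗ[k]
          DegHom 1 (𝟙_ (Gr C)) (Q.val (wordObj ι a ⊗ wordObj ι b)) :=
        preₗ k 1 _ (λ_ (𝟙_ (Gr C))).inv ∘ₗ postₗ k 1 _ (μ Q.core ⟨wordObj ι a⟩ ⟨wordObj ι b⟩) ∘ₗ
          tensorₗ k (zero_add 1) (ofHom (power α a))
      have e : pre (power α (.tensor a b)) (Q.d (wordObj ι (.tensor a b))) =
          φ (pre (power α a) (Q.d (wordObj ι a))) + ψ (pre (power α b) (Q.d (wordObj ι b))) :=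
        hQ.pre_mul_d (power α a) (power α b)
      have hz {w y : FreeSym V} (f : wordObj ι y ⟶ wordObj ι w) (s : ℤˣ) (r : k)
          (h : Q.act f = 0) : s • r • pre (power α y) (Q.actDeg 1 f) = 0 := by
        rw [actDeg_eq_zero 1 h, pre_zero, smul_zero, smul_zero]
      rw [e, ha, hb, map_neg, map_neg, ← neg_add]
      refine congrArg _ (congrArg₂ (· + ·) ?_ ?_)
      · refine (hQ.map_insertSum c hfin φ.toAddMonoidHom _ _ fun y f s r h => hz f s r h).trans
          (congrArg _ ?_)
        funext y f s r
        refine (map_int_units_smul _ _ _).trans ?_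
        refine Eq.trans ?_ (mul_smul _ _ _).symm
        refine congrArg _ ((φ.map_smul _ _).trans ?_)
        refine (congrArg (r • ·) (hQ.mul_actDeg_left (power α y) (power α b) f)).trans ?_
        exact smul_comm _ _ _
      · refine (hQ.map_insertSum c hfin ψ.toAddMonoidHom _ _ fun y f s r h => hz f s r h).trans
          (congrArg _ ?_)
        funext y f s r
        refine (map_int_units_smul _ _ _).trans ?_
        refine Eq.trans ?_ (mul_smul _ _ _).symm
        refine congrArg _ ((ψ.map_smul _ _).trans ?_)
        refine (congrArg (r • ·) (hQ.mul_actDeg_right (power α a) (power α y) f)).trans ?_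
        exact smul_comm _ _ _

lemma map_genSum {N : Type*} [AddCommGroup N] [Module k N] {α : Q.Family} {v : V}
    (φ : DegHom 1 (𝟙_ (Gr C)) (Q.val (ι.obj v)) →ₗ[k] N) :
    φ (genSum c α v) = ∑ᶠ g : Φ.GenClass v, c.coeff g.out.hom •
      φ (pre (power α g.out.word) (Q.actGen g.out.hom g.out.isGen)) := by
  refine (AddMonoidHom.map_finsum φ.toAddMonoidHom ((hfin v).subset fun g hg h => hg ?_)).trans
    (finsum_congr fun g => φ.map_smul _ _)
  rw [← actDeg_gen, actDeg_eq_zero 1 h, pre_zero, smul_zero]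

/-- The square of the differential vanishes on solutions of the master equation. -/
theorem pre_d_d (hF : (FreeSym.lift (Core.functorToCore ι)).IsEquivalence)
    (hc : OddVersion.Resolving.{vC} Φ k c) {α : Q.Family} (hα : α ∈ Q.limV)
    (h : ∀ v, pre (α v) (Q.d (ι.obj v)) + genSum c α v = 0) (v : V) :
    pre (α v) (comp (l := 2) (by norm_num) (Q.d (ι.obj v)) (Q.d (ι.obj v))) = 0 := by
  have e : (1 : ℤ) + 1 = 2 := by norm_num
  have hdeg (g : Φ.GenClass v) : (Φ.deg g.out.hom : ℤ) = 1 := by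
    rw [Φ.deg_gen _ g.out.isGen, Nat.cast_one]
  -- The function to which the resolving condition is applied: a composite of two generators has
  -- degree two. It is compatible with orientations because the powers of `α` are invariant under
  -- isomorphisms of words.
  let m (y : FreeSym V) (f : wordObj ι y ⟶ ι.obj v) : DegHom 2 (𝟙_ (Gr C)) (Q.val (ι.obj v)) :=
    pre (power α y) (Q.actDeg 2 f)
  have hm : doubleSum c m = 0 := by
    refine hQ.doubleSum_eq_zero c hfin hc m (fun y f hf => ?_) fun y y' τ f => ?_
    · change pre _ _ = 0
      rw [actDeg_eq_zero 2 hf, pre_zero]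
    · change pre _ _ = _ • pre _ _
      rw [← hQ.power_map hF hα τ, ← pre_pre, hQ.pre_map_actDeg, pre_units_smul, smul_smul,
        Int.units_mul_self, one_smul]
  have h₁ : pre (α v) (Q.d (ι.obj v)) = -genSum c α v := eq_neg_of_add_eq_zero_left (h v)
  -- A generator is odd and anticommutes with the differential. This sign cancels the one in
  -- `pre_power_d`.
  have h₂ : ∀ g : Φ.GenClass v, comp e (Q.actGen g.out.hom g.out.isGen) (Q.d (ι.obj v)) =
      -comp e (Q.d _) (Q.actGen g.out.hom g.out.isGen) := fun g =>
    comp_ofEq_eq_neg (Φ.deg_gen _ g.out.isGen) (hQ.d_act g.out.hom) _ e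
  rw [← comp_pre, h₁, neg_comp]
  have h₃ := hQ.map_genSum c hfin (α := α) ((compₗ k e).flip (Q.d (ι.obj v)))
  refine (congrArg Neg.neg (h₃.trans ?_)).trans neg_zero
  rw [← hm]
  refine finsum_congr fun g => congrArg _ ?_
  change comp e (pre _ _) _ = _
  rw [comp_pre, h₂, pre_neg, ← comp_pre, hQ.pre_power_d c hfin h, neg_comp, neg_neg]
  refine (hQ.map_insertSum c hfin ((compₗ k e).flip
    (Q.actGen g.out.hom g.out.isGen)).toAddMonoidHom _ _ fun y f s r hf => ?_).trans
    (congrArg _ ?_)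
  · rw [actDeg_eq_zero 1 hf, pre_zero, smul_zero, smul_zero]
  · funext y f s r
    refine (map_int_units_smul _ _ _).trans ?_
    rw [mul_smul]
    refine congrArg _ ((((compₗ k e).flip (Q.actGen g.out.hom g.out.isGen)).map_smul _ _).trans ?_)
    rw [smul_comm (Φ.ε f g.out.hom) r]
    refine congrArg _ ?_
    change comp e (pre _ _) _ = _ • pre _ _
    rw [comp_pre, ← actDeg_gen, hQ.actDeg_comp_right e _ _ (hdeg g), pre_units_smul]

end IsOdd
end OddOpData
end
end

section
/-! ### Invariance of the sum over all generators -/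

section
variable {V : Type uV} [Groupoid.{vV} V] {F : Type uF} [Category.{vF} F] [MonoidalCategory F]
  [SymmetricCategory F] {ι : V ⥤ F} {Φ : OddVersion ι}
variable {C : Type uC} [Category.{vC} C] [MonoidalCategory C] [GradedTarget C]
  [SymmetricCategory C] [Preadditive C] [MonoidalPreadditive C]
variable {k : Type u} [CommRing k] [Linear k C] (c : Φ.Weight k)
open DegHom
open Functor.LaxMonoidal (μ ε)

/-- The action of the morphisms of `V` on generators. -/
def OddVersion.genEquiv {v u : V} (τ : v ⟶ u) : Φ.Gen v ≃ Φ.Gen u where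
  toFun g := ⟨g.word, g.hom ≫ ι.map τ, (Φ.gen_target _ _ g.isGen).1⟩
  invFun g := ⟨g.word, g.hom ≫ ι.map (Groupoid.inv τ), (Φ.gen_target _ _ g.isGen).1⟩
  left_inv g := by
    obtain ⟨w, f, h⟩ := g
    simp
  right_inv g := by
    obtain ⟨w, f, h⟩ := g
    simp

/-- The action of the morphisms of `V` on classes of generators. -/
def OddVersion.genClassEquiv {v u : V} (τ : v ⟶ u) : Φ.GenClass v ≃ Φ.GenClass u :=
  Quotient.congr (OddVersion.genEquiv τ) fun a b => by
    refine exists_congr fun σ => ?_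
    change _ ↔ σ.hom ≫ b.hom ≫ ι.map τ = a.hom ≫ ι.map τ
    rw [← assoc, cancel_mono]

namespace OddOpData
variable {Q : OddOpData Φ C}

/-- The contribution of a generator to the master equation. -/
def genTerm (α : Q.Family) {v : V} (g : Φ.Gen v) : DegHom 1 (𝟙_ (Gr C)) (Q.val (ι.obj v)) :=
  c.coeff g.hom • pre (power α g.word) (Q.actGen g.hom g.isGen)

namespace IsOdd
variable (hQ : Q.IsOdd)
include hQ

lemma pre_map_actGen {X Y : F} {v : V} (σ : X ≅ Y) (f : Y ⟶ ι.obj v) (h : Φ.IsGen f) :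
    pre (Q.core.map (⟨σ⟩ : (⟨X⟩ : Core F) ⟶ ⟨Y⟩)) (Q.actGen f h) =
      Q.actGen (σ.hom ≫ f) (Φ.gen_source σ f h).1 := by
  rw [← actDeg_gen, ← actDeg_gen, hQ.pre_map_actDeg, (Φ.gen_source σ f h).2, one_smul]

lemma actGen_map {X : F} {v u : V} (f : X ⟶ ι.obj v) (h : Φ.IsGen f) (τ : v ⟶ u) :
    post (Q.actGen f h) (Q.core.map ((Core.functorToCore ι).map τ)) =
      Q.actGen (f ≫ ι.map τ) (Φ.gen_target f τ h).1 := by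
  let σ : ι.obj v ≅ ι.obj u := ((Core.functorToCore ι).map τ).iso
  rw [← actDeg_gen, ← actDeg_gen]
  refine (hQ.actDeg_map f σ).trans ?_
  exact (congrArg (· • Q.actDeg 1 (f ≫ ι.map τ)) (Φ.gen_target f τ h).2).trans (one_smul _ _)

variable (hF : (FreeSym.lift (Core.functorToCore ι)).IsEquivalence) {α : Q.Family}
  (hα : α ∈ Q.limV)
include hF hα

/-- Weight, power and action of a generator are all invariant under isomorphisms of its source, so
the representative chosen for a class is immaterial. -/
lemma genTerm_congr {v : V} {a b : Φ.Gen v} (h : a ≈ b) : genTerm c α a = genTerm c α b := by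
  obtain ⟨w, f, hf⟩ := a
  obtain ⟨σ, rfl⟩ : ∃ σ : wordObj ι w ≅ wordObj ι b.word, σ.hom ≫ b.hom = f := h
  unfold genTerm
  rw [c.source_iso _ _ b.isGen, ← hQ.power_map hF hα σ, ← pre_pre, hQ.pre_map_actGen]

/-- A morphism of `V` permutes the classes of generators. The chosen representative of the image of
a class is only equivalent to the image of the chosen representative, which is harmless by
`genTerm_congr`. -/
lemma genSum_map {v u : V} (τ : v ⟶ u) (hfin : Q.ActsFinitely) [MonoidalLinear k C] :
    post (genSum c α v) (Q.core.map ((Core.functorToCore ι).map τ)) = genSum c α u := by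
  refine (hQ.map_genSum c hfin (postₗ k 1 _ (Q.core.map ((Core.functorToCore ι).map τ)))).trans ?_
  refine finsum_eq_of_bijective (OddVersion.genClassEquiv τ) (Equiv.bijective _) fun g => ?_
  have h₁ : (OddVersion.genClassEquiv τ g).out ≈ OddVersion.genEquiv τ g.out := by
    refine Quotient.exact ((Quotient.out_eq _).trans ?_)
    conv_lhs => rw [← Quotient.out_eq g]
    rfl
  refine Eq.trans ?_ (hQ.genTerm_congr c hF hα h₁).symm
  have h₂ : c.coeff (g.out.hom ≫ ι.map τ) = c.coeff g.out.hom := c.target_iso _ _ g.out.isGen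
  unfold genTerm
  refine congrArg₂ (· • ·) h₂.symm ?_
  change post (pre _ _) _ = _
  rw [← pre_post, hQ.actGen_map]
  rfl

omit hF in
lemma pre_d_map {v u : V} (τ : v ⟶ u) :
    post (pre (α v) (Q.d (ι.obj v))) (Q.core.map ((Core.functorToCore ι).map τ)) =
      pre (α u) (Q.d (ι.obj u)) := by
  have h₁ := hQ.d_map ((Core.functorToCore ι).map τ).iso
  rw [← hα τ]
  refine (pre_post _ _ _).symm.trans ((congrArg _ h₁.symm).trans (pre_pre _ _ _))

end IsOdd
end OddOpData

/-! ### Elements of tensor products with dual objects -/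

section
variable {D : Type uC} [Category.{vC} D] [MonoidalCategory D] {A Z : D} [HasRightDual A]

/-- This is the adjunction between tensoring with the dual of `A` and tensoring with `A`, at the
unit object. -/
lemma eta_whiskerLeft_bijective :
    Function.Bijective (fun g : Aᘁ ⟶ Z => η_ A Aᘁ ≫ A ◁ g) := by
  have h (g : Aᘁ ⟶ Z) : η_ A Aᘁ ≫ A ◁ g =
      tensorLeftHomEquiv (𝟙_ D) A Aᘁ Z ((Iso.homCongr (ρ_ Aᘁ).symm (Iso.refl Z)) g) := by
    rw [tensorLeftHomEquiv]
    simp [unitors_inv_equal]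
  rw [show (fun g : Aᘁ ⟶ Z => η_ A Aᘁ ≫ A ◁ g) = _ from funext h]
  exact (Equiv.bijective _).comp (Equiv.bijective _)

end

/-! ### The dual of an odd op -/

namespace OddOp
variable (P : OddOp Φ C) [∀ v : V, HasRightDual (P.atV v)]

omit [∀ v : V, HasRightDual (P.atV v)] in
lemma mapV_id (v : V) : P.mapV (𝟙 v) = 𝟙 _ :=
  (congrArg P.core.map ((Core.functorToCore ι).map_id v)).trans (P.core.map_id _)

omit [∀ v : V, HasRightDual (P.atV v)] in
lemma mapV_comp {v u t : V} (τ : v ⟶ u) (σ : u ⟶ t) : P.mapV (τ ≫ σ) = P.mapV τ ≫ P.mapV σ :=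
  (congrArg P.core.map ((Core.functorToCore ι).map_comp _ _)).trans (P.core.map_comp _ _)

/-- The contragredient `V`-module. -/
abbrev dualMod : V ⥤ Gr C where
  obj v := (P.atV v)ᘁ
  map τ := (P.mapV (Groupoid.inv τ))ᘁ
  map_id v := by
    rw [show Groupoid.inv (𝟙 v) = 𝟙 v by simp, mapV_id, rightAdjointMate_id]
  map_comp {v u t} τ σ := by
    rw [show Groupoid.inv (τ ≫ σ) = Groupoid.inv σ ≫ Groupoid.inv τ by simp, mapV_comp,
      comp_rightAdjointMate]

variable {P} {R : GrOp F C}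

/-- A morphism of `V`-modules as a natural transformation. -/
def DualModHom.nat (g : DualModHom P R) : P.dualMod ⟶ ι ⋙ R.fn where
  app := g.app
  naturality _ _ τ := (g.natural τ).symm

/-- A natural transformation as a morphism of `V`-modules. -/
def DualModHom.ofNat (g : P.dualMod ⟶ ι ⋙ R.fn) : DualModHom P R where
  app := g.app
  natural τ := (g.naturality τ).symm

lemma DualModHom.word_eq (g : DualModHom P R) : ∀ w, g.word w = wordMap g.nat w
  | .of _ => rfl
  | .unit => rfl
  | .tensor a b => congrArg₂ (fun s t => (s ⊗ₘ t) ≫ μ R.fn _ _) (word_eq g a) (word_eq g b)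

/-- The composition of a morphism of `V`-modules with a morphism of ops. -/
def DualModHom.comp {S : GrOp F C} (g : DualModHom P R) (f : GrOp.Hom R S) : DualModHom P S :=
  .ofNat (g.nat ≫ Functor.whiskerLeft ι f.trans)

lemma DualModHom.comp_word {S : GrOp F C} (g : DualModHom P R) (f : GrOp.Hom R S) (w : FreeSym V) :
    (g.comp f).word w = g.word w ≫ f.trans.app _ := by
  have := f.monoidal
  exact (word_eq _ w).trans ((wordMap_comp g.nat f.trans w).trans
    (congrArg (· ≫ _) (word_eq g w).symm))

variable (d : ∀ X, DegHom 1 (R.fn.obj X) (R.fn.obj X))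

/-- The family of elements that corresponds to a morphism from the dual `V`-module. -/
def DualModHom.elt (g : DualModHom P R) : (hadamardD P R d).Family := fun v =>
  η_ (P.atV v) (P.atV v)ᘁ ≫ P.atV v ◁ g.app v

/-- Under the duality the contragredient action on `P(v)ᘁ` becomes the action on the first factor of
`P(v) ⊗ R(v)`, so linearity over `V` turns into invariance of the element. -/
lemma DualModHom.elt_mem_limV (g : DualModHom P R) : g.elt d ∈ (hadamardD P R d).limV := by
  intro v u τ
  have h₁ : P.mapV (Groupoid.inv τ) ≫ P.mapV τ = 𝟙 _ := by
    rw [← mapV_comp, Groupoid.inv_comp, mapV_id]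
  have h₂ := coevaluation_comp_rightAdjointMate (P.mapV (Groupoid.inv τ))
  change (η_ (P.atV v) (P.atV v)ᘁ ≫ P.atV v ◁ g.app v) ≫ (P.mapV τ ⊗ₘ R.fn.map (ι.map τ)) =
    η_ (P.atV u) (P.atV u)ᘁ ≫ P.atV u ◁ g.app u
  rw [MonoidalCategory.tensorHom_def', assoc, ← whiskerLeft_comp_assoc, g.natural,
    whiskerLeft_comp_assoc, reassoc_of% h₂, ← whisker_exchange_assoc,
    ← comp_whiskerRight, h₁, id_whiskerRight, comp_id]

lemma tensorμ_whiskerLeft {D : Type uC} [Category.{vC} D] [MonoidalCategory D] [SymmetricCategory D]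
    {W X Y A B K A' B' L : D} (w : W ⟶ 𝟙_ D ⊗ 𝟙_ D) (x : 𝟙_ D ⟶ X ⊗ A) (y : 𝟙_ D ⟶ Y ⊗ B)
    (m : X ⊗ Y ⟶ K) (f : A ⟶ A') (g : B ⟶ B') (n : A' ⊗ B' ⟶ L) :
    (w ≫ (x ⊗ₘ y) ≫ tensorμ X A Y B ≫ m ▷ (A ⊗ B)) ≫ K ◁ ((f ⊗ₘ g) ≫ n) =
      w ≫ ((x ≫ X ◁ f) ⊗ₘ (y ≫ Y ◁ g)) ≫ tensorμ X A' Y B' ≫ (m ⊗ₘ n) := by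
  have h := tensorμ_natural (𝟙 X) f (𝟙 Y) g
  rw [id_tensorHom, id_tensorHom, id_tensorHom_id, id_tensorHom] at h
  rw [← MonoidalCategory.tensorHom_comp_tensorHom, assoc, assoc, assoc, assoc, reassoc_of% h,
    MonoidalCategory.tensorHom_def m, whiskerLeft_comp, whisker_exchange_assoc]

lemma coevTensor_whiskerLeft {X Y : F} {A B : Gr C} (x : 𝟙_ (Gr C) ⟶ P.val X ⊗ A)
    (y : 𝟙_ (Gr C) ⟶ P.val Y ⊗ B) (f : A ⟶ R.fn.obj X) (g : B ⟶ R.fn.obj Y) :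
    coevTensor P x y ≫ P.val (X ⊗ Y) ◁ ((f ⊗ₘ g) ≫ μ R.fn X Y) =
      elementMul (hadamardCore P.toOddOpData R) (X := ⟨X⟩) (Y := ⟨Y⟩)
        (x ≫ P.val X ◁ f) (y ≫ P.val Y ◁ g) := by
  refine (tensorμ_whiskerLeft _ x y (μ P.core ⟨X⟩ ⟨Y⟩) f g (μ R.fn X Y)).trans ?_
  exact congrArg (fun t => (λ_ (𝟙_ (Gr C))).inv ≫ ((x ≫ P.val X ◁ f) ⊗ₘ (y ≫ P.val Y ◁ g)) ≫ t)
    (hadamardCore_μ P.toOddOpData R X Y).symm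

/-- The coevaluation of a word, the extension of `g` to words and the tensor power follow the same
recursion. In the tensor case the exchange that defines the product in `P ⊗ R` is the one built into
`coevTensor`. -/
lemma DualModHom.power_elt (g : DualModHom P R) : ∀ w : FreeSym V,
    OddOpData.power (g.elt d) w = P.coev w ≫ P.val (wordObj ι w) ◁ g.word w
  | .of _ => rfl
  | .unit => (hadamardCore_ε P.toOddOpData R).trans
      ((congrArg ((λ_ (𝟙_ (Gr C))).inv ≫ ·) (MonoidalCategory.tensorHom_def _ _)).trans
        (assoc _ _ _).symm)
  | .tensor a b => by
      refine Eq.trans ?_ (coevTensor_whiskerLeft (P.coev a) (P.coev b) (g.word a) (g.word b)).symm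
      exact congrArg₂ (elementMul (hadamardCore P.toOddOpData R) (X := ⟨wordObj ι a⟩)
        (Y := ⟨wordObj ι b⟩)) (power_elt g a) (power_elt g b)

end OddOp
end
end

section
/-! ### Derivations of ops -/

section
variable {F : Type uF} [Category.{vF} F] [MonoidalCategory F] [SymmetricCategory F]
variable {C : Type uC} [Category.{vC} C] [MonoidalCategory C] [GradedTarget C]
  [SymmetricCategory C] [Preadditive C] [MonoidalPreadditive C]
open DegHom
open Functor.LaxMonoidal (μ ε)

/-- The two mixed terms are equal up to the Koszul sign and cancel. This is why the square of an odd
derivation is again a derivation, see `IsDerivation.sq`. -/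
lemma comp_tensorD {A B : Gr C} (e : (1 : ℤ) + 1 = 2) (d : DegHom 1 A A) (d' : DegHom 1 B B) :
    comp e (tensorD d d') (tensorD d d') =
      DegHom.whiskerRight (comp e d d) B + DegHom.whiskerLeft A (comp e d' d') := by
  unfold DegHom.tensorD DegHom.whiskerLeft DegHom.whiskerRight
  rw [comp_add, add_comp, add_comp,
    comp_tensor _ _ e e (add_zero 0) (add_zero 2),
    comp_tensor _ _ e (zero_add 1) (add_zero 1) e,
    comp_tensor _ _ e (add_zero 1) (zero_add 1) e,
    comp_tensor _ _ e (add_zero 0) e (zero_add 2)]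
  simp only [ofHom_comp, comp_ofHom, ofEq_rfl, pre_id, post_id, mul_zero, mul_one,
    Int.negOnePow_zero, Int.negOnePow_one, one_smul, Units.neg_smul]
  abel

lemma IsDerivation.tensorD {R : GrOp F C} {d : ∀ X, DegHom 1 (R.fn.obj X) (R.fn.obj X)}
    (hd : IsDerivation (𝟙 R.fn) d) (X Y : F) :
    pre (μ R.fn X Y) (d (X ⊗ Y)) = post (DegHom.tensorD (d X) (d Y)) (μ R.fn X Y) :=
  hd.tensor X Y

lemma IsDerivation.sq {R : GrOp F C} {d : ∀ X, DegHom 1 (R.fn.obj X) (R.fn.obj X)}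
    (hd : IsDerivation (𝟙 R.fn) d) (e : (1 : ℤ) + 1 = 2) :
    IsDerivation (𝟙 R.fn) fun X => comp e (d X) (d X) where
  natural φ := by
    rw [← comp_pre, hd.natural, post_comp, hd.natural, comp_post]
  unit := by
    rw [← comp_pre, hd.unit, DegHom.zero_comp]
  tensor X Y := by
    rw [← comp_pre, hd.tensorD, post_comp, hd.tensorD, comp_post, comp_tensorD]
    rfl

lemma isDerivation_zero (R : GrOp F C) (n : ℤ) :
    IsDerivation (𝟙 R.fn) fun X => (0 : DegHom n (R.fn.obj X) (R.fn.obj X)) where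
  natural φ := by rw [pre_zero, zero_post]
  unit := pre_zero _
  tensor X Y := by
    unfold leibniz
    rw [zero_tensor, tensor_zero, add_zero, pre_zero, zero_post]

lemma DGOp.isDerivation (O : DGOp F C) : IsDerivation (𝟙 O.fn) O.d where
  natural := O.d_natural
  unit := pre_ε_eq_zero O.d (O.d_natural _) (O.d_tensor _ _)
  tensor := O.d_tensor

/-- Together with `IsDerivation.post_hom` this makes both sides of the commutation of `f` with
differentials derivations along `f`, to be compared on generators. -/
lemma IsDerivation.pre_hom {R S : GrOp F C} (f : GrOp.Hom R S)
    {d : ∀ X, DegHom 1 (S.fn.obj X) (S.fn.obj X)} (hd : IsDerivation (𝟙 S.fn) d) :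
    IsDerivation f.trans fun X => pre (f.trans.app X) (d X) where
  natural φ := by
    rw [pre_pre, f.trans.naturality, ← pre_pre, hd.natural, pre_post]
  unit := by
    have := f.monoidal
    rw [pre_pre, NatTrans.IsMonoidal.unit, hd.unit]
  tensor X Y := by
    have := f.monoidal
    rw [pre_pre, NatTrans.IsMonoidal.tensor, ← pre_pre, hd.tensor, pre_leibniz, NatTrans.id_app,
      NatTrans.id_app, comp_id, comp_id]

lemma IsDerivation.post_hom {R S : GrOp F C} (f : GrOp.Hom R S)
    {d : ∀ X, DegHom 1 (R.fn.obj X) (R.fn.obj X)} (hd : IsDerivation (𝟙 R.fn) d) :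
    IsDerivation f.trans fun X => post (d X) (f.trans.app X) where
  natural φ := by
    rw [pre_post, hd.natural, post_post, f.trans.naturality, ← post_post]
  unit := by
    rw [pre_post, hd.unit, zero_post]
  tensor X Y := by
    have := f.monoidal
    rw [pre_post, hd.tensorD, post_post, NatTrans.IsMonoidal.tensor, ← post_post]
    unfold leibniz DegHom.tensorD DegHom.whiskerLeft DegHom.whiskerRight
    rw [post_add, tensor_post, tensor_post, post_ofHom, post_ofHom, id_comp, id_comp]

end

/-! ### The master equation in terms of the dual -/

section
variable {V : Type uV} [Groupoid.{vV} V] {F : Type uF} [Category.{vF} F] [MonoidalCategory F]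
  [SymmetricCategory F] {ι : V ⥤ F} {Φ : OddVersion ι}
variable {C : Type uC} [Category.{vC} C] [MonoidalCategory C] [GradedTarget C]
  [SymmetricCategory C] [Preadditive C] [MonoidalPreadditive C]
variable {k : Type u} [CommRing k] [Linear k C] [MonoidalLinear k C] (c : Φ.Weight k)
open DegHom
open Functor.LaxMonoidal (μ ε)

namespace OddOp
variable {P : OddOp Φ C} [∀ v : V, HasRightDual (P.atV v)] {R : GrOp F C}

/-- The term of the differential on generators that is given by the transposes of the
generators. -/
def dualTerm (g : DualModHom P R) {v : V} (a : Φ.Gen v) :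
    DegHom 1 (P.atV v)ᘁ (R.fn.obj (ι.obj v)) :=
  post (P.transpose (P.actGen a.hom a.isGen)) (g.word a.word ≫ R.fn.map a.hom)

/-- The negative of the differential on generators. -/
def dualSum (g : DualModHom P R) (v : V) : DegHom 1 (P.atV v)ᘁ (R.fn.obj (ι.obj v)) :=
  post (P.transpose (w := .of v) (P.d (ι.obj v))) (g.app v) +
    ∑ᶠ a : Φ.GenClass v, c.coeff a.out.hom • dualTerm g a.out

lemma post_whiskerRight {A B K L : Gr C} {n : ℤ} (s : DegHom n A B) (f : K ⟶ L) :
    post (DegHom.whiskerRight s K) (B ◁ f) = pre (A ◁ f) (DegHom.whiskerRight s L) := by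
  unfold DegHom.whiskerRight
  rw [tensor_post_whiskerLeft, pre_whiskerLeft_tensor, post_ofHom, pre_ofHom, id_comp, comp_id]

lemma pre_whiskerLeft_tensor_ofHom {A B K L L' : Gr C} {m n : ℤ} (e : m = n) (s : DegHom m A B)
    (f : K ⟶ L) (g : L ⟶ L') :
    pre (A ◁ f) (ofEq e (tensor (add_zero m) s (ofHom g))) =
      post (DegHom.whiskerRight (ofEq e s) K) (B ◁ (f ≫ g)) := by
  subst e
  unfold DegHom.whiskerRight
  rw [ofEq_rfl, ofEq_rfl, tensor_post_whiskerLeft, pre_whiskerLeft_tensor, post_ofHom, pre_ofHom,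
    id_comp]

/-- A transpose moves the action of the generator from the dual side back to the factor `P` of the
coevaluation of the word. Combined with `g` on the other factor, this is the action of the generator
on a tensor power of the element. -/
lemma twist_dualTerm (d : ∀ X, DegHom 1 (R.fn.obj X) (R.fn.obj X)) (g : DualModHom P R) {v : V}
    (a : Φ.Gen v) : twist (dualTerm g a) = pre (OddOpData.power (g.elt d) a.word)
      ((hadamardD P R d).actGen a.hom a.isGen) := by
  refine ((twist_post _ _).trans (congrArg (post · _) (twist_transpose _ _))).trans ?_
  rw [g.power_elt d]
  refine Eq.trans ?_ (pre_pre _ _ _)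
  rw [← pre_post]
  exact congrArg _ (pre_whiskerLeft_tensor_ofHom _ _ _ _).symm

lemma actsFinitely (hP : P.LocallyFinite) (d : ∀ X, DegHom 1 (R.fn.obj X) (R.fn.obj X)) :
    (hadamardD P R d).ActsFinitely := fun v => (hP v).subset fun g hg h => hg (by
  have : tensor (add_zero _) (P.act g.out.hom) (ofHom (R.fn.map g.out.hom)) = 0 := by
    rw [h, zero_tensor]
  exact this)

lemma dualTerm_eq_zero (g : DualModHom P R) {v : V} (a : Φ.Gen v) (h : P.act a.hom = 0) :
    dualTerm g a = 0 := by
  apply twist_injective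
  refine ((twist_post _ _).trans (congrArg (post · _) (twist_transpose _ _))).trans ?_
  rw [← OddOpData.actDeg_gen, OddOpData.actDeg_eq_zero 1 h, twist_zero]
  unfold DegHom.whiskerRight
  rw [zero_tensor, pre_zero, zero_post]

lemma map_dualSum_aux (hP : P.LocallyFinite) (g : DualModHom P R) {v : V} {N : Type*}
    [AddCommGroup N] [Module k N] (φ : DegHom 1 (P.atV v)ᘁ (R.fn.obj (ι.obj v)) →ₗ[k] N) :
    φ (∑ᶠ a : Φ.GenClass v, c.coeff a.out.hom • dualTerm g a.out) =
      ∑ᶠ a : Φ.GenClass v, c.coeff a.out.hom • φ (dualTerm g a.out) := by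
  refine (AddMonoidHom.map_finsum φ.toAddMonoidHom ((hP v).subset fun a ha h => ha ?_)).trans
    (finsum_congr fun a => φ.map_smul _ _)
  rw [dualTerm_eq_zero g _ h, smul_zero]

/-- The master equation for the element that corresponds to a morphism of `V`-modules. -/
lemma twist_dualSum (hP : P.LocallyFinite) (d : ∀ X, DegHom 1 (R.fn.obj X) (R.fn.obj X))
    (g : DualModHom P R) (v : V) :
    twist (pre (g.app v) (d (ι.obj v)) + dualSum c g v) =
      pre (g.elt d v) ((hadamardD P R d).d (ι.obj v)) + OddOpData.genSum c (g.elt d) v := by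
  unfold dualSum
  rw [twist_add, twist_add, ← add_assoc]
  refine congrArg₂ (· + ·) ?_ ?_
  · rw [twist_pre_left, twist_post]
    have h : twist (P.transpose (w := .of v) (P.d (ι.obj v))) =
        pre (η_ (P.atV v) (P.atV v)ᘁ) (DegHom.whiskerRight (P.d (ι.obj v)) (P.atV v)ᘁ) :=
      twist_transpose _ _
    rw [h, ← pre_post, post_whiskerRight, pre_pre, add_comm, ← pre_add]
    rfl
  · refine (map_dualSum_aux c hP g twistₗ).trans (finsum_congr fun a => congrArg _ ?_)
    exact twist_dualTerm d g a.out

lemma dualSum_comp (hP : P.LocallyFinite) {S : GrOp F C} (g : DualModHom P R) (f : GrOp.Hom R S)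
    (v : V) : dualSum c (g.comp f) v = post (dualSum c g v) (f.trans.app (ι.obj v)) := by
  unfold dualSum
  rw [post_add, post_post]
  refine congrArg₂ (· + ·) rfl ?_
  refine Eq.trans ?_ (map_dualSum_aux c hP g (postₗ k 1 _ (f.trans.app (ι.obj v)))).symm
  refine finsum_congr fun a => congrArg _ ?_
  change post _ _ = post (post _ _) _
  rw [post_post, g.comp_word, assoc, assoc, f.trans.naturality]

/-- The differential on generators is compatible with the morphisms of `V`. -/
lemma dualSum_natural (hF : (FreeSym.lift (Core.functorToCore ι)).IsEquivalence)
    (hP : P.LocallyFinite) (g : DualModHom P R) {v u : V} (τ : v ⟶ u) :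
    pre (P.dualMod.map τ) (dualSum c g u) = post (dualSum c g v) (R.fn.map (ι.map τ)) := by
  -- The expression `dualSum` does not involve a differential on `R`. The zero derivation is thus
  -- sufficient to reduce to the invariance of the terms of the master equation.
  let Q := hadamardD P R fun _ => 0
  have hQ : Q.IsOdd := hadamardD_isOdd P R _ (isDerivation_zero R 1)
  have hα : g.elt _ ∈ Q.limV := g.elt_mem_limV _
  have key (v : V) : twist (dualSum c g v) = pre (g.elt _ v) (Q.d (ι.obj v)) +
      OddOpData.genSum c (Q := Q) (g.elt _) v := by
    rw [← twist_dualSum c hP, pre_zero, zero_add]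
  have h : post (twist (dualSum c g v)) (P.mapV τ ⊗ₘ R.fn.map (ι.map τ)) =
      twist (dualSum c g u) := by
    refine (congrArg (post · _) (key v)).trans (((post_add _ _ _).trans ?_).trans (key u).symm)
    exact congrArg₂ (· + ·) (hQ.pre_d_map hα τ) (hQ.genSum_map c hF hα τ (actsFinitely hP _))
  have h' : P.mapV τ ≫ P.mapV (Groupoid.inv τ) = 𝟙 _ := by
    rw [← mapV_comp, Groupoid.comp_inv, mapV_id]
  apply twist_injective
  refine (twist_pre _ _).trans ?_
  rw [twist_post, ← h, post_post, ← tensorHom_id, MonoidalCategory.tensorHom_comp_tensorHom, h',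
    comp_id, id_tensorHom]

variable [∀ X : F, HasColimitsOfShape (WordOver ι X) C]
  [∀ (X : F) (A : C), PreservesColimitsOfShape (WordOver ι X) (tensorLeft A)]

/-- The Feynman transform exists. -/
theorem nonempty_feynmanTransform (hF : IsFeynmanCategory.{w} ι)
    (hc : OddVersion.Resolving.{vC} Φ k c) (hP : P.LocallyFinite) :
    Nonempty (P.FeynmanTransform c) := by
  obtain ⟨R, i, hi⟩ := exists_isFreeOp (C := C) hF P.dualMod
  let g : DualModHom P R := .ofNat i
  obtain ⟨d, hd, hd'⟩ := hi.exists_derivation (n := 1) (fun v => -dualSum c g v) fun τ => by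
    rw [pre_neg, neg_post, dualSum_natural c hF.isoCondition hP]
  have hd₀ (v : V) : pre (g.app v) (d (ι.obj v)) + dualSum c g v = 0 :=
    add_eq_zero_iff_eq_neg.2 (hd' v)
  have hQ := hadamardD_isOdd P R d hd
  -- The tautological element solves the master equation: this is the definition of `d` on
  -- generators, read through the duality.
  have hME (v : V) : pre (g.elt d v) ((hadamardD P R d).d (ι.obj v)) +
      OddOpData.genSum c (g.elt d) v = 0 :=
    (twist_dualSum c hP d g v).symm.trans ((congrArg twist (hd₀ v)).trans twist_zero)
  have e : (1 : ℤ) + 1 = 2 := by norm_num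
  have hsq (v : V) : pre (g.app v) (comp e (d (ι.obj v)) (d (ι.obj v))) = 0 := by
    have h := hQ.pre_d_d c (actsFinitely hP d) hF.isoCondition hc (g.elt_mem_limV d) hME v
    -- The mixed terms cancel and `P` has square zero differential, so only `1 ⊗ d²` survives. Hence
    -- the vanishing for the tautological element is the vanishing of `d²` on generators.
    have h₁ : comp e ((hadamardD P R d).d (ι.obj v)) ((hadamardD P R d).d (ι.obj v)) =
        DegHom.whiskerLeft (P.atV v) (comp e (d (ι.obj v)) (d (ι.obj v))) := by
      refine (comp_tensorD e _ _).trans ?_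
      rw [P.d_d]
      unfold DegHom.whiskerRight
      rw [zero_tensor, zero_add]
      rfl
    apply twist_injective
    rw [twist_pre_left, twist_zero]
    exact (congrArg (pre _) h₁.symm).trans h
  refine ⟨{ op := { R with
              d := d
              d_d := fun X => hi.derivation_ext (f := ⟨𝟙 R.fn⟩) (hd.sq e)
                (isDerivation_zero R 2) (fun v => (hsq v).trans (pre_zero _).symm) X
              d_natural := hd.natural
              d_tensor := hd.tensorD }
            incl := g
            free := fun S h => ?_
            d_incl := hd₀ }⟩
  obtain ⟨f, hf⟩ := hi.exists_lift S h.nat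
  exact ⟨f, hf, fun f' hf' => hi.op_hom_ext _ _ fun v => (hf' v).trans (hf v).symm⟩

end OddOp
end
end

section
/-! ### Morphisms from the Feynman transform -/

section
variable {V : Type uV} [Groupoid.{vV} V] {F : Type uF} [Category.{vF} F] [MonoidalCategory F]
  [SymmetricCategory F] {ι : V ⥤ F} {Φ : OddVersion ι}
variable {C : Type uC} [Category.{vC} C] [MonoidalCategory C] [GradedTarget C]
  [SymmetricCategory C] [Preadditive C] [MonoidalPreadditive C]
variable {k : Type u} [CommRing k] [Linear k C] [MonoidalLinear k C] {c : Φ.Weight k}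
open DegHom
open Functor.LaxMonoidal (μ ε)

/-- The identity morphism of a graded op. -/
def GrOp.Hom.id (R : GrOp F C) : GrOp.Hom R R := ⟨𝟙 R.fn⟩

/-- The composition of morphisms of graded ops. -/
def GrOp.Hom.comp {R S T : GrOp F C} (f : GrOp.Hom R S) (g : GrOp.Hom S T) : GrOp.Hom R T :=
  have := f.monoidal
  have := g.monoidal
  ⟨f.trans ≫ g.trans⟩

lemma DGOp.Hom.ext_trans {R S : DGOp F C} {f g : DGOp.Hom R S} (h : f.toHom = g.toHom) :
    f = g := by
  obtain ⟨f, hf⟩ := f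
  obtain ⟨g, hg⟩ := g
  obtain rfl : f = g := h
  rfl

/-- A master equation solution as an equation with the sum over all generators. -/
lemma OddOpData.finsum_psi {Q : OddOpData Φ C} (hfin : Q.ActsFinitely) (α : Q.Family) (v : V) :
    ∑ᶠ n : ℕ, psi c n α v = genSum c α v := by
  have hs : (Function.support fun g : Φ.GenClass v => c.coeff g.out.hom •
      pre (power α g.out.word) (Q.actGen g.out.hom g.out.isGen)).Finite :=
    (hfin v).subset fun g hg h => hg (by
      dsimp only
      rw [← actDeg_gen, actDeg_eq_zero 1 h, pre_zero, smul_zero])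
  unfold genSum psi
  set t : Φ.GenClass v → DegHom 1 (𝟙_ (Gr C)) (Q.val (ι.obj v)) := fun g => c.coeff g.out.hom •
      pre (power α g.out.word) (Q.actGen g.out.hom g.out.isGen) with ht
  have h₁ (n : ℕ) : ∑ᶠ (g : Φ.GenClass v) (_ : g.out.word.length = n), t g =
      ∑ g ∈ hs.toFinset, if g.out.word.length = n then t g else 0 := by
    rw [finsum_eq_sum_of_support_subset _ (s := hs.toFinset)]
    · refine Finset.sum_congr rfl fun g _ => ?_
      by_cases h : g.out.word.length = n <;> simp [h]
    · intro g hg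
      rw [Set.Finite.coe_toFinset]
      intro h
      exact hg (by simp [h])
  -- All generators that contribute lie in one finite set, so the sums over arities and over classes
  -- may be interchanged; each class contributes at exactly one arity.
  rw [finsum_congr h₁, finsum_eq_sum_of_support_subset (s := hs.toFinset) t (by simp),
    finsum_sum_comm]
  · refine Finset.sum_congr rfl fun g _ => ?_
    rw [finsum_eq_single _ g.out.word.length fun n hn => if_neg hn.symm, if_pos rfl]
  · intro g _
    refine (Set.finite_singleton g.out.word.length).subset fun n hn => ?_
    by_contra h
    exact hn (if_neg fun h' => h h'.symm)

lemma OddOpData.mem_masterEquation_iff {Q : OddOpData Φ C} (hfin : Q.ActsFinitely) {α : Q.Family} :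
    α ∈ Q.masterEquation c ↔ α ∈ Q.limV ∧
      ∀ v : V, pre (α v) (Q.d (ι.obj v)) + genSum c α v = 0 := by
  refine and_congr_right fun _ => forall_congr' fun v => ?_
  rw [OddOpData.finsum_psi hfin]

namespace OddOp
variable {P : OddOp Φ C} [∀ v : V, HasRightDual (P.atV v)]

lemma hadamard_actsFinitely (hP : P.LocallyFinite) (O : DGOp F C) :
    (hadamard P O).ActsFinitely := actsFinitely hP O.d

/-- The converse of the passage from equivariance to invariance: the two maps out of the dual are
compared through the elements to which they correspond. -/
lemma comp_eq_rightAdjointMate_comp {D : Type uC} [Category.{vC} D] [MonoidalCategory D]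
    {A B Z Z' : D} [HasRightDual A] [HasRightDual B] {p : A ⟶ B} {q : B ⟶ A} (hpq : p ≫ q = 𝟙 A)
    {g : Aᘁ ⟶ Z} {g' : Bᘁ ⟶ Z'} {r : Z ⟶ Z'}
    (h : (η_ A Aᘁ ≫ A ◁ g) ≫ (p ⊗ₘ r) = η_ B Bᘁ ≫ B ◁ g') : g ≫ r = qᘁ ≫ g' := by
  apply eta_whiskerLeft_bijective.1
  dsimp only
  have h₂ := congrArg (· ≫ q ▷ Z') h
  rw [assoc, assoc, ← tensorHom_id, MonoidalCategory.tensorHom_comp_tensorHom, hpq, comp_id,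
    id_tensorHom, tensorHom_id, assoc, whisker_exchange, ← reassoc_of%
    coevaluation_comp_rightAdjointMate q] at h₂
  rw [whiskerLeft_comp, whiskerLeft_comp, h₂]

/-- The morphism of `V`-modules that corresponds to a family of elements. -/
lemma exists_elt_eq {R : GrOp F C} (d : ∀ X, DegHom 1 (R.fn.obj X) (R.fn.obj X))
    {α : (hadamardD P R d).Family} (hα : α ∈ (hadamardD P R d).limV) :
    ∃ g : DualModHom P R, g.elt d = α := by
  have key (v : V) : ∃ g : (P.atV v)ᘁ ⟶ R.fn.obj (ι.obj v),
      η_ (P.atV v) (P.atV v)ᘁ ≫ P.atV v ◁ g = α v :=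
    (eta_whiskerLeft_bijective (A := P.atV v)).2 (α v)
  choose g hg using key
  refine ⟨⟨g, fun {v u} τ => ?_⟩, funext hg⟩
  have h : α v ≫ (P.mapV τ ⊗ₘ R.fn.map (ι.map τ)) = α u := hα τ
  rw [← hg v, ← hg u] at h
  refine comp_eq_rightAdjointMate_comp ?_ h
  rw [← mapV_comp, Groupoid.comp_inv, mapV_id]

namespace FeynmanTransform
variable (T : P.FeynmanTransform c)

lemma hom_ext {S : GrOp F C} (f g : GrOp.Hom T.op.toGrOp S)
    (h : ∀ v, T.incl.app v ≫ f.trans.app (ι.obj v) = T.incl.app v ≫ g.trans.app (ι.obj v)) :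
    f = g :=
  (T.free S (T.incl.comp f)).unique (fun _ => rfl) fun v => (h v).symm

lemma pre_incl_d (v : V) : pre (T.incl.app v) (T.op.d (ι.obj v)) = -dualSum c T.incl v :=
  eq_neg_of_add_eq_zero_left (T.d_incl v)

variable [∀ X : F, HasColimitsOfShape (WordOver ι X) C]
  [∀ (X : F) (A : C), PreservesColimitsOfShape (WordOver ι X) (tensorLeft A)]
  (hF : IsFeynmanCategory.{w} ι)
include hF

/-- Every op with the universal property of the free op is given by the construction. -/
lemma isFreeOp : IsFreeOp T.incl.nat := by
  obtain ⟨R, i, hi⟩ := exists_isFreeOp (C := C) hF P.dualMod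
  obtain ⟨f, hf, -⟩ := T.free R (.ofNat i)
  obtain ⟨g, hg⟩ := hi.exists_lift T.op.toGrOp T.incl.nat
  have hg' : i ≫ Functor.whiskerLeft ι g.trans = T.incl.nat := by
    ext v : 2
    exact hg v
  -- By the two uniqueness statements, `f` and `g` are mutually inverse. The colimit properties of
  -- the constructed free op are then carried along this isomorphism.
  have hfg (X : F) : f.trans.app X ≫ g.trans.app X = 𝟙 _ := by
    have : f.comp g = GrOp.Hom.id _ := T.hom_ext _ _ fun v => by
      change T.incl.app v ≫ f.trans.app _ ≫ g.trans.app _ = T.incl.app v ≫ 𝟙 _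
      rw [reassoc_of% (hf v), comp_id]
      exact hg v
    exact congrArg (fun t => t.trans.app X) this
  have hgf (X : F) : g.trans.app X ≫ f.trans.app X = 𝟙 _ := by
    have : g.comp f = GrOp.Hom.id _ := hi.op_hom_ext _ _ fun v => by
      change i.app v ≫ g.trans.app _ ≫ f.trans.app _ = i.app v ≫ 𝟙 _
      rw [reassoc_of% (hg v), comp_id]
      exact hf v
    exact congrArg (fun t => t.trans.app X) this
  have := g.monoidal
  have hw {X : F} (y) (φ : wordObj ι y ⟶ X) : wordMap T.incl.nat y ≫ T.op.fn.map φ =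
      wordMap i y ≫ R.fn.map φ ≫ g.trans.app X := by
    rw [← hg', wordMap_comp, assoc, g.trans.naturality]
  refine ⟨fun {X Z} s t h => ?_, fun {X Z} s hs => ?_, fun {X Y Z} s t h => ?_, fun S s => ?_⟩
  · have : g.trans.app X ≫ s = g.trans.app X ≫ t := hi.hom_ext _ _ fun y φ => by
      have h' := h y φ
      rwa [reassoc_of% hw, reassoc_of% hw] at h'
    rw [← id_comp s, ← id_comp t, ← hfg, assoc, assoc, this]
  · obtain ⟨t, ht⟩ := hi.exists_desc s hs
    refine ⟨f.trans.app X ≫ t, fun y φ => ?_⟩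
    rw [reassoc_of% hw, reassoc_of% hgf, ht]
  · have : (g.trans.app X ⊗ₘ g.trans.app Y) ≫ s = (g.trans.app X ⊗ₘ g.trans.app Y) ≫ t :=
      hi.tensor_ext _ _ fun y φ z ψ => by
        have h' := h y φ z ψ
        rw [hw, hw, ← assoc, ← assoc, ← MonoidalCategory.tensorHom_comp_tensorHom, assoc,
          assoc] at h'
        exact h'
    rw [← id_comp s, ← id_comp t, ← id_tensorHom_id, ← hfg, ← hfg,
      ← MonoidalCategory.tensorHom_comp_tensorHom, assoc, assoc, this]
  · obtain ⟨t, ht, -⟩ := T.free S (.ofNat s)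
    exact ⟨t, ht⟩

/-- A morphism of graded ops from the Feynman transform commutes with the differentials if and
only if the family of elements that corresponds to it solves the master equation. -/
lemma comm_iff (hP : P.LocallyFinite) {O : DGOp F C} (f : GrOp.Hom T.op.toGrOp O.toGrOp) :
    (∀ X : F, pre (f.trans.app X) (O.d X) = post (T.op.d X) (f.trans.app X)) ↔
      (T.incl.comp f).elt O.d ∈ (hadamard P O).masterEquation c := by
  have h₁ (v : V) : pre (T.incl.app v) (post (T.op.d (ι.obj v)) (f.trans.app (ι.obj v))) =
      -dualSum c (T.incl.comp f) v := by
    rw [pre_post, pre_incl_d, neg_post, dualSum_comp c hP]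
  have h₂ (v : V) : pre (T.incl.app v) (pre (f.trans.app (ι.obj v)) (O.d (ι.obj v))) =
      pre ((T.incl.comp f).app v) (O.d (ι.obj v)) := pre_pre _ _ _
  -- On the generators at `v`, commutation with the differentials is the vanishing of a map out of
  -- the dual. Since `twist` is injective, this is the vanishing of the corresponding element, the
  -- left side of the master equation.
  have h₃ (v : V) : pre (T.incl.app v) (pre (f.trans.app (ι.obj v)) (O.d (ι.obj v))) =
      pre (T.incl.app v) (post (T.op.d (ι.obj v)) (f.trans.app (ι.obj v))) ↔
      pre ((T.incl.comp f).elt O.d v) ((hadamard P O).d (ι.obj v)) +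
        OddOpData.genSum c (Q := hadamard P O) ((T.incl.comp f).elt O.d) v = 0 := by
    have h := twist_dualSum c hP O.d (T.incl.comp f) v
    rw [h₁, h₂, ← add_eq_zero_iff_eq_neg, ← twist_injective.eq_iff, twist_zero]
    exact (Eq.congr_left h)
  refine Iff.trans ?_ (OddOpData.mem_masterEquation_iff (hadamard_actsFinitely hP O)).symm
  refine ⟨fun h => ⟨(T.incl.comp f).elt_mem_limV O.d, fun v => (h₃ v).1 ?_⟩, fun h X => ?_⟩
  · rw [h]
  · exact (T.isFreeOp hF).derivation_ext (f := f) (O.isDerivation.pre_hom f)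
      (T.op.isDerivation.post_hom f) (fun v => (h₃ v).2 (h.2 v)) X

/-- Injectivity combines freeness with duality. For surjectivity an invariant family is a morphism
of `V`-modules by duality and extends by freeness; the master equation then says that the extension
commutes with the differentials. -/
theorem bijOn_family (hP : P.LocallyFinite) (O : DGOp F C) :
    Set.BijOn (fun f : DGOp.Hom T.op O => T.family f) Set.univ
      ((hadamard P O).masterEquation c) := by
  refine ⟨fun f _ => (T.comm_iff hF hP f.toHom).1 f.comm, fun f _ f' _ h => ?_, fun α hα => ?_⟩
  · exact DGOp.Hom.ext_trans (T.hom_ext _ _ fun v =>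
      eta_whiskerLeft_bijective.1 (congrFun h v))
  · obtain ⟨g, hg⟩ := exists_elt_eq (P := P) O.d hα.1
    obtain ⟨f, hf, -⟩ := T.free O.toGrOp g
    have e : (T.incl.comp f).elt O.d = α := by
      rw [← hg]
      funext v
      exact congrArg (fun t => η_ (P.atV v) (P.atV v)ᘁ ≫ P.atV v ◁ t) (hf v)
    exact ⟨⟨f, (T.comm_iff hF hP f).2 (e ▸ hα)⟩, Set.mem_univ _, e⟩

end FeynmanTransform
end OddOp
end
end

section
/-! ### Naturality of the master equation -/

section
variable {V : Type uV} [Groupoid.{vV} V] {F : Type uF} [Category.{vF} F] [MonoidalCategory F]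
  [SymmetricCategory F] {ι : V ⥤ F} {Φ : OddVersion ι}
variable {C : Type uC} [Category.{vC} C] [MonoidalCategory C] [GradedTarget C]
  [SymmetricCategory C] [Preadditive C] [MonoidalPreadditive C]
variable {k : Type u} [CommRing k] [Linear k C] [MonoidalLinear k C] {c : Φ.Weight k}
open DegHom
open Functor.LaxMonoidal (μ ε)

namespace OddOpData

lemma power_comp {Q Q' : OddOpData Φ C} (t : Q.core ⟶ Q'.core) [t.IsMonoidal] (α : Q.Family) :
    ∀ w : FreeSym V, power (Q := Q') (fun v => α v ≫ t.app ⟨ι.obj v⟩) w =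
      power α w ≫ t.app ⟨wordObj ι w⟩
  | .of _ => rfl
  | .unit => (NatTrans.IsMonoidal.unit (τ := t)).symm
  | .tensor a b => by
      have h (X Y : Core F) (x : 𝟙_ (Gr C) ⟶ Q.core.obj X) (y : 𝟙_ (Gr C) ⟶ Q.core.obj Y) :
          elementMul Q'.core (x ≫ t.app X) (y ≫ t.app Y) = elementMul Q.core x y ≫ t.app _ := by
        rw [assoc, assoc, NatTrans.IsMonoidal.tensor, MonoidalCategory.tensorHom_comp_tensorHom_assoc]
      exact (congrArg₂ (elementMul Q'.core (X := ⟨wordObj ι a⟩) (Y := ⟨wordObj ι b⟩))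
        (power_comp t α a) (power_comp t α b)).trans (h _ _ _ _)

/-- Morphisms of odd ops preserve solutions of the master equation. -/
theorem masterEquation_map {Q Q' : OddOpData Φ C} (hQ : Q.IsOdd) (hfin : Q.ActsFinitely)
    (hfin' : Q'.ActsFinitely) (t : Q.core ⟶ Q'.core) (ht : t.IsMonoidal)
    (hact : ∀ {X Y : F} (f : X ⟶ Y), pre (t.app ⟨X⟩) (Q'.act f) = post (Q.act f) (t.app ⟨Y⟩))
    (hd : ∀ X : F, pre (t.app ⟨X⟩) (Q'.d X) = post (Q.d X) (t.app ⟨X⟩)) {α : Q.Family}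
    (hα : α ∈ Q.masterEquation c) :
    (fun v => α v ≫ t.app ⟨ι.obj v⟩) ∈ Q'.masterEquation c := by
  rw [mem_masterEquation_iff hfin] at hα
  refine (mem_masterEquation_iff hfin').2 ⟨fun {v u} τ => ?_, fun v => ?_⟩
  · have h : (α v ≫ t.app ⟨ι.obj v⟩) ≫ Q'.core.map ((Core.functorToCore ι).map τ) =
        (α v ≫ Q.core.map ((Core.functorToCore ι).map τ)) ≫ t.app ⟨ι.obj u⟩ :=
      (assoc _ _ _).trans ((congrArg (α v ≫ ·) (t.naturality _).symm).trans (assoc _ _ _).symm)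
    exact h.trans (congrArg (· ≫ t.app ⟨ι.obj u⟩) (hα.1 τ))
  · have h₁ : genSum c (Q := Q') (fun v => α v ≫ t.app ⟨ι.obj v⟩) v =
        post (genSum c α v) (t.app ⟨ι.obj v⟩) := by
      refine Eq.trans ?_ (hQ.map_genSum c hfin (postₗ k 1 _ (t.app ⟨ι.obj v⟩))).symm
      refine finsum_congr fun g => congrArg _ ?_
      change _ = post (pre _ _) _
      have h₂ : pre (t.app ⟨wordObj ι g.out.word⟩) (Q'.actGen g.out.hom g.out.isGen) =
          post (Q.actGen g.out.hom g.out.isGen) (t.app ⟨ι.obj v⟩) := by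
        unfold actGen
        rw [← ofEq_pre, hact, ofEq_post]
      rw [power_comp, ← pre_post, ← h₂, pre_pre]
    have h₂ := congrArg (post · (t.app ⟨ι.obj v⟩)) (hα.2 v)
    rw [h₁, ← pre_pre, hd, pre_post, ← post_add]
    exact h₂.trans (zero_post _)

end OddOpData

namespace OddOp

lemma hadamard_isOdd (P : OddOp Φ C) (O : DGOp F C) : (hadamard P O).IsOdd :=
  hadamardD_isOdd P O.toGrOp O.d O.isDerivation

section
variable {A A' B B' K K' L L' AA BB KK : Gr C}

lemma tensorμ_whiskerRight {m : A ⊗ B ⟶ AA} {m' : A' ⊗ B' ⟶ BB} {f : A ⟶ A'} {g : B ⟶ B'}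
    {h : AA ⟶ BB} (e : m ≫ h = (f ⊗ₘ g) ≫ m') (n : K ⊗ L ⟶ KK) :
    (tensorμ A K B L ≫ (m ⊗ₘ n)) ≫ h ▷ KK =
      (f ▷ K ⊗ₘ g ▷ L) ≫ tensorμ A' K B' L ≫ (m' ⊗ₘ n) := by
  have h := tensorμ_natural f (𝟙 K) g (𝟙 L)
  rw [tensorHom_id, tensorHom_id] at h
  rw [reassoc_of% h, MonoidalCategory.tensorHom_comp_tensorHom, id_tensorHom_id, id_comp, ← e,
    assoc, ← tensorHom_id, MonoidalCategory.tensorHom_comp_tensorHom, comp_id]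

end

/-- The morphism of pointwise tensor products given by a morphism of odd ops. -/
def hadamardMap {P P' : OddOp Φ C} (h : OddOp.Hom P P') (O : GrOp F C) :
    hadamardCore P.toOddOpData O ⟶ hadamardCore P'.toOddOpData O where
  app X := h.trans.app X ▷ O.fn.obj X.of
  naturality X Y f := by
    have e := h.trans.naturality f
    change (P.core.map f ⊗ₘ O.fn.map f.iso.hom) ≫ h.trans.app Y ▷ O.fn.obj Y.of =
      h.trans.app X ▷ O.fn.obj X.of ≫ (P'.core.map f ⊗ₘ O.fn.map f.iso.hom)
    rw [← tensorHom_id, ← tensorHom_id, MonoidalCategory.tensorHom_comp_tensorHom,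
      MonoidalCategory.tensorHom_comp_tensorHom, e, comp_id, id_comp]

instance isMonoidal_hadamardMap {P P' : OddOp Φ C} (h : OddOp.Hom P P') (O : GrOp F C) :
    (hadamardMap h O).IsMonoidal where
  unit := by
    have := h.monoidal
    have e := NatTrans.IsMonoidal.unit (τ := h.trans)
    have h₁ (P : OddOp Φ C) := hadamardCore_ε P.toOddOpData O
    rw [h₁, h₁]
    refine (assoc _ _ _).trans (congrArg _ ?_)
    change (ε P.core ⊗ₘ ε O.fn) ≫ h.trans.app (𝟙_ (Core F)) ▷ O.fn.obj (𝟙_ F) = _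
    rw [← tensorHom_id, MonoidalCategory.tensorHom_comp_tensorHom, e, comp_id]
  tensor X Y := by
    have := h.monoidal
    have e := NatTrans.IsMonoidal.tensor (τ := h.trans) X Y
    have h₁ (P : OddOp Φ C) := hadamardCore_μ P.toOddOpData O X.of Y.of
    have h₂ := tensorμ_whiskerRight e (μ O.fn X.of Y.of)
    exact (congrArg (· ≫ _) (h₁ P)).trans (h₂.trans (congrArg (_ ≫ ·) (h₁ P').symm))

/-- The map `h ⊗ 1` is monoidal and commutes with actions and differentials, so it preserves every
term of the equation. -/
theorem masterEquation_hadamardMap {P P' : OddOp Φ C} (hP : P.LocallyFinite)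
    (hP' : P'.LocallyFinite) (h : OddOp.Hom P P') (O : DGOp F C)
    [∀ v : V, HasRightDual (P.atV v)] [∀ v : V, HasRightDual (P'.atV v)]
    {α : (hadamard P O).Family} (hα : α ∈ (hadamard P O).masterEquation c) :
    (fun v => α v ≫ h.trans.app ⟨ι.obj v⟩ ▷ O.fn.obj (ι.obj v)) ∈
      (hadamard P' O).masterEquation c := by
  refine OddOpData.masterEquation_map (Q' := hadamard P' O) (hadamard_isOdd P O)
    (hadamard_actsFinitely hP O)
    (hadamard_actsFinitely hP' O) (hadamardMap h O.toGrOp)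
    (isMonoidal_hadamardMap h O.toGrOp) (fun {X Y} f => ?_) (fun X => ?_) hα
  · have : pre (h.trans.app ⟨X⟩ ▷ O.fn.obj X) (tensor (add_zero _) (P'.act f)
        (ofHom (O.fn.map f))) = post (tensor (add_zero _) (P.act f) (ofHom (O.fn.map f)))
          (h.trans.app ⟨Y⟩ ▷ O.fn.obj Y) := by
      rw [pre_whiskerRight_tensor, tensor_post_whiskerRight, h.comm_act]
    exact this
  · have : pre (h.trans.app ⟨X⟩ ▷ O.fn.obj X) (tensorD (P'.d X) (O.d X)) =
        post (tensorD (P.d X) (O.d X)) (h.trans.app ⟨X⟩ ▷ O.fn.obj X) := by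
      unfold DegHom.tensorD DegHom.whiskerLeft DegHom.whiskerRight
      rw [pre_add, post_add, pre_whiskerRight_tensor, pre_whiskerRight_tensor,
        tensor_post_whiskerRight, tensor_post_whiskerRight, h.comm_d, pre_ofHom, post_ofHom,
        comp_id, id_comp]
    exact this

namespace FeynmanTransform

lemma family_comp {P : OddOp Φ C} [∀ v : V, HasRightDual (P.atV v)] (T : P.FeynmanTransform c)
    {O O' : DGOp F C} (f : DGOp.Hom T.op O) (g : DGOp.Hom O O') (v : V) :
    T.family (f.comp g) v = T.family f v ≫ P.atV v ◁ g.trans.app (ι.obj v) := by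
  change η_ (P.atV v) (P.atV v)ᘁ ≫ P.atV v ◁ (T.incl.app v ≫ f.trans.app _ ≫ g.trans.app _) =
    (η_ (P.atV v) (P.atV v)ᘁ ≫ P.atV v ◁ (T.incl.app v ≫ f.trans.app _)) ≫
      P.atV v ◁ g.trans.app (ι.obj v)
  rw [assoc, ← whiskerLeft_comp, assoc]

lemma eta_rightAdjointMate {D : Type uC} [Category.{vC} D] [MonoidalCategory D] {A B Z : D}
    [HasRightDual A] [HasRightDual B] (h : A ⟶ B) (g : Aᘁ ⟶ Z) :
    η_ B Bᘁ ≫ B ◁ (hᘁ ≫ g) = (η_ A Aᘁ ≫ A ◁ g) ≫ h ▷ Z := by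
  rw [whiskerLeft_comp, reassoc_of% coevaluation_comp_rightAdjointMate h, ← whisker_exchange, assoc]

variable [∀ X : F, HasColimitsOfShape (WordOver ι X) C]
  [∀ (X : F) (A : C), PreservesColimitsOfShape (WordOver ι X) (tensorLeft A)]

/-- An argument with the universal element: the identity of the transform of `P` corresponds to a
solution in the product of `P` with it. The image of this solution under `h` is a solution for `P'`,
and the morphism it represents is `r`. Uniqueness is already forced by the values on generators. -/
theorem existsUnique_map (hF : IsFeynmanCategory.{w} ι) {P P' : OddOp Φ C}
    [∀ v : V, HasRightDual (P.atV v)] [∀ v : V, HasRightDual (P'.atV v)] (hP : P.LocallyFinite)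
    (hP' : P'.LocallyFinite) (T : P.FeynmanTransform c) (T' : P'.FeynmanTransform c)
    (h : OddOp.Hom P P') :
    ∃! r : DGOp.Hom T'.op T.op,
      (∀ v : V, T'.incl.app v ≫ r.trans.app (ι.obj v) =
        (h.trans.app ⟨ι.obj v⟩ : P.atV v ⟶ P'.atV v)ᘁ ≫ T.incl.app v) ∧
      ∀ (O : DGOp F C) (f : DGOp.Hom T.op O) (v : V), T'.family (r.comp f) v =
        T.family f v ≫ h.trans.app ⟨ι.obj v⟩ ▷ O.fn.obj (ι.obj v) := by
  let i : DGOp.Hom T.op T.op :=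
    { GrOp.Hom.id T.op.toGrOp with comm := fun X => (pre_id _).trans (post_id _).symm }
  obtain ⟨r, -, hr⟩ := (T'.bijOn_family hF hP' T.op).surjOn
    (masterEquation_hadamardMap hP hP' h T.op ((T.bijOn_family hF hP T.op).mapsTo (Set.mem_univ i)))
  have hr' (v : V) : T'.incl.app v ≫ r.trans.app (ι.obj v) =
      (h.trans.app ⟨ι.obj v⟩ : P.atV v ⟶ P'.atV v)ᘁ ≫ T.incl.app v := by
    apply (eta_whiskerLeft_bijective (A := P'.atV v)).1
    have e : η_ (P'.atV v) (P'.atV v)ᘁ ≫ P'.atV v ◁ (T'.incl.app v ≫ r.trans.app (ι.obj v)) =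
        (η_ (P.atV v) (P.atV v)ᘁ ≫ P.atV v ◁ (T.incl.app v ≫ 𝟙 _)) ≫
          h.trans.app ⟨ι.obj v⟩ ▷ T.op.fn.obj (ι.obj v) := congrFun hr v
    rw [comp_id] at e
    exact e.trans (eta_rightAdjointMate (A := P.atV v) (B := P'.atV v)
      (h.trans.app ⟨ι.obj v⟩) (T.incl.app v)).symm
  refine ⟨r, ⟨hr', fun O f v => ?_⟩, fun r' hr'' => ?_⟩
  · have e : T'.incl.app v ≫ r.trans.app (ι.obj v) ≫ f.trans.app (ι.obj v) =
        (h.trans.app ⟨ι.obj v⟩ : P.atV v ⟶ P'.atV v)ᘁ ≫ T.incl.app v ≫ f.trans.app (ι.obj v) := by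
      rw [reassoc_of% (hr' v)]
    exact (congrArg (fun t => η_ (P'.atV v) (P'.atV v)ᘁ ≫ P'.atV v ◁ t) e).trans
      (eta_rightAdjointMate (A := P.atV v) (B := P'.atV v) (h.trans.app ⟨ι.obj v⟩) _)
  · exact DGOp.Hom.ext_trans (T'.hom_ext _ _ fun v => (hr''.1 v).trans (hr' v).symm)

end FeynmanTransform
end OddOp

/-! ### Generators of arity one and two -/

namespace OddOpData
variable {Q : OddOpData Φ C}

lemma psi_eq_zero {n : ℕ} {v : V} (h : ∀ g : Φ.GenClass v, g.out.word.length ≠ n)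
    (α : Q.Family) : psi c n α v = 0 :=
  finsum_eq_zero_of_forall_eq_zero fun g =>
    haveI : IsEmpty (g.out.word.length = n) := ⟨h g⟩
    finsum_of_isEmpty _

lemma finsum_psi_of_length {v : V} (s : Finset ℕ)
    (h : ∀ g : Φ.GenClass v, g.out.word.length ∈ s) (α : Q.Family) :
    ∑ᶠ n : ℕ, psi c n α v = ∑ n ∈ s, psi c n α v :=
  finsum_eq_sum_of_support_subset _ fun n hn => by
    by_contra h'
    refine hn (psi_eq_zero (fun g hg => h' ?_) α)
    rw [← hg]
    exact h g

/-- When both arguments are `α`, the contribution of a generator depends only on its class. The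
chosen order of the two factors therefore does not matter. -/
lemma psi_two_eq_circ (hQ : Q.IsOdd) (hF : (FreeSym.lift (Core.functorToCore ι)).IsEquivalence)
    {α : Q.Family} (hα : α ∈ Q.limV)
    (s : ∀ (v : V) (g : Φ.GenClass v), g.out.word.length = 2 → OrderedRep g) (v : V) :
    psi c 2 α v = circ c s α α v := by
  refine finsum_congr fun g => finsum_congr fun h => ?_
  let a : Φ.Gen v := ⟨.tensor (.of (s v g h).fst) (.of (s v g h).snd), (s v g h).hom,
    (s v g h).isGen⟩
  have e : a ≈ g.out := (s v g h).rep
  exact (hQ.genTerm_congr c hF hα e).symm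

lemma half_bracket (s : ∀ (v : V) (g : Φ.GenClass v), g.out.word.length = 2 → OrderedRep g)
    [Invertible (2 : k)] (α : Q.Family) (v : V) :
    (⅟2 : k) • bracket c s α α v = circ c s α α v := by
  unfold bracket
  rw [← two_smul k, smul_smul, invOf_mul_self, one_smul]

end OddOpData
end
end

end FeynOps
end

/-! ### The main theorem -/

theorem mainTheorem10
    -- the Feynman category, its odd version, and the resolving set of generators
    {V : Type uV} [Groupoid.{vV} V] {F : Type uF} [Category.{vF} F] [MonoidalCategory F]
    [SymmetricCategory F] (ι : V ⥤ F) (hF : FeynOps.IsFeynmanCategory.{w} ι)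
    (Φ : FeynOps.OddVersion ι)
    -- the target category
    {k : Type u} [CommRing k]
    {C : Type uC} [Category.{vC} C] [MonoidalCategory C] [SymmetricCategory C] [Preadditive C]
    [MonoidalPreadditive C] [Linear k C] [MonoidalLinear k C]
    [HasColimitsOfSize.{w, w} C] [∀ X : C, PreservesColimitsOfSize.{w, w} (tensorLeft X)]
    [FeynOps.GradedTarget C]
    (c : Φ.Weight k) (hc : FeynOps.OddVersion.Resolving.{vC} Φ k c)
    -- the op over the odd version
    (P : FeynOps.OddOp Φ C) [∀ v : V, HasRightDual (P.atV v)] (hP : P.LocallyFinite) :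
    -- the Feynman transform exists
    Nonempty (P.FeynmanTransform c) ∧
    ∀ T : P.FeynmanTransform c,
      -- the bijection
      (∀ O : FeynOps.DGOp F C, Set.BijOn
        (fun f : FeynOps.DGOp.Hom T.op O => T.family f) Set.univ
        ((FeynOps.hadamard P O).masterEquation c)) ∧
      -- it is natural in the op
      (∀ (O O' : FeynOps.DGOp F C) (f : FeynOps.DGOp.Hom T.op O) (g : FeynOps.DGOp.Hom O O')
        (v : V), T.family (f.comp g) v = T.family f v ≫ P.atV v ◁ g.trans.app (ι.obj v)) ∧
      -- it is natural in the odd op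
      (∀ (P' : FeynOps.OddOp Φ C) [∀ v : V, HasRightDual (P'.atV v)], P'.LocallyFinite →
        ∀ (T' : P'.FeynmanTransform c) (h : FeynOps.OddOp.Hom P P'),
          ∃! r : FeynOps.DGOp.Hom T'.op T.op,
            (∀ v : V, T'.incl.app v ≫ r.trans.app (ι.obj v) =
              (h.trans.app ⟨ι.obj v⟩ : P.atV v ⟶ P'.atV v)ᘁ ≫ T.incl.app v) ∧
            ∀ (O : FeynOps.DGOp F C) (f : FeynOps.DGOp.Hom T.op O) (v : V),
              T'.family (r.comp f) v =
                T.family f v ≫ h.trans.app ⟨ι.obj v⟩ ▷ O.fn.obj (ι.obj v)) ∧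
      -- the shape of the master equation when the generators have arity one or two
      (∀ (O : FeynOps.DGOp F C)
        (s : ∀ (v : V) (g : Φ.GenClass v), g.out.word.length = 2 →
          FeynOps.OddOpData.OrderedRep g) (α : (FeynOps.hadamard P O).Family),
        ((∀ (v : V) (g : Φ.GenClass v), g.out.word.length = 1 ∨ g.out.word.length = 2) →
          (α ∈ (FeynOps.hadamard P O).masterEquation c ↔
            α ∈ (FeynOps.hadamard P O).limV ∧ ∀ v : V,
              FeynOps.DegHom.pre (α v) ((FeynOps.hadamard P O).d (ι.obj v)) +
                FeynOps.OddOpData.circ c s α α v + FeynOps.OddOpData.delta c α v = 0) ∧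
          ∀ [Invertible (2 : k)], (α ∈ (FeynOps.hadamard P O).masterEquation c ↔
            α ∈ (FeynOps.hadamard P O).limV ∧ ∀ v : V,
              FeynOps.DegHom.pre (α v) ((FeynOps.hadamard P O).d (ι.obj v)) +
                (⅟2 : k) • FeynOps.OddOpData.bracket c s α α v +
                FeynOps.OddOpData.delta c α v = 0)) ∧
        ((∀ (v : V) (g : Φ.GenClass v), g.out.word.length = 2) →
          (α ∈ (FeynOps.hadamard P O).masterEquation c ↔
            α ∈ (FeynOps.hadamard P O).limV ∧ ∀ v : V,
              FeynOps.DegHom.pre (α v) ((FeynOps.hadamard P O).d (ι.obj v)) +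
                FeynOps.OddOpData.circ c s α α v = 0) ∧
          ∀ [Invertible (2 : k)], (α ∈ (FeynOps.hadamard P O).masterEquation c ↔
            α ∈ (FeynOps.hadamard P O).limV ∧ ∀ v : V,
              FeynOps.DegHom.pre (α v) ((FeynOps.hadamard P O).d (ι.obj v)) +
                (⅟2 : k) • FeynOps.OddOpData.bracket c s α α v = 0))) := by
  -- Essential smallness of the categories of words is what allows the colimits available in `C`,
  -- and their preservation by the tensor product, to be used for the free op.
  have hs (X : F) := FeynOps.essentiallySmall_wordOver hF X
  have (X : F) : HasColimitsOfShape (FeynOps.WordOver ι X) C :=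
    FeynOps.hasColimitsOfShape_of_size.{w} C
  have (X : F) (A : C) : PreservesColimitsOfShape (FeynOps.WordOver ι X) (tensorLeft A) :=
    FeynOps.preservesColimitsOfShape_of_size.{w} (tensorLeft A)
  refine ⟨FeynOps.OddOp.nonempty_feynmanTransform c hF hc hP, fun T =>
    ⟨T.bijOn_family hF hP, fun O O' f g v => T.family_comp f g v, fun P' _ hP' T' h =>
      FeynOps.OddOp.FeynmanTransform.existsUnique_map hF hP hP' T T' h, fun O s α => ?_⟩⟩
  have hQ := FeynOps.OddOp.hadamard_isOdd P O
  have hcirc (hα : α ∈ (FeynOps.hadamard P O).limV) (v : V) :=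
    FeynOps.OddOpData.psi_two_eq_circ (c := c) hQ hF.isoCondition hα s v
  refine ⟨fun hl => ?_, fun hl => ?_⟩
  · have key : α ∈ (FeynOps.hadamard P O).masterEquation c ↔
        α ∈ (FeynOps.hadamard P O).limV ∧ ∀ v : V,
          FeynOps.DegHom.pre (α v) ((FeynOps.hadamard P O).d (ι.obj v)) +
            FeynOps.OddOpData.circ c s α α v + FeynOps.OddOpData.delta c α v = 0 := by
      refine and_congr_right fun hα => forall_congr' fun v => ?_
      -- Only arities two and one occur, listed in the order in which the quadratic term and `Δ`
      -- appear in the equation.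
      rw [FeynOps.OddOpData.finsum_psi_of_length {2, 1} (fun g => by simpa using (hl v g).symm),
        Finset.sum_pair (by norm_num), hcirc hα, ← add_assoc]
      rfl
    refine ⟨key, fun {_} => ?_⟩
    simp only [FeynOps.OddOpData.half_bracket]
    exact key
  · have key : α ∈ (FeynOps.hadamard P O).masterEquation c ↔
        α ∈ (FeynOps.hadamard P O).limV ∧ ∀ v : V,
          FeynOps.DegHom.pre (α v) ((FeynOps.hadamard P O).d (ι.obj v)) +
            FeynOps.OddOpData.circ c s α α v = 0 := by
      refine and_congr_right fun hα => forall_congr' fun v => ?_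
      rw [FeynOps.OddOpData.finsum_psi_of_length {2} (fun g => by simpa using hl v g),
        Finset.sum_singleton, hcirc hα]
    refine ⟨key, fun {_} => ?_⟩
    simp only [FeynOps.OddOpData.half_bracket]
    exact key
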